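/- Let $M=S^1\times S^1\times S^3$, where $S^3$ is the group of unit quaternions. Let $\xi_1=\partial_1$ and $\partial_2$ be the unit tangent fields of the first and the second circle, let $e_1(x)=xi$, $e_2(x)=xj$, $e_3(x)=xk$ be the standard left-invariant frame of $S^3$, and let $\xi_0=e_3$, which is tangent to the fibres of the Hopf fibration $S^3\to S^2$. For $s\in[0,1]$ let $\mathcal F_s$ be the one-dimensional foliation of $M$ spanned by $\xi_s=(1-s)\xi_0+s\xi_1$, let $\eta_s=(1-s)\xi_1-s\xi_0$ (which spans the orthogonal complement of $\xi_s$ in the tori generated by $\xi_0,\xi_1$), and let $\rho:\mathbb R\to\mathbb R$ be a nowhere vanishing function. Let $J_s$ be the endomorphism of the normal bundle $TM/T\mathcal F_s$ with $$J_s\partial_2=\rho(s)\,\eta_s,\qquad J_s(\rho(s)\,\eta_s)=-\partial_2,\qquad J_se_1=e_2,\qquad J_se_2=-e_1 .$$ (The choice $\rho(s)=(s^2+(1-s)^2)^{-1/2}$ makes $\rho(s)\eta_s$ a unit vector; the value $\rho(s)=s/(s^2+(1-s)^2)$, for $s>0$, gives the standard left-invariant complex structure $J_s\partial_2=-e_3$,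 $J_se_1=e_2$ on the transversal $\{*\}\times S^1\times S^3$.) A form $\omega$ is basic if $i_X\omega=i_Xd\omega=0$ for all $X$ tangent to the leaves; $\partial,\bar\partial$ are the components of type $(1,0)$, $(0,1)$ of $d$ on complex-valued basic forms; the basic $\partial\bar\partial$-lemma is the statement $\mathrm{Ker}\,\partial\cap\mathrm{Im}\,\bar\partial=\mathrm{Ker}\,\bar\partial\cap\mathrm{Im}\,\partial=\mathrm{Im}\,\partial\bar\partial$ on basic forms. The foliation is transversely symplectic if there is a closed real basic 2-form which is non-degenerate on the normal bundle, and transversely Kähler with respect to a transverse complex structure $J$ if there is a closed real $J$-invariant basic 2-form $\omega$ with $\omega(v,Jv)>0$ for all non-zero normal vectors $v$. Then the following hold. 1. For every $s\in[0,1]$ the field $\xi_s$ vanishes nowhere, $J_s$ is a transverse holomorphic structure of $\mathcal F_s$ (it is invariant along the leaves and its Nijenhuis tensor vanishes), there is a transverse Riemannian metric of $\mathcal F_s$ compatible with $J_s$, and $\mathcal F_s$ is homologically orientable: $H^4(M/\mathcal F_s)=\mathbb R$. If $\rho$ is smooth, then $\xi_s$ and $J_s$ (extended to $TM$ by $J_s\xi_s=0$)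 depend smoothly on $s$. 2. $(\mathcal F_0,J_0)$ is transversely Kähler, and it satisfies the basic $\partial\bar\partial$-lemma. 3. For every $s\in(0,1]$ the foliation $\mathcal F_s$ is not transversely symplectic, and it is not transversely Kähler with respect to any transverse complex structure. 4. For every irrational $s\in(0,1]$ the basic $\partial\bar\partial$-lemma fails for $(\mathcal F_s,J_s)$. In particular neither property is rigid under deformations that move the foliation: every neighbourhood of $0$ in $\mathbb R$ contains an $s\in[0,1]$ for which $\mathcal F_s$ is not transversely Kähler and $(\mathcal F_s,J_s)$ does not satisfy the basic $\partial\bar\partial$-lemma. -/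

import Mathlib

open scoped Manifold ContDiff Topology Quaternion
open Set

noncomputable section

namespace BasicGeom

/-! ### Vector fields and differential forms on a smooth manifold

Vector fields are derivations of the algebra of smooth functions, a complex-valued `k`-form is an
alternating map on vector fields with values in smooth complex functions which is multilinear over
the smooth real functions, and the exterior derivative is given by the Koszul formula. -/

section General

variable {E : Type*} [NormedAddCommGroup E] [NormedSpace ℝ E] {H : Type*} [TopologicalSpace H]
variable (I : ModelWithCorners ℝ E H) (M : Type*) [TopologicalSpace M] [ChartedSpace H M]

/-- Smooth real functions on `M`. -/
abbrev Fun := C^∞⟮I, M; 𝓘(ℝ, ℝ), ℝ⟯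

/-- Smooth complex functions on `M`. -/
abbrev CFun := C^∞⟮I, M; 𝓘(ℝ, ℂ), ℂ⟯

/-- Smooth vector fields on `M`. -/
abbrev VField := Derivation ℝ (Fun I M) (Fun I M)

variable {I M}

instance : SMul ℂ (CFun I M) where
  smul c f := ⟨fun x => c * f x, (contDiff_const.mul contDiff_id).contMDiff.comp f.contMDiff⟩

theorem cfun_smul_apply (c : ℂ) (f : CFun I M) (x : M) : (c • f) x = c * f x := rfl

/-- Smooth complex functions form a complex vector space (pointwise). -/
instance : Module ℂ (CFun I M) where
  one_smul f := by ext x; simp [cfun_smul_apply]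
  mul_smul a b f := by ext x; simp [cfun_smul_apply, mul_assoc]
  smul_zero a := by ext x; simp [cfun_smul_apply]
  smul_add a f g := by ext x; simp [cfun_smul_apply, mul_add]
  add_smul a b f := by ext x; simp [cfun_smul_apply, add_mul]
  zero_smul f := by ext x; simp [cfun_smul_apply]

/-- Real part of a smooth complex function. -/
def reF (f : CFun I M) : Fun I M :=
  ⟨fun x => (f x).re, Complex.reCLM.contDiff.contMDiff.comp f.contMDiff⟩

/-- Imaginary part of a smooth complex function. -/
def imF (f : CFun I M) : Fun I M :=
  ⟨fun x => (f x).im, Complex.imCLM.contDiff.contMDiff.comp f.contMDiff⟩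

/-- A smooth real function, seen as a complex one. -/
def ofRealF (f : Fun I M) : CFun I M :=
  ⟨fun x => (f x : ℂ), Complex.ofRealCLM.contDiff.contMDiff.comp f.contMDiff⟩

/-- Derivative of a smooth complex function along a vector field. -/
def act (X : VField I M) (f : CFun I M) : CFun I M :=
  ofRealF (X (reF f)) + Complex.I • ofRealF (X (imF f))

variable (I M) in
/-- Arbitrary complex-valued functions of `k` vector fields. -/
abbrev Cochain (k : ℕ) := (Fin k → VField I M) → CFun I M

/-- `θ` is a (complex-valued) differential form: alternating and multilinear over `C^∞(M)`. -/
def IsForm {k : ℕ} (θ : Cochain I M k) : Prop :=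
  ∃ α : VField I M [⋀^Fin k]→ₗ[Fun I M] CFun I M, ∀ v, α v = θ v

/-- `θ` takes real values. -/
def IsReal {k : ℕ} (θ : Cochain I M k) : Prop := ∀ v, imF (θ v) = 0

/-- Exterior derivative:
`dθ(X₀, …, Xₖ) = ∑ᵢ (-1)ⁱ Xᵢ θ(…, X̂ᵢ, …) + ∑_{i<j} (-1)^(i+j) θ([Xᵢ, Xⱼ], …, X̂ᵢ, …, X̂ⱼ, …)`.
In the second sum the pair `i ≤ j` stands for the pair `i < j + 1` of the formula,
hence the sign in front. -/
def extD : ∀ {k : ℕ}, Cochain I M k → Cochain I M (k + 1)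
  | 0, θ => fun v => act (v 0) (θ (Fin.removeNth 0 v))
  | n + 1, θ => fun v =>
      (∑ i : Fin (n + 2), (-1 : ℂ) ^ (i : ℕ) • act (v i) (θ (i.removeNth v))) -
        ∑ i : Fin (n + 1), ∑ j ∈ Finset.Ici i, (-1 : ℂ) ^ ((i : ℕ) + (j : ℕ)) •
          θ (Fin.cons ⁅v i.castSucc, v j.succ⁆ (j.removeNth (i.castSucc.removeNth v)))

/-! ### Foliations

A foliation enters through the module `F` of the vector fields tangent to its leaves. -/

/-- `θ` is a basic form: `i_X θ = 0` and `i_X dθ = 0` for every `X` tangent to the leaves. -/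
def IsBasic (F : Submodule (Fun I M) (VField I M)) {k : ℕ} (θ : Cochain I M k) : Prop :=
  IsForm θ ∧ (∀ v, (∃ i, v i ∈ F) → θ v = 0) ∧ (∀ v, (∃ i, v i ∈ F) → extD θ v = 0)

/-- The value of `X` at the point `p` is tangent to the leaf through `p`. -/
def TangentAt (F : Submodule (Fun I M) (VField I M)) (p : M) (X : VField I M) : Prop :=
  ∃ Y ∈ F, ∀ f : Fun I M, (X f) p = (Y f) p

/-- There is a closed real basic 2-form which is non-degenerate on the normal bundle. -/
def IsTransverselySymplectic (F : Submodule (Fun I M) (VField I M)) : Prop :=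
  ∃ θ : Cochain I M 2, IsBasic F θ ∧ IsReal θ ∧ extD θ = 0 ∧
    ∀ (p : M) (X : VField I M), (∀ Y, θ ![X, Y] p = 0) → TangentAt F p X

/-- `J`, an endomorphism of `TM` preserving the tangent bundle of the foliation, induces on the
normal bundle `TM / F` a transverse complex structure: an almost complex structure with
`L_X J = 0` for `X` tangent to the leaves and with vanishing Nijenhuis tensor. -/
structure IsTransverselyHolomorphic (F : Submodule (Fun I M) (VField I M))
    (J : VField I M →ₗ[Fun I M] VField I M) : Prop where
  preserves : ∀ X ∈ F, J X ∈ F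
  sq : ∀ X, J (J X) + X ∈ F
  invariant : ∀ X ∈ F, ∀ Y, ⁅X, J Y⁆ - J ⁅X, Y⁆ ∈ F
  integrable : ∀ X Y, ⁅J X, J Y⁆ - J ⁅X, J Y⁆ - J ⁅J X, Y⁆ + J (J ⁅X, Y⁆) ∈ F

/-- `g` is (the pullback to `TM` of) a Riemannian metric on the normal bundle with `L_X g = 0` for
`X` tangent to the leaves. -/
structure IsTransverseMetric (F : Submodule (Fun I M) (VField I M))
    (g : VField I M →ₗ[Fun I M] VField I M →ₗ[Fun I M] Fun I M) : Prop where
  symm : ∀ X Y, g X Y = g Y X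
  horizontal : ∀ X ∈ F, ∀ Y, g X Y = 0
  pos : ∀ (p : M) (X : VField I M), ¬ TangentAt F p X → 0 < g X X p
  invariant : ∀ X ∈ F, ∀ Y Z, X (g Y Z) = g ⁅X, Y⁆ Z + g Y ⁅X, Z⁆

/-- The foliation is transversely holomorphic with complex structure `J` and admits a transverse
Riemannian metric, which can be chosen compatible with `J`. -/
def IsTransverselyHermitian (F : Submodule (Fun I M) (VField I M))
    (J : VField I M →ₗ[Fun I M] VField I M) : Prop :=
  IsTransverselyHolomorphic F J ∧ ∃ g, IsTransverseMetric F g ∧ ∀ X Y, g (J X) (J Y) = g X Y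

/-- The transversely holomorphic foliation `(F, J)` is transversely Kähler: there is a closed real
basic 2-form `θ` which is `J`-invariant and such that `θ(X, JX)` is positive on the normal
bundle. -/
def IsTransverselyKahler (F : Submodule (Fun I M) (VField I M))
    (J : VField I M →ₗ[Fun I M] VField I M) : Prop :=
  IsTransverselyHolomorphic F J ∧
    ∃ θ : Cochain I M 2, IsBasic F θ ∧ IsReal θ ∧ extD θ = 0 ∧
      (∀ X Y, θ ![J X, J Y] = θ ![X, Y]) ∧
      ∀ (p : M) (X : VField I M), ¬ TangentAt F p X → 0 < (θ ![X, J X] p).re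

/-- `H^(k+1)(M / F) = ℝ`: the basic cohomology of degree `k + 1` is spanned by the class of one
closed real basic form, and this class is not zero. For a foliation of codimension `k + 1` this is
homological orientability. -/
def HasOneDimBasicCohomology (F : Submodule (Fun I M) (VField I M)) (k : ℕ) : Prop :=
  ∃ ν : Cochain I M (k + 1), IsBasic F ν ∧ IsReal ν ∧ extD ν = 0 ∧
    ∀ θ : Cochain I M (k + 1), IsBasic F θ → IsReal θ → extD θ = 0 →
      ∃! c : ℝ, ∃ η : Cochain I M k, IsBasic F η ∧ IsReal η ∧ θ = (c : ℂ) • ν + extD η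

/-! ### The operators `∂` and `∂̄` -/

/-- The action of `J` on forms: `(J · θ)(X₁, …, Xₖ) = ∑ᵢ θ(X₁, …, J Xᵢ, …, Xₖ)`. -/
def actJ (J : VField I M →ₗ[Fun I M] VField I M) {k : ℕ} (θ : Cochain I M k) : Cochain I M k :=
  fun v => ∑ i, θ (Function.update v i (J (v i)))

/-- A basic `k`-form is of type `(p, q)`, `p + q = k`, if it is an eigenvector of the action of `J`
with eigenvalue `i (p - q)`. -/
def IsType (F : Submodule (Fun I M) (VField I M)) (J : VField I M →ₗ[Fun I M] VField I M)
    {k : ℕ} (p q : ℤ) (θ : Cochain I M k) : Prop :=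
  IsBasic F θ ∧ p + q = k ∧ actJ J θ = (Complex.I * ((p : ℂ) - (q : ℂ))) • θ

/-- `∂θ = ½ (dθ - i (J · dθ - d (J · θ)))`: the part of type `(1, 0)` of `d`, see `del_eq`. -/
def del (J : VField I M →ₗ[Fun I M] VField I M) {k : ℕ} (θ : Cochain I M k) :
    Cochain I M (k + 1) :=
  (1 / 2 : ℂ) • (extD θ - Complex.I • (actJ J (extD θ) - extD (actJ J θ)))

/-- `∂̄θ = ½ (dθ + i (J · dθ - d (J · θ)))`: the part of type `(0, 1)` of `d`, see `delbar_eq`. -/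
def delbar (J : VField I M →ₗ[Fun I M] VField I M) {k : ℕ} (θ : Cochain I M k) :
    Cochain I M (k + 1) :=
  (1 / 2 : ℂ) • (extD θ + Complex.I • (actJ J (extD θ) - extD (actJ J θ)))

theorem act_smul (X : VField I M) (c : ℂ) (f : CFun I M) : act X (c • f) = c • act X f := by
  have h1 : reF (c • f) = c.re • reF f - c.im • imF f := by
    ext x; exact Complex.mul_re c (f x)
  have h2 : imF (c • f) = c.re • imF f + c.im • reF f := by
    ext x; exact Complex.mul_im c (f x)
  ext x
  simp only [act, h1, h2, map_add, map_sub, Derivation.map_smul]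
  change ((c.re * (X (reF f)) x - c.im * (X (imF f)) x : ℝ) : ℂ) +
      Complex.I * ((c.re * (X (imF f)) x + c.im * (X (reF f)) x : ℝ) : ℂ) =
    c * (((X (reF f)) x : ℂ) + Complex.I * ((X (imF f)) x : ℂ))
  apply Complex.ext <;> simp

theorem extD_smul {k : ℕ} (c : ℂ) (θ : Cochain I M k) : extD (c • θ) = c • extD θ := by
  funext v
  cases k with
  | zero => simp [extD, act_smul]
  | succ n =>
    simp only [extD, Pi.smul_apply, act_smul, smul_sub, Finset.smul_sum]
    simp only [smul_comm c]

theorem actJ_add (J : VField I M →ₗ[Fun I M] VField I M) {k : ℕ} (θ τ : Cochain I M k) :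
    actJ J (θ + τ) = actJ J θ + actJ J τ := by
  funext v; simp [actJ, Finset.sum_add_distrib]

/-- `del` is the component of type `(p + 1, q)` of `d`. -/
theorem del_eq {F : Submodule (Fun I M) (VField I M)} {J : VField I M →ₗ[Fun I M] VField I M}
    {k : ℕ} {p q : ℤ} {θ : Cochain I M k} {β γ : Cochain I M (k + 1)} (hθ : IsType F J p q θ)
    (hβ : IsType F J (p + 1) q β) (hγ : IsType F J p (q + 1) γ) (h : extD θ = β + γ) :
    del J θ = β := by
  rw [del, hθ.2.2, extD_smul, h, actJ_add, hβ.2.2, hγ.2.2]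
  match_scalars <;>
    first | linear_combination (-1 / 2 : ℂ) * Complex.I_sq
          | linear_combination (1 / 2 : ℂ) * Complex.I_sq

/-- `delbar` is the component of type `(p, q + 1)` of `d`. -/
theorem delbar_eq {F : Submodule (Fun I M) (VField I M)} {J : VField I M →ₗ[Fun I M] VField I M}
    {k : ℕ} {p q : ℤ} {θ : Cochain I M k} {β γ : Cochain I M (k + 1)} (hθ : IsType F J p q θ)
    (hβ : IsType F J (p + 1) q β) (hγ : IsType F J p (q + 1) γ) (h : extD θ = β + γ) :
    delbar J θ = γ := by
  rw [delbar, hθ.2.2, extD_smul, h, actJ_add, hβ.2.2, hγ.2.2]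
  match_scalars <;>
    first | linear_combination (-1 / 2 : ℂ) * Complex.I_sq
          | linear_combination (1 / 2 : ℂ) * Complex.I_sq

/-- A family consisting of one `k`-form for each degree `k`; the forms of degree greater than
`dim M` vanish, so that these are the elements of the graded space of forms. -/
abbrev Graded (I : ModelWithCorners ℝ E H) (M : Type*) [TopologicalSpace M] [ChartedSpace H M] :=
  ∀ k : ℕ, Cochain I M k

/-- `∂` on the graded space of forms. -/
def delG (J : VField I M →ₗ[Fun I M] VField I M) (θ : Graded I M) : Graded I M
  | 0 => 0
  | k + 1 => del J (θ k)

/-- `∂̄` on the graded space of forms. -/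
def delbarG (J : VField I M →ₗ[Fun I M] VField I M) (θ : Graded I M) : Graded I M
  | 0 => 0
  | k + 1 => delbar J (θ k)

/-- The graded space of complex-valued basic forms. -/
def basicForms (F : Submodule (Fun I M) (VField I M)) : Set (Graded I M) :=
  {θ | ∀ k, IsBasic F (θ k)}

/-- The basic `∂∂̄`-lemma: `Ker ∂ ∩ Im ∂̄ = Ker ∂̄ ∩ Im ∂ = Im ∂∂̄` on basic forms. -/
def SatisfiesDDbarLemma (F : Submodule (Fun I M) (VField I M))
    (J : VField I M →ₗ[Fun I M] VField I M) : Prop :=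
  {θ ∈ basicForms F | delG J θ = 0} ∩ delbarG J '' basicForms F =
      {θ ∈ basicForms F | delbarG J θ = 0} ∩ delG J '' basicForms F ∧
    {θ ∈ basicForms F | delbarG J θ = 0} ∩ delG J '' basicForms F =
      (fun θ => delG J (delbarG J θ)) '' basicForms F

/-! ### Smooth flows and their generators -/

theorem contMDiff_deriv_flow [IsManifold I ∞ M] {Φ : ℝ × M → M} (hΦ : ContMDiff (𝓘(ℝ, ℝ).prod I) I ∞ Φ)
    (f : Fun I M) : ContMDiff I 𝓘(ℝ, ℝ) ∞ (fun p => deriv (fun t => f (Φ (t, p))) 0) := by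
  intro p
  have : IsManifold I 1 M := IsManifold.of_le (n := ∞) (by simp)
  have hg : ContMDiff (I.prod 𝓘(ℝ, ℝ)) 𝓘(ℝ, ℝ) ∞
      (Function.uncurry fun (p : M) (t : ℝ) => f (Φ (t, p))) :=
    f.contMDiff.comp (hΦ.comp (contMDiff_snd.prodMk contMDiff_fst))
  have h := ContMDiffAt.mfderiv (x₀ := p) (m := ∞) (fun (p : M) (t : ℝ) => f (Φ (t, p)))
    (fun _ => (0 : ℝ)) (hg _) contMDiffAt_const (by simp)
  let φ : M → ℝ →L[ℝ] ℝ := fun q => fderiv ℝ (fun t : ℝ => f (Φ (t, q))) 0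
  have h1 : ContMDiffAt I 𝓘(ℝ, ℝ →L[ℝ] ℝ) ∞ φ p := by
    rw [← inTangentCoordinates_model_space (I := 𝓘(ℝ, ℝ)) (I' := 𝓘(ℝ, ℝ)) (fun _ : M => (0 : ℝ))
      (fun q => f (Φ (0, q))) φ p]
    simpa only [mfderiv_eq_fderiv] using h
  have h2 := h1.clm_apply (contMDiffAt_const (c := (1 : ℝ)))
  exact h2

theorem differentiableAt_flow {Φ : ℝ × M → M} (hΦ : ContMDiff (𝓘(ℝ, ℝ).prod I) I ∞ Φ)
    (f : Fun I M) (p : M) (t : ℝ) : DifferentiableAt ℝ (fun t => f (Φ (t, p))) t := by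
  have hg : ContMDiff 𝓘(ℝ, ℝ) 𝓘(ℝ, ℝ) ∞ (fun t : ℝ => f (Φ (t, p))) :=
    f.contMDiff.comp (hΦ.comp (contMDiff_id.prodMk contMDiff_const))
  exact (hg.contDiff.differentiable (by simp)) t

/-- Infinitesimal generator of a smooth flow: `(X f)(p) = d/dt f(Φₜ(p))` at `t = 0`. -/
def generator [IsManifold I ∞ M] (Φ : ℝ × M → M) (hΦ : ContMDiff (𝓘(ℝ, ℝ).prod I) I ∞ Φ)
    (h0 : ∀ p, Φ (0, p) = p) : VField I M :=
  Derivation.mk'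
    { toFun := fun f => ⟨fun p => deriv (fun t => f (Φ (t, p))) 0, contMDiff_deriv_flow hΦ f⟩
      map_add' := fun f g => by
        ext p
        exact deriv_add (differentiableAt_flow hΦ f p 0) (differentiableAt_flow hΦ g p 0)
      map_smul' := fun c f => by
        ext p
        exact deriv_const_mul c (differentiableAt_flow hΦ f p 0) }
    (fun f g => by
      ext p
      have h := deriv_mul (differentiableAt_flow hΦ f p 0) (differentiableAt_flow hΦ g p 0)
      refine h.trans ?_
      simp only [h0]
      change _ = f p * _ + g p * _
      rw [add_comm, mul_comm _ (g p)]
      rfl)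

/-- The 1-form `df`, as a linear map on vector fields. -/
def differential (f : Fun I M) : VField I M →ₗ[Fun I M] Fun I M where
  toFun X := X f
  map_add' _ _ := rfl
  map_smul' _ _ := rfl

/-- The family of vector fields `ξ` and the family of endomorphisms `J` of `TM` depend smoothly on
the parameter. -/
def IsSmoothFamily (ξ : ℝ → VField I M) (J : ℝ → VField I M →ₗ[Fun I M] VField I M) : Prop :=
  (∀ f : Fun I M, ContMDiff (𝓘(ℝ, ℝ).prod I) 𝓘(ℝ, ℝ) ∞ fun q : ℝ × M => (ξ q.1 f) q.2) ∧
    ∀ (X : VField I M) (f : Fun I M),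
      ContMDiff (𝓘(ℝ, ℝ).prod I) 𝓘(ℝ, ℝ) ∞ fun q : ℝ × M => (J q.1 X f) q.2

end General

/-! ### The manifold `S¹ × S¹ × S³` and the family of foliations on it -/

instance finrank_quaternion_fact : Fact (Module.finrank ℝ ℍ = 3 + 1) :=
  ⟨Quaternion.finrank_eq_four⟩

/-- The 3-sphere of unit quaternions. -/
abbrev S3 := Metric.sphere (0 : ℍ) 1

/-- The manifold `S¹ × S¹ × S³`. -/
abbrev M5 := Circle × Circle × S3

/-- The model with corners of `S¹ × S¹ × S³`. -/
abbrev I5 := (𝓡 1).prod ((𝓡 1).prod (𝓡 3))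

/-- Unit tangent field `∂₁` of the first circle, the generator of `z₁ ↦ exp(it) z₁`. -/
def circ1 : VField I5 M5 :=
  generator (fun q : ℝ × M5 => (Circle.exp q.1 * q.2.1, q.2.2.1, q.2.2.2))
    (((contMDiff_circleExp.comp contMDiff_fst).mul (contMDiff_fst.comp contMDiff_snd)).prodMk
      (contMDiff_snd.comp contMDiff_snd))
    (fun p => by simp)

/-- Unit tangent field `∂₂` of the second circle, the generator of `z₂ ↦ exp(it) z₂`. -/
def circ2 : VField I5 M5 :=
  generator (fun q : ℝ × M5 => (q.2.1, Circle.exp q.1 * q.2.2.1, q.2.2.2))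
    ((contMDiff_fst.comp contMDiff_snd).prodMk
      (((contMDiff_circleExp.comp contMDiff_fst).mul
        (contMDiff_fst.comp (contMDiff_snd.comp contMDiff_snd))).prodMk
        (contMDiff_snd.comp (contMDiff_snd.comp contMDiff_snd))))
    (fun p => by simp)

theorem contMDiff_circle_coe : ContMDiff (𝓡 1) 𝓘(ℝ, ℂ) ∞ (fun z : Circle => (z : ℂ)) :=
  haveI := finrank_real_complex_fact'
  contMDiff_coe_sphere (E := ℂ) (n := 1)

/-- `cos t + u sin t`. -/
def qexp (u : ℍ) (t : ℝ) : ℍ := (Real.cos t : ℍ) + Real.sin t • u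

theorem norm_qexp {u : ℍ} (hu : u.re = 0) (hu1 : Quaternion.normSq u = 1) (t : ℝ) :
    ‖qexp u t‖ = 1 := by
  have h : Quaternion.normSq (qexp u t) = 1 := by
    rw [Quaternion.normSq_def'] at hu1 ⊢
    simp only [qexp, Quaternion.re_add, Quaternion.imI_add, Quaternion.imJ_add, Quaternion.imK_add,
      Quaternion.re_coe, Quaternion.imI_coe, Quaternion.imJ_coe, Quaternion.imK_coe,
      Quaternion.re_smul, Quaternion.imI_smul, Quaternion.imJ_smul, Quaternion.imK_smul, hu,
      smul_eq_mul] at hu1 ⊢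
    nlinarith [Real.sin_sq_add_cos_sq t]
  rw [Quaternion.normSq_eq_norm_mul_self] at h
  nlinarith [norm_nonneg (qexp u t)]

/-- The flow `x ↦ x (cos t + u sin t)` on the unit quaternions. -/
def s3Flow (u : ℍ) (hu : u.re = 0) (hu1 : Quaternion.normSq u = 1) (q : ℝ × S3) : S3 :=
  ⟨(q.2 : ℍ) * qexp u q.1, by
    rw [mem_sphere_zero_iff_norm, norm_mul, norm_qexp hu hu1, mul_one]
    exact mem_sphere_zero_iff_norm.1 q.2.2⟩

theorem contMDiff_s3Flow (u : ℍ) (hu : u.re = 0) (hu1 : Quaternion.normSq u = 1) :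
    ContMDiff (𝓘(ℝ, ℝ).prod (𝓡 3)) (𝓡 3) ∞ (s3Flow u hu hu1) := by
  have h1 : ContDiff ℝ ∞ (qexp u) := by
    have : qexp u = fun t => Real.cos t • (1 : ℍ) + Real.sin t • u := by
      funext t
      simp only [qexp]
      congr 1
      ext <;> simp
    rw [this]
    exact (Real.contDiff_cos.smul contDiff_const).add (Real.contDiff_sin.smul contDiff_const)
  have h2 : ContMDiff (𝓘(ℝ, ℝ).prod (𝓡 3)) 𝓘(ℝ, ℍ × ℍ) ∞
      (fun q : ℝ × S3 => ((q.2 : ℍ), qexp u q.1)) :=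
    (contMDiff_coe_sphere.comp contMDiff_snd).prodMk_space
      (h1.contMDiff.comp contMDiff_fst)
  have h3 : ContDiff ℝ ∞ (fun z : ℍ × ℍ => z.1 * z.2) := contDiff_fst.mul contDiff_snd
  exact (h3.contMDiff.comp h2).codRestrict_sphere _

/-- The generator on `S¹ × S¹ × S³` of the flow `x ↦ x (cos t + u sin t)` on `S³`. -/
def s3Field (u : ℍ) (hu : u.re = 0) (hu1 : Quaternion.normSq u = 1) : VField I5 M5 :=
  generator (fun q : ℝ × M5 => (q.2.1, q.2.2.1, s3Flow u hu hu1 (q.1, q.2.2.2)))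
    ((contMDiff_fst.comp contMDiff_snd).prodMk
      ((contMDiff_fst.comp (contMDiff_snd.comp contMDiff_snd)).prodMk
        ((contMDiff_s3Flow u hu hu1).comp (contMDiff_fst.prodMk
          (contMDiff_snd.comp (contMDiff_snd.comp contMDiff_snd))))))
    (fun p => by
      have : s3Flow u hu hu1 (0, p.2.2) = p.2.2 := by
        apply Subtype.ext
        simp [s3Flow, qexp]
      simp [this])

theorem normSq_quat {a b c d : ℝ} (h : a ^ 2 + b ^ 2 + c ^ 2 + d ^ 2 = 1) :
    Quaternion.normSq (⟨a, b, c, d⟩ : ℍ) = 1 :=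
  (Quaternion.normSq_def' (⟨a, b, c, d⟩ : ℍ)).trans h

/-- The left-invariant field `e₁(x) = x i` on `S³`. The three fields `e₁, e₂, e₃` satisfy
`[e₁, e₂] = 2 e₃` and its cyclic permutations. -/
def e1 : VField I5 M5 := s3Field ⟨0, 1, 0, 0⟩ rfl (normSq_quat (by norm_num))

/-- The left-invariant field `e₂(x) = x j` on `S³`. -/
def e2 : VField I5 M5 := s3Field ⟨0, 0, 1, 0⟩ rfl (normSq_quat (by norm_num))

/-- The left-invariant field `e₃(x) = x k` on `S³`. Its flow `x ↦ x (cos t + k sin t)` is the Hopf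
flow, whose orbits are the fibres of the Hopf fibration `S³ → S²`. -/
def e3 : VField I5 M5 := s3Field ⟨0, 0, 0, 1⟩ rfl (normSq_quat (by norm_num))

/-- A real linear function of the first circle coordinate `z₁ ∈ S¹ ⊂ ℂ`. -/
def coordA (L : ℂ →L[ℝ] ℝ) : Fun I5 M5 :=
  ⟨fun p => L p.1, L.contDiff.contMDiff.comp (contMDiff_circle_coe.comp contMDiff_fst)⟩

/-- A real linear function of the second circle coordinate `z₂ ∈ S¹ ⊂ ℂ`. -/
def coordB (L : ℂ →L[ℝ] ℝ) : Fun I5 M5 :=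
  ⟨fun p => L p.2.1, L.contDiff.contMDiff.comp
    (contMDiff_circle_coe.comp (contMDiff_fst.comp contMDiff_snd))⟩

/-- A real linear function of the coordinate `x ∈ S³ ⊂ ℍ`. -/
def coordQ (L : ℍ →ₗ[ℝ] ℝ) : Fun I5 M5 :=
  ⟨fun p => L p.2.2, (LinearMap.toContinuousLinearMap L).contDiff.contMDiff.comp
    (contMDiff_coe_sphere.comp (contMDiff_snd.comp contMDiff_snd))⟩

/-- The components of `x = x₀ + x₁ i + x₂ j + x₃ k`, as functions on `S¹ × S¹ × S³`. -/
def x0 : Fun I5 M5 := coordQ (show ℍ →ₗ[ℝ] ℝ from QuaternionAlgebra.reₗ _ _ _)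

/-- See `x0`. -/
def x1 : Fun I5 M5 := coordQ (show ℍ →ₗ[ℝ] ℝ from QuaternionAlgebra.imIₗ _ _ _)

/-- See `x0`. -/
def x2 : Fun I5 M5 := coordQ (show ℍ →ₗ[ℝ] ℝ from QuaternionAlgebra.imJₗ _ _ _)

/-- See `x0`. -/
def x3 : Fun I5 M5 := coordQ (show ℍ →ₗ[ℝ] ℝ from QuaternionAlgebra.imKₗ _ _ _)

/-- The angular form of the first circle. The forms `dt1, dt2, a1, a2, a3` are the coframe dual to
`circ1, circ2, e1, e2, e3`. -/
def dt1 : VField I5 M5 →ₗ[Fun I5 M5] Fun I5 M5 :=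
  coordA Complex.reCLM • differential (coordA Complex.imCLM) -
    coordA Complex.imCLM • differential (coordA Complex.reCLM)

/-- The angular form of the second circle. -/
def dt2 : VField I5 M5 →ₗ[Fun I5 M5] Fun I5 M5 :=
  coordB Complex.reCLM • differential (coordB Complex.imCLM) -
    coordB Complex.imCLM • differential (coordB Complex.reCLM)

/-- The form `α₁ = ⟨x i, dx⟩` on `S³`. -/
def a1 : VField I5 M5 →ₗ[Fun I5 M5] Fun I5 M5 :=
  -x1 • differential x0 + x0 • differential x1 + x3 • differential x2 - x2 • differential x3

/-- The form `α₂ = ⟨x j, dx⟩` on `S³`. -/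
def a2 : VField I5 M5 →ₗ[Fun I5 M5] Fun I5 M5 :=
  -x2 • differential x0 - x3 • differential x1 + x0 • differential x2 + x1 • differential x3

/-- The form `α₃ = ⟨x k, dx⟩` on `S³`. -/
def a3 : VField I5 M5 →ₗ[Fun I5 M5] Fun I5 M5 :=
  -x3 • differential x0 + x2 • differential x1 - x1 • differential x2 + x0 • differential x3

/-- `ξₛ = (1 - s) ξ₀ + s ξ₁`, where `ξ₀` is tangent to the Hopf fibres and `ξ₁` to the first
circle. -/
def xi (s : ℝ) : VField I5 M5 := (1 - s) • e3 + s • circ1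

/-- The vector fields tangent to the foliation spanned by `ξₛ`. -/
def fol (s : ℝ) : Submodule (Fun I5 M5) (VField I5 M5) := Submodule.span (Fun I5 M5) {xi s}

/-- The orthogonal complement `(1 - s) ξ₁ - s ξ₀` of `ξₛ` in the tori spanned by `ξ₀`, `ξ₁`. -/
def eta (s : ℝ) : VField I5 M5 := (1 - s) • circ1 - s • e3

/-- The 1-form equal to `1` on `eta s` and to `0` on `ξₛ`, `∂₂`, `e₁`, `e₂`. -/
def etaDual (s : ℝ) : VField I5 M5 →ₗ[Fun I5 M5] Fun I5 M5 :=
  (s ^ 2 + (1 - s) ^ 2)⁻¹ • ((1 - s) • dt1 - s • a3)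

/-- The endomorphism of `TM` with `∂₂ ↦ r η`, `r η ↦ -∂₂`, `e₁ ↦ e₂`, `e₂ ↦ -e₁`, `ξₛ ↦ 0`, where
`η = eta s`. -/
def transJ (r s : ℝ) : VField I5 M5 →ₗ[Fun I5 M5] VField I5 M5 :=
  dt2.smulRight (r • eta s) - (etaDual s).smulRight (r⁻¹ • circ2) +
    a1.smulRight e2 - a2.smulRight e1

end BasicGeom

end

open BasicGeom

/-!
Everything is reduced to explicit computations with the left-invariant frame `∂₁, ∂₂, e₁, e₂, e₃` of
the group `S¹ × S¹ × S³` and to two elliptic equations that are solved by explicit kernels.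

*Vector fields and forms.* Smooth functions on the group extend to the algebra `ℂ × ℂ × ℍ`
(`exists_extension`), so Hadamard's lemma identifies derivations with tangent vectors
(`apply_eq_fderiv`) and the left-invariant frame is a basis of the module of vector fields
(`frameBasis`). All identities between differential operators on forms follow by induction on the
degree from Cartan's formula `contr_extD`. By this formula a form is basic for the foliation spanned
by `ξ` if and only if `ι_ξ θ = 0` and `L_ξ θ = 0` (`isBasic_span_iff`).

*Analysis.* The mean over the invariant measure of a derivative along a left-invariant field is zero.
For functions on the base `S²` of the Hopf fibration, convolution with `½ log sin` along quarter
circles solves the Poisson equation (`exists_poisson`); for the torus of the two circles, a Fourier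
series gives a Green operator of `∂₂² + r² ∂₁²` that commutes with the frame (`laplacian_green`).

*Orientability.* Integrating along the orbits of `∂₂`, `∂₁`, `e₃` and then solving the Poisson
equation, each function that is constant on the leaves and of mean zero is the divergence of a basic
field (`exists_divergence`); hence basic cohomology of degree four is `ℝ`
(`hasOneDimBasicCohomology`).

*The parameter zero.* The fundamental form of the transverse metric is closed. For the
`∂∂̄`-lemma, a form `α` closed under `d` and `dᶜ = [J, d]` differs from its average over the torus by
`d dᶜ` of a contraction of the Green operator (`sub_torusMean_eq_ddc`), because `{dᶜ, ι_X} = L_{JX}`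
if `X` preserves `J`. On forms invariant under the torus, contractions with `∂₂` and `η` anticommute
with `d` and `dᶜ`, which reduces the lemma to the component along `e₁, e₂` of a 2-form, that is, to
the Poisson equation (`torusExact_two`).

*Non-zero parameters.* As `[e₁, e₂] = 2 e₃` and `e₃` has a component along `η` modulo `ξ`, the mean of
the component along `e₁, e₂` of `dβ` is a non-zero multiple of the mean of `β(η)`
(`cmean₀_extD_area`). With `ζ = ∂₂* + i (r η)*`, of type `(1, 0)`, the form `∂̄ζ = dζ` is therefore not
in the image of `∂∂̄`, while it is `∂`-closed (`not_satisfiesDDbarLemma`). For a closed basic 2-form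
`θ`, the average over the second circle of `ι_{∂₂} θ` is a closed 1-form on `S¹ × S³` whose class
vanishes by the same relation, so it is exact (`exists_potential`). Two integrations by parts show
that the Pfaffian of `θ` has mean zero (`mean_pfaffian`). By connectedness it has a zero, and there
`θ` is degenerate (`not_isTransverselySymplectic`). This argument applies to every `s ≠ 0`, rational
or not.
-/

noncomputable section

namespace BasicGeom

/-! ### Integrals depending smoothly on a parameter -/

section Parametric
open MeasureTheory
variable {P W F : Type*} [NormedAddCommGroup P] [NormedSpace ℝ P] [FiniteDimensional ℝ P]
  [MeasurableSpace P] [BorelSpace P]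
  [NormedAddCommGroup W] [NormedSpace ℝ W] [FiniteDimensional ℝ W]
  [NormedAddCommGroup F] [NormedSpace ℝ F]

omit [FiniteDimensional ℝ W] in
/-- The integral is a convolution, evaluated at the origin, of the kernel with a function depending
on a parameter. -/
theorem contDiff_integral_smul {H : P × W → F} (hH : ContDiff ℝ ∞ H) {ν : Measure P} {K : P → ℝ}
    (hK : Integrable K ν) {k : Set P} (hk : IsCompact k) (hK0 : ∀ t, t ∉ k → K t = 0) :
    ContDiff ℝ ∞ (fun y => ∫ t, K t • H (t, y) ∂ν) := by
  obtain ⟨R, hR⟩ := hk.isBounded.subset_ball 0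
  let χ : ContDiffBump (0 : P) := ⟨|R| + 1, |R| + 2, by positivity, by linarith⟩
  have h := contDiffOn_convolution_right_with_param_comp (n := (⊤ : ℕ∞)) (μ := ν)
    (ContinuousLinearMap.lsmul ℝ ℝ : ℝ →L[ℝ] F →L[ℝ] F) (s := (univ : Set W)) (v := fun _ => (0 : P))
    contDiffOn_const (f := K) (g := fun y x => χ x • H (-x, y)) (k := Metric.closedBall 0 (|R| + 2))
    isOpen_univ (isCompact_closedBall _ _) ?_ hK.locallyIntegrable ?_
  · rw [contDiffOn_univ] at h
    convert h using 1
    funext y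
    simp only [convolution, ContinuousLinearMap.lsmul_apply]
    refine integral_congr_ae (Filter.Eventually.of_forall fun t => ?_)
    by_cases ht : t ∈ k
    · have h1 : χ (0 - t) = 1 := by
        apply χ.one_of_mem_closedBall
        have h2 := hR ht
        rw [mem_ball_zero_iff] at h2
        simp only [zero_sub, Metric.mem_closedBall, dist_zero_right, norm_neg]
        exact h2.le.trans ((le_abs_self R).trans (by simp [χ]))
      rw [zero_sub] at h1
      simp [h1]
    · simp [hK0 t ht]
  · intro p x _ hx
    have : χ x = 0 := by
      apply χ.zero_of_le_dist
      simp only [Metric.mem_closedBall, not_le] at hx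
      exact hx.le
    simp [this]
  · apply ContDiff.contDiffOn
    exact (χ.contDiff.comp contDiff_snd).smul (hH.comp (contDiff_snd.neg.prodMk contDiff_fst))

theorem hasFDerivAt_integral_smul {H : P × W → F} (hH : ContDiff ℝ ∞ H) {ν : Measure P}
    {K : P → ℝ}
    (hK : Integrable K ν) {k : Set P} (hk : IsCompact k) (hK0 : ∀ t, t ∉ k → K t = 0) (y : W) :
    Integrable (fun t => K t • fderiv ℝ (fun z => H (t, z)) y) ν ∧
    HasFDerivAt (fun y => ∫ t, K t • H (t, y) ∂ν)
      (∫ t, K t • fderiv ℝ (fun z => H (t, z)) y ∂ν) y := by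
  have hd : ∀ t z, HasFDerivAt (fun z => H (t, z))
      ((fderiv ℝ H (t, z)).comp (ContinuousLinearMap.inr ℝ P W)) z := fun t z =>
    ((hH.differentiable (by simp)) (t, z)).hasFDerivAt.comp z (hasFDerivAt_prodMk_right t z)
  have hd' : ∀ t z, fderiv ℝ (fun z => H (t, z)) z =
      (fderiv ℝ H (t, z)).comp (ContinuousLinearMap.inr ℝ P W) := fun t z => (hd t z).fderiv
  have hc : Continuous fun q : P × W => (fderiv ℝ H q).comp (ContinuousLinearMap.inr ℝ P W) :=
    ((hH.continuous_fderiv (by simp)).clm_comp continuous_const)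
  obtain ⟨C, hC⟩ := (hk.prod (isCompact_closedBall y 1)).exists_bound_of_continuousOn hc.continuousOn
  have bd : ∀ t, ∀ z ∈ Metric.ball y 1, ‖K t • fderiv ℝ (fun z => H (t, z)) z‖ ≤ |K t| * C := by
    intro t z hz
    by_cases ht : t ∈ k
    · rw [norm_smul, hd', Real.norm_eq_abs]
      gcongr
      exact hC (t, z) ⟨ht, Metric.ball_subset_closedBall hz⟩
    · simp [hK0 t ht]
  have hm : ∀ z, AEStronglyMeasurable (fun t => K t • H (t, z)) ν := fun z =>
    hK.aestronglyMeasurable.smul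
      ((hH.continuous.comp (continuous_id.prodMk continuous_const)).aestronglyMeasurable)
  have hm' : AEStronglyMeasurable (fun t => K t • fderiv ℝ (fun z => H (t, z)) y) ν := by
    simp only [hd']
    exact hK.aestronglyMeasurable.smul
      ((hc.comp (continuous_id.prodMk continuous_const)).aestronglyMeasurable)
  have hb : Integrable (fun t => |K t| * C) ν := hK.abs.mul_const C
  refine ⟨hb.mono' hm' (Filter.Eventually.of_forall fun t => bd t y (Metric.mem_ball_self one_pos)),
    ?_⟩
  refine hasFDerivAt_integral_of_dominated_of_fderiv_le (s := Metric.ball y 1)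
    (bound := fun t => |K t| * C) (F' := fun z t => K t • fderiv ℝ (fun z => H (t, z)) z)
    (Metric.ball_mem_nhds y one_pos)
    (Filter.Eventually.of_forall hm) ?_ hm' (Filter.Eventually.of_forall bd) hb ?_
  · obtain ⟨C', hC'⟩ := hk.exists_bound_of_continuousOn
      (hH.continuous.comp (continuous_id.prodMk (continuous_const (y := y)))).continuousOn
    refine (hK.abs.mul_const C').mono' (hm y) (Filter.Eventually.of_forall fun t => ?_)
    by_cases ht : t ∈ k
    · rw [norm_smul, Real.norm_eq_abs]
      gcongr
      exact hC' t ht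
    · simp [hK0 t ht]
  · refine Filter.Eventually.of_forall fun t z _ => ?_
    have := (hd t z).const_smul (K t)
    rw [hd']
    exact this

/-- Differentiation under the integral. -/
theorem fderiv_integral_smul [CompleteSpace F] {H : P × W → F} (hH : ContDiff ℝ ∞ H) {ν : Measure P}
    {K : P → ℝ}
    (hK : Integrable K ν) {k : Set P} (hk : IsCompact k) (hK0 : ∀ t, t ∉ k → K t = 0) (y v : W) :
    fderiv ℝ (fun y => ∫ t, K t • H (t, y) ∂ν) y v =
      ∫ t, K t • fderiv ℝ (fun z => H (t, z)) y v ∂ν := by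
  obtain ⟨h1, h2⟩ := hasFDerivAt_integral_smul hH hK hk hK0 y
  rw [h2.fderiv, ContinuousLinearMap.integral_apply h1]
  rfl

omit [FiniteDimensional ℝ W] in
/-- Hadamard's lemma. -/
theorem exists_hadamard {f : W → ℝ} (hf : ContDiff ℝ ∞ f) (p : W) :
    ∃ G : W → W →L[ℝ] ℝ, ContDiff ℝ ∞ G ∧ G p = fderiv ℝ f p ∧
      ∀ y, f y = f p + G y (y - p) := by
  have hH : ContDiff ℝ ∞ (fun q : ℝ × W => fderiv ℝ f (p + q.1 • (q.2 - p))) :=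
    (hf.fderiv_right (m := ∞) (by simp)).comp
      (contDiff_const.add (contDiff_fst.smul (contDiff_snd.sub contDiff_const)))
  have hK : Integrable ((Icc (0 : ℝ) 1).indicator fun _ => (1 : ℝ)) :=
    (integrable_indicator_iff measurableSet_Icc).2 (integrableOn_const (by simp))
  have key : ∀ y, ∫ t, (Icc (0 : ℝ) 1).indicator (fun _ => (1 : ℝ)) t •
      fderiv ℝ f (p + t • (y - p)) = ∫ t in (0 : ℝ)..1, fderiv ℝ f (p + t • (y - p)) := by
    intro y
    rw [intervalIntegral.integral_of_le zero_le_one, ← integral_Icc_eq_integral_Ioc,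
      ← integral_indicator measurableSet_Icc]
    congr 1
    funext t
    by_cases ht : t ∈ Icc (0 : ℝ) 1 <;> simp [ht]
  refine ⟨fun y => ∫ t, (Icc (0 : ℝ) 1).indicator (fun _ => (1 : ℝ)) t •
    fderiv ℝ f (p + t • (y - p)), contDiff_integral_smul hH hK (isCompact_Icc (a := 0) (b := 1)) ?_, ?_, ?_⟩
  · intro t ht
    simp [ht]
  · simp only [key]
    simp
  · intro y
    have hcont : Continuous fun t : ℝ => fderiv ℝ f (p + t • (y - p)) :=
      (hf.continuous_fderiv (by simp)).comp (by fun_prop)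
    simp only [key]
    rw [ContinuousLinearMap.intervalIntegral_apply (hcont.intervalIntegrable _ _)]
    have := intervalIntegral.integral_eq_sub_of_hasDerivAt (a := 0) (b := 1)
      (f := fun t : ℝ => f (p + t • (y - p)))
      (f' := fun t : ℝ => fderiv ℝ f (p + t • (y - p)) (y - p)) ?_ ?_
    · rw [this]; simp
    · intro t _
      have h1 : HasDerivAt (fun t : ℝ => p + t • (y - p)) (y - p) t := by
        simpa using ((hasDerivAt_id t).smul_const (y - p)).const_add p
      exact ((hf.differentiable (by simp)) _).hasFDerivAt.comp_hasDerivAt t h1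
    · exact (hcont.clm_apply continuous_const).intervalIntegrable _ _

end Parametric

/-! ### Smooth functions on `S¹ × S¹ × S³` as restrictions from the ambient algebra -/

/-- The algebra `ℂ × ℂ × ℍ`, in which `S¹ × S¹ × S³` is a subgroup of the group of units. -/
abbrev V8 := ℂ × ℂ × ℍ

/-- The inclusion of `S¹ × S¹ × S³` in `ℂ × ℂ × ℍ`. -/
def emb (p : M5) : V8 := (p.1, p.2.1, p.2.2)

theorem emb_mul (p q : M5) : emb (p * q) = emb p * emb q := rfl

theorem emb_one : emb 1 = 1 := rfl

theorem contMDiff_emb : ContMDiff I5 𝓘(ℝ, V8) ∞ emb :=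
  (contMDiff_circle_coe.comp contMDiff_fst).prodMk_space
    ((contMDiff_circle_coe.comp (contMDiff_fst.comp contMDiff_snd)).prodMk_space
      (contMDiff_coe_sphere.comp (contMDiff_snd.comp contMDiff_snd)))

/-- The open set of the elements of `ℂ × ℂ × ℍ` with non-zero components. -/
def nzOpens : TopologicalSpace.Opens V8 :=
  ⟨{y | y.1 ≠ 0 ∧ y.2.1 ≠ 0 ∧ y.2.2 ≠ 0},
    (isOpen_ne_fun continuous_fst continuous_const).inter
      ((isOpen_ne_fun (continuous_fst.comp continuous_snd) continuous_const).inter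
        (isOpen_ne_fun (continuous_snd.comp continuous_snd) continuous_const))⟩

theorem norm_normalize {W : Type*} [NormedAddCommGroup W] [NormedSpace ℝ W] {y : W} (hy : y ≠ 0) :
    ‖(‖y‖⁻¹ • y)‖ = 1 := by
  rw [norm_smul, norm_inv, norm_norm, inv_mul_cancel₀ (norm_ne_zero_iff.2 hy)]

theorem contMDiff_normalize {X : Type*} [TopologicalSpace X] {H' : Type*} [TopologicalSpace H']
    {E' : Type*} [NormedAddCommGroup E'] [NormedSpace ℝ E'] {J : ModelWithCorners ℝ E' H'}
    [ChartedSpace H' X] {W : Type*} [NormedAddCommGroup W] [InnerProductSpace ℝ W]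
    {g : X → W} (hg : ContMDiff J 𝓘(ℝ, W) ∞ g) (h0 : ∀ x, g x ≠ 0) :
    ContMDiff J 𝓘(ℝ, W) ∞ (fun x => ‖g x‖⁻¹ • g x) := by
  intro x
  have h : ContDiffAt ℝ ∞ (fun y : W => ‖y‖⁻¹ • y) (g x) :=
    ((contDiffAt_norm ℝ (h0 x)).inv (norm_ne_zero_iff.2 (h0 x))).smul contDiffAt_id
  exact h.contMDiffAt.comp x (hg x)

/-- The retraction of the open set of elements with non-zero components on `S¹ × S¹ × S³`. -/
def retr (y : nzOpens) : M5 :=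
  (⟨‖y.1.1‖⁻¹ • y.1.1, mem_sphere_zero_iff_norm.2 (norm_normalize y.2.1)⟩,
    ⟨‖y.1.2.1‖⁻¹ • y.1.2.1, mem_sphere_zero_iff_norm.2 (norm_normalize y.2.2.1)⟩,
    ⟨‖y.1.2.2‖⁻¹ • y.1.2.2, mem_sphere_zero_iff_norm.2 (norm_normalize y.2.2.2)⟩)

theorem contMDiff_retr : ContMDiff 𝓘(ℝ, V8) I5 ∞ retr := by
  have hv : ContMDiff 𝓘(ℝ, V8) 𝓘(ℝ, V8) ∞ (Subtype.val : nzOpens → V8) := contMDiff_subtype_val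
  have h1 : ContMDiff 𝓘(ℝ, V8) 𝓘(ℝ, ℂ) ∞ (fun y : nzOpens => y.1.1) :=
    contDiff_fst.contMDiff.comp hv
  have h2 : ContMDiff 𝓘(ℝ, V8) 𝓘(ℝ, ℂ) ∞ (fun y : nzOpens => y.1.2.1) :=
    (contDiff_fst.comp contDiff_snd).contMDiff.comp hv
  have h3 : ContMDiff 𝓘(ℝ, V8) 𝓘(ℝ, ℍ) ∞ (fun y : nzOpens => y.1.2.2) :=
    (contDiff_snd.comp contDiff_snd).contMDiff.comp hv
  have := finrank_real_complex_fact'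
  refine ContMDiff.prodMk ?_ (ContMDiff.prodMk ?_ ?_)
  · exact (contMDiff_normalize h1 (fun y => y.2.1)).codRestrict_sphere (n := 1) (E := ℂ)
      (fun y => mem_sphere_zero_iff_norm.2 (norm_normalize y.2.1))
  · exact (contMDiff_normalize h2 (fun y => y.2.2.1)).codRestrict_sphere (n := 1) (E := ℂ)
      (fun y => mem_sphere_zero_iff_norm.2 (norm_normalize y.2.2.1))
  · exact (contMDiff_normalize h3 (fun y => y.2.2.2)).codRestrict_sphere
      (fun y => mem_sphere_zero_iff_norm.2 (norm_normalize y.2.2.2))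

theorem retr_emb (p : M5) (h : emb p ∈ nzOpens) : retr ⟨emb p, h⟩ = p := by
  refine Prod.ext (Circle.ext ?_) (Prod.ext (Circle.ext ?_) (Subtype.ext ?_))
  · have : ‖(p.1 : ℂ)‖ = 1 := Circle.norm_coe _
    simp [retr, emb, this]
  · have : ‖(p.2.1 : ℂ)‖ = 1 := Circle.norm_coe _
    simp [retr, emb, this]
  · have : ‖(p.2.2 : ℍ)‖ = 1 := mem_sphere_zero_iff_norm.1 p.2.2.2
    simp [retr, emb, this]

theorem emb_mem_nzOpens (p : M5) : emb p ∈ nzOpens := by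
  refine ⟨Circle.coe_ne_zero _, Circle.coe_ne_zero _, fun h => ?_⟩
  have : ‖(p.2.2 : ℍ)‖ = 1 := mem_sphere_zero_iff_norm.1 p.2.2.2
  rw [show (p.2.2 : ℍ) = 0 from h] at this
  simp at this

/-- A smooth cutoff function on a Euclidean space, equal to `1` on the unit sphere and to `0` near
the origin. -/
def cutoff {W : Type*} [NormedAddCommGroup W] (y : W) : ℝ :=
  Real.smoothTransition (2 * ‖y‖ ^ 2 - 1)

theorem contDiff_cutoff {W : Type*} [NormedAddCommGroup W] [InnerProductSpace ℝ W] :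
    ContDiff ℝ ∞ (cutoff : W → ℝ) :=
  Real.smoothTransition.contDiff.comp
    ((contDiff_const.mul (contDiff_norm_sq ℝ)).sub contDiff_const)

theorem cutoff_of_norm_eq_one {W : Type*} [NormedAddCommGroup W] {y : W} (h : ‖y‖ = 1) :
    cutoff y = 1 := by
  rw [cutoff, h]; exact Real.smoothTransition.one_of_one_le (by norm_num)

theorem eventually_cutoff_eq_zero {X W : Type*} [TopologicalSpace X] [NormedAddCommGroup W]
    {g : X → W} {x : X} (hg : ContinuousAt g x) (h : g x = 0) : ∀ᶠ y in 𝓝 x, cutoff (g y) = 0 := by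
  have h1 : ContinuousAt (fun y => 2 * ‖g y‖ ^ 2 - 1) x :=
    (continuousAt_const.mul (hg.norm.pow 2)).sub continuousAt_const
  have h2 := h1.eventually_lt (g := fun _ => (0 : ℝ)) continuousAt_const (by simp [h])
  filter_upwards [h2] with y hy
  exact Real.smoothTransition.zero_of_nonpos hy.le

open Classical in
/-- Every smooth function on `S¹ × S¹ × S³` is the restriction of a smooth function on
`ℂ × ℂ × ℍ`. -/
theorem exists_extension (f : Fun I5 M5) :
    ∃ F : V8 → ℝ, ContDiff ℝ ∞ F ∧ ∀ p, F (emb p) = f p := by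
  let c : V8 → ℝ := fun y => cutoff y.1 * cutoff y.2.1 * cutoff y.2.2
  have hc : ContDiff ℝ ∞ c :=
    ((contDiff_cutoff.comp contDiff_fst).mul
      (contDiff_cutoff.comp (contDiff_fst.comp contDiff_snd))).mul
      (contDiff_cutoff.comp (contDiff_snd.comp contDiff_snd))
  let F0 : V8 → ℝ := fun y => if h : y ∈ nzOpens then f (retr ⟨y, h⟩) else 0
  refine ⟨fun y => c y * F0 y, ?_, ?_⟩
  · rw [contDiff_iff_contDiffAt]
    intro y
    by_cases hy : y ∈ nzOpens
    · refine hc.contDiffAt.mul ?_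
      rw [← contMDiffAt_iff_contDiffAt]
      have h1 : ContMDiffAt 𝓘(ℝ, V8) 𝓘(ℝ, ℝ) ∞ (fun x : nzOpens => F0 x) ⟨y, hy⟩ := by
        have h2 : (fun x : nzOpens => F0 x) = fun x => f (retr x) := by
          funext x
          simp [F0]
        rw [h2]
        exact (f.contMDiff.comp contMDiff_retr) _
      exact contMDiffAt_subtype_iff.1 h1
    · have h0 : ∀ᶠ z in 𝓝 y, c z = 0 := by
        have : y.1 = 0 ∨ y.2.1 = 0 ∨ y.2.2 = 0 := by
          by_contra hcon
          push Not at hcon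
          exact hy hcon
        rcases this with h | h | h
        · filter_upwards [eventually_cutoff_eq_zero (x := y) continuousAt_fst h] with z hz
          simp [c, hz]
        · filter_upwards [eventually_cutoff_eq_zero (x := y) (g := fun z : V8 => z.2.1)
            (by fun_prop) h] with z hz
          simp [c, hz]
        · filter_upwards [eventually_cutoff_eq_zero (x := y) (g := fun z : V8 => z.2.2)
            (by fun_prop) h] with z hz
          simp [c, hz]
      refine (contDiffAt_const (c := (0 : ℝ))).congr_of_eventuallyEq ?_
      filter_upwards [h0] with z hz
      simp [hz]
  · intro p
    have h1 : c (emb p) = 1 := by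
      simp only [c]
      rw [cutoff_of_norm_eq_one, cutoff_of_norm_eq_one, cutoff_of_norm_eq_one]
      · simp
      · simp [emb]
      · exact Circle.norm_coe _
      · exact Circle.norm_coe _
    simp [h1, F0, emb_mem_nzOpens p, retr_emb]

/-- The restriction to `S¹ × S¹ × S³` of a smooth function on `ℂ × ℂ × ℍ`. -/
def restr (F : V8 → ℝ) (hF : ContDiff ℝ ∞ F) : Fun I5 M5 :=
  ⟨fun p => F (emb p), hF.contMDiff.comp contMDiff_emb⟩

theorem restr_apply (F : V8 → ℝ) (hF : ContDiff ℝ ∞ F) (p : M5) : restr F hF p = F (emb p) := rfl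

/-- The restriction to `S¹ × S¹ × S³` of a linear function on `ℂ × ℂ × ℍ`. -/
def lin (L : V8 →L[ℝ] ℝ) : Fun I5 M5 := restr L L.contDiff

/-! ### Derivations of the algebra of smooth functions are vector fields -/

/-- The value at `p` of a derivation, as a vector of `ℂ × ℂ × ℍ`. -/
def vec (X : VField I5 M5) (p : M5) : V8 :=
  ∑ i, X (lin (LinearMap.toContinuousLinearMap ((Module.finBasis ℝ V8).coord i))) p •
    Module.finBasis ℝ V8 i

theorem deriv_const_fun (X : VField I5 M5) (c : ℝ) : X (algebraMap ℝ (Fun I5 M5) c) = 0 :=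
  X.map_algebraMap c

/-- A derivation acts on functions through its values as vectors. -/
theorem apply_eq_fderiv (X : VField I5 M5) (f : Fun I5 M5) {F : V8 → ℝ} (hF : ContDiff ℝ ∞ F)
    (hf : ∀ p, F (emb p) = f p) (p : M5) : X f p = fderiv ℝ F (emb p) (vec X p) := by
  obtain ⟨G, hG, hGp, hFG⟩ := exists_hadamard hF (emb p)
  let b := Module.finBasis ℝ V8
  let ℓ : Fin (Module.finrank ℝ V8) → V8 →L[ℝ] ℝ :=
    fun i => LinearMap.toContinuousLinearMap (b.coord i)
  let g : Fin (Module.finrank ℝ V8) → Fun I5 M5 := fun i =>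
    restr (fun y => G y (b i)) (hG.clm_apply contDiff_const)
  -- Hadamard's lemma on the level of functions on `M`; a derivation annihilates the constants and
  -- evaluates products of functions vanishing at `p` to zero.
  have h1 : f = algebraMap ℝ (Fun I5 M5) (f p) +
      ∑ i, (lin (ℓ i) - algebraMap ℝ (Fun I5 M5) (ℓ i (emb p))) * g i := by
    ext q
    have h2 : (∑ i, (lin (ℓ i) - algebraMap ℝ (Fun I5 M5) (ℓ i (emb p))) * g i) q =
        ∑ i, (ℓ i (emb q) - ℓ i (emb p)) * G (emb q) (b i) := by
      rw [← ContMDiffMap.coeFnAddMonoidHom_apply, map_sum, Finset.sum_apply]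
      rfl
    change f q = f p + (∑ i, (lin (ℓ i) - algebraMap ℝ (Fun I5 M5) (ℓ i (emb p))) * g i) q
    rw [h2, ← hf q, hFG, hf p]
    congr 1
    conv_lhs => rw [← b.sum_repr (emb q - emb p)]
    rw [map_sum]
    refine Finset.sum_congr rfl fun i _ => ?_
    rw [map_smul, smul_eq_mul]
    congr 1
    simp [ℓ, b]
  conv_lhs => rw [h1]
  rw [map_add, deriv_const_fun, zero_add, map_sum, ← ContMDiffMap.coeFnAddMonoidHom_apply, map_sum,
    Finset.sum_apply, vec, map_sum]
  refine Finset.sum_congr rfl fun i _ => ?_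
  rw [ContMDiffMap.coeFnAddMonoidHom_apply, Derivation.leibniz, map_sub, deriv_const_fun, sub_zero,
    map_smul, ← hGp]
  change (ℓ i (emb p) - ℓ i (emb p)) * _ + G (emb p) (b i) * X (lin (ℓ i)) p = _
  rw [smul_eq_mul, sub_self, zero_mul, zero_add, mul_comm]

theorem apply_lin (X : VField I5 M5) (L : V8 →L[ℝ] ℝ) (p : M5) : X (lin L) p = L (vec X p) := by
  rw [apply_eq_fderiv X (lin L) L.contDiff (fun _ => rfl), ContinuousLinearMap.fderiv]

/-- A vector field is determined by its values. -/
theorem ext_vec {X Y : VField I5 M5} (h : ∀ p, vec X p = vec Y p) : X = Y := by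
  ext f p
  obtain ⟨F, hF, hf⟩ := exists_extension f
  rw [apply_eq_fderiv X f hF hf, apply_eq_fderiv Y f hF hf, h]

theorem vec_eq {X : VField I5 M5} {p : M5} {v : V8} (h : ∀ L : V8 →L[ℝ] ℝ, X (lin L) p = L v) :
    vec X p = v := by
  have : ∀ L : V8 →L[ℝ] ℝ, L (vec X p) = L v := fun L => by rw [← apply_lin, h]
  exact (Module.finBasis ℝ V8).ext_elem fun i =>
    this (LinearMap.toContinuousLinearMap ((Module.finBasis ℝ V8).coord i))

theorem vec_add (X Y : VField I5 M5) (p : M5) : vec (X + Y) p = vec X p + vec Y p :=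
  vec_eq fun L => by
    rw [map_add, ← apply_lin, ← apply_lin]; rfl

theorem vec_smul (f : Fun I5 M5) (X : VField I5 M5) (p : M5) : vec (f • X) p = f p • vec X p :=
  vec_eq fun L => by
    rw [map_smul, ← apply_lin]; rfl

theorem vec_rsmul (c : ℝ) (X : VField I5 M5) (p : M5) : vec (c • X) p = c • vec X p :=
  vec_eq fun L => by
    rw [map_smul, ← apply_lin]; rfl

/-! ### The left-invariant frame -/

/-- The frame `∂₁, ∂₂, e₁, e₂, e₃`. -/
def frame : Fin 5 → VField I5 M5 := ![circ1, circ2, e1, e2, e3]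

/-- The dual coframe. -/
def coframe : Fin 5 → VField I5 M5 →ₗ[Fun I5 M5] Fun I5 M5 := ![dt1, dt2, a1, a2, a3]

/-- The quaternion `a i + b j + c k`. -/
def imq (a b c : ℝ) : ℍ := ⟨0, a, b, c⟩

@[simp] theorem imq_re (a b c : ℝ) : (imq a b c).re = 0 := rfl
@[simp] theorem imq_imI (a b c : ℝ) : (imq a b c).imI = a := rfl
@[simp] theorem imq_imJ (a b c : ℝ) : (imq a b c).imJ = b := rfl
@[simp] theorem imq_imK (a b c : ℝ) : (imq a b c).imK = c := rfl

theorem ext_V8 {v w : V8} (h1 : v.1.re = w.1.re) (h2 : v.1.im = w.1.im) (h3 : v.2.1.re = w.2.1.re)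
    (h4 : v.2.1.im = w.2.1.im) (h5 : v.2.2.re = w.2.2.re) (h6 : v.2.2.imI = w.2.2.imI)
    (h7 : v.2.2.imJ = w.2.2.imJ) (h8 : v.2.2.imK = w.2.2.imK) : v = w :=
  Prod.ext (Complex.ext h1 h2) (Prod.ext (Complex.ext h3 h4) (Quaternion.ext _ _ h5 h6 h7 h8))

/-- An element of the Lie algebra of `S¹ × S¹ × S³`, as a vector tangent at the unit. -/
def lieV (w : Fin 5 → ℝ) : V8 := (⟨0, w 0⟩, ⟨0, w 1⟩, imq (w 2) (w 3) (w 4))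

theorem lieV_single : ∀ i, lieV (Pi.single i 1) =
    (![(Complex.I, 0, 0), (0, Complex.I, 0), (0, 0, imq 1 0 0), (0, 0, imq 0 1 0),
      (0, 0, imq 0 0 1)] : Fin 5 → V8) i := by
  intro i
  apply ext_V8 <;> fin_cases i <;> simp [lieV]

theorem qexp_eq (u : ℍ) (t : ℝ) : qexp u t = Real.cos t • (1 : ℍ) + Real.sin t • u := by
  apply Quaternion.ext <;> simp [qexp]

theorem hasDerivAt_qexp {u : ℍ} (hu : u * u = -1) (t : ℝ) :
    HasDerivAt (qexp u) (qexp u t * u) t := by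
  have h : qexp u = fun t => Real.cos t • (1 : ℍ) + Real.sin t • u := funext (qexp_eq u)
  have h1 := ((Real.hasDerivAt_cos t).smul_const (1 : ℍ)).add
    ((Real.hasDerivAt_sin t).smul_const u)
  rw [qexp_eq u t, h]
  refine h1.congr_deriv ?_
  simp only [add_mul, smul_mul_assoc, one_mul, hu, smul_neg, neg_smul]
  abel

theorem hasDerivAt_circleExp (t : ℝ) :
    HasDerivAt (fun t => (Circle.exp t : ℂ)) ((Circle.exp t : ℂ) * Complex.I) t := by
  have h : (fun t => (Circle.exp t : ℂ)) = fun t : ℝ => Complex.exp (t * Complex.I) :=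
    funext fun t => Circle.coe_exp t
  rw [h, Circle.coe_exp]
  have h1 : HasDerivAt (fun t : ℝ => (t : ℂ) * Complex.I) (1 * Complex.I) t :=
    (Complex.ofRealCLM.hasDerivAt).mul_const Complex.I
  simpa using h1.cexp

theorem deriv_linear_comp (L : V8 →L[ℝ] ℝ) {c : ℝ → V8} {v : V8} (h : HasDerivAt c v 0) :
    deriv (fun t => L (c t)) 0 = L v :=
  (L.hasFDerivAt.comp_hasDerivAt 0 h).deriv

theorem vec_circ1 (p : M5) : vec circ1 p = emb p * (Complex.I, 0, 0) := by
  refine vec_eq fun L => ?_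
  have h : HasDerivAt (fun t : ℝ => emb (Circle.exp t * p.1, p.2.1, p.2.2))
      (emb p * (Complex.I, 0, 0)) 0 := by
    have h1 := ((hasDerivAt_circleExp 0).mul_const (p.1 : ℂ)).prodMk
      (hasDerivAt_const (0 : ℝ) ((p.2.1 : ℂ), (p.2.2 : ℍ)))
    refine h1.congr_deriv ?_
    apply ext_V8 <;> simp [emb]
  exact deriv_linear_comp L h

theorem vec_circ2 (p : M5) : vec circ2 p = emb p * (0, Complex.I, 0) := by
  refine vec_eq fun L => ?_
  have h : HasDerivAt (fun t : ℝ => emb (p.1, Circle.exp t * p.2.1, p.2.2))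
      (emb p * (0, Complex.I, 0)) 0 := by
    have h1 := (hasDerivAt_const (0 : ℝ) (p.1 : ℂ)).prodMk
      (((hasDerivAt_circleExp 0).mul_const (p.2.1 : ℂ)).prodMk
      (hasDerivAt_const (0 : ℝ) (p.2.2 : ℍ)))
    refine h1.congr_deriv ?_
    apply ext_V8 <;> simp [emb]
  exact deriv_linear_comp L h

theorem mul_self_of_unit_im {u : ℍ} (hu : u.re = 0) (hu1 : Quaternion.normSq u = 1) :
    u * u = -1 := by
  rw [Quaternion.normSq_def'] at hu1
  ext <;> simp [hu] <;> nlinarith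

theorem vec_s3Field (u : ℍ) (hu : u.re = 0) (hu1 : Quaternion.normSq u = 1) (p : M5) :
    vec (s3Field u hu hu1) p = emb p * (0, 0, u) := by
  refine vec_eq fun L => ?_
  have h : HasDerivAt (fun t : ℝ => emb (p.1, p.2.1, s3Flow u hu hu1 (t, p.2.2)))
      (emb p * (0, 0, u)) 0 := by
    have h1 := (hasDerivAt_const (0 : ℝ) (p.1 : ℂ)).prodMk
      ((hasDerivAt_const (0 : ℝ) (p.2.1 : ℂ)).prodMk
      ((hasDerivAt_qexp (mul_self_of_unit_im hu hu1) 0).const_mul (p.2.2 : ℍ)))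
    refine h1.congr_deriv ?_
    apply ext_V8 <;> simp [emb, qexp_eq]
  exact deriv_linear_comp L h

theorem vec_frame (i : Fin 5) (p : M5) : vec (frame i) p = emb p * lieV (Pi.single i 1) := by
  rw [lieV_single]
  fin_cases i
  · exact vec_circ1 p
  · exact vec_circ2 p
  · exact vec_s3Field _ _ _ p
  · exact vec_s3Field _ _ _ p
  · exact vec_s3Field _ _ _ p

theorem lieV_add (v w : Fin 5 → ℝ) : lieV (v + w) = lieV v + lieV w := by
  apply ext_V8 <;> simp [lieV]

theorem lieV_smul (c : ℝ) (w : Fin 5 → ℝ) : lieV (c • w) = c • lieV w := by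
  apply ext_V8 <;> simp [lieV]

/-- `lieV` as a linear map. -/
def lieVₗ : (Fin 5 → ℝ) →ₗ[ℝ] V8 := ⟨⟨lieV, lieV_add⟩, lieV_smul⟩

/-- The left-invariant vector field with components `w` in the frame. -/
def fld (w : Fin 5 → ℝ) : VField I5 M5 := ∑ i, w i • frame i

/-- The value at `p` of a derivation, as a linear function of the derivation. -/
def vecₗ (p : M5) : VField I5 M5 →ₗ[ℝ] V8 :=
  ⟨⟨fun X => vec X p, fun X Y => vec_add X Y p⟩, fun c X => vec_rsmul c X p⟩

theorem vec_fld (w : Fin 5 → ℝ) (p : M5) : vec (fld w) p = emb p * lieV w := by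
  change vecₗ p (fld w) = _
  have h : lieVₗ w = lieV w := rfl
  rw [fld, map_sum, ← h, LinearMap.pi_apply_eq_sum_univ lieVₗ w, Finset.mul_sum]
  refine Finset.sum_congr rfl fun i _ => ?_
  rw [map_smul, mul_smul_comm]
  congr 1
  exact (vec_frame i p).trans 
    (congrArg (fun v => emb p * lieV v) (by funext j; simp [Pi.single_apply, eq_comm]))

theorem apply_coordA (X : VField I5 M5) (L : ℂ →L[ℝ] ℝ) (p : M5) :
    X (coordA L) p = L (vec X p).1 :=
  apply_lin X (L.comp (ContinuousLinearMap.fst ℝ ℂ (ℂ × ℍ))) p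

theorem apply_coordB (X : VField I5 M5) (L : ℂ →L[ℝ] ℝ) (p : M5) :
    X (coordB L) p = L (vec X p).2.1 :=
  apply_lin X ((L.comp (ContinuousLinearMap.fst ℝ ℂ ℍ)).comp
    (ContinuousLinearMap.snd ℝ ℂ (ℂ × ℍ))) p

theorem apply_coordQ (X : VField I5 M5) (L : ℍ →ₗ[ℝ] ℝ) (p : M5) :
    X (coordQ L) p = L (vec X p).2.2 :=
  apply_lin X (((LinearMap.toContinuousLinearMap L).comp (ContinuousLinearMap.snd ℝ ℂ ℍ)).comp
    (ContinuousLinearMap.snd ℝ ℂ (ℂ × ℍ))) p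

theorem dt1_apply (X : VField I5 M5) (p : M5) :
    dt1 X p = (p.1 : ℂ).re * (vec X p).1.im - (p.1 : ℂ).im * (vec X p).1.re := by
  change (p.1 : ℂ).re * X (coordA Complex.imCLM) p - (p.1 : ℂ).im * X (coordA Complex.reCLM) p = _
  rw [apply_coordA, apply_coordA]; rfl

theorem dt2_apply (X : VField I5 M5) (p : M5) :
    dt2 X p = (p.2.1 : ℂ).re * (vec X p).2.1.im - (p.2.1 : ℂ).im * (vec X p).2.1.re := by
  change (p.2.1 : ℂ).re * X (coordB Complex.imCLM) p -
    (p.2.1 : ℂ).im * X (coordB Complex.reCLM) p = _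
  rw [apply_coordB, apply_coordB]; rfl

theorem apply_x0 (X : VField I5 M5) (p : M5) : X x0 p = (vec X p).2.2.re := apply_coordQ X _ p
theorem apply_x1 (X : VField I5 M5) (p : M5) : X x1 p = (vec X p).2.2.imI := apply_coordQ X _ p
theorem apply_x2 (X : VField I5 M5) (p : M5) : X x2 p = (vec X p).2.2.imJ := apply_coordQ X _ p
theorem apply_x3 (X : VField I5 M5) (p : M5) : X x3 p = (vec X p).2.2.imK := apply_coordQ X _ p

theorem a1_apply (X : VField I5 M5) (p : M5) :
    a1 X p = -(p.2.2 : ℍ).imI * (vec X p).2.2.re + (p.2.2 : ℍ).re * (vec X p).2.2.imI +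
      (p.2.2 : ℍ).imK * (vec X p).2.2.imJ - (p.2.2 : ℍ).imJ * (vec X p).2.2.imK := by
  rw [← apply_x0, ← apply_x1, ← apply_x2, ← apply_x3]; rfl

theorem a2_apply (X : VField I5 M5) (p : M5) :
    a2 X p = -(p.2.2 : ℍ).imJ * (vec X p).2.2.re - (p.2.2 : ℍ).imK * (vec X p).2.2.imI +
      (p.2.2 : ℍ).re * (vec X p).2.2.imJ + (p.2.2 : ℍ).imI * (vec X p).2.2.imK := by
  rw [← apply_x0, ← apply_x1, ← apply_x2, ← apply_x3]; rfl

theorem a3_apply (X : VField I5 M5) (p : M5) :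
    a3 X p = -(p.2.2 : ℍ).imK * (vec X p).2.2.re + (p.2.2 : ℍ).imJ * (vec X p).2.2.imI -
      (p.2.2 : ℍ).imI * (vec X p).2.2.imJ + (p.2.2 : ℍ).re * (vec X p).2.2.imK := by
  rw [← apply_x0, ← apply_x1, ← apply_x2, ← apply_x3]; rfl

theorem normSq_circle (z : Circle) : (z : ℂ).re ^ 2 + (z : ℂ).im ^ 2 = 1 := by
  have := Circle.normSq_coe z
  rw [Complex.normSq_apply] at this
  linarith

theorem normSq_S3 (x : S3) :
    (x : ℍ).re ^ 2 + (x : ℍ).imI ^ 2 + (x : ℍ).imJ ^ 2 + (x : ℍ).imK ^ 2 = 1 := by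
  have h : ‖(x : ℍ)‖ = 1 := mem_sphere_zero_iff_norm.1 x.2
  rw [← Quaternion.normSq_def', Quaternion.normSq_eq_norm_mul_self, h, mul_one]

/-- The components of a field in the frame are given by the coframe. -/
theorem coframe_apply_of_vec {X : VField I5 M5} {p : M5} {w : Fin 5 → ℝ}
    (h : vec X p = emb p * lieV w) (i : Fin 5) : coframe i X p = w i := by
  have h1 := normSq_circle p.1
  have h2 := normSq_circle p.2.1
  have h3 := normSq_S3 p.2.2
  fin_cases i
  · change dt1 X p = _
    rw [dt1_apply, h]; simp [emb, lieV]; linear_combination w 0 * h1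
  · change dt2 X p = _
    rw [dt2_apply, h]; simp [emb, lieV]; linear_combination w 1 * h2
  · change a1 X p = _
    rw [a1_apply, h]; simp [emb, lieV]; linear_combination w 2 * h3
  · change a2 X p = _
    rw [a2_apply, h]; simp [emb, lieV]; linear_combination w 3 * h3
  · change a3 X p = _
    rw [a3_apply, h]; simp [emb, lieV]; linear_combination w 4 * h3

theorem tangent_circle1 (X : VField I5 M5) (p : M5) :
    (p.1 : ℂ).re * (vec X p).1.re + (p.1 : ℂ).im * (vec X p).1.im = 0 := by
  have h : coordA Complex.reCLM * coordA Complex.reCLM + coordA Complex.imCLM * coordA Complex.imCLM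
      = algebraMap ℝ (Fun I5 M5) 1 := by
    ext q
    change (q.1 : ℂ).re * (q.1 : ℂ).re + (q.1 : ℂ).im * (q.1 : ℂ).im = 1
    linarith [normSq_circle q.1]
  have h2 := congrArg (fun f => (X f) p) h
  simp only [deriv_const_fun, map_add, Derivation.leibniz] at h2
  change (p.1 : ℂ).re * X (coordA Complex.reCLM) p + (p.1 : ℂ).re * X (coordA Complex.reCLM) p +
    ((p.1 : ℂ).im * X (coordA Complex.imCLM) p + (p.1 : ℂ).im * X (coordA Complex.imCLM) p) = 0 at h2
  rw [apply_coordA, apply_coordA] at h2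
  simp only [Complex.reCLM_apply, Complex.imCLM_apply] at h2
  linarith

theorem tangent_circle2 (X : VField I5 M5) (p : M5) :
    (p.2.1 : ℂ).re * (vec X p).2.1.re + (p.2.1 : ℂ).im * (vec X p).2.1.im = 0 := by
  have h : coordB Complex.reCLM * coordB Complex.reCLM + coordB Complex.imCLM * coordB Complex.imCLM
      = algebraMap ℝ (Fun I5 M5) 1 := by
    ext q
    change (q.2.1 : ℂ).re * (q.2.1 : ℂ).re + (q.2.1 : ℂ).im * (q.2.1 : ℂ).im = 1
    linarith [normSq_circle q.2.1]
  have h2 := congrArg (fun f => (X f) p) h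
  simp only [deriv_const_fun, map_add, Derivation.leibniz] at h2
  change (p.2.1 : ℂ).re * X (coordB Complex.reCLM) p + (p.2.1 : ℂ).re * X (coordB Complex.reCLM) p +
    ((p.2.1 : ℂ).im * X (coordB Complex.imCLM) p +
      (p.2.1 : ℂ).im * X (coordB Complex.imCLM) p) = 0 at h2
  rw [apply_coordB, apply_coordB] at h2
  simp only [Complex.reCLM_apply, Complex.imCLM_apply] at h2
  linarith

theorem tangent_S3 (X : VField I5 M5) (p : M5) :
    (p.2.2 : ℍ).re * (vec X p).2.2.re + (p.2.2 : ℍ).imI * (vec X p).2.2.imI +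
      (p.2.2 : ℍ).imJ * (vec X p).2.2.imJ + (p.2.2 : ℍ).imK * (vec X p).2.2.imK = 0 := by
  have h : x0 * x0 + x1 * x1 + x2 * x2 + x3 * x3 = algebraMap ℝ (Fun I5 M5) 1 := by
    ext q
    change (q.2.2 : ℍ).re * (q.2.2 : ℍ).re + (q.2.2 : ℍ).imI * (q.2.2 : ℍ).imI +
      (q.2.2 : ℍ).imJ * (q.2.2 : ℍ).imJ + (q.2.2 : ℍ).imK * (q.2.2 : ℍ).imK = 1
    linarith [normSq_S3 q.2.2]
  have h2 := congrArg (fun f => (X f) p) h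
  simp only [deriv_const_fun, map_add, Derivation.leibniz] at h2
  change (p.2.2 : ℍ).re * X x0 p + (p.2.2 : ℍ).re * X x0 p +
    ((p.2.2 : ℍ).imI * X x1 p + (p.2.2 : ℍ).imI * X x1 p) +
    ((p.2.2 : ℍ).imJ * X x2 p + (p.2.2 : ℍ).imJ * X x2 p) +
    ((p.2.2 : ℍ).imK * X x3 p + (p.2.2 : ℍ).imK * X x3 p) = 0 at h2
  rw [apply_x0, apply_x1, apply_x2, apply_x3] at h2
  linarith

theorem vec_eq_coframe (X : VField I5 M5) (p : M5) :
    vec X p = emb p * lieV (fun i => coframe i X p) := by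
  have h1 := normSq_circle p.1
  have h2 := normSq_circle p.2.1
  have h3 := normSq_S3 p.2.2
  have t1 := tangent_circle1 X p
  have t2 := tangent_circle2 X p
  have t3 := tangent_S3 X p
  change _ = emb p * (⟨0, dt1 X p⟩, ⟨0, dt2 X p⟩, imq (a1 X p) (a2 X p) (a3 X p))
  rw [dt1_apply, dt2_apply, a1_apply, a2_apply, a3_apply]
  generalize vec X p = v at *
  rw [show emb p = ((p.1 : ℂ), (p.2.1 : ℂ), (p.2.2 : ℍ)) from rfl]
  apply ext_V8 <;> simp
  · linear_combination -v.1.re * h1 + (p.1 : ℂ).re * t1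
  · linear_combination -v.1.im * h1 + (p.1 : ℂ).im * t1
  · linear_combination -v.2.1.re * h2 + (p.2.1 : ℂ).re * t2
  · linear_combination -v.2.1.im * h2 + (p.2.1 : ℂ).im * t2
  · linear_combination -v.2.2.re * h3 + (p.2.2 : ℍ).re * t3
  · linear_combination -v.2.2.imI * h3 + (p.2.2 : ℍ).imI * t3
  · linear_combination -v.2.2.imJ * h3 + (p.2.2 : ℍ).imJ * t3
  · linear_combination -v.2.2.imK * h3 + (p.2.2 : ℍ).imK * t3

theorem frame_eq_fld (i : Fin 5) : frame i = fld (Pi.single i 1) :=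
  ext_vec fun p => by rw [vec_frame, vec_fld]

theorem coframe_fld (w : Fin 5 → ℝ) (i : Fin 5) :
    coframe i (fld w) = algebraMap ℝ (Fun I5 M5) (w i) := by
  ext p
  exact coframe_apply_of_vec (vec_fld w p) i

theorem coframe_frame (i j : Fin 5) : coframe i (frame j) = if i = j then 1 else 0 := by
  rw [frame_eq_fld, coframe_fld, Pi.single_apply]
  split_ifs <;> simp

theorem sum_coframe_smul_frame (X : VField I5 M5) : ∑ i, coframe i X • frame i = X := by
  refine ext_vec fun p => ?_
  rw [vec_eq_coframe X p, ← vec_fld]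
  have h1 : ∀ (s : Finset (Fin 5)) (Y : Fin 5 → VField I5 M5),
      vec (∑ i ∈ s, Y i) p = ∑ i ∈ s, vec (Y i) p := fun s Y => map_sum (vecₗ p) Y s
  rw [fld, h1, h1]
  exact Finset.sum_congr rfl fun i _ => by rw [vec_smul, vec_rsmul]

/-- The left-invariant frame is a basis of the module of vector fields. -/
def frameBasis : Module.Basis (Fin 5) (Fun I5 M5) (VField I5 M5) :=
  Module.Basis.ofEquivFun
    { toFun := fun X i => coframe i X
      map_add' := fun X Y => by ext; simp
      map_smul' := fun f X => by ext; simp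
      invFun := fun w => ∑ i, w i • frame i
      left_inv := sum_coframe_smul_frame
      right_inv := fun w => by
        funext i
        simp [coframe_frame] }

theorem frameBasis_apply (i : Fin 5) : frameBasis i = frame i := by
  classical
  simp only [frameBasis, Module.Basis.coe_ofEquivFun]
  change ∑ j, (Pi.single i (1 : Fun I5 M5) : Fin 5 → Fun I5 M5) j • frame j = frame i
  rw [Finset.sum_eq_single i] <;> simp +contextual

/-! ### Brackets of left-invariant fields -/

theorem fld_lin (w : Fin 5 → ℝ) (L : V8 →L[ℝ] ℝ) :
    fld w (lin L) = lin (L.comp ((ContinuousLinearMap.mul ℝ V8).flip (lieV w))) := by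
  ext p
  exact (apply_lin _ _ _).trans (congrArg L (vec_fld w p))

/-- The bracket of the Lie algebra of `S¹ × S¹ × S³`. -/
def lieB (v w : Fin 5 → ℝ) : Fin 5 → ℝ :=
  ![0, 0, 2 * (v 3 * w 4 - v 4 * w 3), 2 * (v 4 * w 2 - v 2 * w 4), 2 * (v 2 * w 3 - v 3 * w 2)]

theorem lieV_lieB (v w : Fin 5 → ℝ) :
    lieV (lieB v w) = lieV v * lieV w - lieV w * lieV v := by
  apply ext_V8 <;> simp [lieV, lieB] <;> ring

theorem fld_bracket (v w : Fin 5 → ℝ) : ⁅fld v, fld w⁆ = fld (lieB v w) := by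
  refine ext_vec fun p => ?_
  rw [vec_fld, lieV_lieB]
  refine vec_eq fun L => ?_
  rw [Derivation.commutator_apply]
  change fld v (fld w (lin L)) p - fld w (fld v (lin L)) p = _
  rw [fld_lin w L, fld_lin v L, apply_lin, apply_lin, vec_fld, vec_fld]
  simp [mul_sub, mul_assoc]

theorem fld_add (v w : Fin 5 → ℝ) : fld (v + w) = fld v + fld w := by
  simp [fld, add_smul, Finset.sum_add_distrib]

theorem fld_smul (c : ℝ) (w : Fin 5 → ℝ) : fld (c • w) = c • fld w := by
  simp [fld, mul_smul, Finset.smul_sum]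

theorem fld_apply (w : Fin 5 → ℝ) (f : Fun I5 M5) : fld w f = ∑ i, w i • frame i f := by
  simp only [fld, ← Derivation.coeFnAddMonoidHom_apply, map_sum, Finset.sum_apply]
  rfl

/-! ### Right translations and one-parameter subgroups -/

theorem contMDiff_rmul (h : M5) : ContMDiff I5 I5 ∞ (fun p : M5 => p * h) := by
  refine ContMDiff.prodMk ?_ (ContMDiff.prodMk ?_ ?_)
  · exact contMDiff_fst.mul contMDiff_const
  · exact (contMDiff_fst.comp contMDiff_snd).mul contMDiff_const
  · have h1 : ContDiff ℝ ∞ (fun x : ℍ => x * (h.2.2 : ℍ)) := contDiff_id.mul contDiff_const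
    exact (h1.contMDiff.comp (contMDiff_coe_sphere.comp
      (contMDiff_snd.comp contMDiff_snd))).codRestrict_sphere (fun p : M5 => (p.2.2 * h.2.2).2)

/-- The pullback of functions by the right translation `p ↦ p h`. -/
def rtrans (h : M5) : Fun I5 M5 →ₗ[ℝ] Fun I5 M5 where
  toFun f := ⟨fun p => f (p * h), f.contMDiff.comp (contMDiff_rmul h)⟩
  map_add' _ _ := rfl
  map_smul' _ _ := rfl

theorem rtrans_apply (h : M5) (f : Fun I5 M5) (p : M5) : rtrans h f p = f (p * h) := rfl

/-- Right translations conjugate left-invariant fields by the adjoint action. -/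
theorem fld_rtrans {v w : Fin 5 → ℝ} {h : M5} (hvw : lieV v * emb h = emb h * lieV w)
    (f : Fun I5 M5) : fld v (rtrans h f) = rtrans h (fld w f) := by
  ext p
  obtain ⟨F, hF, hf⟩ := exists_extension f
  have hF' : ContDiff ℝ ∞ (fun y => F (y * emb h)) := hF.comp (contDiff_id.mul contDiff_const)
  rw [apply_eq_fderiv (fld v) (rtrans h f) hF' (fun q => hf (q * h)), rtrans_apply,
    apply_eq_fderiv (fld w) f hF hf, vec_fld, vec_fld, emb_mul]
  have h1 : HasFDerivAt (fun y : V8 => y * emb h)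
      ((ContinuousLinearMap.mul ℝ V8).flip (emb h)) (emb p) :=
    ((ContinuousLinearMap.mul ℝ V8).flip (emb h)).hasFDerivAt
  have h2 := ((hF.differentiable (by simp)) (emb p * emb h)).hasFDerivAt.comp (emb p) h1
  rw [show (fun y => F (y * emb h)) = F ∘ fun y => y * emb h from rfl, h2.fderiv]
  simp [mul_assoc, hvw]

/-- `c` is a curve of the group with `c' = c w`. -/
def IsIntegral (c : ℝ → M5) (w : Fin 5 → ℝ) : Prop :=
  ∀ t, HasDerivAt (fun t => emb (c t)) (emb (c t) * lieV w) t

theorem IsIntegral.hasDerivAt {c : ℝ → M5} {w : Fin 5 → ℝ} (hc : IsIntegral c w) (f : Fun I5 M5)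
    (p : M5) (t : ℝ) : HasDerivAt (fun t => f (p * c t)) (fld w f (p * c t)) t := by
  obtain ⟨F, hF, hf⟩ := exists_extension f
  rw [apply_eq_fderiv (fld w) f hF hf, vec_fld, emb_mul, mul_assoc]
  have h1 := ((hF.differentiable (by simp)) (emb p * emb (c t))).hasFDerivAt.comp_hasDerivAt t
    ((hc t).const_mul (emb p))
  refine h1.congr_of_eventuallyEq (Filter.Eventually.of_forall fun s => ?_)
  simp [← hf, emb_mul]

theorem IsIntegral.continuous {c : ℝ → M5} {w : Fin 5 → ℝ} (hc : IsIntegral c w) (f : Fun I5 M5)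
    (p : M5) : Continuous (fun t => f (p * c t)) :=
  continuous_iff_continuousAt.2 fun t => (hc.hasDerivAt f p t).continuousAt

/-- The one-parameter subgroup of the first circle. -/
def subC1 (t : ℝ) : M5 := (Circle.exp t, 1, 1)

/-- The one-parameter subgroup of the second circle. -/
def subC2 (t : ℝ) : M5 := (1, Circle.exp t, 1)

/-- The one-parameter subgroup of `S³` generated by the imaginary unit `a i + b j + c k`. -/
def subS (a b c : ℝ) (h : a ^ 2 + b ^ 2 + c ^ 2 = 1) (t : ℝ) : M5 :=
  (1, 1, ⟨qexp (imq a b c) t, mem_sphere_zero_iff_norm.2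
    (norm_qexp rfl (normSq_quat (by linarith)) t)⟩)

theorem emb_subC1 (t : ℝ) : emb (subC1 t) = ((Circle.exp t : ℂ), 1, 1) := rfl

theorem emb_subC2 (t : ℝ) : emb (subC2 t) = (1, (Circle.exp t : ℂ), 1) := rfl

theorem emb_subS (a b c : ℝ) (h : a ^ 2 + b ^ 2 + c ^ 2 = 1) (t : ℝ) :
    emb (subS a b c h t) = (1, 1, qexp (imq a b c) t) := rfl

theorem isIntegral_subC1 : IsIntegral subC1 (Pi.single 0 1) := fun t => by
  simp only [emb_subC1]
  refine ((hasDerivAt_circleExp t).prodMk (hasDerivAt_const t ((1 : ℂ), (1 : ℍ)))).congr_deriv ?_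
  apply ext_V8 <;> simp [lieV]

theorem isIntegral_subC2 : IsIntegral subC2 (Pi.single 1 1) := fun t => by
  simp only [emb_subC2]
  refine ((hasDerivAt_const t (1 : ℂ)).prodMk
    ((hasDerivAt_circleExp t).prodMk (hasDerivAt_const t (1 : ℍ)))).congr_deriv ?_
  apply ext_V8 <;> simp [lieV]

theorem isIntegral_subS (a b c : ℝ) (h : a ^ 2 + b ^ 2 + c ^ 2 = 1) :
    IsIntegral (subS a b c h) ![0, 0, a, b, c] := fun t => by
  simp only [emb_subS]
  refine ((hasDerivAt_const t (1 : ℂ)).prodMk ((hasDerivAt_const t (1 : ℂ)).prodMk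
    (hasDerivAt_qexp (u := imq a b c)
      (mul_self_of_unit_im rfl (normSq_quat (by linarith))) t))).congr_deriv ?_
  apply ext_V8 <;> simp [lieV]

theorem contDiff_emb_subC1 : ContDiff ℝ ∞ (fun t => emb (subC1 t)) := by
  simp only [emb_subC1, Circle.coe_exp]
  exact (Complex.contDiff_exp.comp (Complex.ofRealCLM.contDiff.mul contDiff_const)).prodMk
    contDiff_const

theorem contDiff_emb_subC2 : ContDiff ℝ ∞ (fun t => emb (subC2 t)) := by
  simp only [emb_subC2, Circle.coe_exp]
  exact contDiff_const.prodMk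
    ((Complex.contDiff_exp.comp (Complex.ofRealCLM.contDiff.mul contDiff_const)).prodMk
    contDiff_const)

theorem contDiff_emb_subS (a b c : ℝ) (h : a ^ 2 + b ^ 2 + c ^ 2 = 1) :
    ContDiff ℝ ∞ (fun t => emb (subS a b c h t)) := by
  simp only [emb_subS, qexp_eq]
  exact contDiff_const.prodMk (contDiff_const.prodMk
    ((Real.contDiff_cos.smul contDiff_const).add (Real.contDiff_sin.smul contDiff_const)))

theorem emb_injective : Function.Injective emb := fun p q h => by
  have h1 := congrArg Prod.fst h
  have h2 := congrArg (fun v => v.2.1) h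
  have h3 := congrArg (fun v => v.2.2) h
  exact Prod.ext (Circle.ext h1) (Prod.ext (Circle.ext h2) (Subtype.ext h3))

theorem subC1_add (s t : ℝ) : subC1 (s + t) = subC1 s * subC1 t :=
  emb_injective (by simp [emb_subC1, emb_mul, Circle.exp_add])

theorem subC2_add (s t : ℝ) : subC2 (s + t) = subC2 s * subC2 t :=
  emb_injective (by simp [emb_subC2, emb_mul, Circle.exp_add])

theorem subS_add (a b c : ℝ) (h : a ^ 2 + b ^ 2 + c ^ 2 = 1) (s t : ℝ) :
    subS a b c h (s + t) = subS a b c h s * subS a b c h t := by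
  have hu := mul_self_of_unit_im (u := imq a b c) rfl (normSq_quat (by linarith))
  apply emb_injective
  rw [emb_mul, emb_subS, emb_subS, emb_subS]
  refine Prod.ext (by simp) (Prod.ext (by simp) ?_)
  simp only [Prod.snd_mul, qexp_eq, add_mul, mul_add, smul_mul_smul_comm, one_mul, mul_one, hu,
    Real.cos_add, Real.sin_add]
  module

theorem subC1_zero : subC1 0 = 1 := emb_injective (by simp [emb_subC1, emb_one])
theorem subC2_zero : subC2 0 = 1 := emb_injective (by simp [emb_subC2, emb_one])
theorem subS_zero (a b c : ℝ) (h : a ^ 2 + b ^ 2 + c ^ 2 = 1) : subS a b c h 0 = 1 :=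
  emb_injective (by simp [emb_subS, emb_one, qexp_eq])

theorem subC1_two_pi : subC1 (2 * Real.pi) = 1 := emb_injective (by simp [emb_subC1, emb_one])
theorem subC2_two_pi : subC2 (2 * Real.pi) = 1 := emb_injective (by simp [emb_subC2, emb_one])
theorem subS_two_pi (a b c : ℝ) (h : a ^ 2 + b ^ 2 + c ^ 2 = 1) :
    subS a b c h (2 * Real.pi) = 1 :=
  emb_injective (by simp [emb_subS, emb_one, qexp_eq])

/-- Functions annihilated by the frame are constant. -/
theorem eq_of_frame_eq_zero {f : Fun I5 M5} (h : ∀ i, frame i f = 0) (p q : M5) : f p = f q := by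
  have h0 : ∀ w, fld w f = 0 := fun w => by simp [fld_apply, h]
  have hc : ∀ (c : ℝ → M5) (w : Fin 5 → ℝ), IsIntegral c w → ∀ p s t, f (p * c s) = f (p * c t) := by
    intro c w hc p s t
    refine is_const_of_deriv_eq_zero (f := fun t => f (p * c t))
      (fun t => (hc.hasDerivAt f p t).differentiableAt) (fun t => ?_) s t
    rw [(hc.hasDerivAt f p t).deriv, h0]; rfl
  have key : ∀ r : M5, f (p * r) = f p := by
    intro r
    obtain ⟨z, w, x⟩ := r
    have hx : ∃ a b c, ∃ h : a ^ 2 + b ^ 2 + c ^ 2 = 1, ∃ t,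
        subS a b c h t = ((1, 1, x) : M5) := by
      have hn := normSq_S3 x
      obtain ⟨n, hn0, hn1⟩ : ∃ n : ℝ, 0 ≤ n ∧
          n ^ 2 = (x : ℍ).imI ^ 2 + (x : ℍ).imJ ^ 2 + (x : ℍ).imK ^ 2 :=
        ⟨_, Real.sqrt_nonneg _, Real.sq_sqrt (by positivity)⟩
      obtain ⟨t, ht1, ht2⟩ : ∃ t, (x : ℍ).re = Real.cos t ∧ n = Real.sin t := by
        have h1 : ‖(⟨(x : ℍ).re, n⟩ : ℂ)‖ = 1 := by
          rw [← sq_eq_sq₀ (norm_nonneg _) zero_le_one, ← Complex.normSq_eq_norm_sq,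
            Complex.normSq_apply]
          simp only; nlinarith
        refine ⟨Complex.arg ⟨(x : ℍ).re, n⟩, ?_, ?_⟩
        · rw [Complex.cos_arg (by rw [← norm_ne_zero_iff, h1]; exact one_ne_zero), h1, div_one]
        · rw [Complex.sin_arg, h1, div_one]
      rcases eq_or_ne n 0 with h0 | h0
      · refine ⟨1, 0, 0, by norm_num, t, emb_injective ?_⟩
        have h2 : (x : ℍ).imI = 0 := by
          nlinarith [sq_nonneg ((x : ℍ).imI), sq_nonneg ((x : ℍ).imJ), sq_nonneg ((x : ℍ).imK)]
        have h3 : (x : ℍ).imJ = 0 := by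
          nlinarith [sq_nonneg ((x : ℍ).imI), sq_nonneg ((x : ℍ).imJ), sq_nonneg ((x : ℍ).imK)]
        have h4 : (x : ℍ).imK = 0 := by
          nlinarith [sq_nonneg ((x : ℍ).imI), sq_nonneg ((x : ℍ).imJ), sq_nonneg ((x : ℍ).imK)]
        rw [emb_subS]
        apply ext_V8 <;> simp [emb, qexp_eq, h2, h3, h4, ht1, ← ht2, h0]
      · refine ⟨(x : ℍ).imI / n, (x : ℍ).imJ / n, (x : ℍ).imK / n, ?_, t, emb_injective ?_⟩
        · field_simp; linarith
        · rw [emb_subS]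
          apply ext_V8 <;> simp [emb, qexp_eq, ht1, ← ht2] <;> field_simp
    obtain ⟨a, b, c, habc, t, ht⟩ := hx
    have hz : subC1 (Complex.arg z) = ((z, 1, 1) : M5) := by simp [subC1]
    have hw : subC2 (Complex.arg w) = ((1, w, 1) : M5) := by simp [subC2]
    have h1 : ((z, w, x) : M5) = subC1 (Complex.arg z) * subC2 (Complex.arg w) *
        subS a b c habc t := by rw [hz, hw, ht]; simp
    rw [h1, ← mul_assoc, hc _ _ (isIntegral_subS a b c habc) _ t 0, subS_zero, mul_one, ← mul_assoc,
      hc _ _ isIntegral_subC2 _ _ 0, subC2_zero, mul_one, hc _ _ isIntegral_subC1 _ _ 0, subC1_zero,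
      mul_one]
  rw [← key (p⁻¹ * q)]
  simp

section Analysis

open MeasureTheory

/-! ### The invariant mean -/

instance : MeasurableSpace Circle := borel Circle

instance : BorelSpace Circle := ⟨rfl⟩

instance : MeasurableSpace S3 := borel S3

instance : BorelSpace S3 := ⟨rfl⟩

/-- The right-invariant probability measure on the group `S¹ × S¹ × S³`. -/
def haarM : Measure M5 := (Measure.haarMeasure (⊤ : TopologicalSpace.PositiveCompacts M5)).inv

instance : haarM.IsMulRightInvariant := by unfold haarM; infer_instance

instance : IsProbabilityMeasure haarM := by
  constructor
  rw [haarM, Measure.inv_apply, inv_univ]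
  exact Measure.haarMeasure_self

instance : haarM.IsOpenPosMeasure := by unfold haarM; infer_instance

theorem integrable_of_continuous {E : Type*} [NormedAddCommGroup E] {f : M5 → E}
    (hf : Continuous f) :
    Integrable f haarM :=
  hf.integrable_of_hasCompactSupport (HasCompactSupport.of_compactSpace _)

theorem Fun.continuous (f : Fun I5 M5) : Continuous f := f.contMDiff.continuous

theorem Fun.integrable (f : Fun I5 M5) : Integrable f haarM := integrable_of_continuous (Fun.continuous f)

/-- The mean value of a function. -/
def mean : Fun I5 M5 →ₗ[ℝ] ℝ where
  toFun f := ∫ p, f p ∂haarM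
  map_add' f g := integral_add (Fun.integrable f) (Fun.integrable g)
  map_smul' c f := integral_const_mul c f

theorem mean_apply (f : Fun I5 M5) : mean f = ∫ p, f p ∂haarM := rfl

theorem mean_algebraMap (c : ℝ) : mean (algebraMap ℝ (Fun I5 M5) c) = c := by
  change ∫ _, c ∂haarM = c
  simp

theorem eq_zero_of_mean_eq_zero {f : Fun I5 M5} (h0 : ∀ p, 0 ≤ f p) (h : mean f = 0) : f = 0 := by
  have h1 := (integral_eq_zero_iff_of_nonneg h0 (Fun.integrable f)).1 h
  ext p
  exact congrFun ((Continuous.ae_eq_iff_eq haarM (Fun.continuous f) continuous_const).1 h1) p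

/-- The mean value of the derivative along a left-invariant field vanishes, since the flow of the
field preserves the measure. -/
theorem mean_fld {c : ℝ → M5} {w : Fin 5 → ℝ} (hc : IsIntegral c w) (hcc : Continuous c)
    (f : Fun I5 M5) : mean (fld w f) = 0 := by
  have hcont : Continuous fun q : M5 × ℝ => fld w f (q.1 * c q.2) :=
    (Fun.continuous (fld w f)).comp (continuous_fst.mul (hcc.comp continuous_snd))
  have h1 : ∀ p, ∫ t in (0 : ℝ)..1, fld w f (p * c t) = f (p * c 1) - f (p * c 0) := fun p =>
    intervalIntegral.integral_eq_sub_of_hasDerivAt (fun t _ => hc.hasDerivAt f p t)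
      ((hc.continuous (fld w f) p).intervalIntegrable _ _)
  have h2 : ∫ p, (∫ t in (0 : ℝ)..1, fld w f (p * c t)) ∂haarM = 0 := by
    simp only [h1]
    rw [integral_sub, integral_mul_right_eq_self (μ := haarM) f (c 1),
      integral_mul_right_eq_self (μ := haarM) f (c 0), sub_self]
    · exact integrable_of_continuous ((Fun.continuous f).comp (continuous_mul_const _))
    · exact integrable_of_continuous ((Fun.continuous f).comp (continuous_mul_const _))
  have h3 : ∫ p, (∫ t in (0 : ℝ)..1, fld w f (p * c t)) ∂haarM =
      ∫ t in (0 : ℝ)..1, (∫ p, fld w f (p * c t) ∂haarM) := by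
    simp only [intervalIntegral.integral_of_le zero_le_one]
    refine integral_integral_swap ?_
    obtain ⟨C, hC⟩ := (isCompact_univ (X := M5)).exists_bound_of_continuousOn
      (Fun.continuous (fld w f)).continuousOn
    refine Integrable.of_bound hcont.aestronglyMeasurable C (Filter.Eventually.of_forall fun q => ?_)
    exact hC _ (mem_univ _)
  rw [h3] at h2
  simp only [integral_mul_right_eq_self (μ := haarM) (fld w f)] at h2
  rw [intervalIntegral.integral_const] at h2
  rw [mean_apply]
  simpa using h2

/-! ### Convolution operators -/

/-- A curve or surface `c` in the group together with an integrable function `K` on its parameter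
space, vanishing outside a compact set. -/
structure Kernel (P : Type*) [NormedAddCommGroup P] [NormedSpace ℝ P] [MeasureSpace P] where
  /-- The density. -/
  K : P → ℝ
  /-- The parametrization. -/
  c : P → M5
  /-- A compact set containing the support of the density. -/
  supp : Set P
  integrable : Integrable K
  isCompact : IsCompact supp
  eq_zero : ∀ t, t ∉ supp → K t = 0
  contDiff : ContDiff ℝ ∞ (fun t => emb (c t))

namespace Kernel

variable {P : Type*} [NormedAddCommGroup P] [NormedSpace ℝ P] [FiniteDimensional ℝ P]
  [MeasureSpace P] [BorelSpace P] (κ : Kernel P)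

theorem contDiff_aux {F : V8 → ℝ} (hF : ContDiff ℝ ∞ F) :
    ContDiff ℝ ∞ (fun y => ∫ t, κ.K t • F (y * emb (κ.c t))) :=
  contDiff_integral_smul (H := fun q : P × V8 => F (q.2 * emb (κ.c q.1)))
    (hF.comp (contDiff_snd.mul (κ.contDiff.comp contDiff_fst))) κ.integrable κ.isCompact κ.eq_zero

theorem fderiv_aux {F : V8 → ℝ} (hF : ContDiff ℝ ∞ F) (y v : V8) :
    fderiv ℝ (fun y => ∫ t, κ.K t • F (y * emb (κ.c t))) y v =
      ∫ t, κ.K t • fderiv ℝ (fun z => F (z * emb (κ.c t))) y v :=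
  fderiv_integral_smul (H := fun q : P × V8 => F (q.2 * emb (κ.c q.1)))
    (hF.comp (contDiff_snd.mul (κ.contDiff.comp contDiff_fst))) κ.integrable κ.isCompact κ.eq_zero
    y v

omit [FiniteDimensional ℝ P] in
theorem integrable_mul (f : Fun I5 M5) (p : M5) :
    Integrable (fun t => κ.K t * f (p * κ.c t)) := by
  obtain ⟨F, hF, hf⟩ := exists_extension f
  obtain ⟨C, hC⟩ := (isCompact_univ (X := M5)).exists_bound_of_continuousOn (Fun.continuous f).continuousOn
  refine κ.integrable.mul_bdd (c := C) ?_ (Filter.Eventually.of_forall fun t => hC _ (mem_univ _))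
  have : (fun t => f (p * κ.c t)) = fun t => F (emb p * emb (κ.c t)) := by
    funext t; rw [← hf, emb_mul]
  rw [this]
  exact (hF.continuous.comp (continuous_const.mul κ.contDiff.continuous)).aestronglyMeasurable

/-- The convolution operator `f ↦ ∫ K(t) f(p c(t)) dt`. -/
def conv : Fun I5 M5 →ₗ[ℝ] Fun I5 M5 where
  toFun f := ⟨fun p => ∫ t, κ.K t * f (p * κ.c t), by
    obtain ⟨F, hF, hf⟩ := exists_extension f
    have h := (restr _ (κ.contDiff_aux hF)).contMDiff
    have e : (fun p => ∫ t, κ.K t * f (p * κ.c t)) = restr _ (κ.contDiff_aux hF) := by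
      funext p
      rw [restr_apply]
      simp only [← hf, emb_mul, smul_eq_mul]
    rw [e]
    exact h⟩
  map_add' f g := by
    ext p
    change ∫ t, κ.K t * (f (p * κ.c t) + g (p * κ.c t)) = _
    simp only [mul_add]
    exact integral_add (κ.integrable_mul f p) (κ.integrable_mul g p)
  map_smul' a f := by
    ext p
    change ∫ t, κ.K t * (a * f (p * κ.c t)) = a * ∫ t, κ.K t * f (p * κ.c t)
    rw [← integral_const_mul]
    congr 1
    funext t
    ring

theorem conv_apply (f : Fun I5 M5) (p : M5) : κ.conv f p = ∫ t, κ.K t * f (p * κ.c t) := rfl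

/-- Differentiation under the integral. -/
theorem apply_conv (X : VField I5 M5) (f : Fun I5 M5) (p : M5) :
    X (κ.conv f) p = ∫ t, κ.K t * X (rtrans (κ.c t) f) p := by
  obtain ⟨F, hF, hf⟩ := exists_extension f
  rw [apply_eq_fderiv X (κ.conv f) (κ.contDiff_aux hF) (fun q => by
    rw [conv_apply]; simp only [← hf, emb_mul, smul_eq_mul]), κ.fderiv_aux hF]
  refine integral_congr_ae (Filter.Eventually.of_forall fun t => ?_)
  have h2 : ContDiff ℝ ∞ (fun z => F (z * emb (κ.c t))) := hF.comp (contDiff_id.mul contDiff_const)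
  beta_reduce
  rw [apply_eq_fderiv X (rtrans (κ.c t) f) h2 (fun q => by rw [rtrans_apply, ← hf, emb_mul])]
  rfl

/-- The convolution operators commute with the left-invariant fields up to the adjoint action. -/
theorem fld_conv {v : Fin 5 → ℝ} {w : P → Fin 5 → ℝ}
    (h : ∀ t, lieV v * emb (κ.c t) = emb (κ.c t) * lieV (w t)) (f : Fun I5 M5) (p : M5) :
    fld v (κ.conv f) p = ∫ t, κ.K t * fld (w t) f (p * κ.c t) := by
  rw [apply_conv]
  simp only [fld_rtrans (h _), rtrans_apply]

theorem fld_conv_comm {v : Fin 5 → ℝ}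
    (h : ∀ t, lieV v * emb (κ.c t) = emb (κ.c t) * lieV v) (f : Fun I5 M5) :
    fld v (κ.conv f) = κ.conv (fld v f) := by
  ext p
  rw [κ.fld_conv h, conv_apply]

/-- The kernel on an interval. -/
def ofInterval (a b : ℝ) (hab : a ≤ b) (k : ℝ → ℝ) (hk : IntervalIntegrable k volume a b)
    (c : ℝ → M5) (hc : ContDiff ℝ ∞ (fun t => emb (c t))) : Kernel ℝ where
  K := (Ioc a b).indicator k
  c := c
  supp := Icc a b
  integrable := (integrable_indicator_iff measurableSet_Ioc).2
    ((intervalIntegrable_iff_integrableOn_Ioc_of_le hab).1 hk)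
  isCompact := isCompact_Icc
  eq_zero _ ht := indicator_of_notMem (fun h => ht (Ioc_subset_Icc_self h)) _
  contDiff := hc

theorem integral_ofInterval {a b : ℝ} (hab : a ≤ b) {k : ℝ → ℝ}
    (hk : IntervalIntegrable k volume a b)
    {c : ℝ → M5} (hc : ContDiff ℝ ∞ (fun t => emb (c t))) (φ : ℝ → ℝ) :
    ∫ t, (ofInterval a b hab k hk c hc).K t * φ t = ∫ t in a..b, k t * φ t := by
  rw [intervalIntegral.integral_of_le hab, ← integral_indicator measurableSet_Ioc]
  congr 1
  funext t
  by_cases ht : t ∈ Ioc a b <;> simp [ofInterval, ht]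

end Kernel

/-! ### Averages over circle subgroups -/

/-- A circle subgroup, with a parametrization of period `2π`. -/
structure CircleSubgroup where
  /-- The parametrization. -/
  c : ℝ → M5
  /-- The generator. -/
  w : Fin 5 → ℝ
  isIntegral : IsIntegral c w
  contDiff : ContDiff ℝ ∞ (fun t => emb (c t))
  zero : c 0 = 1
  two_pi : c (2 * Real.pi) = 1
  add : ∀ s t, c (s + t) = c s * c t

namespace CircleSubgroup

/-- The first circle. -/
def fst : CircleSubgroup := ⟨subC1, _, isIntegral_subC1, contDiff_emb_subC1, subC1_zero,
  subC1_two_pi, subC1_add⟩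

/-- The second circle. -/
def snd : CircleSubgroup := ⟨subC2, _, isIntegral_subC2, contDiff_emb_subC2, subC2_zero,
  subC2_two_pi, subC2_add⟩

/-- The circle in `S³` generated by an imaginary unit. -/
def sphere (a b c : ℝ) (h : a ^ 2 + b ^ 2 + c ^ 2 = 1) : CircleSubgroup :=
  ⟨subS a b c h, _, isIntegral_subS a b c h, contDiff_emb_subS _ _ _ _, subS_zero _ _ _ _,
    subS_two_pi _ _ _ _, subS_add _ _ _ _⟩

/-- The Hopf circle `exp(tk)`. -/
def hopf : CircleSubgroup := sphere 0 0 1 (by norm_num)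

variable (S : CircleSubgroup)

theorem comm (t : ℝ) : lieV S.w * emb (S.c t) = emb (S.c t) * lieV S.w := by
  have h1 : HasDerivAt (fun s => emb (S.c s) * emb (S.c t)) (emb (S.c 0) * lieV S.w * emb (S.c t))
      0 := (S.isIntegral 0).mul_const _
  have h2 : HasDerivAt (fun s => emb (S.c t) * emb (S.c s)) (emb (S.c t) * (emb (S.c 0) * lieV S.w))
      0 := (S.isIntegral 0).const_mul _
  have h3 : (fun s => emb (S.c s) * emb (S.c t)) = fun s => emb (S.c t) * emb (S.c s) := by
    funext s
    rw [← emb_mul, ← emb_mul, ← S.add, ← S.add, add_comm]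
  rw [h3] at h1
  have h4 := h1.unique h2
  rwa [S.zero, emb_one, one_mul] at h4

/-- The kernel of the average. -/
def avgKernel : Kernel ℝ :=
  Kernel.ofInterval 0 (2 * Real.pi) (by positivity) (fun _ => (2 * Real.pi)⁻¹)
    (continuous_const.intervalIntegrable _ _) S.c S.contDiff

/-- The kernel of the primitive. -/
def primKernel : Kernel ℝ :=
  Kernel.ofInterval 0 (2 * Real.pi) (by positivity) (fun t => (2 * Real.pi)⁻¹ * t)
    ((continuous_const.mul continuous_id).intervalIntegrable _ _) S.c S.contDiff

/-- The average of functions over the orbits of the circle. -/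
def avg : Fun I5 M5 →ₗ[ℝ] Fun I5 M5 := S.avgKernel.conv

/-- A primitive along the orbits of the circle of the functions of average zero. -/
def prim : Fun I5 M5 →ₗ[ℝ] Fun I5 M5 := S.primKernel.conv

theorem avg_apply (f : Fun I5 M5) (p : M5) :
    S.avg f p = ∫ t in (0 : ℝ)..(2 * Real.pi), (2 * Real.pi)⁻¹ * f (p * S.c t) :=
  Kernel.integral_ofInterval _ _ _ _

theorem prim_apply (f : Fun I5 M5) (p : M5) :
    S.prim f p = ∫ t in (0 : ℝ)..(2 * Real.pi), (2 * Real.pi)⁻¹ * t * f (p * S.c t) :=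
  Kernel.integral_ofInterval _ _ _ _

theorem fld_avg (f : Fun I5 M5) : fld S.w (S.avg f) = 0 := by
  rw [avg, Kernel.fld_conv_comm _ S.comm]
  ext p
  change S.avg (fld S.w f) p = 0
  rw [avg_apply, intervalIntegral.integral_const_mul,
    intervalIntegral.integral_eq_sub_of_hasDerivAt (fun t _ => S.isIntegral.hasDerivAt f p t)
      ((S.isIntegral.continuous (fld S.w f) p).intervalIntegrable _ _), S.zero, S.two_pi, sub_self,
    mul_zero]

/-- Integration by parts. -/
theorem prim_fld (f : Fun I5 M5) : S.prim (fld S.w f) = f - S.avg f := by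
  ext p
  change S.prim (fld S.w f) p = f p - S.avg f p
  rw [prim_apply, avg_apply, eq_sub_iff_add_eq, ← intervalIntegral.integral_add]
  · rw [intervalIntegral.integral_eq_sub_of_hasDerivAt
      (f := fun t => (2 * Real.pi)⁻¹ * t * f (p * S.c t))]
    · rw [S.two_pi]
      field_simp
      simp
    · intro t _
      have h := ((hasDerivAt_id t).const_mul (2 * Real.pi)⁻¹).mul (S.isIntegral.hasDerivAt f p t)
      refine h.congr_deriv ?_
      simp only [id]
      ring
    · exact (((continuous_const.mul continuous_id).mul (S.isIntegral.continuous _ p)).add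
        (continuous_const.mul (S.isIntegral.continuous f p))).intervalIntegrable _ _
  · exact ((continuous_const.mul continuous_id).mul
      (S.isIntegral.continuous _ p)).intervalIntegrable _ _
  · exact (continuous_const.mul (S.isIntegral.continuous f p)).intervalIntegrable _ _

theorem fld_prim (f : Fun I5 M5) : fld S.w (S.prim f) = f - S.avg f := by
  rw [← prim_fld, prim, Kernel.fld_conv_comm _ S.comm]

theorem avg_eq_self {f : Fun I5 M5} (h : fld S.w f = 0) : S.avg f = f := by
  have := S.prim_fld f
  rw [h, map_zero] at this
  exact (sub_eq_zero.1 this.symm).symm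

theorem continuous : Continuous S.c := by
  have h : Topology.IsInducing emb :=
    Topology.IsInducing.prodMap Topology.IsInducing.subtypeVal
      (Topology.IsInducing.prodMap Topology.IsInducing.subtypeVal Topology.IsInducing.subtypeVal)
  exact h.continuous_iff.2 S.contDiff.continuous

theorem mean_fld (f : Fun I5 M5) : mean (fld S.w f) = 0 :=
  BasicGeom.mean_fld S.isIntegral S.continuous f

theorem mean_avg (f : Fun I5 M5) : mean (S.avg f) = mean f := by
  have h := S.mean_fld (S.prim f)
  rw [fld_prim, map_sub] at h
  linarith

end CircleSubgroup

/-! ### The Poisson equation on the base of the Hopf fibration -/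

theorem circ1_eq : circ1 = fld (Pi.single 0 1) := frame_eq_fld 0
theorem circ2_eq : circ2 = fld (Pi.single 1 1) := frame_eq_fld 1
theorem e1_eq : e1 = fld (Pi.single 2 1) := frame_eq_fld 2
theorem e2_eq : e2 = fld (Pi.single 3 1) := frame_eq_fld 3
theorem e3_eq : e3 = fld (Pi.single 4 1) := frame_eq_fld 4

theorem hopf_fld : fld CircleSubgroup.hopf.w = e3 := by
  rw [e3_eq]
  congr 1
  funext i
  fin_cases i <;> rfl

theorem fst_fld : fld CircleSubgroup.fst.w = circ1 := circ1_eq.symm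

theorem snd_fld : fld CircleSubgroup.snd.w = circ2 := circ2_eq.symm

theorem lie_e1_e2 : ⁅e1, e2⁆ = (2 : ℝ) • e3 := by
  rw [e1_eq, e2_eq, e3_eq, fld_bracket, ← fld_smul]
  congr 1; funext i; fin_cases i <;> simp [lieB]

theorem lie_e2_e3 : ⁅e2, e3⁆ = (2 : ℝ) • e1 := by
  rw [e1_eq, e2_eq, e3_eq, fld_bracket, ← fld_smul]
  congr 1; funext i; fin_cases i <;> simp [lieB]

theorem lie_e3_e1 : ⁅e3, e1⁆ = (2 : ℝ) • e2 := by
  rw [e1_eq, e2_eq, e3_eq, fld_bracket, ← fld_smul]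
  congr 1; funext i; fin_cases i <;> simp [lieB]

theorem lie_circ1_fld (w : Fin 5 → ℝ) : ⁅circ1, fld w⁆ = 0 := by
  rw [circ1_eq, fld_bracket, show (0 : VField I5 M5) = fld 0 by simp [fld]]
  congr 1; funext i; fin_cases i <;> simp [lieB]

theorem lie_circ2_fld (w : Fin 5 → ℝ) : ⁅circ2, fld w⁆ = 0 := by
  rw [circ2_eq, fld_bracket, show (0 : VField I5 M5) = fld 0 by simp [fld]]
  congr 1; funext i; fin_cases i <;> simp [lieB]

theorem apply_comm_of_lie {X Y Z : VField I5 M5} (h : ⁅X, Y⁆ = Z) (f : Fun I5 M5) :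
    X (Y f) = Y (X f) + Z f := by
  rw [← h, Derivation.commutator_apply]; abel

theorem mean_e1 (f : Fun I5 M5) : mean (e1 f) = 0 := by
  have h := (CircleSubgroup.sphere 1 0 0 (by norm_num)).mean_fld f
  rwa [show fld (CircleSubgroup.sphere 1 0 0 (by norm_num)).w = e1 by
    rw [e1_eq]; congr 1; funext i; fin_cases i <;> rfl] at h

theorem mean_e2 (f : Fun I5 M5) : mean (e2 f) = 0 := by
  have h := (CircleSubgroup.sphere 0 1 0 (by norm_num)).mean_fld f
  rwa [show fld (CircleSubgroup.sphere 0 1 0 (by norm_num)).w = e2 by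
    rw [e2_eq]; congr 1; funext i; fin_cases i <;> rfl] at h

theorem mean_circ1 (f : Fun I5 M5) : mean (circ1 f) = 0 := by
  rw [← fst_fld]; exact CircleSubgroup.mean_fld _ f

theorem mean_circ2 (f : Fun I5 M5) : mean (circ2 f) = 0 := by
  rw [← snd_fld]; exact CircleSubgroup.mean_fld _ f

namespace Kernel

variable {P : Type*} [NormedAddCommGroup P] [NormedSpace ℝ P] [FiniteDimensional ℝ P]
  [MeasureSpace P] [BorelSpace P] (κ : Kernel P)

omit [FiniteDimensional ℝ P] in
theorem integrable_mul_continuous {φ : P → ℝ} (hφ : Continuous φ) :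
    Integrable (fun t => κ.K t * φ t) := by
  obtain ⟨C, hC⟩ := κ.isCompact.exists_bound_of_continuousOn hφ.continuousOn
  refine (κ.integrable.abs.mul_const C).mono'
    (κ.integrable.aestronglyMeasurable.mul hφ.aestronglyMeasurable)
    (Filter.Eventually.of_forall fun t => ?_)
  by_cases ht : t ∈ κ.supp
  · rw [norm_mul, Real.norm_eq_abs]
    gcongr
    exact hC t ht
  · simp [κ.eq_zero t ht]

/-- The product of a kernel and a continuous function. -/
def weight (φ : P → ℝ) (hφ : Continuous φ) : Kernel P where
  K t := κ.K t * φ t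
  c := κ.c
  supp := κ.supp
  integrable := κ.integrable_mul_continuous hφ
  isCompact := κ.isCompact
  eq_zero t ht := by simp [κ.eq_zero t ht]
  contDiff := κ.contDiff

omit [FiniteDimensional ℝ P] in
theorem integrable_weight_mul {φ : P → ℝ} (hφ : Continuous φ) (f : Fun I5 M5) (p : M5) :
    Integrable (fun t => κ.K t * φ t * f (p * κ.c t)) := (κ.weight φ hφ).integrable_mul f p

theorem weight_conv_apply {φ : P → ℝ} (hφ : Continuous φ) (f : Fun I5 M5) (p : M5) :
    (κ.weight φ hφ).conv f p = ∫ t, κ.K t * φ t * f (p * κ.c t) := rfl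

/-- Derivatives of convolutions when the adjoint action rotates the plane of `v` and `w`. -/
theorem fld_conv_rot {v w : Fin 5 → ℝ} {φ ψ : P → ℝ} (hφ : Continuous φ) (hψ : Continuous ψ)
    (h : ∀ t, lieV v * emb (κ.c t) = emb (κ.c t) * lieV (φ t • v + ψ t • w)) (f : Fun I5 M5) :
    fld v (κ.conv f) = (κ.weight φ hφ).conv (fld v f) + (κ.weight ψ hψ).conv (fld w f) := by
  ext p
  change _ = (κ.weight φ hφ).conv (fld v f) p + (κ.weight ψ hψ).conv (fld w f) p
  rw [κ.fld_conv h, weight_conv_apply, weight_conv_apply,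
    ← integral_add (κ.integrable_weight_mul hφ _ p) (κ.integrable_weight_mul hψ _ p)]
  congr 1
  funext t
  rw [fld_add, fld_smul, fld_smul]
  change κ.K t * (φ t * (fld v f) (p * κ.c t) + ψ t * (fld w f) (p * κ.c t)) = _
  ring

/-- Sums of squares are preserved when the adjoint action is a rotation. -/
theorem fld_fld_conv_rot {v w : Fin 5 → ℝ} {φ ψ : P → ℝ} (hφ : Continuous φ) (hψ : Continuous ψ)
    (h1 : ∀ t, lieV v * emb (κ.c t) = emb (κ.c t) * lieV (φ t • v + -ψ t • w))
    (h2 : ∀ t, lieV w * emb (κ.c t) = emb (κ.c t) * lieV (φ t • w + ψ t • v))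
    (h3 : ∀ t, φ t ^ 2 + ψ t ^ 2 = 1) (f : Fun I5 M5) :
    fld v (fld v (κ.conv f)) + fld w (fld w (κ.conv f)) =
      κ.conv (fld v (fld v f) + fld w (fld w f)) := by
  rw [κ.fld_conv_rot hφ hψ.neg h1, κ.fld_conv_rot hφ hψ h2, map_add, map_add,
    (κ.weight φ hφ).fld_conv_rot hφ hψ.neg h1, (κ.weight _ hψ.neg).fld_conv_rot hφ hψ.neg h1,
    (κ.weight φ hφ).fld_conv_rot hφ hψ h2, (κ.weight ψ hψ).fld_conv_rot hφ hψ h2]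
  ext p
  have i1 := ((κ.weight φ hφ).weight φ hφ).integrable_mul (fld v (fld v f)) p
  have i2 := ((κ.weight φ hφ).weight _ hψ.neg).integrable_mul (fld w (fld v f)) p
  have i3 := ((κ.weight _ hψ.neg).weight φ hφ).integrable_mul (fld v (fld w f)) p
  have i4 := ((κ.weight _ hψ.neg).weight _ hψ.neg).integrable_mul (fld w (fld w f)) p
  have i5 := ((κ.weight φ hφ).weight φ hφ).integrable_mul (fld w (fld w f)) p
  have i6 := ((κ.weight φ hφ).weight ψ hψ).integrable_mul (fld v (fld w f)) p
  have i7 := ((κ.weight ψ hψ).weight φ hφ).integrable_mul (fld w (fld v f)) p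
  have i8 := ((κ.weight ψ hψ).weight ψ hψ).integrable_mul (fld v (fld v f)) p
  refine (congrArg₂ (· + ·) (congrArg₂ (· + ·) (integral_add i1 i2).symm (integral_add i3 i4).symm)
    (congrArg₂ (· + ·) (integral_add i5 i6).symm (integral_add i7 i8).symm)).trans ?_
  refine (congrArg₂ (· + ·) (integral_add (i1.add i2) (i3.add i4)).symm
    (integral_add (i5.add i6) (i7.add i8)).symm).trans ?_
  refine (integral_add ((i1.add i2).add (i3.add i4)) ((i5.add i6).add (i7.add i8))).symm.trans ?_
  refine integral_congr_ae (Filter.Eventually.of_forall fun t => ?_)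
  have h := h3 t
  change κ.K t * φ t * φ t * fld v (fld v f) (p * κ.c t) +
    κ.K t * φ t * (-ψ t) * fld w (fld v f) (p * κ.c t) +
    (κ.K t * (-ψ t) * φ t * fld v (fld w f) (p * κ.c t) +
      κ.K t * (-ψ t) * (-ψ t) * fld w (fld w f) (p * κ.c t)) +
    (κ.K t * φ t * φ t * fld w (fld w f) (p * κ.c t) +
      κ.K t * φ t * ψ t * fld v (fld w f) (p * κ.c t) +
      (κ.K t * ψ t * φ t * fld w (fld v f) (p * κ.c t) +
        κ.K t * ψ t * ψ t * fld v (fld v f) (p * κ.c t))) =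
    κ.K t * (fld v (fld v f) (p * κ.c t) + fld w (fld w f) (p * κ.c t))
  linear_combination (κ.K t * (fld v (fld v f) (p * κ.c t) + fld w (fld w f) (p * κ.c t))) * h

end Kernel

/-- The adjoint action of the circle of `i`. -/
theorem e2_rot (h : (1 : ℝ) ^ 2 + 0 ^ 2 + 0 ^ 2 = 1) (t : ℝ) :
    lieV (Pi.single 3 1) * emb (subS 1 0 0 h t) = emb (subS 1 0 0 h t) *
      lieV (Real.cos (2 * t) • Pi.single 3 1 + -Real.sin (2 * t) • Pi.single 4 1) := by
  have h1 := Real.sin_sq_add_cos_sq t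
  rw [emb_subS, Real.cos_two_mul, Real.sin_two_mul]
  apply ext_V8 <;> simp [lieV, qexp_eq] <;>
    first | ring1 | linear_combination (-2 * Real.cos t) * h1

theorem e3_rot (h : (1 : ℝ) ^ 2 + 0 ^ 2 + 0 ^ 2 = 1) (t : ℝ) :
    lieV (Pi.single 4 1) * emb (subS 1 0 0 h t) = emb (subS 1 0 0 h t) *
      lieV (Real.cos (2 * t) • Pi.single 4 1 + Real.sin (2 * t) • Pi.single 3 1) := by
  have h1 := Real.sin_sq_add_cos_sq t
  rw [emb_subS, Real.cos_two_mul, Real.sin_two_mul]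
  apply ext_V8 <;> simp [lieV, qexp_eq] <;>
    first | ring1 | linear_combination (-2 * Real.cos t) * h1

/-- The adjoint action of the Hopf circle. -/
theorem e1_hopf (t : ℝ) :
    lieV (Pi.single 2 1) * emb (CircleSubgroup.hopf.c t) = emb (CircleSubgroup.hopf.c t) *
      lieV (Real.cos (2 * t) • Pi.single 2 1 + -Real.sin (2 * t) • Pi.single 3 1) := by
  have h1 := Real.sin_sq_add_cos_sq t
  rw [show CircleSubgroup.hopf.c t = subS 0 0 1 (by norm_num) t from rfl, emb_subS,
    Real.cos_two_mul, Real.sin_two_mul]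
  apply ext_V8 <;> simp [lieV, qexp_eq] <;>
    first | ring1 | linear_combination (-2 * Real.cos t) * h1

theorem e2_hopf (t : ℝ) :
    lieV (Pi.single 3 1) * emb (CircleSubgroup.hopf.c t) = emb (CircleSubgroup.hopf.c t) *
      lieV (Real.cos (2 * t) • Pi.single 3 1 + Real.sin (2 * t) • Pi.single 2 1) := by
  have h1 := Real.sin_sq_add_cos_sq t
  rw [show CircleSubgroup.hopf.c t = subS 0 0 1 (by norm_num) t from rfl, emb_subS,
    Real.cos_two_mul, Real.sin_two_mul]
  apply ext_V8 <;> simp [lieV, qexp_eq] <;>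
    first | ring1 | linear_combination (-2 * Real.cos t) * h1

/-- The sum of the squares of the frame of `S³`. -/
def casimir (f : Fun I5 M5) : Fun I5 M5 := e1 (e1 f) + (e2 (e2 f) + e3 (e3 f))

/-- The kernels supported on the quarter circle `exp(ti)`, `0 ≤ t ≤ π / 2`. -/
def quarter (k : ℝ → ℝ) (hk : IntervalIntegrable k volume 0 (Real.pi / 2)) : Kernel ℝ :=
  Kernel.ofInterval 0 (Real.pi / 2) (by positivity) k hk (subS 1 0 0 (by norm_num))
    (contDiff_emb_subS _ _ _ _)

theorem e1_quarter {k : ℝ → ℝ} (hk : IntervalIntegrable k volume 0 (Real.pi / 2))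
    (f : Fun I5 M5) : e1 ((quarter k hk).conv f) = (quarter k hk).conv (e1 f) := by
  rw [e1_eq]
  have h := (CircleSubgroup.sphere 1 0 0 (by norm_num)).comm
  have hw : (CircleSubgroup.sphere 1 0 0 (by norm_num)).w = Pi.single 2 1 := by
    funext i; fin_cases i <;> rfl
  rw [hw] at h
  exact Kernel.fld_conv_comm _ h f

theorem casimir_quarter {k : ℝ → ℝ} (hk : IntervalIntegrable k volume 0 (Real.pi / 2))
    (f : Fun I5 M5) : casimir ((quarter k hk).conv f) = (quarter k hk).conv (casimir f) := by
  have hφ : Continuous fun t => Real.cos (2 * t) := by fun_prop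
  have hψ : Continuous fun t => Real.sin (2 * t) := by fun_prop
  rw [casimir, casimir, map_add, e1_quarter, e1_quarter, e2_eq, e3_eq]
  rw [(quarter k hk).fld_fld_conv_rot hφ hψ (fun t => e2_rot (by norm_num) t)
    (fun t => e3_rot (by norm_num) t) (fun t => by linarith [Real.sin_sq_add_cos_sq (2 * t)])]

theorem e3_avg (f : Fun I5 M5) : e3 (CircleSubgroup.hopf.avg f) = 0 := by
  rw [← hopf_fld]; exact CircleSubgroup.fld_avg _ f

theorem avg_e3 (f : Fun I5 M5) : CircleSubgroup.hopf.avg (e3 f) = 0 := by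
  rw [← e3_avg f, ← hopf_fld]
  exact (Kernel.fld_conv_comm _ CircleSubgroup.hopf.comm f).symm

theorem horizontal_laplacian_avg (f : Fun I5 M5) :
    e1 (e1 (CircleSubgroup.hopf.avg f)) + e2 (e2 (CircleSubgroup.hopf.avg f)) =
      CircleSubgroup.hopf.avg (e1 (e1 f) + e2 (e2 f)) := by
  have hφ : Continuous fun t => Real.cos (2 * t) := by fun_prop
  have hψ : Continuous fun t => Real.sin (2 * t) := by fun_prop
  rw [e1_eq, e2_eq]
  exact Kernel.fld_fld_conv_rot _ hφ hψ e1_hopf e2_hopf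
    (fun t => by linarith [Real.sin_sq_add_cos_sq (2 * t)]) f

theorem quarter_conv_apply {k : ℝ → ℝ} (hk : IntervalIntegrable k volume 0 (Real.pi / 2))
    (f : Fun I5 M5) (p : M5) : (quarter k hk).conv f p =
      ∫ t in (0 : ℝ)..(Real.pi / 2), k t * f (p * subS 1 0 0 (by norm_num) t) :=
  Kernel.integral_ofInterval _ _ _ _

/-- Restricted to functions on the base of the Hopf fibration, averages over the Hopf circles of
convolutions with the quarter circle are the operators of integration over spherical caps, and
Darboux's equation computes their Laplacians. -/
theorem laplacian_avg_quarter {κ : ℝ → ℝ} (hκ : IntervalIntegrable κ volume 0 (Real.pi / 2))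
    (hκ1 : IntervalIntegrable (fun t => κ t * Real.sin (2 * t)) volume 0 (Real.pi / 2))
    (hκ2 : IntervalIntegrable (fun t => κ t * Real.cos (2 * t)) volume 0 (Real.pi / 2))
    {f : Fun I5 M5} (hf : e3 f = 0) :
    e1 (e1 (CircleSubgroup.hopf.avg ((quarter _ hκ1).conv f))) +
      e2 (e2 (CircleSubgroup.hopf.avg ((quarter _ hκ1).conv f))) =
    CircleSubgroup.hopf.avg ((quarter _ hκ1).conv (e1 (e1 f)) +
      (2 : ℝ) • (quarter _ hκ2).conv (e1 f)) := by
  have hφ : Continuous fun t => Real.cos (2 * t) := by fun_prop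
  have hψ : Continuous fun t => Real.sin (2 * t) := by fun_prop
  have hconv : ∀ (φ : ℝ → ℝ) (hφ : Continuous φ)
      (h : IntervalIntegrable (fun t => κ t * φ t) volume 0 (Real.pi / 2)) (g : Fun I5 M5),
      ((quarter κ hκ).weight φ hφ).conv g = (quarter _ h).conv g := by
    intro φ hφ h g
    ext p
    rw [quarter_conv_apply, Kernel.weight_conv_apply]
    simp only [mul_assoc]
    exact Kernel.integral_ofInterval _ _ _ (fun t => φ t * g (p * subS 1 0 0 (by norm_num) t))
  -- the field `e₃` kills the averages; for `e₂ f` this relates `e₂ (e₂ f)` to `e₁ f`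
  have key : CircleSubgroup.hopf.avg ((quarter _ hκ1).conv (e2 (e2 f))) =
      (2 : ℝ) • CircleSubgroup.hopf.avg ((quarter _ hκ2).conv (e1 f)) := by
    have h1 := (quarter κ hκ).fld_conv_rot hφ hψ (fun t => e3_rot (by norm_num) t) (e2 f)
    rw [← e3_eq, ← e2_eq, hconv _ hφ hκ2, hconv _ hψ hκ1] at h1
    have h2 := congrArg CircleSubgroup.hopf.avg h1
    have h3 : e3 (e2 f) = -((2 : ℝ) • e1 f) := by
      have := apply_comm_of_lie lie_e2_e3 f
      rw [hf, map_zero] at this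
      exact eq_neg_of_add_eq_zero_left this.symm
    rw [avg_e3, map_add, h3, map_neg, map_neg, map_smul, map_smul] at h2
    rw [← sub_eq_zero, h2]
    abel
  have h4 := congrArg CircleSubgroup.hopf.avg (casimir_quarter hκ1 f)
  simp only [casimir, hf, map_zero, add_zero] at h4
  rw [← add_assoc, map_add _ _ (e3 _), avg_e3, add_zero, map_add, map_add (Kernel.conv _) (e1 (e1 f)),
    map_add] at h4
  rw [horizontal_laplacian_avg, map_add _ (e1 _), h4, map_add, map_smul, key]

/-- An integration by parts for the logarithmic kernel `½ log (sin t)`, which is the Green function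
of the sphere. -/
theorem integral_log_sin_kernel {n n' n'' : ℝ → ℝ} (h1 : ∀ t, HasDerivAt n (n' t) t)
    (h2 : ∀ t, HasDerivAt n' (n'' t) t) (h3 : Continuous n'') :
    ∫ t in (0 : ℝ)..(Real.pi / 2), (1 / 2 * Real.log (Real.sin t) * Real.sin (2 * t) * n'' t +
      2 * (1 / 2 * Real.log (Real.sin t) * Real.cos (2 * t) * n' t)) =
    n 0 - ∫ t in (0 : ℝ)..(Real.pi / 2), Real.sin (2 * t) * n t := by
  have c1 : Continuous n := continuous_iff_continuousAt.2 fun t => (h1 t).continuousAt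
  have c2 : Continuous n' := continuous_iff_continuousAt.2 fun t => (h2 t).continuousAt
  have hlog : IntervalIntegrable (fun t => Real.log (Real.sin t)) volume 0 (Real.pi / 2) :=
    intervalIntegrable_log_sin
  have i1 : IntervalIntegrable (fun t => 1 / 2 * Real.log (Real.sin t) * Real.sin (2 * t) * n'' t +
      2 * (1 / 2 * Real.log (Real.sin t) * Real.cos (2 * t) * n' t)) volume 0 (Real.pi / 2) := by
    have := hlog.mul_continuousOn (g := fun t => 1 / 2 * Real.sin (2 * t) * n'' t +
      Real.cos (2 * t) * n' t) (by fun_prop)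
    refine this.congr ?_
    intro t _
    simp only
    ring
  have i2 : IntervalIntegrable (fun t => Real.sin (2 * t) * n t) volume 0 (Real.pi / 2) :=
    Continuous.intervalIntegrable (by fun_prop) _ _
  rw [eq_sub_iff_add_eq, ← intervalIntegral.integral_add i1 i2]
  -- The integrand has the primitive `½ sin (2t) log (sin t) n' - cos² t n`, continuous up to `0`.
  have hΦ := intervalIntegral.integral_eq_sub_of_hasDerivAt_of_le (a := 0) (b := Real.pi / 2)
    (by positivity) (f := fun t => Real.cos t * (Real.sin t * Real.log (Real.sin t)) * n' t -
      Real.cos t ^ 2 * n t) ?_ ?_ (i1.add i2)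
  · rw [hΦ]
    simp
  · have hl : Continuous fun t => Real.sin t * Real.log (Real.sin t) :=
      Real.continuous_mul_log.comp Real.continuous_sin
    exact Continuous.continuousOn (by fun_prop)
  · intro t ht
    have hs : 0 < Real.sin t := Real.sin_pos_of_pos_of_lt_pi ht.1 (by linarith [ht.2, Real.pi_pos])
    have d1 := (Real.hasDerivAt_sin t).log hs.ne'
    have d2 := (((Real.hasDerivAt_cos t).mul ((Real.hasDerivAt_sin t).mul d1)).mul (h2 t)).sub
      (((Real.hasDerivAt_cos t).pow 2).mul (h1 t))
    refine d2.congr_deriv ?_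
    simp only [Pi.mul_apply, Pi.pow_apply, Real.sin_two_mul, Real.cos_two_mul]
    field_simp
    have := Real.sin_sq_add_cos_sq t
    have hc : Real.sin t ^ 2 = 1 - Real.cos t ^ 2 := by linarith
    ring_nf
    simp only [hc]
    ring

/-- If the sum of squares of `e₁` and `e₂` annihilates `f`, so do `e₁` and `e₂`. -/
theorem harmonic_eq_zero {f : Fun I5 M5} (h : e1 (e1 f) + e2 (e2 f) = 0) : e1 f = 0 ∧ e2 f = 0 := by
  have key : mean (e1 f * e1 f + e2 f * e2 f) = 0 := by
    have h1 := mean_e1 (f * e1 f)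
    have h2 := mean_e2 (f * e2 f)
    have h3 : e1 f * e1 f + e2 f * e2 f = e1 (f * e1 f) + e2 (f * e2 f) - f • (0 : Fun I5 M5) := by
      rw [← h]
      simp only [Derivation.leibniz, smul_eq_mul]
      ring
    rw [h3, smul_zero, sub_zero, map_add, h1, h2, add_zero]
  have h0 := eq_zero_of_mean_eq_zero (fun p => ?_) key
  · constructor <;> ext p
    · have := congrArg (fun g : Fun I5 M5 => g p) h0
      change e1 f p * e1 f p + e2 f p * e2 f p = 0 at this
      change e1 f p = 0
      exact ((mul_self_add_mul_self_eq_zero).1 this).1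
    · have := congrArg (fun g : Fun I5 M5 => g p) h0
      change e1 f p * e1 f p + e2 f p * e2 f p = 0 at this
      change e2 f p = 0
      exact ((mul_self_add_mul_self_eq_zero).1 this).2
  · change 0 ≤ e1 f p * e1 f p + e2 f p * e2 f p
    exact add_nonneg (mul_self_nonneg _) (mul_self_nonneg _)

/-- Functions on the base of the Hopf fibration. -/
structure IsBase (f : Fun I5 M5) : Prop where
  circ1 : circ1 f = 0
  circ2 : circ2 f = 0
  e3 : e3 f = 0

theorem IsBase.eq_mean {f : Fun I5 M5} (hf : IsBase f) (h : e1 (e1 f) + e2 (e2 f) = 0) :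
    f = algebraMap ℝ _ (mean f) := by
  obtain ⟨h1, h2⟩ := harmonic_eq_zero h
  have hc := eq_of_frame_eq_zero (f := f) fun i => by
    fin_cases i
    exacts [hf.circ1, hf.circ2, h1, h2, hf.e3]
  have h3 : f = algebraMap ℝ _ (f 1) := by
    ext p; exact hc p 1
  conv_rhs => rw [h3, mean_algebraMap]
  exact h3

theorem circ1_kernel {P : Type*} [NormedAddCommGroup P] [NormedSpace ℝ P] [FiniteDimensional ℝ P]
    [MeasureSpace P] [BorelSpace P] (κ : Kernel P) (f : Fun I5 M5) :
    circ1 (κ.conv f) = κ.conv (circ1 f) := by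
  rw [circ1_eq]
  refine κ.fld_conv_comm (fun t => ?_) f
  apply ext_V8 <;> simp [lieV, emb, mul_comm]

theorem circ2_kernel {P : Type*} [NormedAddCommGroup P] [NormedSpace ℝ P] [FiniteDimensional ℝ P]
    [MeasureSpace P] [BorelSpace P] (κ : Kernel P) (f : Fun I5 M5) :
    circ2 (κ.conv f) = κ.conv (circ2 f) := by
  rw [circ2_eq]
  refine κ.fld_conv_comm (fun t => ?_) f
  apply ext_V8 <;> simp [lieV, emb, mul_comm]

theorem isBase_avg {P : Type*} [NormedAddCommGroup P] [NormedSpace ℝ P] [FiniteDimensional ℝ P]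
    [MeasureSpace P] [BorelSpace P] (κ : Kernel P) {f : Fun I5 M5} (hf : IsBase f) :
    IsBase (CircleSubgroup.hopf.avg (κ.conv f)) where
  circ1 := by
    rw [CircleSubgroup.avg, circ1_kernel, circ1_kernel, hf.circ1, map_zero, map_zero]
  circ2 := by
    rw [CircleSubgroup.avg, circ2_kernel, circ2_kernel, hf.circ2, map_zero, map_zero]
  e3 := e3_avg _

/-- The Poisson equation on the base of the Hopf fibration can be solved for functions of mean
value zero. -/
theorem exists_poisson {f : Fun I5 M5} (hf : IsBase f) :
    ∃ u, IsBase u ∧ e1 (e1 u) + e2 (e2 u) = f - algebraMap ℝ _ (mean f) := by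
  have hs := isIntegral_subS 1 0 0 (by norm_num)
  have hs1 : fld ![0, 0, 1, 0, 0] = e1 := by
    rw [e1_eq]; congr 1; funext i; fin_cases i <;> rfl
  have hd : ∀ g p t, HasDerivAt (fun t => g (p * subS 1 0 0 (by norm_num) t))
      (e1 g (p * subS 1 0 0 (by norm_num) t)) t := fun g p t => by
    have := hs.hasDerivAt g p t
    rwa [hs1] at this
  have hcont : ∀ g : Fun I5 M5, ∀ p, Continuous fun t => g (p * subS 1 0 0 (by norm_num) t) :=
    fun g p => hs.continuous g p
  have hlog : IntervalIntegrable (fun t => 1 / 2 * Real.log (Real.sin t)) volume 0 (Real.pi / 2) :=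
    intervalIntegrable_log_sin.const_mul _
  have hlog1 := hlog.mul_continuousOn (g := fun t => Real.sin (2 * t)) (by fun_prop)
  have hlog2 := hlog.mul_continuousOn (g := fun t => Real.cos (2 * t)) (by fun_prop)
  have h1 : IntervalIntegrable (fun _ : ℝ => (1 : ℝ)) volume 0 (Real.pi / 2) :=
    continuous_const.intervalIntegrable _ _
  have h11 := h1.mul_continuousOn (g := fun t => Real.sin (2 * t)) (by fun_prop)
  have h12 := h1.mul_continuousOn (g := fun t => Real.cos (2 * t)) (by fun_prop)
  have hu := laplacian_avg_quarter hlog hlog1 hlog2 hf.e3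
  have hh := laplacian_avg_quarter h1 h11 h12 hf.e3
  -- The logarithmic kernel reproduces `f`, up to its average over the spheres.
  have Eu : (quarter _ hlog1).conv (e1 (e1 f)) + (2 : ℝ) • (quarter _ hlog2).conv (e1 f) =
      f - (quarter _ h11).conv f := by
    ext p
    change (quarter _ hlog1).conv (e1 (e1 f)) p + 2 * (quarter _ hlog2).conv (e1 f) p =
      f p - (quarter _ h11).conv f p
    have := integral_log_sin_kernel (hd f p) (hd (e1 f) p) (hcont (e1 (e1 f)) p)
    rw [subS_zero, mul_one, intervalIntegral.integral_add, intervalIntegral.integral_const_mul]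
      at this
    · rw [quarter_conv_apply, quarter_conv_apply, quarter_conv_apply, this]
      simp only [one_mul]
    · exact hlog1.mul_continuousOn (hcont _ p).continuousOn
    · exact (hlog2.mul_continuousOn (hcont _ p).continuousOn).const_mul 2
  -- The kernel `1` gives a harmonic function, hence the constant `mean f`.
  have Eh : (quarter _ h11).conv (e1 (e1 f)) + (2 : ℝ) • (quarter _ h12).conv (e1 f) = 0 := by
    ext p
    change (quarter _ h11).conv (e1 (e1 f)) p + 2 * (quarter _ h12).conv (e1 f) p = 0
    rw [quarter_conv_apply, quarter_conv_apply, ← intervalIntegral.integral_const_mul,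
      ← intervalIntegral.integral_add]
    · rw [intervalIntegral.integral_eq_sub_of_hasDerivAt
        (f := fun t => Real.sin (2 * t) * e1 f (p * subS 1 0 0 (by norm_num) t))]
      · have : 2 * (Real.pi / 2) = Real.pi := by ring
        simp [this]
      · intro t _
        have d := ((hasDerivAt_id t).const_mul 2).sin.mul (hd (e1 f) p t)
        refine d.congr_deriv ?_
        simp only [id]
        ring
      · exact (h11.mul_continuousOn (hcont _ p).continuousOn).add
          ((h12.mul_continuousOn (hcont _ p).continuousOn).const_mul 2)
    · exact h11.mul_continuousOn (hcont _ p).continuousOn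
    · exact (h12.mul_continuousOn (hcont _ p).continuousOn).const_mul 2
  have hA : CircleSubgroup.hopf.avg f = f :=
    CircleSubgroup.avg_eq_self _ (by rw [hopf_fld]; exact hf.e3)
  rw [Eu, map_sub, hA] at hu
  rw [Eh, map_zero] at hh
  refine ⟨_, isBase_avg (quarter _ hlog1) hf, ?_⟩
  rw [hu, (isBase_avg (quarter _ h11) hf).eq_mean hh]
  have hm := congrArg mean hu
  rw [map_add, mean_e1, mean_e2, map_sub, add_zero] at hm
  rw [sub_eq_zero.1 hm.symm]

/-! ### The Green operator on the orbits of the two circles -/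

/-- Integration by parts, twice, for periodic functions. -/
theorem integral_mul_sub_deriv_deriv {φ φ' h h' h'' : ℝ → ℝ} {m : ℝ}
    (hφ : ∀ t, HasDerivAt φ (φ' t) t) (hφ' : ∀ t, HasDerivAt φ' (-m ^ 2 * φ t) t)
    (hh : ∀ t, HasDerivAt h (h' t) t) (hh' : ∀ t, HasDerivAt h' (h'' t) t) (hc : Continuous h'')
    (pφ : φ (2 * Real.pi) = φ 0) (pφ' : φ' (2 * Real.pi) = φ' 0)
    (ph : h (2 * Real.pi) = h 0) (ph' : h' (2 * Real.pi) = h' 0) :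
    ∫ t in (0 : ℝ)..(2 * Real.pi), φ t * (h t - h'' t) =
      (1 + m ^ 2) * ∫ t in (0 : ℝ)..(2 * Real.pi), φ t * h t := by
  have c1 : Continuous φ := continuous_iff_continuousAt.2 fun t => (hφ t).continuousAt
  have c2 : Continuous h := continuous_iff_continuousAt.2 fun t => (hh t).continuousAt
  have key : ∫ t in (0 : ℝ)..(2 * Real.pi), (-m ^ 2 * φ t * h t - φ t * h'' t) = 0 := by
    rw [intervalIntegral.integral_eq_sub_of_hasDerivAt
      (f := fun t => φ' t * h t - φ t * h' t)]
    · rw [pφ, pφ', ph, ph', sub_self]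
    · intro t _
      refine (((hφ' t).mul (hh t)).sub ((hφ t).mul (hh' t))).congr_deriv ?_
      ring
    · exact Continuous.intervalIntegrable (by fun_prop) _ _
  rw [← intervalIntegral.integral_const_mul, ← sub_eq_zero, ← intervalIntegral.integral_sub, ← key]
  · congr 1
    funext t
    ring
  · exact Continuous.intervalIntegrable (by fun_prop) _ _
  · exact Continuous.intervalIntegrable (by fun_prop) _ _

theorem summable_inv_one_add_sq : Summable fun m : ℤ => (1 + (m : ℝ) ^ 2)⁻¹ := by
  have h := Real.summable_one_div_int_pow (p := 2).2 (by norm_num)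
  refine Summable.of_norm_bounded_eventually h ?_
  have : ∀ᶠ m : ℤ in Filter.cofinite, m ≠ 0 := by
    simpa using (Set.finite_singleton (0 : ℤ)).eventually_cofinite_notMem
  filter_upwards [this] with m hm
  have : (0 : ℝ) < (m : ℝ) ^ 2 := by positivity
  rw [Real.norm_of_nonneg (by positivity), one_div]
  exact inv_anti₀ this (by linarith)

theorem hasDerivAt_cos_mul (m t : ℝ) :
    HasDerivAt (fun t => Real.cos (m * t)) (-m * Real.sin (m * t)) t := by
  have := ((hasDerivAt_id t).const_mul m).cos
  refine this.congr_deriv ?_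
  simp only [id]; ring

theorem hasDerivAt_sin_mul (m t : ℝ) :
    HasDerivAt (fun t => Real.sin (m * t)) (m * Real.cos (m * t)) t := by
  have := ((hasDerivAt_id t).const_mul m).sin
  refine this.congr_deriv ?_
  simp only [id]; ring

theorem cos_int_two_pi (m : ℤ) : Real.cos (m * (2 * Real.pi)) = 1 := Real.cos_int_mul_two_pi m
theorem sin_int_two_pi (m : ℤ) : Real.sin (m * (2 * Real.pi)) = 0 := by
  have := Real.sin_int_mul_pi (2 * m)
  rw [← this]; push_cast; ring_nf

/-- A convergent cosine series for the value at `0` of a periodic function. -/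
theorem hasSum_cos_integral {h h' h'' : ℝ → ℝ}
    (hh : ∀ t, HasDerivAt h (h' t) t) (hh' : ∀ t, HasDerivAt h' (h'' t) t) (hc : Continuous h'')
    (ph : Function.Periodic h (2 * Real.pi)) (ph' : Function.Periodic h' (2 * Real.pi)) :
    HasSum (fun m : ℤ => ∫ t in (0 : ℝ)..(2 * Real.pi),
      ((2 * Real.pi)⁻¹ * Real.cos (m * t)) * h t) (h 0) := by
  have : Fact (0 < 2 * Real.pi) := ⟨by positivity⟩
  have c2 : Continuous h := continuous_iff_continuousAt.2 fun t => (hh t).continuousAt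
  let g : AddCircle (2 * Real.pi) → ℂ := fun x => ((ph.lift x : ℝ) : ℂ)
  have hg : Continuous g := by
    refine Complex.continuous_ofReal.comp ?_
    exact continuous_coinduced_dom.2 c2
  have hcoef : ∀ m : ℤ, fourierCoeff g m =
      ((2 * Real.pi)⁻¹ * ∫ t in (0 : ℝ)..(2 * Real.pi), Real.cos (m * t) * h t : ℝ) -
      ((2 * Real.pi)⁻¹ * ∫ t in (0 : ℝ)..(2 * Real.pi), Real.sin (m * t) * h t : ℝ) *
        Complex.I := by
    intro m
    rw [fourierCoeff_eq_intervalIntegral _ _ 0, zero_add, Complex.ofReal_mul, Complex.ofReal_mul,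
      ← intervalIntegral.integral_ofReal, ← intervalIntegral.integral_ofReal, mul_assoc, ← mul_sub,
      ← intervalIntegral.integral_mul_const, ← intervalIntegral.integral_sub]
    · rw [one_div, Complex.real_smul]
      congr 1
      refine intervalIntegral.integral_congr fun t _ => ?_
      simp only [fourier_coe_apply]
      have e : (2 * Real.pi * Complex.I * ((-m : ℤ) : ℂ) * t / ((2 * Real.pi : ℝ) : ℂ)) =
          ((-(m * t) : ℝ) : ℂ) * Complex.I := by
        have : (Real.pi : ℂ) ≠ 0 := by exact_mod_cast Real.pi_ne_zero
        push_cast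
        field_simp
      rw [e, Complex.exp_mul_I, ← Complex.ofReal_cos, ← Complex.ofReal_sin, Real.cos_neg,
        Real.sin_neg]
      change _ * (((ph.lift (t : AddCircle (2 * Real.pi)) : ℝ) : ℂ)) = _
      rw [Function.Periodic.lift_coe]
      push_cast
      ring
    · exact Continuous.intervalIntegrable (by fun_prop) _ _
    · exact Continuous.intervalIntegrable (by fun_prop) _ _
  obtain ⟨C, hC⟩ := (isCompact_Icc (a := (0 : ℝ)) (b := 2 * Real.pi)).exists_bound_of_continuousOn
    (f := fun t => h t - h'' t) (c2.sub hc).continuousOn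
  have hbd : ∀ (m : ℤ) (φ : ℝ → ℝ), (∀ t, |φ t| ≤ 1) →
      |(2 * Real.pi)⁻¹ * ∫ t in (0 : ℝ)..(2 * Real.pi), φ t * (h t - h'' t)| ≤ C := by
    intro m φ hφ
    have := intervalIntegral.norm_integral_le_of_norm_le_const (a := 0) (b := 2 * Real.pi) (C := C)
      (f := fun t => φ t * (h t - h'' t)) fun t ht => by
        rw [uIoc_of_le (by positivity)] at ht
        rw [norm_mul]
        have h1 := hC t ⟨ht.1.le, ht.2⟩
        have h2 := hφ t
        rw [← Real.norm_eq_abs] at h2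
        nlinarith [norm_nonneg (h t - h'' t), norm_nonneg (φ t)]
    rw [Real.norm_eq_abs, sub_zero, abs_of_pos (a := 2 * Real.pi) (by positivity)] at this
    rw [abs_mul, abs_of_pos (a := (2 * Real.pi)⁻¹) (by positivity), inv_mul_le_iff₀ (by positivity)]
    linarith
  have pz : h (2 * Real.pi) = h 0 := by simpa using ph 0
  have pz' : h' (2 * Real.pi) = h' 0 := by simpa using ph' 0
  -- Two integrations by parts bound the coefficients by `(1 + m²)⁻¹`.
  have hsum : Summable (fourierCoeff g) := by
    refine Summable.of_norm_bounded (summable_inv_one_add_sq.mul_left (2 * C)) fun m => ?_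
    have i1 := integral_mul_sub_deriv_deriv (m := m) (hasDerivAt_cos_mul m)
      (fun t => ((hasDerivAt_sin_mul m t).const_mul _).congr_deriv (by ring)) hh hh' hc
      (by rw [cos_int_two_pi, mul_zero, Real.cos_zero])
      (by rw [sin_int_two_pi, mul_zero, mul_zero, Real.sin_zero, mul_zero]) pz pz'
    have i2 := integral_mul_sub_deriv_deriv (m := m) (hasDerivAt_sin_mul m)
      (fun t => ((hasDerivAt_cos_mul m t).const_mul _).congr_deriv (by ring)) hh hh' hc
      (by rw [sin_int_two_pi, mul_zero, Real.sin_zero])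
      (by rw [cos_int_two_pi, mul_zero, Real.cos_zero]) pz pz'
    have b1 := hbd m _ fun t => Real.abs_cos_le_one (m * t)
    have b2 := hbd m _ fun t => Real.abs_sin_le_one (m * t)
    have hp : (0 : ℝ) < 1 + (m : ℝ) ^ 2 := by positivity
    rw [i1, mul_left_comm, abs_mul, abs_of_pos hp] at b1
    rw [i2, mul_left_comm, abs_mul, abs_of_pos hp] at b2
    rw [hcoef]
    refine (norm_sub_le _ _).trans ?_
    rw [norm_mul, Complex.norm_I, mul_one, Complex.norm_real, Complex.norm_real,
      ← div_eq_mul_inv, le_div_iff₀ hp, Real.norm_eq_abs, Real.norm_eq_abs]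
    linarith
  have := Complex.hasSum_re (has_pointwise_sum_fourier_series_of_summable (f := ⟨g, hg⟩) hsum 0)
  have hz : ((⟨g, hg⟩ : C(AddCircle (2 * Real.pi), ℂ)) 0).re = h 0 := by
    change ((ph.lift ((0 : ℝ) : AddCircle (2 * Real.pi)) : ℝ)) = h 0
    rw [Function.Periodic.lift_coe]
  rw [hz] at this
  convert! this using 2 with m
  rw [fourier_eval_zero]
  change _ = ((fourierCoeff g m) • (1 : ℂ)).re
  rw [hcoef, smul_eq_mul, mul_one, Complex.sub_re, Complex.re_ofReal_mul, Complex.I_re, mul_zero,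
    sub_zero, Complex.ofReal_re, ← intervalIntegral.integral_const_mul]
  simp only [mul_assoc]

namespace CircleSubgroup

variable (S : CircleSubgroup)

/-- The kernel of a cosine coefficient. -/
def cosKernel (m : ℤ) : Kernel ℝ :=
  Kernel.ofInterval 0 (2 * Real.pi) (by positivity) (fun t => (2 * Real.pi)⁻¹ * Real.cos (m * t))
    (Continuous.intervalIntegrable (by fun_prop) _ _) S.c S.contDiff

/-- The cosine coefficients of functions along the orbits of the circle. -/
def cosAvg (m : ℤ) : Fun I5 M5 →ₗ[ℝ] Fun I5 M5 := (S.cosKernel m).conv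

theorem cosAvg_apply (m : ℤ) (f : Fun I5 M5) (p : M5) :
    S.cosAvg m f p =
      ∫ t in (0 : ℝ)..(2 * Real.pi), ((2 * Real.pi)⁻¹ * Real.cos (m * t)) * f (p * S.c t) :=
  Kernel.integral_ofInterval _ _ _ _

theorem cosAvg_zero (f : Fun I5 M5) : S.cosAvg 0 f = S.avg f := by
  ext p
  rw [cosAvg_apply, avg_apply]
  simp

theorem periodic (f : Fun I5 M5) (p : M5) :
    Function.Periodic (fun t => f (p * S.c t)) (2 * Real.pi) := fun t => by
  simp only [S.add, S.two_pi, mul_one]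

theorem cosAvg_sub (m : ℤ) (f : Fun I5 M5) :
    S.cosAvg m (f - fld S.w (fld S.w f)) = (1 + (m : ℝ) ^ 2) • S.cosAvg m f := by
  ext p
  change _ = (1 + (m : ℝ) ^ 2) * S.cosAvg m f p
  rw [cosAvg_apply, cosAvg_apply]
  simp only [mul_assoc]
  rw [intervalIntegral.integral_const_mul, intervalIntegral.integral_const_mul]
  have := integral_mul_sub_deriv_deriv (m := m) (hasDerivAt_cos_mul m)
      (fun t => ((hasDerivAt_sin_mul m t).const_mul _).congr_deriv (by ring))
      (S.isIntegral.hasDerivAt f p) (S.isIntegral.hasDerivAt (fld S.w f) p)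
      (S.isIntegral.continuous _ p)
      (by rw [cos_int_two_pi, mul_zero, Real.cos_zero])
      (by rw [sin_int_two_pi, mul_zero, mul_zero, Real.sin_zero, mul_zero])
      (by simpa using S.periodic f p 0) (by simpa using S.periodic (fld S.w f) p 0)
  rw [mul_left_comm, ← this]
  rfl

theorem hasSum_cosAvg (f : Fun I5 M5) (p : M5) : HasSum (fun m : ℤ => S.cosAvg m f p) (f p) := by
  have := hasSum_cos_integral (S.isIntegral.hasDerivAt f p)
    (S.isIntegral.hasDerivAt (fld S.w f) p) (S.isIntegral.continuous _ p) (S.periodic f p)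
    (S.periodic _ p)
  simp only [S.zero, mul_one] at this
  simpa only [cosAvg_apply] using this

theorem abs_cosAvg_le (m : ℤ) {f : Fun I5 M5} {C : ℝ} (hC : ∀ p, |f p| ≤ C) (p : M5) :
    |S.cosAvg m f p| ≤ C := by
  rw [cosAvg_apply]
  have := intervalIntegral.norm_integral_le_of_norm_le_const (a := 0) (b := 2 * Real.pi)
    (C := (2 * Real.pi)⁻¹ * C)
    (f := fun t => ((2 * Real.pi)⁻¹ * Real.cos (m * t)) * f (p * S.c t)) fun t _ => by
      rw [norm_mul, norm_mul, Real.norm_of_nonneg (r := (2 * Real.pi)⁻¹) (by positivity), mul_assoc]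
      refine mul_le_mul_of_nonneg_left ?_ (by positivity)
      have h2 := Real.abs_cos_le_one (m * t)
      have h1 := hC (p * S.c t)
      rw [← Real.norm_eq_abs] at h1 h2
      nlinarith [norm_nonneg (f (p * S.c t)), norm_nonneg (Real.cos (m * t))]
  rw [sub_zero, abs_of_pos (a := 2 * Real.pi) (by positivity)] at this
  refine this.trans_eq ?_
  field_simp

end CircleSubgroup

/-- The box on which the torus `S¹ × S¹` is parametrized. -/
def torusBox : Set (ℝ × ℝ) := Ioc 0 (2 * Real.pi) ×ˢ Ioc 0 (2 * Real.pi)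

theorem measurableSet_torusBox : MeasurableSet torusBox := measurableSet_Ioc.prod measurableSet_Ioc

/-- The coefficients of the Green kernel of `∂₂² + r² ∂₁²`, divided by those of
`(1 - ∂₁²)(1 - ∂₂²)` to make the series converge. -/
def greenCoeff (r : ℝ) (i : ℤ × ℤ) : ℝ :=
  if i = 0 then 0 else
    -(((i.2 : ℝ) ^ 2 + r ^ 2 * (i.1 : ℝ) ^ 2) * ((1 + (i.1 : ℝ) ^ 2) * (1 + (i.2 : ℝ) ^ 2)))⁻¹

theorem symbol_pos {r : ℝ} (hr : r ≠ 0) {i : ℤ × ℤ} (hi : i ≠ 0) :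
    r ^ 2 / (1 + r ^ 2) ≤ (i.2 : ℝ) ^ 2 + r ^ 2 * (i.1 : ℝ) ^ 2 := by
  have h0 : (0 : ℝ) < r ^ 2 := by positivity
  rw [div_le_iff₀ (by positivity)]
  have hsq : ∀ m : ℤ, m ≠ 0 → (1 : ℝ) ≤ (m : ℝ) ^ 2 := fun m hm => by
    have : (1 : ℤ) ≤ m ^ 2 := Int.add_one_le_of_lt (sq_pos_of_ne_zero hm)
    exact_mod_cast this
  by_cases h2 : i.2 = 0
  · have h1 : i.1 ≠ 0 := fun h1 => hi (Prod.ext h1 h2)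
    have := hsq _ h1
    rw [h2]
    push_cast
    nlinarith [mul_pos h0 h0, mul_nonneg h0.le (sub_nonneg.2 this),
      mul_nonneg (mul_pos h0 h0).le (sub_nonneg.2 this)]
  · have := hsq _ h2
    have h3 : 0 ≤ (i.1 : ℝ) ^ 2 := by positivity
    nlinarith [mul_nonneg h0.le h3, mul_nonneg (mul_pos h0 h0).le h3]

theorem abs_greenCoeff_le {r : ℝ} (hr : r ≠ 0) (i : ℤ × ℤ) :
    |greenCoeff r i| ≤
      (1 + r ^ 2) / r ^ 2 * ((1 + (i.1 : ℝ) ^ 2)⁻¹ * (1 + (i.2 : ℝ) ^ 2)⁻¹) := by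
  have h0 : (0 : ℝ) < r ^ 2 := by positivity
  unfold greenCoeff
  split_ifs with hi
  · rw [abs_zero]; positivity
  · have h1 := symbol_pos hr hi
    have h2 : 0 < r ^ 2 / (1 + r ^ 2) := by positivity
    rw [abs_neg, abs_of_nonneg (inv_nonneg.2 (by positivity)), mul_inv, mul_inv]
    refine mul_le_mul_of_nonneg_right ?_ (by positivity)
    rw [← inv_div]
    exact inv_anti₀ h2 h1

theorem summable_inv_mul_inv :
    Summable fun i : ℤ × ℤ => (1 + (i.1 : ℝ) ^ 2)⁻¹ * (1 + (i.2 : ℝ) ^ 2)⁻¹ :=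
  summable_inv_one_add_sq.mul_of_nonneg summable_inv_one_add_sq (fun _ => by positivity)
    (fun _ => by positivity)

/-- The characters of the torus. -/
def torusCos (i : ℤ × ℤ) (q : ℝ × ℝ) : ℝ :=
  ((2 * Real.pi)⁻¹ * Real.cos (i.2 * q.1)) * ((2 * Real.pi)⁻¹ * Real.cos (i.1 * q.2))

theorem continuous_torusCos (i : ℤ × ℤ) : Continuous (torusCos i) := by
  unfold torusCos; fun_prop

theorem abs_torusCos_le (i : ℤ × ℤ) (q : ℝ × ℝ) : ‖torusCos i q‖ ≤ (2 * Real.pi)⁻¹ ^ 2 := by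
  have hp : (0 : ℝ) < (2 * Real.pi)⁻¹ := by positivity
  unfold torusCos
  rw [norm_mul, norm_mul, norm_mul, Real.norm_of_nonneg hp.le, Real.norm_eq_abs, Real.norm_eq_abs]
  have h1 := Real.abs_cos_le_one (i.2 * q.1)
  have h2 := Real.abs_cos_le_one (i.1 * q.2)
  calc _ ≤ ((2 * Real.pi)⁻¹ * 1) * ((2 * Real.pi)⁻¹ * 1) := by gcongr
    _ = _ := by ring

theorem norm_greenCoeff_mul_le {r : ℝ} (hr : r ≠ 0) (i : ℤ × ℤ) (q : ℝ × ℝ) :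
    ‖greenCoeff r i * torusCos i q‖ ≤ (1 + r ^ 2) / r ^ 2 * (2 * Real.pi)⁻¹ ^ 2 *
      ((1 + (i.1 : ℝ) ^ 2)⁻¹ * (1 + (i.2 : ℝ) ^ 2)⁻¹) := by
  rw [norm_mul, Real.norm_eq_abs (greenCoeff r i)]
  calc _ ≤ ((1 + r ^ 2) / r ^ 2 * ((1 + (i.1 : ℝ) ^ 2)⁻¹ * (1 + (i.2 : ℝ) ^ 2)⁻¹)) *
        (2 * Real.pi)⁻¹ ^ 2 :=
        mul_le_mul (abs_greenCoeff_le hr i) (abs_torusCos_le i q) (norm_nonneg _) (by positivity)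
    _ = _ := by ring

/-- The Green function of the torus, smoothed by the inverse of `(1 - ∂₁²)(1 - ∂₂²)`. -/
def greenFun (r : ℝ) (q : ℝ × ℝ) : ℝ := ∑' i : ℤ × ℤ, greenCoeff r i * torusCos i q

theorem continuous_greenFun {r : ℝ} (hr : r ≠ 0) : Continuous (greenFun r) :=
  continuous_tsum (fun i => continuous_const.mul (continuous_torusCos i))
    (summable_inv_mul_inv.mul_left _) (norm_greenCoeff_mul_le hr)

theorem integrableOn_torusBox {g : ℝ × ℝ → ℝ} (hg : Continuous g) : IntegrableOn g torusBox :=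
  (hg.continuousOn.integrableOn_compact (isCompact_Icc.prod isCompact_Icc)).mono_set
    (prod_mono Ioc_subset_Icc_self Ioc_subset_Icc_self)

/-- The kernel of the Green operator. -/
def greenKernel {r : ℝ} (hr : r ≠ 0) : Kernel (ℝ × ℝ) where
  K := torusBox.indicator (greenFun r)
  c q := subC2 q.1 * subC1 q.2
  supp := Icc 0 (2 * Real.pi) ×ˢ Icc 0 (2 * Real.pi)
  integrable := (integrable_indicator_iff measurableSet_torusBox).2
    (integrableOn_torusBox (continuous_greenFun hr))
  isCompact := isCompact_Icc.prod isCompact_Icc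
  eq_zero _ ht := indicator_of_notMem
    (fun h => ht ⟨Ioc_subset_Icc_self h.1, Ioc_subset_Icc_self h.2⟩) _
  contDiff := by
    simp only [emb_mul]
    exact (contDiff_emb_subC2.comp contDiff_fst).mul (contDiff_emb_subC1.comp contDiff_snd)

/-- The components of functions along the characters of the torus. -/
def torusAvg (i : ℤ × ℤ) (f : Fun I5 M5) : Fun I5 M5 :=
  CircleSubgroup.snd.cosAvg i.2 (CircleSubgroup.fst.cosAvg i.1 f)

theorem continuous_torus (f : Fun I5 M5) (p : M5) :
    Continuous fun q : ℝ × ℝ => f (p * (subC2 q.1 * subC1 q.2)) := by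
  have h1 : Continuous subC1 := CircleSubgroup.fst.continuous
  have h2 : Continuous subC2 := CircleSubgroup.snd.continuous
  exact (Fun.continuous f).comp (continuous_const.mul
    ((h2.comp continuous_fst).mul (h1.comp continuous_snd)))

theorem integral_torusCos (i : ℤ × ℤ) (f : Fun I5 M5) (p : M5) :
    ∫ q in torusBox, torusCos i q * f (p * (subC2 q.1 * subC1 q.2)) = torusAvg i f p := by
  rw [torusBox, Measure.volume_eq_prod, setIntegral_prod, torusAvg, CircleSubgroup.cosAvg_apply,
    intervalIntegral.integral_of_le (by positivity)]
  · congr 1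
    funext t
    rw [CircleSubgroup.cosAvg_apply, intervalIntegral.integral_of_le (by positivity),
      ← integral_const_mul]
    congr 1
    funext s
    rw [torusCos, mul_assoc, mul_assoc p]
    rfl
  · exact integrableOn_torusBox ((continuous_torusCos i).mul (continuous_torus f p))

theorem hasSum_greenKernel {r : ℝ} (hr : r ≠ 0) (f : Fun I5 M5) (p : M5) :
    HasSum (fun i => greenCoeff r i * torusAvg i f p) ((greenKernel hr).conv f p) := by
  have e : (greenKernel hr).conv f p =
      ∫ q in torusBox, ∑' i, greenCoeff r i * (torusCos i q * f (p * (subC2 q.1 * subC1 q.2))) := by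
    rw [Kernel.conv_apply, ← integral_indicator measurableSet_torusBox]
    congr 1
    funext q
    by_cases hq : q ∈ torusBox
    · simp only [greenKernel, indicator_of_mem hq, greenFun]
      rw [← tsum_mul_right]
      simp only [mul_assoc]
    · simp only [greenKernel, indicator_of_notMem hq, zero_mul]
  rw [e]
  obtain ⟨C, hC⟩ := (isCompact_univ (X := M5)).exists_bound_of_continuousOn
    (Fun.continuous f).continuousOn
  have hint : ∀ i, IntegrableOn
      (fun q => greenCoeff r i * (torusCos i q * f (p * (subC2 q.1 * subC1 q.2)))) torusBox :=
    fun i => integrableOn_torusBox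
      (continuous_const.mul ((continuous_torusCos i).mul (continuous_torus f p)))
  have h := hasSum_integral_of_summable_integral_norm (μ := volume.restrict torusBox)
    (F := fun i q => greenCoeff r i * (torusCos i q * f (p * (subC2 q.1 * subC1 q.2)))) hint ?_
  · simpa only [integral_const_mul, integral_torusCos] using h
  · refine Summable.of_nonneg_of_le (fun i => integral_nonneg fun q => norm_nonneg _) (fun i => ?_)
      (summable_inv_mul_inv.mul_left
        ((1 + r ^ 2) / r ^ 2 * (2 * Real.pi)⁻¹ ^ 2 * C * volume.real torusBox))
    have := setIntegral_mono_on (hint i).norm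
      (integrableOn_torusBox (continuous_const (y := (1 + r ^ 2) / r ^ 2 * (2 * Real.pi)⁻¹ ^ 2 *
      ((1 + (i.1 : ℝ) ^ 2)⁻¹ * (1 + (i.2 : ℝ) ^ 2)⁻¹) * C))) measurableSet_torusBox fun q _ => by
        rw [← mul_assoc, norm_mul]
        exact mul_le_mul (norm_greenCoeff_mul_le hr i q) (hC _ (mem_univ _)) (norm_nonneg _)
          (by positivity)
    refine this.trans_eq ?_
    rw [setIntegral_const, smul_eq_mul]
    ring

/-- The operator `(1 - ∂₁²)(1 - ∂₂²)`. -/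
def smoother (f : Fun I5 M5) : Fun I5 M5 :=
  (f - circ1 (circ1 f)) - circ2 (circ2 (f - circ1 (circ1 f)))

theorem torusAvg_smoother (i : ℤ × ℤ) (f : Fun I5 M5) :
    torusAvg i (smoother f) = ((1 + (i.1 : ℝ) ^ 2) * (1 + (i.2 : ℝ) ^ 2)) • torusAvg i f := by
  have h1 : ∀ g, CircleSubgroup.fst.cosAvg i.1 (circ2 g) =
      circ2 (CircleSubgroup.fst.cosAvg i.1 g) := fun g => (circ2_kernel _ g).symm
  have h2 := CircleSubgroup.fst.cosAvg_sub i.1 f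
  have h3 := CircleSubgroup.snd.cosAvg_sub i.2 (CircleSubgroup.fst.cosAvg i.1
    (f - circ1 (circ1 f)))
  rw [fst_fld] at h2
  rw [snd_fld] at h3
  rw [torusAvg, smoother, map_sub (CircleSubgroup.fst.cosAvg i.1), h1, h1, h3, h2, map_smul,
    smul_smul, mul_comm]
  rfl

theorem torusAvg_laplacian (r : ℝ) (i : ℤ × ℤ) (f : Fun I5 M5) :
    torusAvg i (circ2 (circ2 f) + r ^ 2 • circ1 (circ1 f)) =
      -((i.2 : ℝ) ^ 2 + r ^ 2 * (i.1 : ℝ) ^ 2) • torusAvg i f := by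
  have h1 : ∀ g, CircleSubgroup.fst.cosAvg i.1 (circ2 g) =
      circ2 (CircleSubgroup.fst.cosAvg i.1 g) := fun g => (circ2_kernel _ g).symm
  have h2 := CircleSubgroup.fst.cosAvg_sub i.1 f
  have h3 := CircleSubgroup.snd.cosAvg_sub i.2 (CircleSubgroup.fst.cosAvg i.1 f)
  rw [fst_fld, map_sub, sub_eq_iff_eq_add] at h2
  rw [snd_fld, map_sub, sub_eq_iff_eq_add] at h3
  have h2' : CircleSubgroup.fst.cosAvg i.1 (circ1 (circ1 f)) =
    -((i.1 : ℝ) ^ 2) • CircleSubgroup.fst.cosAvg i.1 f := by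
    rw [← sub_eq_iff_eq_add'] at h2
    rw [← h2, add_smul, one_smul, neg_smul]
    abel
  rw [← sub_eq_iff_eq_add'] at h3
  rw [torusAvg, map_add, map_smul, h1, h1, h2', map_add, map_smul, map_smul, ← h3, torusAvg]
  module

theorem hasSum_torusAvg (f : Fun I5 M5) (p : M5) : HasSum (fun i => torusAvg i f p) (f p) := by
  obtain ⟨C, hC⟩ := (isCompact_univ (X := M5)).exists_bound_of_continuousOn
    (Fun.continuous (smoother f)).continuousOn
  have hs : Summable fun i => torusAvg i f p := by
    refine Summable.of_norm_bounded (summable_inv_mul_inv.mul_left C) fun i => ?_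
    have h := CircleSubgroup.snd.abs_cosAvg_le i.2
      (CircleSubgroup.fst.abs_cosAvg_le i.1 fun p => hC p (mem_univ p)) p
    change |torusAvg i (smoother f) p| ≤ C at h
    rw [torusAvg_smoother] at h
    change |((1 + (i.1 : ℝ) ^ 2) * (1 + (i.2 : ℝ) ^ 2)) * torusAvg i f p| ≤ C at h
    rw [abs_mul, abs_of_pos (by positivity)] at h
    rw [← mul_inv, ← div_eq_mul_inv, le_div_iff₀ (by positivity), mul_comm]
    exact h
  have h1 := hs.hasSum.prod_fiberwise fun m =>
    CircleSubgroup.snd.hasSum_cosAvg (CircleSubgroup.fst.cosAvg m f) p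
  rw [(CircleSubgroup.fst.hasSum_cosAvg f p).unique h1]
  exact hs.hasSum

/-- The Green operator of `∂₂² + r² ∂₁²`. -/
def green {r : ℝ} (hr : r ≠ 0) : Fun I5 M5 →ₗ[ℝ] Fun I5 M5 where
  toFun f := (greenKernel hr).conv (smoother f)
  map_add' f g := by
    rw [← map_add]
    congr 1
    simp only [smoother, map_add, map_sub]
    abel
  map_smul' c f := by
    rw [RingHom.id_apply, ← map_smul]
    congr 1
    simp only [smoother, Derivation.map_smul, map_sub, smul_sub]

theorem fld_green {r : ℝ} (hr : r ≠ 0) (w : Fin 5 → ℝ) (f : Fun I5 M5) :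
    fld w (green hr f) = green hr (fld w f) := by
  have h1 : ∀ g, circ1 (fld w g) = fld w (circ1 g) := fun g => by
    rw [apply_comm_of_lie (lie_circ1_fld w)]; simp
  have h2 : ∀ g, circ2 (fld w g) = fld w (circ2 g) := fun g => by
    rw [apply_comm_of_lie (lie_circ2_fld w)]; simp
  change fld w ((greenKernel hr).conv (smoother f)) = (greenKernel hr).conv (smoother (fld w f))
  rw [(greenKernel hr).fld_conv_comm]
  · congr 1
    simp only [smoother, h1, h2, map_sub]
  · intro t
    change _ * emb (subC2 t.1 * subC1 t.2) = emb (subC2 t.1 * subC1 t.2) * _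
    rw [emb_mul, emb_subC1, emb_subC2]
    apply ext_V8 <;> simp [lieV, mul_comm]

/-- The Green operator inverts the Laplacian up to the average over the torus. -/
theorem green_laplacian {r : ℝ} (hr : r ≠ 0) (f : Fun I5 M5) :
    green hr (circ2 (circ2 f) + r ^ 2 • circ1 (circ1 f)) =
      f - CircleSubgroup.snd.avg (CircleSubgroup.fst.avg f) := by
  ext p
  have h1 := hasSum_greenKernel hr (smoother (circ2 (circ2 f) + r ^ 2 • circ1 (circ1 f))) p
  have h2 := (hasSum_torusAvg f p).sub
    (hasSum_ite_eq (0 : ℤ × ℤ) (torusAvg 0 f p))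
  have e0 : torusAvg 0 f = CircleSubgroup.snd.avg (CircleSubgroup.fst.avg f) := by
    rw [torusAvg, ← CircleSubgroup.cosAvg_zero, ← CircleSubgroup.cosAvg_zero]; rfl
  change (greenKernel hr).conv (smoother _) p = f p - _
  rw [← e0]
  refine h1.unique ?_
  convert! h2 using 2 with i
  rw [torusAvg_smoother, torusAvg_laplacian, smul_smul]
  change greenCoeff r i * ((((1 + (i.1 : ℝ) ^ 2) * (1 + (i.2 : ℝ) ^ 2)) *
    (-((i.2 : ℝ) ^ 2 + r ^ 2 * (i.1 : ℝ) ^ 2))) * torusAvg i f p) = _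
  unfold greenCoeff
  by_cases hi : i = 0
  · simp [hi]
  · rw [if_neg hi, if_neg hi, sub_zero]
    have h3 := symbol_pos hr hi
    have h4 : 0 < r ^ 2 / (1 + r ^ 2) := by positivity
    have h5 : (i.2 : ℝ) ^ 2 + r ^ 2 * (i.1 : ℝ) ^ 2 ≠ 0 := (h4.trans_le h3).ne'
    have h6 : 1 + (i.1 : ℝ) ^ 2 ≠ 0 := by positivity
    have h7 : 1 + (i.2 : ℝ) ^ 2 ≠ 0 := by positivity
    field_simp

/-- The Green operator solves the Laplace equation for functions of average zero over the torus. -/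
theorem laplacian_green {r : ℝ} (hr : r ≠ 0) (f : Fun I5 M5) :
    circ2 (circ2 (green hr f)) + r ^ 2 • circ1 (circ1 (green hr f)) =
      f - CircleSubgroup.snd.avg (CircleSubgroup.fst.avg f) := by
  rw [← green_laplacian hr, circ1_eq, circ2_eq, fld_green, fld_green, fld_green, fld_green, map_add,
    map_smul]

end Analysis

/-! ### Cartan calculus -/

section Cartan

variable {E : Type*} [NormedAddCommGroup E] [NormedSpace ℝ E] {H : Type*} [TopologicalSpace H]
variable {I : ModelWithCorners ℝ E H} {M : Type*} [TopologicalSpace M] [ChartedSpace H M]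

/-- The complex linear extension of a real linear operator on functions. -/
def cplx (T : Fun I M →ₗ[ℝ] Fun I M) : CFun I M →ₗ[ℂ] CFun I M where
  toFun f := ofRealF (T (reF f)) + Complex.I • ofRealF (T (imF f))
  map_add' f g := by
    have h1 : reF (f + g) = reF f + reF g := by ext x; exact Complex.add_re _ _
    have h2 : imF (f + g) = imF f + imF g := by ext x; exact Complex.add_im _ _
    ext x
    rw [h1, h2, map_add, map_add]
    change (((T (reF f) x + T (reF g) x : ℝ) : ℂ) +
      Complex.I * ((T (imF f) x + T (imF g) x : ℝ) : ℂ)) =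
      (((T (reF f) x : ℝ) : ℂ) + Complex.I * ((T (imF f) x : ℝ) : ℂ)) +
      (((T (reF g) x : ℝ) : ℂ) + Complex.I * ((T (imF g) x : ℝ) : ℂ))
    push_cast
    ring
  map_smul' c f := by
    have h1 : reF (c • f) = c.re • reF f - c.im • imF f := by
      ext x; exact Complex.mul_re c (f x)
    have h2 : imF (c • f) = c.re • imF f + c.im • reF f := by
      ext x; exact Complex.mul_im c (f x)
    ext x
    rw [h1, h2, map_sub, map_add, map_smul, map_smul, map_smul, map_smul]
    change ((c.re * (T (reF f)) x - c.im * (T (imF f)) x : ℝ) : ℂ) +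
        Complex.I * ((c.re * (T (imF f)) x + c.im * (T (reF f)) x : ℝ) : ℂ) =
      c * (((T (reF f)) x : ℂ) + Complex.I * ((T (imF f)) x : ℂ))
    apply Complex.ext <;> simp

theorem cplx_apply (T : Fun I M →ₗ[ℝ] Fun I M) (f : CFun I M) (p : M) :
    cplx T f p = (T (reF f) p : ℂ) + Complex.I * (T (imF f) p : ℂ) := rfl

theorem reF_cplx (T : Fun I M →ₗ[ℝ] Fun I M) (f : CFun I M) : reF (cplx T f) = T (reF f) := by
  ext p
  change (cplx T f p).re = _
  rw [cplx_apply]; simp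

theorem imF_cplx (T : Fun I M →ₗ[ℝ] Fun I M) (f : CFun I M) : imF (cplx T f) = T (imF f) := by
  ext p
  change (cplx T f p).im = _
  rw [cplx_apply]; simp

theorem cfun_ext {f g : CFun I M} (h1 : reF f = reF g) (h2 : imF f = imF g) : f = g := by
  ext p
  exact Complex.ext (congrArg (fun h : Fun I M => h p) h1) (congrArg (fun h : Fun I M => h p) h2)

theorem reF_act (X : VField I M) (f : CFun I M) : reF (act X f) = X (reF f) := reF_cplx _ f
theorem imF_act (X : VField I M) (f : CFun I M) : imF (act X f) = X (imF f) := imF_cplx _ f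

theorem reF_add (f g : CFun I M) : reF (f + g) = reF f + reF g := by ext x; exact Complex.add_re _ _
theorem imF_add (f g : CFun I M) : imF (f + g) = imF f + imF g := by ext x; exact Complex.add_im _ _
theorem reF_sub (f g : CFun I M) : reF (f - g) = reF f - reF g := by ext x; exact Complex.sub_re _ _
theorem imF_sub (f g : CFun I M) : imF (f - g) = imF f - imF g := by ext x; exact Complex.sub_im _ _
theorem reF_smul (h : Fun I M) (f : CFun I M) : reF (h • f) = h * reF f := by
  ext x; exact Complex.smul_re _ _
theorem imF_smul (h : Fun I M) (f : CFun I M) : imF (h • f) = h * imF f := by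
  ext x; exact Complex.smul_im _ _
theorem reF_zero : reF (0 : CFun I M) = 0 := rfl
theorem imF_zero : imF (0 : CFun I M) = 0 := rfl
theorem reF_ofRealF (f : Fun I M) : reF (ofRealF f) = f := rfl
theorem imF_ofRealF (f : Fun I M) : imF (ofRealF f) = 0 := by
  ext x; exact Complex.ofReal_im (f x)

theorem act_add (X : VField I M) (f g : CFun I M) : act X (f + g) = act X f + act X g :=
  map_add (cplx (X : Fun I M →ₗ[ℝ] Fun I M)) f g
theorem add_act (X Y : VField I M) (f : CFun I M) : act (X + Y) f = act X f + act Y f := by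
  apply cfun_ext <;> simp only [reF_act, imF_act, reF_add, imF_add] <;> rfl
theorem smul_act (h : Fun I M) (X : VField I M) (f : CFun I M) : act (h • X) f = h • act X f := by
  apply cfun_ext <;> simp only [reF_act, imF_act, reF_smul, imF_smul] <;> rfl
theorem act_fsmul (X : VField I M) (h : Fun I M) (f : CFun I M) :
    act X (h • f) = h • act X f + X h • f := by
  apply cfun_ext <;> simp only [reF_act, imF_act, reF_add, imF_add, reF_smul, imF_smul,
    Derivation.leibniz, smul_eq_mul] <;> ring
theorem lie_act (X Y : VField I M) (f : CFun I M) :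
    act ⁅X, Y⁆ f = act X (act Y f) - act Y (act X f) := by
  apply cfun_ext <;> simp only [reF_act, imF_act, reF_sub, imF_sub, Derivation.commutator_apply]

/-- Contraction with a vector field. -/
def contr {k : ℕ} (X : VField I M) (θ : Cochain I M (k + 1)) : Cochain I M k :=
  fun v => θ (Fin.cons X v)

/-- The Lie derivative along a vector field. -/
def lieD {k : ℕ} (X : VField I M) (θ : Cochain I M k) : Cochain I M k :=
  fun v => act X (θ v) - ∑ i, θ (Function.update v i ⁅X, v i⁆)

theorem contr_add {k : ℕ} (X : VField I M) (θ τ : Cochain I M (k + 1)) :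
    contr X (θ + τ) = contr X θ + contr X τ := rfl
theorem contr_sub {k : ℕ} (X : VField I M) (θ τ : Cochain I M (k + 1)) :
    contr X (θ - τ) = contr X θ - contr X τ := rfl
theorem contr_neg {k : ℕ} (X : VField I M) (θ : Cochain I M (k + 1)) :
    contr X (-θ) = -contr X θ := rfl
theorem contr_zero {k : ℕ} (X : VField I M) : contr X (0 : Cochain I M (k + 1)) = 0 := rfl
theorem contr_smul {k : ℕ} (X : VField I M) (c : ℂ) (θ : Cochain I M (k + 1)) :
    contr X (c • θ) = c • contr X θ := rfl

theorem ext_contr {k : ℕ} {θ τ : Cochain I M (k + 1)} (h : ∀ X, contr X θ = contr X τ) : θ = τ := by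
  funext v
  have := congrFun (h (v 0)) (Fin.tail v)
  simpa only [contr, Fin.cons_self_tail] using this

theorem extD_add {k : ℕ} (θ τ : Cochain I M k) : extD (θ + τ) = extD θ + extD τ := by
  funext v
  cases k with
  | zero => simp [extD, act_add]
  | succ n =>
    simp only [extD, Pi.add_apply, act_add, smul_add, Finset.sum_add_distrib]
    abel

theorem extD_neg {k : ℕ} (θ : Cochain I M k) : extD (-θ) = -extD θ := by
  rw [← neg_one_smul ℂ θ, extD_smul, neg_one_smul]

theorem extD_sub {k : ℕ} (θ τ : Cochain I M k) : extD (θ - τ) = extD θ - extD τ := by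
  rw [sub_eq_add_neg, extD_add, extD_neg, ← sub_eq_add_neg]

theorem extD_zero {k : ℕ} : extD (0 : Cochain I M k) = 0 := by
  simpa using extD_smul 0 (0 : Cochain I M k)

theorem actJ_smul (J : VField I M →ₗ[Fun I M] VField I M) {k : ℕ} (c : ℂ) (θ : Cochain I M k) :
    actJ J (c • θ) = c • actJ J θ := by
  funext v; simp [actJ, Finset.smul_sum]

theorem actJ_neg (J : VField I M →ₗ[Fun I M] VField I M) {k : ℕ} (θ : Cochain I M k) :
    actJ J (-θ) = -actJ J θ := by
  rw [← neg_one_smul ℂ θ, actJ_smul, neg_one_smul]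

theorem actJ_sub (J : VField I M →ₗ[Fun I M] VField I M) {k : ℕ} (θ τ : Cochain I M k) :
    actJ J (θ - τ) = actJ J θ - actJ J τ := by
  rw [sub_eq_add_neg, actJ_add, actJ_neg, ← sub_eq_add_neg]

theorem actJ_zero (J : VField I M →ₗ[Fun I M] VField I M) {k : ℕ} :
    actJ J (0 : Cochain I M k) = 0 := by
  simpa using actJ_smul J 0 (0 : Cochain I M k)

theorem actJ_degree_zero (J : VField I M →ₗ[Fun I M] VField I M) (θ : Cochain I M 0) :
    actJ J θ = 0 := by
  funext v; simp [actJ]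

theorem lieD_add {k : ℕ} (X : VField I M) (θ τ : Cochain I M k) :
    lieD X (θ + τ) = lieD X θ + lieD X τ := by
  funext v
  simp only [lieD, Pi.add_apply, act_add, Finset.sum_add_distrib]
  abel

theorem lieD_smul {k : ℕ} (X : VField I M) (c : ℂ) (θ : Cochain I M k) :
    lieD X (c • θ) = c • lieD X θ := by
  funext v
  simp only [lieD, Pi.smul_apply, act_smul, smul_sub, Finset.smul_sum]

theorem lieD_neg {k : ℕ} (X : VField I M) (θ : Cochain I M k) : lieD X (-θ) = -lieD X θ := by
  rw [← neg_one_smul ℂ θ, lieD_smul, neg_one_smul]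

theorem lieD_sub {k : ℕ} (X : VField I M) (θ τ : Cochain I M k) :
    lieD X (θ - τ) = lieD X θ - lieD X τ := by
  rw [sub_eq_add_neg, lieD_add, lieD_neg, ← sub_eq_add_neg]

theorem lieD_zero {k : ℕ} (X : VField I M) : lieD X (0 : Cochain I M k) = 0 := by
  simpa using lieD_smul X 0 (0 : Cochain I M k)

/-- `[ι_Y, L_X] = -ι_{[X, Y]}`. -/
theorem contr_lieD {k : ℕ} (X Y : VField I M) (θ : Cochain I M (k + 1)) :
    contr Y (lieD X θ) = lieD X (contr Y θ) - contr ⁅X, Y⁆ θ := by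
  funext v
  simp only [contr, lieD, Pi.sub_apply, Fin.sum_univ_succ, Fin.cons_zero, Fin.cons_succ,
    Fin.update_cons_zero, Fin.cons_update]
  abel

/-- `[ι_X, J] = ι_{JX}`. -/
theorem contr_actJ (J : VField I M →ₗ[Fun I M] VField I M) {k : ℕ} (X : VField I M)
    (θ : Cochain I M (k + 1)) :
    contr X (actJ J θ) = actJ J (contr X θ) + contr (J X) θ := by
  funext v
  simp only [contr, actJ, Pi.add_apply, Fin.sum_univ_succ, Fin.cons_zero, Fin.cons_succ,
    Fin.update_cons_zero, Fin.cons_update]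
  abel

theorem lieD_degree_zero (X : VField I M) (θ : Cochain I M 0) (v : Fin 0 → VField I M) :
    lieD X θ v = act X (θ v) := by
  simp [lieD]

/-! ### Differential forms -/

theorem IsForm.exists_eq {k : ℕ} {θ : Cochain I M k} (h : IsForm θ) :
    ∃ α : VField I M [⋀^Fin k]→ₗ[Fun I M] CFun I M, θ = fun v => α v := by
  obtain ⟨α, hα⟩ := h
  exact ⟨α, funext fun v => (hα v).symm⟩

theorem IsForm.zero {k : ℕ} : IsForm (0 : Cochain I M k) := ⟨0, fun _ => rfl⟩

theorem IsForm.add {k : ℕ} {θ τ : Cochain I M k} (h1 : IsForm θ) (h2 : IsForm τ) :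
    IsForm (θ + τ) := by
  obtain ⟨α, rfl⟩ := h1.exists_eq
  obtain ⟨β, rfl⟩ := h2.exists_eq
  exact ⟨α + β, fun _ => rfl⟩

theorem IsForm.sub {k : ℕ} {θ τ : Cochain I M k} (h1 : IsForm θ) (h2 : IsForm τ) :
    IsForm (θ - τ) := by
  obtain ⟨α, rfl⟩ := h1.exists_eq
  obtain ⟨β, rfl⟩ := h2.exists_eq
  exact ⟨α - β, fun _ => rfl⟩

theorem IsForm.fsmul {k : ℕ} {θ : Cochain I M k} (h1 : IsForm θ) (h : Fun I M) :
    IsForm (h • θ) := by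
  obtain ⟨α, rfl⟩ := h1.exists_eq
  exact ⟨h • α, fun _ => rfl⟩

theorem smul_smul_comm (c : ℂ) (h : Fun I M) (f : CFun I M) : c • h • f = h • c • f := by
  ext p
  change c * (h p * f p) = h p * (c * f p)
  ring

instance : SMulCommClass (Fun I M) ℂ (CFun I M) := ⟨fun h c f => (smul_smul_comm c h f).symm⟩

theorem IsForm.smul {k : ℕ} {θ : Cochain I M k} (h1 : IsForm θ) (c : ℂ) : IsForm (c • θ) := by
  obtain ⟨α, rfl⟩ := h1.exists_eq
  exact ⟨c • α, fun _ => rfl⟩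

theorem IsForm.sum {k : ℕ} {ι : Type*} (s : Finset ι) {θ : ι → Cochain I M k}
    (h : ∀ i ∈ s, IsForm (θ i)) : IsForm (∑ i ∈ s, θ i) := by
  classical
  induction s using Finset.induction_on with
  | empty => simpa using IsForm.zero
  | insert a s ha ih =>
    rw [Finset.sum_insert ha]
    exact (h a (Finset.mem_insert_self _ _)).add
      (ih fun i hi => h i (Finset.mem_insert_of_mem hi))

theorem isForm_degree_zero (θ : Cochain I M 0) : IsForm θ :=
  ⟨AlternatingMap.constOfIsEmpty (Fun I M) (VField I M) (Fin 0) (θ Fin.elim0), fun v => by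
    rw [AlternatingMap.constOfIsEmpty_apply, Subsingleton.elim v Fin.elim0]; rfl⟩

theorem IsForm.contr {k : ℕ} {θ : Cochain I M (k + 1)} (h : IsForm θ) (X : VField I M) :
    IsForm (contr X θ) := by
  obtain ⟨α, rfl⟩ := h.exists_eq
  exact ⟨α.curryLeft X, fun v => rfl⟩

theorem IsForm.add_contr {k : ℕ} {θ : Cochain I M (k + 1)} (h : IsForm θ) (X Y : VField I M) :
    BasicGeom.contr (X + Y) θ = BasicGeom.contr X θ + BasicGeom.contr Y θ := by
  obtain ⟨α, rfl⟩ := h.exists_eq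
  funext v
  exact α.map_vecCons_add v X Y

theorem IsForm.fsmul_contr {k : ℕ} {θ : Cochain I M (k + 1)} (h : IsForm θ) (f : Fun I M)
    (X : VField I M) : BasicGeom.contr (f • X) θ = f • BasicGeom.contr X θ := by
  obtain ⟨α, rfl⟩ := h.exists_eq
  funext v
  exact α.map_vecCons_smul v f X

theorem IsForm.contr_contr {k : ℕ} {θ : Cochain I M (k + 2)} (h : IsForm θ) (X : VField I M) :
    BasicGeom.contr X (BasicGeom.contr X θ) = 0 := by
  obtain ⟨α, rfl⟩ := h.exists_eq
  funext v
  exact α.map_eq_zero_of_eq _ (i := 0) (j := 1) rfl (by simp)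

theorem IsForm.contr_anticomm {k : ℕ} {θ : Cochain I M (k + 2)} (h : IsForm θ)
    (X Y : VField I M) :
    BasicGeom.contr X (BasicGeom.contr Y θ) = -BasicGeom.contr Y (BasicGeom.contr X θ) := by
  have h1 := h.contr_contr (X + Y)
  rw [h.add_contr, (h.contr X).add (h.contr Y) |>.add_contr, contr_add, contr_add, h.contr_contr,
    h.contr_contr] at h1
  rw [eq_neg_iff_add_eq_zero]
  simpa using h1

theorem IsForm.zero_contr {k : ℕ} {θ : Cochain I M (k + 1)} (h : IsForm θ) :
    BasicGeom.contr (0 : VField I M) θ = 0 := by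
  rw [← zero_smul (Fun I M) (0 : VField I M), h.fsmul_contr, zero_smul]

theorem real_smul_eq (c : ℝ) (X : VField I M) : c • X = (algebraMap ℝ (Fun I M) c) • X := by
  rw [algebraMap_smul]

theorem algebraMap_smul_cfun (c : ℝ) (f : CFun I M) :
    (algebraMap ℝ (Fun I M) c) • f = (c : ℂ) • f := by
  ext p
  rfl

theorem IsForm.rsmul_contr {k : ℕ} {θ : Cochain I M (k + 1)} (h : IsForm θ) (c : ℝ)
    (X : VField I M) : BasicGeom.contr (c • X) θ = (c : ℂ) • BasicGeom.contr X θ := by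
  rw [real_smul_eq, h.fsmul_contr]
  funext v
  exact algebraMap_smul_cfun c _

theorem IsForm.neg_contr {k : ℕ} {θ : Cochain I M (k + 1)} (h : IsForm θ) (X : VField I M) :
    BasicGeom.contr (-X) θ = -BasicGeom.contr X θ := by
  have := h.add_contr X (-X)
  rw [add_neg_cancel, h.zero_contr] at this
  exact eq_neg_of_add_eq_zero_right this.symm

theorem IsForm.sub_contr {k : ℕ} {θ : Cochain I M (k + 1)} (h : IsForm θ) (X Y : VField I M) :
    BasicGeom.contr (X - Y) θ = BasicGeom.contr X θ - BasicGeom.contr Y θ := by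
  rw [sub_eq_add_neg, h.add_contr, h.neg_contr, ← sub_eq_add_neg]

/-- A 1-cochain is a form if it is linear. -/
theorem isForm_one {θ : Cochain I M 1} (h1 : ∀ X Y, contr (X + Y) θ = contr X θ + contr Y θ)
    (h2 : ∀ (f : Fun I M) X, contr (f • X) θ = f • contr X θ) : IsForm θ := by
  let L : VField I M →ₗ[Fun I M] CFun I M :=
    { toFun := fun X => contr X θ Fin.elim0
      map_add' := fun X Y => congrFun (h1 X Y) _
      map_smul' := fun f X => congrFun (h2 f X) _ }
  refine ⟨AlternatingMap.ofSubsingleton (Fun I M) (VField I M) (CFun I M) (0 : Fin 1) L,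
    fun v => ?_⟩
  change contr (v 0) θ Fin.elim0 = θ v
  unfold contr
  congr 1
  funext i
  rw [Fin.eq_zero i]
  rfl

/-- A cochain of degree at least two is a form if all contractions with one field are forms, and
the contractions with the same field twice vanish. -/
theorem isForm_of_contr {k : ℕ} {θ : Cochain I M (k + 2)} (h0 : ∀ X, IsForm (contr X θ))
    (h1 : ∀ X Y, contr (X + Y) θ = contr X θ + contr Y θ)
    (h3 : ∀ X, contr X (contr X θ) = 0) : IsForm θ := by
  have anti : ∀ X Y, contr X (contr Y θ) = -contr Y (contr X θ) := fun X Y => by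
    have h := h3 (X + Y)
    rw [h1, ((h0 X).add (h0 Y)).add_contr, contr_add, contr_add, h3, h3] at h
    rw [eq_neg_iff_add_eq_zero]
    simpa using h
  have h2 : ∀ (f : Fun I M) X, contr (f • X) θ = f • contr X θ := fun f X => by
    refine ext_contr fun Y => ?_
    rw [anti, (h0 Y).fsmul_contr]
    change _ = f • contr Y (contr X θ)
    rw [anti Y X, smul_neg]
  have key : ∀ v : Fin (k + 2) → VField I M, θ v = contr (v 0) θ (Fin.tail v) := fun v => by
    rw [contr, Fin.cons_self_tail]
  choose α hα using h0
  let μ : MultilinearMap (Fun I M) (fun _ : Fin (k + 2) => VField I M) (CFun I M) :=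
    LinearMap.uncurryLeft
      { toFun := fun X => (α X).toMultilinearMap
        map_add' := fun X Y => by
          ext1 v
          change α (X + Y) v = α X v + α Y v
          rw [hα, hα, hα, h1]; rfl
        map_smul' := fun f X => by
          ext1 v
          change α (f • X) v = f • α X v
          rw [hα, hα, h2]; rfl }
  have hμ : ∀ v, μ v = θ v := fun v => by
    rw [key, ← hα]; rfl
  have hzero : ∀ (v : Fin (k + 2) → VField I M) (j : Fin (k + 1)), v 0 = v j.succ → θ v = 0 := by
    intro v j hj
    rw [key, ← hα]
    by_cases h : j = 0
    · subst h
      have := congrFun (h3 (v 0)) (Fin.tail (Fin.tail v))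
      rw [hα]
      have e : Fin.tail v = Fin.cons (v 0) (Fin.tail (Fin.tail v)) := by
        conv_lhs => rw [← Fin.cons_self_tail (Fin.tail v)]
        rw [hj]; rfl
      rw [e]
      exact this
    · have hs := (α (v 0)).map_swap (Fin.tail v) (Ne.symm h)
      rw [← neg_eq_zero, ← hs, hα]
      have := congrFun (h3 (v 0)) (Fin.tail (Fin.tail v ∘ Equiv.swap 0 j))
      have e : (Fin.tail v ∘ Equiv.swap 0 j) =
          Fin.cons (v 0) (Fin.tail (Fin.tail v ∘ Equiv.swap 0 j)) := by
        conv_lhs => rw [← Fin.cons_self_tail (Fin.tail v ∘ Equiv.swap 0 j)]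
        congr 1
        simp only [Function.comp, Equiv.swap_apply_left]
        exact hj.symm
      rw [e]
      exact this
  -- Two equal arguments are moved to the position `0`, or both lie in the tail.
  refine ⟨{ μ with map_eq_zero_of_eq' := ?_ }, hμ⟩
  intro v i j hv hij
  change μ v = 0
  rw [hμ]
  induction i using Fin.cases with
  | zero =>
    induction j using Fin.cases with
    | zero => exact absurd rfl hij
    | succ j => exact hzero v j hv
  | succ i =>
    induction j using Fin.cases with
    | zero => exact hzero v i hv.symm
    | succ j =>
      rw [key, ← hα]
      exact (α (v 0)).map_eq_zero_of_eq _ (i := i) (j := j) hv fun h => hij (by rw [h])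

theorem vlie_add (X Y Z : VField I M) : ⁅X, Y + Z⁆ = ⁅X, Y⁆ + ⁅X, Z⁆ := by
  ext1 f
  simp only [Derivation.commutator_apply, Derivation.add_apply, map_add]
  abel

theorem add_vlie (X Y Z : VField I M) : ⁅X + Y, Z⁆ = ⁅X, Z⁆ + ⁅Y, Z⁆ := by
  ext1 f
  simp only [Derivation.commutator_apply, Derivation.add_apply, map_add]
  abel

theorem vlie_anti (X Y : VField I M) : ⁅X, Y⁆ = -⁅Y, X⁆ := by
  ext1 f
  simp only [Derivation.commutator_apply, Derivation.neg_apply, neg_sub]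

theorem vlie_fsmul (X : VField I M) (f : Fun I M) (Y : VField I M) :
    ⁅X, f • Y⁆ = f • ⁅X, Y⁆ + X f • Y := by
  ext1 g
  simp only [Derivation.commutator_apply, Derivation.add_apply, Derivation.smul_apply,
    Derivation.leibniz, smul_eq_mul]
  ring

theorem fsmul_vlie (X : VField I M) (f : Fun I M) (Y : VField I M) :
    ⁅f • X, Y⁆ = f • ⁅X, Y⁆ - Y f • X := by
  ext1 g
  simp only [Derivation.commutator_apply, Derivation.sub_apply, Derivation.smul_apply,
    Derivation.leibniz, smul_eq_mul]
  ring

theorem IsForm.lieD {k : ℕ} {θ : Cochain I M k} (h : IsForm θ) (X : VField I M) :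
    IsForm (lieD X θ) := by
  induction k with
  | zero => exact isForm_degree_zero _
  | succ k ih =>
    cases k with
    | zero =>
      refine isForm_one (fun Y Z => ?_) fun f Y => ?_
      · simp only [contr_lieD, vlie_add, h.add_contr, lieD_add]
        abel
      · rw [contr_lieD, contr_lieD, h.fsmul_contr,
          vlie_fsmul, h.add_contr, h.fsmul_contr, h.fsmul_contr]
        funext v
        simp only [Pi.sub_apply, lieD_degree_zero, Pi.smul_apply, Pi.add_apply, act_fsmul, smul_sub]
        abel
    | succ k =>
      refine isForm_of_contr (fun Y => ?_) (fun Y Z => ?_) fun Y => ?_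
      · rw [contr_lieD]
        exact (ih (h.contr Y)).sub (h.contr _)
      · simp only [contr_lieD, vlie_add, h.add_contr, lieD_add]
        abel
      · simp only [contr_lieD, contr_sub, h.contr_contr, lieD_zero]
        rw [h.contr_anticomm Y]
        abel

theorem IsForm.actJ {k : ℕ} {θ : Cochain I M k} (h : IsForm θ)
    (J : VField I M →ₗ[Fun I M] VField I M) : IsForm (actJ J θ) := by
  induction k with
  | zero => exact isForm_degree_zero _
  | succ k ih =>
    cases k with
    | zero =>
      refine isForm_one (fun Y Z => ?_) fun f Y => ?_
      · simp only [contr_actJ, map_add, h.add_contr, actJ_degree_zero]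
        abel
      · simp only [contr_actJ, map_smul, h.fsmul_contr, actJ_degree_zero, zero_add]
    | succ k =>
      refine isForm_of_contr (fun Y => ?_) (fun Y Z => ?_) fun Y => ?_
      · rw [contr_actJ]
        exact (ih (h.contr Y)).add (h.contr _)
      · simp only [contr_actJ, map_add, h.add_contr, actJ_add]
        abel
      · simp only [contr_actJ, contr_add, h.contr_contr, actJ_zero]
        rw [h.contr_anticomm Y]
        abel

theorem IsForm.neg_one_pow_smul_cons {k : ℕ} {θ : Cochain I M (k + 1)} (h : IsForm θ)
    (v : Fin (k + 1) → VField I M) (j : Fin (k + 1)) (Y : VField I M) :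
    (-1 : ℂ) ^ (j : ℕ) • θ (Fin.cons Y (j.removeNth v)) = θ (Function.update v j Y) := by
  obtain ⟨α, rfl⟩ := h.exists_eq
  have h1 := α.map_insertNth j Y (j.removeNth v)
  rw [Fin.insertNth_removeNth] at h1
  beta_reduce
  rw [h1]
  change _ = (-1) ^ (j : ℕ) • α (Fin.cons Y (j.removeNth v))
  rcases Nat.even_or_odd (j : ℕ) with hj | hj
  · rw [hj.neg_one_pow, hj.neg_one_pow, one_smul, one_smul]
  · rw [hj.neg_one_pow, hj.neg_one_pow, neg_smul, neg_smul, one_smul, one_smul]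

theorem sum_Ici_eq {k : ℕ} {A : Type*} [AddCommMonoid A] (i : Fin (k + 1)) (f : Fin (k + 1) → A) :
    ∑ j ∈ Finset.Ici i, f j = ∑ j, if i ≤ j then f j else 0 := by
  rw [← Finset.sum_filter]
  congr 1
  ext j; simp

/-- Cartan's formula in degree zero. -/
theorem contr_extD_zero (X : VField I M) (θ : Cochain I M 0) :
    contr X (extD θ) = lieD X θ := by
  funext v
  rw [lieD_degree_zero]
  rfl

/-- Cartan's formula. It is proved by splitting off from the Koszul formula the terms in which `X`
is differentiated along or enters a bracket, and it is all that is used of that formula. -/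
theorem contr_extD {k : ℕ} (X : VField I M) {θ : Cochain I M (k + 1)} (h : IsForm θ) :
    contr X (extD θ) = lieD X θ - extD (contr X θ) := by
  funext w
  have hA : ∀ i : Fin (k + 1), Fin.removeNth i.succ (Fin.cons X w : Fin (k + 2) → VField I M) =
      (Fin.cons X (i.removeNth w) : Fin (k + 1) → VField I M) := fun i => by
    funext j
    induction j using Fin.cases with
    | zero => simp [Fin.removeNth]
    | succ j => simp [Fin.removeNth]
  have hB : ∑ j : Fin (k + 1), (-1 : ℂ) ^ (j : ℕ) • θ (Fin.cons ⁅X, w j⁆ (j.removeNth w)) =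
      ∑ j, θ (Function.update w j ⁅X, w j⁆) :=
    Finset.sum_congr rfl fun j _ => h.neg_one_pow_smul_cons w j _
  simp only [contr, extD, Pi.sub_apply, lieD]
  rw [Fin.sum_univ_succ, Fin.sum_univ_succ (n := k) (f := fun i => ∑ j ∈ Finset.Ici i, _)]
  simp only [hA, Fin.removeNth_zero, Fin.tail_cons, Fin.cons_zero, Fin.cons_succ, Fin.val_zero,
    pow_zero, one_smul, Fin.castSucc_zero, zero_add, Fin.val_succ, pow_succ, mul_neg, mul_one,
    neg_smul, Finset.sum_neg_distrib]
  have h0 : Finset.Ici (0 : Fin (k + 1)) = Finset.univ := by ext j; simp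
  rw [h0, hB]
  cases k with
  | zero =>
    simp only [Finset.univ_eq_empty, Finset.sum_empty, contr]
    simp
    abel
  | succ m =>
    simp only [contr]
    have hC : ∀ i : Fin (m + 1), ∑ j ∈ Finset.Ici i.succ, (-1 : ℂ) ^ ((i : ℕ) + 1 + (j : ℕ)) •
        θ (Fin.cons ⁅w i.castSucc, w j⁆
          (j.removeNth (i.succ.castSucc.removeNth (Fin.cons X w : Fin (m + 3) → VField I M)))) =
        -∑ j ∈ Finset.Ici i, (-1 : ℂ) ^ ((i : ℕ) + (j : ℕ)) • θ (Fin.cons X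
          (Fin.cons ⁅w i.castSucc, w j.succ⁆ (j.removeNth (i.castSucc.removeNth w)))) := by
      intro i
      rw [sum_Ici_eq, sum_Ici_eq, Fin.sum_univ_succ, ← Finset.sum_neg_distrib]
      rw [if_neg (by simp), zero_add]
      refine Finset.sum_congr rfl fun j _ => ?_
      by_cases hij : i ≤ j
      · rw [if_pos (Fin.succ_le_succ_iff.2 hij), if_pos hij]
        have e1 : (j.succ.removeNth (i.succ.castSucc.removeNth
            (Fin.cons X w : Fin (m + 3) → VField I M))) =
            (Fin.cons X (j.removeNth (i.castSucc.removeNth w)) : Fin (m + 1) → VField I M) := by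
          rw [← Fin.succ_castSucc, hA]
          funext l
          induction l using Fin.cases with
          | zero => simp [Fin.removeNth]
          | succ l => simp [Fin.removeNth]
        have e2 := congrFun (h.contr_anticomm ⁅w i.castSucc, w j.succ⁆ X)
          (j.removeNth (i.castSucc.removeNth w))
        change θ (Fin.cons X (Fin.cons _ _)) = -θ (Fin.cons _ (Fin.cons X _)) at e2
        rw [e1, e2, smul_neg, neg_neg, Fin.val_succ]
        congr 1
        ring
      · rw [if_neg (fun h => hij (Fin.succ_le_succ_iff.1 h)), if_neg hij, neg_zero]
    have hD : ∀ i : Fin (m + 1), (Fin.cons X w : Fin (m + 3) → VField I M) i.succ.castSucc =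
      w i.castSucc := fun i => rfl
    simp only [hD]
    rw [Finset.sum_congr rfl fun i _ => hC i, Finset.sum_neg_distrib]
    abel

theorem IsForm.extD {k : ℕ} {θ : Cochain I M k} (h : IsForm θ) : IsForm (extD θ) := by
  induction k with
  | zero =>
    refine isForm_one (fun Y Z => ?_) fun f Y => ?_
    · simp only [contr_extD_zero]
      funext v
      simp only [lieD_degree_zero, Pi.add_apply, add_act]
    · simp only [contr_extD_zero]
      funext v
      simp only [lieD_degree_zero, Pi.smul_apply, smul_act]
  | succ k ih =>
    refine isForm_of_contr (fun X => ?_) (fun X Y => ?_) fun X => ?_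
    · rw [contr_extD X h]
      exact (h.lieD X).sub (ih (h.contr X))
    · have hl : BasicGeom.lieD (X + Y) θ = BasicGeom.lieD X θ + BasicGeom.lieD Y θ := by
        obtain ⟨α, rfl⟩ := h.exists_eq
        funext v
        simp only [BasicGeom.lieD, Pi.add_apply, add_act, add_vlie, α.map_update_add,
          Finset.sum_add_distrib]
        abel
      rw [contr_extD _ h, contr_extD _ h, contr_extD _ h, hl, h.add_contr, extD_add]
      abel
    · rw [contr_extD X h, contr_sub, contr_lieD]
      have hX : ⁅X, X⁆ = 0 := by ext1 f; simp
      rw [hX, h.zero_contr, sub_zero]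
      cases k with
      | zero => rw [contr_extD_zero, sub_self]
      | succ k => rw [contr_extD X (h.contr X), h.contr_contr, extD_zero, sub_zero, sub_self]

theorem lieD_lieD_sub {k : ℕ} (X Y : VField I M) {θ : Cochain I M k} (h : IsForm θ) :
    lieD X (lieD Y θ) - lieD Y (lieD X θ) = lieD ⁅X, Y⁆ θ := by
  induction k with
  | zero =>
    funext v
    simp only [Pi.sub_apply, lieD_degree_zero, lie_act]
  | succ k ih =>
    refine ext_contr fun Z => ?_
    have hj : ⁅⁅X, Y⁆, Z⁆ = ⁅X, ⁅Y, Z⁆⁆ - ⁅Y, ⁅X, Z⁆⁆ := by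
      ext1 f
      simp only [Derivation.commutator_apply, Derivation.sub_apply, map_sub]
      abel
    simp only [contr_sub, contr_lieD, lieD_sub]
    rw [← ih (h.contr Z), hj, h.sub_contr]
    abel

/-- The Lie derivative commutes with the exterior derivative. -/
theorem lieD_extD {k : ℕ} (X : VField I M) {θ : Cochain I M k} (h : IsForm θ) :
    lieD X (extD θ) = extD (lieD X θ) := by
  induction k with
  | zero =>
    refine ext_contr fun Y => ?_
    rw [contr_lieD, contr_extD_zero, contr_extD_zero, contr_extD_zero, ← lieD_lieD_sub X Y h]
    abel
  | succ k ih =>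
    refine ext_contr fun Y => ?_
    rw [contr_lieD, contr_extD Y h, contr_extD Y (h.lieD X), contr_extD _ h, contr_lieD, lieD_sub,
      extD_sub, ih (h.contr Y), ← lieD_lieD_sub X Y h]
    abel

/-- `d² = 0`. -/
theorem extD_extD {k : ℕ} {θ : Cochain I M k} (h : IsForm θ) : extD (extD θ) = 0 := by
  induction k with
  | zero =>
    refine ext_contr fun X => ?_
    rw [contr_extD X h.extD, contr_extD_zero, lieD_extD X h, sub_self, contr_zero]
  | succ k ih =>
    refine ext_contr fun X => ?_
    rw [contr_extD X h.extD, contr_extD X h, extD_sub, ih (h.contr X), sub_zero, lieD_extD X h,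
      sub_self, contr_zero]

/-- The Lie derivative commutes with `J` if the field preserves `J`. -/
theorem lieD_actJ {J : VField I M →ₗ[Fun I M] VField I M} {X : VField I M}
    (hJ : ∀ Y, ⁅X, J Y⁆ = J ⁅X, Y⁆) {k : ℕ} (θ : Cochain I M k) :
    lieD X (actJ J θ) = actJ J (lieD X θ) := by
  induction k with
  | zero => rw [actJ_degree_zero, actJ_degree_zero, lieD_zero]
  | succ k ih =>
    refine ext_contr fun Y => ?_
    rw [contr_lieD, contr_actJ, contr_actJ, contr_actJ, contr_lieD, contr_lieD, lieD_add, ih, hJ,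
      actJ_sub]
    abel

/-- The exterior product `φ ∧ θ` with a real 1-form. -/
def wedge (φ : VField I M →ₗ[Fun I M] Fun I M) : ∀ {k : ℕ}, Cochain I M k → Cochain I M (k + 1)
  | 0, θ => fun v => φ (v 0) • θ (Fin.tail v)
  | _ + 1, θ => fun v => φ (v 0) • θ (Fin.tail v) - wedge φ (contr (v 0) θ) (Fin.tail v)

theorem contr_wedge_zero (φ : VField I M →ₗ[Fun I M] Fun I M) (X : VField I M)
    (θ : Cochain I M 0) : contr X (wedge φ θ) = φ X • θ := rfl

theorem contr_wedge (φ : VField I M →ₗ[Fun I M] Fun I M) {k : ℕ} (X : VField I M)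
    (θ : Cochain I M (k + 1)) :
    contr X (wedge φ θ) = φ X • θ - wedge φ (contr X θ) := rfl

theorem wedge_add (φ : VField I M →ₗ[Fun I M] Fun I M) {k : ℕ} (θ τ : Cochain I M k) :
    wedge φ (θ + τ) = wedge φ θ + wedge φ τ := by
  induction k with
  | zero => funext v; exact smul_add _ _ _
  | succ k ih =>
    refine ext_contr fun X => ?_
    rw [contr_add]
    simp only [contr_wedge, contr_add, ih, smul_add]
    abel

theorem wedge_fsmul (φ : VField I M →ₗ[Fun I M] Fun I M) {k : ℕ} (f : Fun I M)
    (θ : Cochain I M k) : wedge φ (f • θ) = f • wedge φ θ := by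
  induction k with
  | zero =>
    funext v
    change φ (v 0) • f • θ (Fin.tail v) = f • φ (v 0) • θ (Fin.tail v)
    rw [smul_smul, smul_smul, mul_comm]
  | succ k ih =>
    refine ext_contr fun X => ?_
    have e : ∀ τ : Cochain I M (k + 1), contr X (f • τ) = f • contr X τ := fun _ => rfl
    have e' : ∀ τ : Cochain I M (k + 2), contr X (f • τ) = f • contr X τ := fun _ => rfl
    rw [e', contr_wedge, contr_wedge, e, ih, smul_sub, smul_comm]

theorem wedge_zero (φ : VField I M →ₗ[Fun I M] Fun I M) {k : ℕ} :
    wedge φ (0 : Cochain I M k) = 0 := by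
  simpa using wedge_fsmul φ 0 (0 : Cochain I M k)

theorem wedge_neg (φ : VField I M →ₗ[Fun I M] Fun I M) {k : ℕ} (θ : Cochain I M k) :
    wedge φ (-θ) = -wedge φ θ := by
  simpa using wedge_fsmul φ (-1) θ

theorem wedge_sub (φ : VField I M →ₗ[Fun I M] Fun I M) {k : ℕ} (θ τ : Cochain I M k) :
    wedge φ (θ - τ) = wedge φ θ - wedge φ τ := by
  rw [sub_eq_add_neg, wedge_add, wedge_neg, ← sub_eq_add_neg]

theorem IsForm.wedge {k : ℕ} {θ : Cochain I M k} (h : IsForm θ)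
    (φ : VField I M →ₗ[Fun I M] Fun I M) : IsForm (wedge φ θ) := by
  induction k with
  | zero =>
    refine isForm_one (fun X Y => ?_) fun f X => ?_
    · simp only [contr_wedge_zero, map_add, add_smul]
    · simp only [contr_wedge_zero, map_smul, smul_eq_mul, mul_smul]
  | succ k ih =>
    refine isForm_of_contr (fun X => ?_) (fun X Y => ?_) fun X => ?_
    · rw [contr_wedge]
      exact (h.fsmul _).sub (ih (h.contr X))
    · simp only [contr_wedge, map_add, add_smul, h.add_contr, wedge_add]
      abel
    · rw [contr_wedge, contr_sub]
      have e : BasicGeom.contr X (φ X • θ) = φ X • BasicGeom.contr X θ := rfl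
      rw [e]
      cases k with
      | zero => rw [contr_wedge_zero, sub_self]
      | succ k => rw [contr_wedge, h.contr_contr, wedge_zero, sub_zero, sub_self]

theorem zero_wedge {k : ℕ} (θ : Cochain I M k) :
    wedge (0 : VField I M →ₗ[Fun I M] Fun I M) θ = 0 := by
  induction k with
  | zero =>
    refine ext_contr fun X => ?_
    rw [contr_wedge_zero, LinearMap.zero_apply, zero_smul, contr_zero]
  | succ k ih =>
    refine ext_contr fun X => ?_
    rw [contr_wedge, ih, LinearMap.zero_apply, zero_smul, sub_zero, contr_zero]

theorem rsmul_wedge (c : ℝ) (φ : VField I M →ₗ[Fun I M] Fun I M) {k : ℕ} (θ : Cochain I M k) :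
    wedge (c • φ) θ = (c : ℂ) • wedge φ θ := by
  have e : ∀ {k : ℕ} (X : VField I M) (τ : Cochain I M k),
      (c • φ) X • τ = (c : ℂ) • φ X • τ := fun X τ => by
    funext v
    ext p
    change (((c * φ X p : ℝ) : ℂ) * τ v p) = (c : ℂ) * ((φ X p : ℂ) * τ v p)
    push_cast
    ring
  induction k with
  | zero => refine ext_contr fun X => e X θ
  | succ k ih =>
    refine ext_contr fun X => ?_
    rw [contr_wedge, ih, contr_smul, contr_wedge, smul_sub, e]

theorem wedge_self {φ : VField I M →ₗ[Fun I M] Fun I M} {k : ℕ} (θ : Cochain I M k) :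
    wedge φ (wedge φ θ) = 0 := by
  induction k with
  | zero =>
    refine ext_contr fun X => ?_
    rw [contr_wedge, contr_wedge_zero, wedge_fsmul, sub_self, contr_zero]
  | succ k ih =>
    refine ext_contr fun X => ?_
    rw [contr_wedge, contr_wedge, wedge_sub, wedge_fsmul, ih, sub_zero, sub_self, contr_zero]

/-- The Lie derivative is a derivation of the exterior product. Here `ψ` is the Lie derivative
of `φ`. -/
theorem lieD_wedge_add {φ ψ : VField I M →ₗ[Fun I M] Fun I M} {X : VField I M}
    (hφ : ∀ Y, X (φ Y) = φ ⁅X, Y⁆ + ψ Y) {k : ℕ} (θ : Cochain I M k) :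
    lieD X (wedge φ θ) = wedge φ (lieD X θ) + wedge ψ θ := by
  have hs : ∀ {k : ℕ} (f : Fun I M) (τ : Cochain I M k), lieD X (f • τ) =
      f • lieD X τ + X f • τ := fun f τ => by
    funext v
    simp only [lieD, Pi.smul_apply, Pi.add_apply, act_fsmul, smul_sub, Finset.smul_sum]
    abel
  induction k with
  | zero =>
    refine ext_contr fun Y => ?_
    rw [contr_lieD, contr_add, contr_wedge_zero, contr_wedge_zero, contr_wedge_zero,
      contr_wedge_zero, hs, hφ, add_smul]
    abel
  | succ k ih =>
    refine ext_contr fun Y => ?_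
    rw [contr_lieD, contr_add, contr_wedge, contr_wedge, contr_wedge, contr_wedge, contr_lieD,
      lieD_sub, ih, hs, hφ, wedge_sub, add_smul]
    abel

/-- The Lie derivative along `X` commutes with the product with a 1-form preserved by `X`. -/
theorem lieD_wedge {φ : VField I M →ₗ[Fun I M] Fun I M} {X : VField I M}
    (hφ : ∀ Y, X (φ Y) = φ ⁅X, Y⁆) {k : ℕ} (θ : Cochain I M k) :
    lieD X (wedge φ θ) = wedge φ (lieD X θ) := by
  rw [lieD_wedge_add (ψ := 0) (fun Y => by rw [hφ, LinearMap.zero_apply, add_zero]), zero_wedge,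
    add_zero]

/-! ### Basic forms of a foliation spanned by one vector field -/

/-- The contraction of `θ` with `ξ` vanishes; no condition in degree zero. -/
def Horizontal (ξ : VField I M) : ∀ {k : ℕ}, Cochain I M k → Prop
  | 0, _ => True
  | _ + 1, θ => contr ξ θ = 0

/-- Basic forms of the foliation spanned by `ξ`, by Cartan's formula: horizontal forms invariant
under the flow of `ξ`. -/
structure BasicFor (ξ : VField I M) {k : ℕ} (θ : Cochain I M k) : Prop where
  isForm : IsForm θ
  horizontal : Horizontal ξ θ
  invariant : lieD ξ θ = 0

theorem IsForm.eq_zero_of_mem_span {k : ℕ} {θ : Cochain I M (k + 1)} {ξ : VField I M}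
    (h : IsForm θ) (h0 : BasicGeom.contr ξ θ = 0) (v : Fin (k + 1) → VField I M)
    (hv : ∃ i, v i ∈ Submodule.span (Fun I M) {ξ}) : θ v = 0 := by
  obtain ⟨i, hi⟩ := hv
  obtain ⟨f, hf⟩ := Submodule.mem_span_singleton.1 hi
  have h1 := h.neg_one_pow_smul_cons v i ξ
  have h2 : θ (Fin.cons ξ (i.removeNth v)) = 0 := congrFun h0 _
  rw [h2, smul_zero] at h1
  obtain ⟨α, rfl⟩ := h.exists_eq
  beta_reduce at h1 ⊢
  rw [← Function.update_eq_self i v, ← hf, α.map_update_smul, ← h1, smul_zero]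

theorem isBasic_span_iff {ξ : VField I M} {k : ℕ} {θ : Cochain I M k} :
    IsBasic (Submodule.span (Fun I M) {ξ}) θ ↔ BasicFor ξ θ := by
  have hξ : ξ ∈ Submodule.span (Fun I M) {ξ} := Submodule.mem_span_singleton_self ξ
  constructor
  · rintro ⟨h1, h2, h3⟩
    have e3 : contr ξ (extD θ) = 0 := by
      funext v
      exact h3 _ ⟨0, hξ⟩
    cases k with
    | zero => exact ⟨h1, trivial, by rw [← contr_extD_zero, e3]⟩
    | succ k =>
      have e2 : contr ξ θ = 0 := by
        funext v
        exact h2 _ ⟨0, hξ⟩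
      refine ⟨h1, e2, ?_⟩
      rwa [contr_extD ξ h1, e2, extD_zero, sub_zero] at e3
  · rintro ⟨h1, h2, h3⟩
    cases k with
    | zero =>
      exact ⟨h1, fun v ⟨i, _⟩ => i.elim0,
        h1.extD.eq_zero_of_mem_span (by rw [contr_extD_zero, h3])⟩
    | succ k =>
      refine ⟨h1, h1.eq_zero_of_mem_span h2, h1.extD.eq_zero_of_mem_span ?_⟩
      rw [contr_extD ξ h1, h3, h2, extD_zero, sub_zero]

namespace BasicFor

variable {ξ : VField I M} {k : ℕ}

theorem contr_eq {θ : Cochain I M (k + 1)} (h : BasicFor ξ θ) : BasicGeom.contr ξ θ = 0 :=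
  h.horizontal

theorem zero : BasicFor ξ (0 : Cochain I M k) := ⟨IsForm.zero, by cases k <;> trivial, lieD_zero ξ⟩

theorem add {θ τ : Cochain I M k} (h : BasicFor ξ θ) (h' : BasicFor ξ τ) :
    BasicFor ξ (θ + τ) where
  isForm := h.isForm.add h'.isForm
  horizontal := by
    cases k with
    | zero => trivial
    | succ k => rw [Horizontal, contr_add, h.contr_eq, h'.contr_eq, add_zero]
  invariant := by rw [lieD_add, h.invariant, h'.invariant, add_zero]

theorem smul {θ : Cochain I M k} (h : BasicFor ξ θ) (c : ℂ) : BasicFor ξ (c • θ) where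
  isForm := h.isForm.smul c
  horizontal := by
    cases k with
    | zero => trivial
    | succ k => rw [Horizontal, contr_smul, h.contr_eq, smul_zero]
  invariant := by rw [lieD_smul, h.invariant, smul_zero]

theorem neg {θ : Cochain I M k} (h : BasicFor ξ θ) : BasicFor ξ (-θ) := by
  rw [← neg_one_smul ℂ θ]; exact h.smul _

theorem sub {θ τ : Cochain I M k} (h : BasicFor ξ θ) (h' : BasicFor ξ τ) :
    BasicFor ξ (θ - τ) := by
  rw [sub_eq_add_neg]; exact h.add h'.neg

theorem extD {θ : Cochain I M k} (h : BasicFor ξ θ) : BasicFor ξ (extD θ) where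
  isForm := h.isForm.extD
  horizontal := by
    cases k with
    | zero => rw [Horizontal, contr_extD_zero, h.invariant]
    | succ k => rw [Horizontal, contr_extD ξ h.isForm, h.invariant, h.contr_eq, extD_zero, sub_zero]
  invariant := by rw [lieD_extD ξ h.isForm, h.invariant, extD_zero]

theorem actJ {J : VField I M →ₗ[Fun I M] VField I M} (hJ0 : J ξ = 0)
    (hJ : ∀ Y, ⁅ξ, J Y⁆ = J ⁅ξ, Y⁆) {θ : Cochain I M k} (h : BasicFor ξ θ) :
    BasicFor ξ (actJ J θ) where
  isForm := h.isForm.actJ J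
  horizontal := by
    cases k with
    | zero => trivial
    | succ k =>
      rw [Horizontal, contr_actJ, h.contr_eq, hJ0, h.isForm.zero_contr, actJ_zero, add_zero]
  invariant := by rw [lieD_actJ hJ, h.invariant, actJ_zero]

theorem contr {θ : Cochain I M (k + 1)} (h : BasicFor ξ θ) {X : VField I M} (hX : ⁅ξ, X⁆ = 0) :
    BasicFor ξ (contr X θ) where
  isForm := h.isForm.contr X
  horizontal := by
    cases k with
    | zero => trivial
    | succ k => rw [Horizontal, h.isForm.contr_anticomm, h.contr_eq, contr_zero, neg_zero]
  invariant := by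
    have := contr_lieD ξ X θ
    rw [h.invariant, hX, h.isForm.zero_contr, contr_zero, sub_zero] at this
    exact this.symm

theorem wedge {θ : Cochain I M k} (h : BasicFor ξ θ) {φ : VField I M →ₗ[Fun I M] Fun I M}
    (h0 : φ ξ = 0) (hφ : ∀ Y, ξ (φ Y) = φ ⁅ξ, Y⁆) : BasicFor ξ (wedge φ θ) where
  isForm := h.isForm.wedge φ
  horizontal := by
    cases k with
    | zero => rw [Horizontal, contr_wedge_zero, h0, zero_smul]
    | succ k => rw [Horizontal, contr_wedge, h0, h.contr_eq, wedge_zero, zero_smul, sub_zero]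
  invariant := by rw [lieD_wedge hφ, h.invariant, wedge_zero]

end BasicFor

/-- The twisted differential `dᶜ = [J, d]`. -/
def dc (J : VField I M →ₗ[Fun I M] VField I M) {k : ℕ} (θ : Cochain I M k) : Cochain I M (k + 1) :=
  actJ J (extD θ) - extD (actJ J θ)

theorem del_eq_dc (J : VField I M →ₗ[Fun I M] VField I M) {k : ℕ} (θ : Cochain I M k) :
    del J θ = (1 / 2 : ℂ) • (extD θ - Complex.I • dc J θ) := rfl

theorem delbar_eq_dc (J : VField I M →ₗ[Fun I M] VField I M) {k : ℕ} (θ : Cochain I M k) :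
    delbar J θ = (1 / 2 : ℂ) • (extD θ + Complex.I • dc J θ) := rfl

theorem dc_add (J : VField I M →ₗ[Fun I M] VField I M) {k : ℕ} (θ τ : Cochain I M k) :
    dc J (θ + τ) = dc J θ + dc J τ := by
  simp only [dc, extD_add, actJ_add]; abel

theorem dc_smul (J : VField I M →ₗ[Fun I M] VField I M) {k : ℕ} (c : ℂ) (θ : Cochain I M k) :
    dc J (c • θ) = c • dc J θ := by
  simp only [dc, extD_smul, actJ_smul, smul_sub]

theorem dc_neg (J : VField I M →ₗ[Fun I M] VField I M) {k : ℕ} (θ : Cochain I M k) :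
    dc J (-θ) = -dc J θ := by
  rw [← neg_one_smul ℂ θ, dc_smul, neg_one_smul]

theorem dc_sub (J : VField I M →ₗ[Fun I M] VField I M) {k : ℕ} (θ τ : Cochain I M k) :
    dc J (θ - τ) = dc J θ - dc J τ := by
  rw [sub_eq_add_neg, dc_add, dc_neg, ← sub_eq_add_neg]

theorem dc_zero (J : VField I M →ₗ[Fun I M] VField I M) {k : ℕ} : dc J (0 : Cochain I M k) = 0 := by
  simpa using dc_smul J 0 (0 : Cochain I M k)

theorem dc_degree_zero (J : VField I M →ₗ[Fun I M] VField I M) (θ : Cochain I M 0) :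
    dc J θ = actJ J (extD θ) := by
  rw [dc, actJ_degree_zero, extD_zero, sub_zero]

theorem BasicFor.dc {J : VField I M →ₗ[Fun I M] VField I M} {ξ : VField I M} (hJ0 : J ξ = 0)
    (hJ : ∀ Y, ⁅ξ, J Y⁆ = J ⁅ξ, Y⁆) {k : ℕ} {θ : Cochain I M k} (h : BasicFor ξ θ) :
    BasicFor ξ (dc J θ) :=
  (h.extD.actJ hJ0 hJ).sub (h.actJ hJ0 hJ).extD

/-- `d dᶜ = -dᶜ d`. -/
theorem extD_dc (J : VField I M →ₗ[Fun I M] VField I M) {k : ℕ} {θ : Cochain I M k}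
    (h : IsForm θ) : extD (dc J θ) = -dc J (extD θ) := by
  rw [dc, dc, extD_sub, extD_extD (h.actJ J), extD_extD h, actJ_zero]
  abel

/-- `{dᶜ, ι_X} = L_{JX}` if `X` preserves `J`. -/
theorem contr_dc {J : VField I M →ₗ[Fun I M] VField I M} {X : VField I M}
    (hJ : ∀ Y, ⁅X, J Y⁆ = J ⁅X, Y⁆) {k : ℕ} {θ : Cochain I M (k + 1)} (h : IsForm θ) :
    contr X (dc J θ) = lieD (J X) θ - dc J (contr X θ) := by
  rw [dc, dc, contr_sub, contr_actJ, contr_extD X h, contr_extD (J X) h,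
    contr_extD X (h.actJ J), contr_actJ, lieD_actJ hJ, extD_add, actJ_sub]
  abel

theorem contr_dc_zero (J : VField I M →ₗ[Fun I M] VField I M) (X : VField I M)
    (θ : Cochain I M 0) : contr X (dc J θ) = lieD (J X) θ := by
  rw [dc_degree_zero, contr_actJ, actJ_degree_zero, contr_extD_zero, zero_add]

end Cartan

/-! ### Forms and the left-invariant frame -/

theorem fld_eq_sum (w : Fin 5 → ℝ) : fld w = ∑ i, w i • frame i := by
  ext1 f
  rw [fld_apply, Fin.sum_univ_five, Fin.sum_univ_five]
  rfl

theorem IsForm.contr_sum {k : ℕ} {ι : Type*} {θ : Cochain I5 M5 (k + 1)} (h : IsForm θ)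
    (s : Finset ι) (X : ι → VField I5 M5) :
    BasicGeom.contr (∑ i ∈ s, X i) θ = ∑ i ∈ s, BasicGeom.contr (X i) θ := by
  classical
  induction s using Finset.induction_on with
  | empty => simpa using h.zero_contr
  | insert a s ha ih => rw [Finset.sum_insert ha, Finset.sum_insert ha, h.add_contr, ih]

theorem IsForm.contr_fld {k : ℕ} {θ : Cochain I5 M5 (k + 1)} (h : IsForm θ) (w : Fin 5 → ℝ) :
    BasicGeom.contr (fld w) θ = ∑ i, (w i : ℂ) • BasicGeom.contr (frame i) θ := by
  rw [fld_eq_sum, h.contr_sum]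
  exact Finset.sum_congr rfl fun i _ => h.rsmul_contr _ _

theorem IsForm.contr_eq_sum {k : ℕ} {θ : Cochain I5 M5 (k + 1)} (h : IsForm θ)
    (X : VField I5 M5) :
    BasicGeom.contr X θ = ∑ i, coframe i X • BasicGeom.contr (frame i) θ := by
  conv_lhs => rw [← sum_coframe_smul_frame X, h.contr_sum]
  exact Finset.sum_congr rfl fun i _ => h.fsmul_contr _ _

theorem ext_frame {k : ℕ} {θ τ : Cochain I5 M5 (k + 1)} (h1 : IsForm θ) (h2 : IsForm τ)
    (h : ∀ i, contr (frame i) θ = contr (frame i) τ) : θ = τ := by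
  refine ext_contr fun X => ?_
  rw [h1.contr_eq_sum, h2.contr_eq_sum]
  simp only [h]

/-- The action on forms of an operator `T` on functions, through the coefficients in the
left-invariant frame. -/
def frameOp (T : Fun I5 M5 →ₗ[ℝ] Fun I5 M5) : ∀ {k : ℕ}, Cochain I5 M5 k → Cochain I5 M5 k
  | 0, θ => fun v => cplx T (θ v)
  | _ + 1, θ => fun v => ∑ i, coframe i (v 0) • frameOp T (contr (frame i) θ) (Fin.tail v)

variable (T : Fun I5 M5 →ₗ[ℝ] Fun I5 M5)

theorem frameOp_zero_apply (θ : Cochain I5 M5 0) (v : Fin 0 → VField I5 M5) :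
    frameOp T θ v = cplx T (θ v) := rfl

theorem contr_frameOp {k : ℕ} (X : VField I5 M5) (θ : Cochain I5 M5 (k + 1)) :
    contr X (frameOp T θ) = ∑ i, coframe i X • frameOp T (contr (frame i) θ) := by
  funext v
  rw [Finset.sum_apply]
  rfl

theorem contr_frame_frameOp {k : ℕ} (j : Fin 5) (θ : Cochain I5 M5 (k + 1)) :
    contr (frame j) (frameOp T θ) = frameOp T (contr (frame j) θ) := by
  rw [contr_frameOp, Finset.sum_eq_single j]
  · rw [coframe_frame, if_pos rfl, one_smul]
  · intro i _ hij
    rw [coframe_frame, if_neg hij, zero_smul]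
  · simp

theorem frameOp_add {k : ℕ} (θ τ : Cochain I5 M5 k) :
    frameOp T (θ + τ) = frameOp T θ + frameOp T τ := by
  induction k with
  | zero => funext v; exact map_add (cplx T) _ _
  | succ k ih =>
    refine ext_contr fun X => ?_
    rw [contr_add]
    simp only [contr_frameOp, contr_add, ih, smul_add, Finset.sum_add_distrib]

theorem frameOp_smul {k : ℕ} (c : ℂ) (θ : Cochain I5 M5 k) :
    frameOp T (c • θ) = c • frameOp T θ := by
  induction k with
  | zero => funext v; exact map_smul (cplx T) _ _
  | succ k ih =>
    refine ext_contr fun X => ?_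
    rw [contr_smul]
    simp only [contr_frameOp, contr_smul, ih, Finset.smul_sum]
    refine Finset.sum_congr rfl fun i _ => smul_comm _ _ _

theorem frameOp_zero {k : ℕ} : frameOp T (0 : Cochain I5 M5 k) = 0 := by
  simpa using frameOp_smul T 0 (0 : Cochain I5 M5 k)

theorem frameOp_neg {k : ℕ} (θ : Cochain I5 M5 k) : frameOp T (-θ) = -frameOp T θ := by
  rw [← neg_one_smul ℂ θ, frameOp_smul, neg_one_smul]

theorem frameOp_sub {k : ℕ} (θ τ : Cochain I5 M5 k) :
    frameOp T (θ - τ) = frameOp T θ - frameOp T τ := by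
  rw [sub_eq_add_neg, frameOp_add, frameOp_neg, ← sub_eq_add_neg]

theorem frameOp_sum {k : ℕ} {ι : Type*} (s : Finset ι) (θ : ι → Cochain I5 M5 k) :
    frameOp T (∑ i ∈ s, θ i) = ∑ i ∈ s, frameOp T (θ i) := by
  classical
  induction s using Finset.induction_on with
  | empty => simpa using frameOp_zero T
  | insert a s ha ih => rw [Finset.sum_insert ha, Finset.sum_insert ha, frameOp_add, ih]

theorem IsForm.frameOp {k : ℕ} {θ : Cochain I5 M5 k} (h : IsForm θ) : IsForm (frameOp T θ) := by
  induction k with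
  | zero => exact isForm_degree_zero _
  | succ k ih =>
    have hadd : ∀ X Y, BasicGeom.contr (X + Y) (BasicGeom.frameOp T θ) =
        BasicGeom.contr X (BasicGeom.frameOp T θ) +
          BasicGeom.contr Y (BasicGeom.frameOp T θ) := fun X Y => by
      simp only [contr_frameOp, map_add, add_smul, Finset.sum_add_distrib]
    cases k with
    | zero =>
      refine isForm_one hadd fun f X => ?_
      simp only [contr_frameOp, map_smul, smul_eq_mul, mul_smul, Finset.smul_sum]
    | succ k =>
      refine isForm_of_contr (fun X => ?_) hadd fun X => ?_
      · rw [contr_frameOp]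
        exact IsForm.sum _ fun i _ => (ih (h.contr _)).fsmul _
      · have e : ∀ (f : Fun I5 M5) (τ : Cochain I5 M5 (k + 1)),
          BasicGeom.contr X (f • τ) = f • BasicGeom.contr X τ := fun _ _ => rfl
        have e2 : ∀ (g : Fin 5 → Cochain I5 M5 (k + 1)),
          BasicGeom.contr X (∑ i, g i) = ∑ i, BasicGeom.contr X (g i) := fun g => by
            funext v
            simp only [BasicGeom.contr, Finset.sum_apply]
        rw [contr_frameOp, e2]
        simp only [e, contr_frameOp, Finset.smul_sum]
        set S := ∑ i, ∑ j, coframe i X • coframe j X •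
          BasicGeom.frameOp T (BasicGeom.contr (frame j) (BasicGeom.contr (frame i) θ)) with hS
        have hneg : S = -S := by
          conv_lhs => rw [hS, Finset.sum_comm]
          rw [hS, ← Finset.sum_neg_distrib]
          refine Finset.sum_congr rfl fun i _ => ?_
          rw [← Finset.sum_neg_distrib]
          refine Finset.sum_congr rfl fun j _ => ?_
          rw [h.contr_anticomm, frameOp_neg, smul_neg, smul_neg, smul_smul, smul_smul, mul_comm]
        have h2 : (2 : ℂ) • S = 0 := by
          rw [two_smul]
          nth_rewrite 1 [hneg]
          exact neg_add_cancel S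
        exact (smul_eq_zero.1 h2).resolve_left two_ne_zero

theorem contr_fld_frameOp (w : Fin 5 → ℝ) {k : ℕ} {θ : Cochain I5 M5 (k + 1)} (h : IsForm θ) :
    contr (fld w) (frameOp T θ) = frameOp T (contr (fld w) θ) := by
  rw [(h.frameOp T).contr_fld, h.contr_fld, frameOp_sum]
  simp only [contr_frame_frameOp, frameOp_smul]

/-- The operator commutes with the left-invariant fields. -/
def CommutesWithFrame : Prop := ∀ w f, fld w (T f) = T (fld w f)

variable {T}

theorem act_cplx (hT : CommutesWithFrame T) (w : Fin 5 → ℝ) (f : CFun I5 M5) :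
    act (fld w) (cplx T f) = cplx T (act (fld w) f) := by
  apply cfun_ext
  · rw [reF_act, reF_cplx, reF_cplx, reF_act, hT]
  · rw [imF_act, imF_cplx, imF_cplx, imF_act, hT]

theorem lieD_frameOp (hT : CommutesWithFrame T) (w : Fin 5 → ℝ) {k : ℕ} {θ : Cochain I5 M5 k}
    (h : IsForm θ) : lieD (fld w) (frameOp T θ) = frameOp T (lieD (fld w) θ) := by
  induction k with
  | zero =>
    funext v
    rw [lieD_degree_zero, frameOp_zero_apply, frameOp_zero_apply, lieD_degree_zero, act_cplx hT]
  | succ k ih =>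
    refine ext_frame ((h.frameOp T).lieD _) ((h.lieD _).frameOp T) fun j => ?_
    rw [contr_lieD, contr_frame_frameOp, contr_frame_frameOp, contr_lieD, ih (h.contr _),
      frameOp_sub, frame_eq_fld, fld_bracket, contr_fld_frameOp T _ h]

theorem extD_frameOp (hT : CommutesWithFrame T) {k : ℕ} {θ : Cochain I5 M5 k}
    (h : IsForm θ) : extD (frameOp T θ) = frameOp T (extD θ) := by
  induction k with
  | zero =>
    refine ext_frame (h.frameOp T).extD (h.extD.frameOp T) fun j => ?_
    rw [contr_frame_frameOp, contr_extD_zero, contr_extD_zero, frame_eq_fld, lieD_frameOp hT _ h]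
  | succ k ih =>
    refine ext_frame (h.frameOp T).extD (h.extD.frameOp T) fun j => ?_
    rw [contr_frame_frameOp, contr_extD _ (h.frameOp T), contr_extD _ h, contr_frame_frameOp,
      ih (h.contr _), frameOp_sub, frame_eq_fld, lieD_frameOp hT _ h]

theorem actJ_frameOp {J : VField I5 M5 →ₗ[Fun I5 M5] VField I5 M5}
    {c : (Fin 5 → ℝ) → Fin 5 → ℝ} (hJ : ∀ w, J (fld w) = fld (c w)) {k : ℕ} {θ : Cochain I5 M5 k}
    (h : IsForm θ) : actJ J (frameOp T θ) = frameOp T (actJ J θ) := by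
  induction k with
  | zero => rw [actJ_degree_zero, actJ_degree_zero, frameOp_zero]
  | succ k ih =>
    refine ext_frame ((h.frameOp T).actJ J) ((h.actJ J).frameOp T) fun j => ?_
    rw [contr_frame_frameOp, contr_actJ, contr_actJ, contr_frame_frameOp, ih (h.contr _),
      frameOp_add, frame_eq_fld, hJ, contr_fld_frameOp T _ h]

theorem dc_frameOp (hT : CommutesWithFrame T) {J : VField I5 M5 →ₗ[Fun I5 M5] VField I5 M5}
    {c : (Fin 5 → ℝ) → Fin 5 → ℝ} (hJ : ∀ w, J (fld w) = fld (c w)) {k : ℕ} {θ : Cochain I5 M5 k}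
    (h : IsForm θ) : dc J (frameOp T θ) = frameOp T (dc J θ) := by
  rw [dc, dc, frameOp_sub, extD_frameOp hT h, actJ_frameOp hJ h.extD, actJ_frameOp hJ h,
    extD_frameOp hT (h.actJ J)]

theorem BasicFor.frameOp (hT : CommutesWithFrame T) {w : Fin 5 → ℝ} {k : ℕ}
    {θ : Cochain I5 M5 k} (h : BasicFor (fld w) θ) : BasicFor (fld w) (frameOp T θ) where
  isForm := h.isForm.frameOp T
  horizontal := by
    cases k with
    | zero => trivial
    | succ k => rw [Horizontal, contr_fld_frameOp T _ h.isForm, h.contr_eq, frameOp_zero]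
  invariant := by rw [lieD_frameOp hT _ h.isForm, h.invariant, frameOp_zero]

/-! ### Averages and primitives commute with left-invariant fields -/

theorem fst_comm (v : Fin 5 → ℝ) (t : ℝ) : lieV v * emb (CircleSubgroup.fst.c t) =
    emb (CircleSubgroup.fst.c t) * lieV v := by
  change _ * emb (subC1 t) = emb (subC1 t) * _
  rw [emb_subC1]
  apply ext_V8 <;> simp [lieV, mul_comm]

theorem snd_comm (v : Fin 5 → ℝ) (t : ℝ) : lieV v * emb (CircleSubgroup.snd.c t) =
    emb (CircleSubgroup.snd.c t) * lieV v := by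
  change _ * emb (subC2 t) = emb (subC2 t) * _
  rw [emb_subC2]
  apply ext_V8 <;> simp [lieV, mul_comm]

theorem hopf_comm {v : Fin 5 → ℝ} (h2 : v 2 = 0) (h3 : v 3 = 0) (t : ℝ) :
    lieV v * emb (CircleSubgroup.hopf.c t) = emb (CircleSubgroup.hopf.c t) * lieV v := by
  change _ * emb (subS 0 0 1 (by norm_num) t) = emb (subS 0 0 1 (by norm_num) t) * _
  rw [emb_subS]
  apply ext_V8 <;> simp [lieV, mul_comm, h2, h3, qexp]

namespace CircleSubgroup

variable (S : CircleSubgroup) {v : Fin 5 → ℝ}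

theorem fld_avg_comm (hS : ∀ t, lieV v * emb (S.c t) = emb (S.c t) * lieV v) (f : Fun I5 M5) :
    fld v (S.avg f) = S.avg (fld v f) := Kernel.fld_conv_comm _ hS f

theorem fld_prim_comm (hS : ∀ t, lieV v * emb (S.c t) = emb (S.c t) * lieV v) (f : Fun I5 M5) :
    fld v (S.prim f) = S.prim (fld v f) := Kernel.fld_conv_comm _ hS f

end CircleSubgroup

/-! ### The average over the torus -/

/-- The average over the orbits of the two circles. -/
def torusMean : Fun I5 M5 →ₗ[ℝ] Fun I5 M5 := CircleSubgroup.snd.avg ∘ₗ CircleSubgroup.fst.avg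

theorem commutes_torusMean : CommutesWithFrame torusMean := fun w f => by
  change fld w (CircleSubgroup.snd.avg _) = CircleSubgroup.snd.avg _
  rw [CircleSubgroup.fld_avg_comm _ (snd_comm _), CircleSubgroup.fld_avg_comm _ (fst_comm _)]

theorem commutes_green {r : ℝ} (hr : r ≠ 0) : CommutesWithFrame (green hr) := fld_green hr

theorem circ1_torusMean (f : Fun I5 M5) : circ1 (torusMean f) = 0 := by
  change circ1 (CircleSubgroup.snd.avg (CircleSubgroup.fst.avg f)) = 0
  rw [circ1_eq, CircleSubgroup.fld_avg_comm _ (snd_comm _), show fld (Pi.single 0 1) (CircleSubgroup.fst.avg f) = 0 from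
    CircleSubgroup.fst.fld_avg f, map_zero]

theorem circ2_torusMean (f : Fun I5 M5) : circ2 (torusMean f) = 0 := by
  rw [circ2_eq]
  exact CircleSubgroup.snd.fld_avg _

theorem lie_circ1_frame (j : Fin 5) : ⁅circ1, frame j⁆ = 0 := by
  rw [frame_eq_fld, lie_circ1_fld]

theorem lie_circ2_frame (j : Fin 5) : ⁅circ2, frame j⁆ = 0 := by
  rw [frame_eq_fld, lie_circ2_fld]

/-- The Lie derivative along a field commuting with the frame acts on frame coefficients. -/
theorem lieD_frameOp_eq_zero {X : VField I5 M5} (hX : ∀ j, ⁅X, frame j⁆ = 0)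
    (h0 : ∀ f, X (T f) = 0) {k : ℕ} {θ : Cochain I5 M5 k} (h : IsForm θ) :
    lieD X (frameOp T θ) = 0 := by
  induction k with
  | zero =>
    funext v
    rw [lieD_degree_zero, frameOp_zero_apply]
    apply cfun_ext
    · rw [reF_act, reF_cplx, h0]; rfl
    · rw [imF_act, imF_cplx, h0]; rfl
  | succ k ih =>
    refine ext_frame ((h.frameOp T).lieD X) IsForm.zero fun j => ?_
    rw [contr_lieD, contr_frame_frameOp, ih (h.contr _), hX, (h.frameOp T).zero_contr, sub_zero,
      contr_zero]

/-- The Green operator on forms. -/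
theorem laplacian_frameOp_green {r : ℝ} (hr : r ≠ 0) {k : ℕ} {θ : Cochain I5 M5 k}
    (h : IsForm θ) :
    lieD circ2 (lieD circ2 (frameOp (green hr) θ)) +
      ((r ^ 2 : ℝ) : ℂ) • lieD circ1 (lieD circ1 (frameOp (green hr) θ)) =
      θ - frameOp torusMean θ := by
  induction k with
  | zero =>
    funext v
    simp only [Pi.add_apply, Pi.smul_apply, Pi.sub_apply, lieD_degree_zero, frameOp_zero_apply,
      ← algebraMap_smul_cfun]
    apply cfun_ext
    · simp only [reF_add, reF_sub, reF_smul, reF_act, reF_cplx]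
      have := laplacian_green hr (reF (θ v))
      rw [Algebra.smul_def] at this
      exact this
    · simp only [imF_add, imF_sub, imF_smul, imF_act, imF_cplx]
      have := laplacian_green hr (imF (θ v))
      rw [Algebra.smul_def] at this
      exact this
  | succ k ih =>
    have hG := h.frameOp (green hr)
    refine ext_frame (((hG.lieD _).lieD _).add (((hG.lieD _).lieD _).smul _))
      (h.sub (h.frameOp _)) fun j => ?_
    have e1 : ∀ {τ : Cochain I5 M5 (k + 1)}, IsForm τ →
        contr (frame j) (lieD circ1 τ) = lieD circ1 (contr (frame j) τ) := fun hτ => by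
      rw [contr_lieD, lie_circ1_frame, hτ.zero_contr, sub_zero]
    have e2 : ∀ {τ : Cochain I5 M5 (k + 1)}, IsForm τ →
        contr (frame j) (lieD circ2 τ) = lieD circ2 (contr (frame j) τ) := fun hτ => by
      rw [contr_lieD, lie_circ2_frame, hτ.zero_contr, sub_zero]
    rw [contr_add, contr_smul, contr_sub, e1 (hG.lieD _), e1 hG, e2 (hG.lieD _), e2 hG,
      contr_frame_frameOp, contr_frame_frameOp, ih (h.contr _)]

/-! ### The transverse structures of the family -/

/-- Two linear maps on vector fields agree if they agree on left-invariant fields. -/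
theorem lin_ext {N : Type*} [AddCommGroup N] [Module (Fun I5 M5) N]
    {φ ψ : VField I5 M5 →ₗ[Fun I5 M5] N} (h : ∀ w, φ (fld w) = ψ (fld w)) (X : VField I5 M5) :
    φ X = ψ X := by
  have : φ = ψ := frameBasis.ext fun i => by rw [frameBasis_apply, frame_eq_fld, h]
  rw [this]

/-- A tensorial expression vanishes if it vanishes on left-invariant fields. -/
theorem tensor_eq_zero {N : Type*} [AddCommGroup N] [Module (Fun I5 M5) N]
    {D : VField I5 M5 → N} (hadd : ∀ X Y, D (X + Y) = D X + D Y)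
    (hsmul : ∀ (f : Fun I5 M5) X, D (f • X) = f • D X) (h : ∀ w, D (fld w) = 0)
    (X : VField I5 M5) : D X = 0 :=
  lin_ext (φ := ⟨⟨D, hadd⟩, hsmul⟩) (ψ := 0) h X

theorem norm_pos (s : ℝ) : 0 < s ^ 2 + (1 - s) ^ 2 := by
  nlinarith [sq_nonneg s, sq_nonneg (1 - s), sq_nonneg (2 * s - 1)]

/-- The components of `ξₛ`. -/
def xiV (s : ℝ) : Fin 5 → ℝ := ![s, 0, 0, 0, 1 - s]

/-- The components of `ηₛ`. -/
def etaV (s : ℝ) : Fin 5 → ℝ := ![1 - s, 0, 0, 0, -s]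

theorem fld_eq (w : Fin 5 → ℝ) :
    fld w = w 0 • circ1 + w 1 • circ2 + w 2 • e1 + w 3 • e2 + w 4 • e3 := by
  rw [fld, Fin.sum_univ_five]; rfl

theorem xi_eq (s : ℝ) : xi s = fld (xiV s) := by
  rw [fld_eq]
  change (1 - s) • e3 + s • circ1 =
    s • circ1 + (0 : ℝ) • circ2 + (0 : ℝ) • e1 + (0 : ℝ) • e2 + (1 - s) • e3
  module

theorem eta_eq (s : ℝ) : eta s = fld (etaV s) := by
  rw [fld_eq]
  change (1 - s) • circ1 - s • e3 =
    (1 - s) • circ1 + (0 : ℝ) • circ2 + (0 : ℝ) • e1 + (0 : ℝ) • e2 + (-s) • e3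
  module

theorem dt1_fld (w : Fin 5 → ℝ) : dt1 (fld w) = algebraMap ℝ (Fun I5 M5) (w 0) := coframe_fld w 0
theorem dt2_fld (w : Fin 5 → ℝ) : dt2 (fld w) = algebraMap ℝ (Fun I5 M5) (w 1) := coframe_fld w 1
theorem a1_fld (w : Fin 5 → ℝ) : a1 (fld w) = algebraMap ℝ (Fun I5 M5) (w 2) := coframe_fld w 2
theorem a2_fld (w : Fin 5 → ℝ) : a2 (fld w) = algebraMap ℝ (Fun I5 M5) (w 3) := coframe_fld w 3
theorem a3_fld (w : Fin 5 → ℝ) : a3 (fld w) = algebraMap ℝ (Fun I5 M5) (w 4) := coframe_fld w 4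

theorem etaDual_fld (s : ℝ) (w : Fin 5 → ℝ) : etaDual s (fld w) =
    algebraMap ℝ (Fun I5 M5) ((s ^ 2 + (1 - s) ^ 2)⁻¹ * ((1 - s) * w 0 - s * w 4)) := by
  simp only [etaDual, LinearMap.smul_apply, LinearMap.sub_apply, dt1_fld, a3_fld,
    Algebra.smul_def, map_mul, map_sub]

/-- The 1-form equal to `1` on `ξₛ` and to `0` on `ηₛ`, `∂₂`, `e₁`, `e₂`. -/
def xiDual (s : ℝ) : VField I5 M5 →ₗ[Fun I5 M5] Fun I5 M5 :=
  (s ^ 2 + (1 - s) ^ 2)⁻¹ • (s • dt1 + (1 - s) • a3)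

theorem xiDual_fld (s : ℝ) (w : Fin 5 → ℝ) : xiDual s (fld w) =
    algebraMap ℝ (Fun I5 M5) ((s ^ 2 + (1 - s) ^ 2)⁻¹ * (s * w 0 + (1 - s) * w 4)) := by
  simp only [xiDual, LinearMap.smul_apply, LinearMap.add_apply, dt1_fld, a3_fld,
    Algebra.smul_def, map_mul, map_add]

/-- The matrix of `transJ`. -/
def jvec (r s : ℝ) (w : Fin 5 → ℝ) : Fin 5 → ℝ :=
  ![r * w 1 * (1 - s), -(r⁻¹ * ((s ^ 2 + (1 - s) ^ 2)⁻¹ * ((1 - s) * w 0 - s * w 4))), -w 3, w 2,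
    -(r * w 1 * s)]

theorem transJ_apply (r s : ℝ) (X : VField I5 M5) : transJ r s X =
    dt2 X • (r • eta s) - etaDual s X • (r⁻¹ • circ2) + a1 X • e2 - a2 X • e1 := rfl

theorem transJ_fld (r s : ℝ) (w : Fin 5 → ℝ) : transJ r s (fld w) = fld (jvec r s w) := by
  rw [transJ_apply, dt2_fld, etaDual_fld, a1_fld, a2_fld, fld_eq, eta]
  simp only [algebraMap_smul]
  change _ = (r * w 1 * (1 - s)) • circ1 +
    (-(r⁻¹ * ((s ^ 2 + (1 - s) ^ 2)⁻¹ * ((1 - s) * w 0 - s * w 4)))) • circ2 + (-w 3) • e1 +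
    w 2 • e2 + (-(r * w 1 * s)) • e3
  module

variable {r s : ℝ}

theorem transJ_xi : transJ r s (xi s) = 0 := by
  rw [xi_eq, transJ_fld, show (0 : VField I5 M5) = fld 0 by simp [fld]]
  congr 1
  funext i
  fin_cases i <;> simp [jvec, xiV]
  right; right; ring

theorem transJ_transJ (hr : r ≠ 0) (X : VField I5 M5) :
    transJ r s (transJ r s X) + X = xiDual s X • xi s := by
  have h := norm_pos s
  refine lin_ext (φ := transJ r s ∘ₗ transJ r s + LinearMap.id)
    (ψ := (xiDual s).smulRight (xi s)) (fun w => ?_) X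
  change transJ r s (transJ r s (fld w)) + fld w = xiDual s (fld w) • xi s
  rw [xiDual_fld, xi_eq, algebraMap_smul, transJ_fld, transJ_fld, ← fld_add, ← fld_smul]
  congr 1
  funext i
  fin_cases i <;> simp [jvec, xiV] <;> field_simp <;> ring

theorem transJ_eq_zero_iff (hr : r ≠ 0) {X : VField I5 M5} : transJ r s X = 0 ↔ X ∈ fol s := by
  constructor
  · intro h
    have := transJ_transJ (s := s) hr X
    rw [h, map_zero, zero_add] at this
    exact Submodule.mem_span_singleton.2 ⟨_, this.symm⟩
  · intro h
    obtain ⟨f, rfl⟩ := Submodule.mem_span_singleton.1 h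
    rw [map_smul, transJ_xi, smul_zero]

theorem lie_invariant_transJ {v : Fin 5 → ℝ}
    (h : ∀ w, lieB v (jvec r s w) = jvec r s (lieB v w)) (Y : VField I5 M5) :
    ⁅fld v, transJ r s Y⁆ = transJ r s ⁅fld v, Y⁆ := by
  rw [← sub_eq_zero]
  refine tensor_eq_zero (D := fun Y => ⁅fld v, transJ r s Y⁆ - transJ r s ⁅fld v, Y⁆)
    (fun X Y => ?_) (fun f X => ?_) (fun w => ?_) Y
  · rw [map_add, vlie_add, vlie_add, map_add]; abel
  · rw [map_smul, vlie_fsmul, vlie_fsmul, map_add, map_smul, map_smul, smul_sub]; abel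
  · rw [transJ_fld, fld_bracket, fld_bracket, transJ_fld, h, sub_self]

theorem lie_xi_transJ (Y : VField I5 M5) : ⁅xi s, transJ r s Y⁆ = transJ r s ⁅xi s, Y⁆ := by
  rw [xi_eq]
  refine lie_invariant_transJ (fun w => ?_) Y
  funext i
  fin_cases i <;> simp [jvec, xiV, lieB]

theorem lie_eta_transJ (Y : VField I5 M5) : ⁅eta s, transJ r s Y⁆ = transJ r s ⁅eta s, Y⁆ := by
  rw [eta_eq]
  refine lie_invariant_transJ (fun w => ?_) Y
  funext i
  fin_cases i <;> simp [jvec, etaV, lieB]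

theorem lie_circ2_transJ (Y : VField I5 M5) : ⁅circ2, transJ r s Y⁆ = transJ r s ⁅circ2, Y⁆ := by
  rw [circ2_eq]
  refine lie_invariant_transJ (fun w => ?_) Y
  funext i
  fin_cases i <;> simp [jvec, lieB]

theorem nijenhuis_transJ (hr : r ≠ 0) (X Y : VField I5 M5) :
    ⁅transJ r s X, transJ r s Y⁆ - transJ r s ⁅X, transJ r s Y⁆ - transJ r s ⁅transJ r s X, Y⁆ +
      transJ r s (transJ r s ⁅X, Y⁆) ∈ fol s := by
  have h := norm_pos s
  rw [← transJ_eq_zero_iff (r := r) hr]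
  refine tensor_eq_zero (D := fun Y => transJ r s (⁅transJ r s X, transJ r s Y⁆ -
    transJ r s ⁅X, transJ r s Y⁆ - transJ r s ⁅transJ r s X, Y⁆ + transJ r s (transJ r s ⁅X, Y⁆)))
    (fun Y Z => ?_) (fun f Y => ?_) (fun w => ?_) Y
  · simp only [map_add, map_sub, vlie_add]; abel
  · simp only [map_add, map_sub, vlie_fsmul, map_smul, smul_sub, smul_add]; abel
  · refine tensor_eq_zero (D := fun X => transJ r s (⁅transJ r s X, transJ r s (fld w)⁆ -
      transJ r s ⁅X, transJ r s (fld w)⁆ - transJ r s ⁅transJ r s X, fld w⁆ +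
      transJ r s (transJ r s ⁅X, fld w⁆))) (fun Y Z => ?_) (fun f Y => ?_) (fun v => ?_) X
    · simp only [map_add, map_sub, add_vlie]; abel
    · simp only [map_add, map_sub, fsmul_vlie, map_smul, smul_sub, smul_add]; abel
    · simp only [transJ_fld, fld_bracket]
      rw [← neg_add_eq_sub, ← neg_add_eq_sub, ← neg_one_smul ℝ (fld _),
        ← neg_one_smul ℝ (fld (jvec r s (lieB v _)))]
      simp only [← fld_smul, ← fld_add, transJ_fld]
      rw [show (0 : VField I5 M5) = fld 0 by simp [fld]]
      congr 1
      funext i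
      fin_cases i <;> simp [jvec, lieB] <;> field_simp <;> ring_nf <;> simp

theorem isTransverselyHolomorphic (hr : r ≠ 0) :
    IsTransverselyHolomorphic (fol s) (transJ r s) where
  preserves X hX := by
    rw [(transJ_eq_zero_iff hr).2 hX]
    exact zero_mem _
  sq X := by
    rw [transJ_transJ hr]
    exact Submodule.smul_mem _ _ (Submodule.mem_span_singleton_self _)
  invariant X hX Y := by
    obtain ⟨f, rfl⟩ := Submodule.mem_span_singleton.1 hX
    rw [fsmul_vlie, fsmul_vlie, map_sub, map_smul, map_smul, lie_xi_transJ, transJ_xi, smul_zero,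
      sub_zero, sub_sub_cancel_left]
    exact neg_mem (Submodule.smul_mem _ _ (Submodule.mem_span_singleton_self _))
  integrable := nijenhuis_transJ hr

theorem const_mul_algebraMap (a b : ℝ) : a • algebraMap ℝ (Fun I5 M5) b =
    algebraMap ℝ (Fun I5 M5) (a * b) := by rw [Algebra.smul_def, map_mul]

theorem dt2_transJ (X : VField I5 M5) : dt2 (transJ r s X) = -(r⁻¹ • etaDual s X) := by
  refine lin_ext (φ := dt2 ∘ₗ transJ r s) (ψ := -(r⁻¹ • etaDual s)) (fun w => ?_) X
  change dt2 (transJ r s (fld w)) = -(r⁻¹ • etaDual s (fld w))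
  rw [transJ_fld, dt2_fld, etaDual_fld, const_mul_algebraMap, ← map_neg]
  congr 1

theorem etaDual_transJ (X : VField I5 M5) : etaDual s (transJ r s X) = r • dt2 X := by
  have h := norm_pos s
  refine lin_ext (φ := etaDual s ∘ₗ transJ r s) (ψ := r • dt2) (fun w => ?_) X
  change etaDual s (transJ r s (fld w)) = r • dt2 (fld w)
  rw [transJ_fld, dt2_fld, etaDual_fld, const_mul_algebraMap]
  congr 1
  simp [jvec]
  field_simp
  ring

theorem a1_transJ (X : VField I5 M5) : a1 (transJ r s X) = -a2 X := by
  refine lin_ext (φ := a1 ∘ₗ transJ r s) (ψ := -a2) (fun w => ?_) X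
  change a1 (transJ r s (fld w)) = -a2 (fld w)
  rw [transJ_fld, a1_fld, a2_fld, ← map_neg]
  rfl

theorem a2_transJ (X : VField I5 M5) : a2 (transJ r s X) = a1 X := by
  refine lin_ext (φ := a2 ∘ₗ transJ r s) (ψ := a1) (fun w => ?_) X
  change a2 (transJ r s (fld w)) = a1 (fld w)
  rw [transJ_fld, a1_fld, a2_fld]
  rfl

/-- The Lie derivative of a left-invariant 1-form. -/
theorem apply_covector {φ ψ : VField I5 M5 →ₗ[Fun I5 M5] Fun I5 M5} {v : Fin 5 → ℝ}
    {c : (Fin 5 → ℝ) → ℝ} (hc : ∀ w, φ (fld w) = algebraMap ℝ (Fun I5 M5) (c w))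
    (h : ∀ w, φ (fld (lieB v w)) + ψ (fld w) = 0) (Y : VField I5 M5) :
    fld v (φ Y) = φ ⁅fld v, Y⁆ + ψ Y := by
  rw [← sub_eq_zero]
  refine tensor_eq_zero (D := fun Y => fld v (φ Y) - (φ ⁅fld v, Y⁆ + ψ Y))
    (fun X Y => ?_) (fun f X => ?_) (fun w => ?_) Y
  · simp only [map_add, vlie_add]; abel
  · simp only [map_smul, vlie_fsmul, map_add, smul_eq_mul, Derivation.leibniz]; ring
  · rw [hc, fld_bracket, h, Derivation.map_algebraMap, sub_zero]

theorem apply_dt2 (v : Fin 5 → ℝ) (Y : VField I5 M5) : fld v (dt2 Y) = dt2 ⁅fld v, Y⁆ := by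
  rw [apply_covector (ψ := 0) dt2_fld (fun w => ?_), LinearMap.zero_apply, add_zero]
  rw [dt2_fld, LinearMap.zero_apply]
  simp [lieB]

theorem apply_dt1 (v : Fin 5 → ℝ) (Y : VField I5 M5) : fld v (dt1 Y) = dt1 ⁅fld v, Y⁆ := by
  rw [apply_covector (ψ := 0) dt1_fld (fun w => ?_), LinearMap.zero_apply, add_zero]
  rw [dt1_fld, LinearMap.zero_apply]
  simp [lieB]

theorem xi_etaDual (t : ℝ) (Y : VField I5 M5) : xi s (etaDual t Y) = etaDual t ⁅xi s, Y⁆ := by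
  rw [xi_eq, apply_covector (ψ := 0) (etaDual_fld t) (fun w => ?_), LinearMap.zero_apply, add_zero]
  rw [etaDual_fld, LinearMap.zero_apply]
  simp [lieB, xiV]

theorem xi_a1 (Y : VField I5 M5) :
    xi s (a1 Y) = a1 ⁅xi s, Y⁆ + (2 * (1 - s)) • a2 Y := by
  rw [xi_eq, apply_covector (ψ := (2 * (1 - s)) • a2) a1_fld (fun w => ?_)]
  · rfl
  · rw [a1_fld, LinearMap.smul_apply, a2_fld, const_mul_algebraMap, ← map_add, ← map_zero
      (algebraMap ℝ (Fun I5 M5))]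
    congr 1
    simp [lieB, xiV]
    ring

theorem xi_a2 (Y : VField I5 M5) :
    xi s (a2 Y) = a2 ⁅xi s, Y⁆ - (2 * (1 - s)) • a1 Y := by
  rw [xi_eq, apply_covector (ψ := -((2 * (1 - s)) • a1)) a2_fld (fun w => ?_)]
  · rw [sub_eq_add_neg]; rfl
  · rw [a2_fld, LinearMap.neg_apply, LinearMap.smul_apply, a1_fld, const_mul_algebraMap, ← map_neg,
      ← map_add, ← map_zero (algebraMap ℝ (Fun I5 M5))]
    congr 1
    simp [lieB, xiV]
    ring

theorem dt2_xi : dt2 (xi s) = 0 := by rw [xi_eq, dt2_fld]; simp [xiV]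
theorem a1_xi : a1 (xi s) = 0 := by rw [xi_eq, a1_fld]; simp [xiV]
theorem a2_xi : a2 (xi s) = 0 := by rw [xi_eq, a2_fld]; simp [xiV]
theorem etaDual_xi : etaDual s (xi s) = 0 := by
  rw [xi_eq, etaDual_fld, ← map_zero (algebraMap ℝ (Fun I5 M5))]
  congr 1
  simp [xiV]
  right; ring

/-- The transverse metric for which the frame `∂₂, r η, e₁, e₂` is orthonormal. -/
def transMetric (r s : ℝ) : VField I5 M5 →ₗ[Fun I5 M5] VField I5 M5 →ₗ[Fun I5 M5] Fun I5 M5 :=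
  LinearMap.mk₂ (Fun I5 M5)
    (fun X Y => dt2 X * dt2 Y + (r⁻¹ • etaDual s X) * (r⁻¹ • etaDual s Y) + a1 X * a1 Y +
      a2 X * a2 Y)
    (fun X Y Z => by simp only [map_add, smul_add]; ring)
    (fun f X Y => by simp only [map_smul, smul_eq_mul, ← mul_smul_comm]; ring)
    (fun X Y Z => by simp only [map_add, smul_add]; ring)
    (fun f X Y => by simp only [map_smul, smul_eq_mul, ← mul_smul_comm]; ring)

theorem transMetric_apply (r s : ℝ) (X Y : VField I5 M5) : transMetric r s X Y =
    dt2 X * dt2 Y + (r⁻¹ • etaDual s X) * (r⁻¹ • etaDual s Y) + a1 X * a1 Y + a2 X * a2 Y := rfl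

theorem transMetric_pos (hr : r ≠ 0) (p : M5) (X : VField I5 M5) (hX : ¬ TangentAt (fol s) p X) :
    0 < transMetric r s X X p := by
  have e : transMetric r s X X p = dt2 X p * dt2 X p +
    (r⁻¹ * etaDual s X p) * (r⁻¹ * etaDual s X p) + a1 X p * a1 X p + a2 X p * a2 X p := rfl
  have h1 := mul_self_nonneg (dt2 X p)
  have h2 := mul_self_nonneg (r⁻¹ * etaDual s X p)
  have h3 := mul_self_nonneg (a1 X p)
  have h4 := mul_self_nonneg (a2 X p)
  rcases (show 0 ≤ transMetric r s X X p by rw [e]; positivity).lt_or_eq with h | h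
  · exact h
  · refine absurd ⟨xiDual s X • xi s, Submodule.smul_mem _ _ (Submodule.mem_span_singleton_self _),
      fun f => ?_⟩ hX
    rw [e] at h
    have z1 : dt2 X p = 0 := mul_self_eq_zero.1 (by linarith)
    have z2 : r⁻¹ * etaDual s X p = 0 := mul_self_eq_zero.1 (by linarith)
    have z3 : a1 X p = 0 := mul_self_eq_zero.1 (by linarith)
    have z4 : a2 X p = 0 := mul_self_eq_zero.1 (by linarith)
    have z2' : etaDual s X p = 0 := (mul_eq_zero.1 z2).resolve_left (inv_ne_zero hr)
    rw [← transJ_transJ hr X, transJ_apply r s X]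
    simp only [map_add, map_sub, map_smul]
    change X f p = dt2 X p * transJ r s (r • eta s) f p -
      etaDual s X p * transJ r s (r⁻¹ • circ2) f p + a1 X p * transJ r s e2 f p -
      a2 X p * transJ r s e1 f p + X f p
    rw [z1, z2', z3, z4]
    ring

theorem transMetric_symm (X Y : VField I5 M5) : transMetric r s X Y = transMetric r s Y X := by
  rw [transMetric_apply, transMetric_apply]; ring

theorem transMetric_xi (f : Fun I5 M5) (Y : VField I5 M5) : transMetric r s (f • xi s) Y = 0 := by
  rw [transMetric_apply, map_smul, map_smul, map_smul, map_smul, dt2_xi, a1_xi, a2_xi, etaDual_xi]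
  simp

theorem xi_transMetric (Y Z : VField I5 M5) : xi s (transMetric r s Y Z) =
    transMetric r s ⁅xi s, Y⁆ Z + transMetric r s Y ⁅xi s, Z⁆ := by
  have hd : ∀ Y, xi s (dt2 Y) = dt2 ⁅xi s, Y⁆ := fun Y => by rw [xi_eq, apply_dt2]
  simp only [transMetric_apply, map_add, Derivation.leibniz, hd, xi_a1, xi_a2, xi_etaDual,
    Derivation.map_algebraMap, smul_eq_mul, Algebra.smul_def]
  ring

theorem transMetric_fsmul_sub (f g : Fun I5 M5) (X Y : VField I5 M5) :
    transMetric r s (f • X - g • xi s) Y = f * transMetric r s X Y := by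
  rw [transMetric_apply, transMetric_apply]
  simp only [map_sub, map_smul, dt2_xi, a1_xi, a2_xi, etaDual_xi, smul_eq_mul,
    mul_zero, sub_zero, Algebra.smul_def]
  ring

theorem isTransverseMetric (hr : r ≠ 0) : IsTransverseMetric (fol s) (transMetric r s) where
  symm := transMetric_symm
  horizontal X hX Y := by
    obtain ⟨f, rfl⟩ := Submodule.mem_span_singleton.1 hX
    exact transMetric_xi f Y
  pos := transMetric_pos hr
  invariant X hX Y Z := by
    obtain ⟨f, rfl⟩ := Submodule.mem_span_singleton.1 hX
    rw [fsmul_vlie, fsmul_vlie, transMetric_fsmul_sub, transMetric_symm Y (f • ⁅xi s, Z⁆ - _),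
      transMetric_fsmul_sub, transMetric_symm _ Y]
    change f * xi s (transMetric r s Y Z) = _
    rw [xi_transMetric, mul_add]

theorem isTransverselyHermitian (hr : r ≠ 0) : IsTransverselyHermitian (fol s) (transJ r s) := by
  refine ⟨isTransverselyHolomorphic hr, _, isTransverseMetric hr, fun X Y => ?_⟩
  have : r⁻¹ • r • dt2 X = dt2 X := by rw [smul_smul, inv_mul_cancel₀ hr, one_smul]
  have h2 : r⁻¹ • r • dt2 Y = dt2 Y := by rw [smul_smul, inv_mul_cancel₀ hr, one_smul]
  simp only [transMetric_apply, dt2_transJ, etaDual_transJ, a1_transJ, a2_transJ, this, h2]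
  ring

theorem xi_ne_zero (s : ℝ) (p : M5) : ∃ f, (xi s f) p ≠ 0 := by
  by_contra! h
  have hd : ∀ (g f : Fun I5 M5), (g • differential f) (xi s) p = 0 := fun g f => by
    change g p * xi s f p = 0
    rw [h, mul_zero]
  have h1 : dt1 (xi s) p = 0 := by
    rw [dt1, LinearMap.sub_apply]
    exact (congrArg₂ (· - ·) (hd _ _) (hd _ _)).trans (sub_zero 0)
  have h3 : a3 (xi s) p = 0 := by
    have e : a3 (xi s) p = (-x3 • differential x0) (xi s) p + (x2 • differential x1) (xi s) p -
      (x1 • differential x2) (xi s) p + (x0 • differential x3) (xi s) p := rfl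
    rw [e, hd, hd, hd, hd]
    simp
  rw [xi_eq, dt1_fld] at h1
  rw [xi_eq, a3_fld] at h3
  change s = 0 at h1
  change 1 - s = 0 at h3
  rw [h1] at h3
  norm_num at h3

theorem isSmoothFamily {ρ : ℝ → ℝ} (hρ : ∀ s, ρ s ≠ 0) (h : ContDiff ℝ ∞ ρ) :
    IsSmoothFamily xi (fun s => transJ (ρ s) s) := by
  have hs : ∀ {g : ℝ → ℝ}, ContDiff ℝ ∞ g →
      ContMDiff (𝓘(ℝ, ℝ).prod I5) 𝓘(ℝ, ℝ) ∞ fun q : ℝ × M5 => g q.1 :=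
    fun hg => hg.contMDiff.comp contMDiff_fst
  have hf : ∀ f : Fun I5 M5, ContMDiff (𝓘(ℝ, ℝ).prod I5) 𝓘(ℝ, ℝ) ∞ fun q : ℝ × M5 => f q.2 :=
    fun f => f.contMDiff.comp contMDiff_snd
  have i1 : ContDiff ℝ ∞ fun s : ℝ => s := contDiff_id
  have i2 : ContDiff ℝ ∞ fun s : ℝ => 1 - s := contDiff_const.sub contDiff_id
  have i3 : ContDiff ℝ ∞ fun s : ℝ => (s ^ 2 + (1 - s) ^ 2)⁻¹ :=
    ((i1.pow 2).add (i2.pow 2)).inv fun s => (norm_pos s).ne'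
  have i4 : ContDiff ℝ ∞ fun s => (ρ s)⁻¹ := h.inv hρ
  refine ⟨fun f => ?_, fun X f => ?_⟩
  · exact ((hs i2).mul (hf (e3 f))).add ((hs i1).mul (hf (circ1 f)))
  · have hη := ((hs i2).mul (hf (circ1 f))).sub ((hs i1).mul (hf (e3 f)))
    have hd := (hs i3).mul (((hs i2).mul (hf (dt1 X))).sub ((hs i1).mul (hf (a3 X))))
    exact ((((hf (dt2 X)).mul ((hs h).mul hη)).sub (hd.mul ((hs i4).mul (hf (circ2 f))))).add
      ((hf (a1 X)).mul (hf (e2 f)))).sub ((hf (a2 X)).mul (hf (e1 f)))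

/-! ### The adapted frame -/

section Brackets

variable {r s : ℝ}

theorem fld_zero : fld 0 = 0 := by simp [fld]

theorem lie_xi_circ2 : ⁅xi s, circ2⁆ = 0 := by
  rw [xi_eq, circ2_eq, fld_bracket, ← fld_zero]
  congr 1; funext i; fin_cases i <;> simp [xiV, lieB]

theorem lie_xi_eta : ⁅xi s, eta s⁆ = 0 := by
  rw [xi_eq, eta_eq, fld_bracket, ← fld_zero]
  congr 1; funext i; fin_cases i <;> simp [xiV, etaV, lieB]

theorem lie_xi_e1 : ⁅xi s, e1⁆ = (2 * (1 - s)) • e2 := by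
  rw [xi_eq, e1_eq, e2_eq, fld_bracket, ← fld_smul]
  congr 1; funext i; fin_cases i <;> simp [xiV, lieB]

theorem lie_xi_e2 : ⁅xi s, e2⁆ = (-(2 * (1 - s))) • e1 := by
  rw [xi_eq, e1_eq, e2_eq, fld_bracket, ← fld_smul]
  congr 1; funext i; fin_cases i <;> simp [xiV, lieB]
  ring

theorem lie_eta_e1 : ⁅eta s, e1⁆ = (-(2 * s)) • e2 := by
  rw [eta_eq, e1_eq, e2_eq, fld_bracket, ← fld_smul]
  congr 1; funext i; fin_cases i <;> simp [etaV, lieB]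

theorem lie_eta_e2 : ⁅eta s, e2⁆ = (2 * s) • e1 := by
  rw [eta_eq, e1_eq, e2_eq, fld_bracket, ← fld_smul]
  congr 1; funext i; fin_cases i <;> simp [etaV, lieB]

theorem lie_circ2_eta : ⁅circ2, eta s⁆ = 0 := by rw [eta_eq, lie_circ2_fld]
theorem lie_circ2_e1 : ⁅circ2, e1⁆ = 0 := by rw [e1_eq, lie_circ2_fld]
theorem lie_circ2_e2 : ⁅circ2, e2⁆ = 0 := by rw [e2_eq, lie_circ2_fld]

theorem circ1_eq_adapted (s : ℝ) : circ1 = (s ^ 2 + (1 - s) ^ 2)⁻¹ • (s • xi s + (1 - s) • eta s) := by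
  have h := norm_pos s
  rw [eq_inv_smul_iff₀ h.ne', xi, eta]
  module

theorem e3_eq_adapted (s : ℝ) : e3 = (s ^ 2 + (1 - s) ^ 2)⁻¹ • ((1 - s) • xi s - s • eta s) := by
  have h := norm_pos s
  rw [eq_inv_smul_iff₀ h.ne', xi, eta]
  module

theorem IsForm.contr_rsmul_sum {k : ℕ} {θ : Cochain I5 M5 (k + 1)} (h : IsForm θ) {a b c : ℝ}
    {X Y : VField I5 M5} : BasicGeom.contr (a • (b • X + c • Y)) θ =
      (a : ℂ) • ((b : ℂ) • BasicGeom.contr X θ + (c : ℂ) • BasicGeom.contr Y θ) := by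
  rw [h.rsmul_contr, h.add_contr, h.rsmul_contr, h.rsmul_contr]

/-- Contraction of a horizontal form with the Hopf field. -/
theorem contr_e3 {k : ℕ} {θ : Cochain I5 M5 (k + 1)} (h : IsForm θ) (h0 : contr (xi s) θ = 0) :
    contr e3 θ = (-((s ^ 2 + (1 - s) ^ 2)⁻¹ * s : ℝ) : ℂ) • contr (eta s) θ := by
  rw [e3_eq_adapted s, h.rsmul_contr, h.sub_contr, h.rsmul_contr, h.rsmul_contr, h0, smul_zero,
    zero_sub, smul_neg, smul_smul, neg_smul]
  push_cast
  rfl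

/-- Forms are determined by the contractions with the adapted frame. -/
theorem eq_zero_of_adapted (s : ℝ) {k : ℕ} {θ : Cochain I5 M5 (k + 1)} (h : IsForm θ)
    (h0 : contr (xi s) θ = 0) (h1 : contr circ2 θ = 0) (h2 : contr (eta s) θ = 0)
    (h3 : contr e1 θ = 0) (h4 : contr e2 θ = 0) : θ = 0 := by
  refine ext_frame h IsForm.zero fun i => ?_
  rw [contr_zero]
  fin_cases i
  · change contr circ1 θ = 0
    rw [circ1_eq_adapted s, h.contr_rsmul_sum, h0, h2]
    simp
  · exact h1
  · exact h3
  · exact h4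
  · change contr e3 θ = 0
    rw [contr_e3 h h0, h2, smul_zero]

theorem IsForm.contr_swap {k : ℕ} {θ : Cochain I5 M5 (k + 2)} (h : IsForm θ)
    {X Y : VField I5 M5} (h0 : BasicGeom.contr Y θ = 0) :
    BasicGeom.contr Y (BasicGeom.contr X θ) = 0 := by
  rw [h.contr_anticomm, h0, contr_zero, neg_zero]

/-- A form all of whose components vanish except possibly the one along `e₁`, `e₂` vanishes if that
one does. -/
theorem eq_zero_of_adapted_two (s : ℝ) {k : ℕ} {θ : Cochain I5 M5 (k + 2)} (h : IsForm θ)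
    (h0 : contr (xi s) θ = 0) (h1 : contr circ2 θ = 0) (h2 : contr (eta s) θ = 0)
    (h3 : contr e2 (contr e1 θ) = 0) : θ = 0 := by
  have e : contr e1 θ = 0 := eq_zero_of_adapted s (h.contr _) (h.contr_swap h0) (h.contr_swap h1)
    (h.contr_swap h2) (h.contr_contr _) h3
  refine eq_zero_of_adapted s h h0 h1 h2 e ?_
  exact eq_zero_of_adapted s (h.contr _) (h.contr_swap h0) (h.contr_swap h1)
    (h.contr_swap h2) (h.contr_swap e) (h.contr_contr _)

theorem eq_zero_of_adapted_three (s : ℝ) {k : ℕ} {θ : Cochain I5 M5 (k + 3)} (h : IsForm θ)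
    (h0 : contr (xi s) θ = 0) (h1 : contr circ2 θ = 0) (h2 : contr (eta s) θ = 0) : θ = 0 := by
  refine eq_zero_of_adapted_two s h h0 h1 h2 ?_
  have h' := h.contr e1
  exact eq_zero_of_adapted s (h'.contr _) (h'.contr_swap (h.contr_swap h0))
    (h'.contr_swap (h.contr_swap h1)) (h'.contr_swap (h.contr_swap h2))
    (h'.contr_swap (h.contr_contr _)) (h'.contr_contr _)

/-- A horizontal form of degree at least four is determined by its component along the whole
adapted frame. -/
theorem eq_zero_of_top (s : ℝ) {k : ℕ} {θ : Cochain I5 M5 (k + 4)} (h : IsForm θ)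
    (h0 : contr (xi s) θ = 0)
    (h1 : contr e2 (contr e1 (contr (eta s) (contr circ2 θ))) = 0) : θ = 0 := by
  have hU := h.contr circ2
  have e1 : contr (eta s) (contr circ2 θ) = 0 := eq_zero_of_adapted_two s (hU.contr _)
    (hU.contr_swap (h.contr_swap h0)) (hU.contr_swap (h.contr_contr _)) (hU.contr_contr _) h1
  have e2 : contr circ2 θ = 0 := eq_zero_of_adapted_three s hU (h.contr_swap h0)
    (h.contr_contr _) e1
  exact eq_zero_of_adapted_three s h h0 e2 <| eq_zero_of_adapted_three s (h.contr _)
    (h.contr_swap h0) (h.contr_swap e2) (h.contr_contr _)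

theorem eq_zero_of_degree (s : ℝ) {k : ℕ} {θ : Cochain I5 M5 (k + 5)} (h : IsForm θ)
    (h0 : contr (xi s) θ = 0) : θ = 0 := by
  refine eq_zero_of_top s h h0 ?_
  have hU := h.contr circ2
  have hη := hU.contr (eta s)
  have h1 := hη.contr e1
  refine eq_zero_of_adapted s (h1.contr _) (h1.contr_swap ?_) (h1.contr_swap ?_)
    (h1.contr_swap ?_) (h1.contr_swap (hη.contr_contr _)) (h1.contr_contr _)
  · exact hη.contr_swap (hU.contr_swap (h.contr_swap h0))
  · exact hη.contr_swap (hU.contr_swap (h.contr_contr _))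
  · exact hη.contr_swap (hU.contr_contr _)

/-! ### Integration by parts for basic forms -/

theorem mean_frame (i : Fin 5) (f : Fun I5 M5) : mean (frame i f) = 0 := by
  fin_cases i
  · exact mean_circ1 f
  · exact mean_circ2 f
  · exact mean_e1 f
  · exact mean_e2 f
  · have := CircleSubgroup.hopf.mean_fld f
    rwa [hopf_fld] at this

theorem mean_fld_eq_zero (w : Fin 5 → ℝ) (f : Fun I5 M5) : mean (fld w f) = 0 := by
  rw [fld_apply, map_sum]
  exact Finset.sum_eq_zero fun i _ => by rw [map_smul, mean_frame, smul_zero]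

/-- The mean of a complex function. -/
def cmean : CFun I5 M5 →+ ℂ where
  toFun f := ⟨mean (reF f), mean (imF f)⟩
  map_zero' := by rw [reF_zero, imF_zero, map_zero]; rfl
  map_add' f g := by rw [reF_add, imF_add, map_add, map_add]; rfl

theorem cmean_act (w : Fin 5 → ℝ) (f : CFun I5 M5) : cmean (act (fld w) f) = 0 := by
  change (⟨mean (reF _), mean (imF _)⟩ : ℂ) = 0
  rw [reF_act, imF_act, mean_fld_eq_zero, mean_fld_eq_zero]; rfl

theorem cmean_smul (c : ℂ) (f : CFun I5 M5) : cmean (c • f) = c * cmean f := by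
  have h1 : reF (c • f) = c.re • reF f - c.im • imF f := by
    ext x; exact Complex.mul_re c (f x)
  have h2 : imF (c • f) = c.re • imF f + c.im • reF f := by
    ext x; exact Complex.mul_im c (f x)
  change (⟨mean (reF _), mean (imF _)⟩ : ℂ) = c * ⟨mean (reF _), mean (imF _)⟩
  rw [h1, h2]
  apply Complex.ext <;> simp

/-- The mean of a form of degree zero. -/
def cmean₀ (θ : Cochain I5 M5 0) : ℂ := cmean (θ Fin.elim0)

theorem cmean₀_add (θ τ : Cochain I5 M5 0) : cmean₀ (θ + τ) = cmean₀ θ + cmean₀ τ :=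
  map_add cmean _ _
theorem cmean₀_sub (θ τ : Cochain I5 M5 0) : cmean₀ (θ - τ) = cmean₀ θ - cmean₀ τ :=
  map_sub cmean _ _
theorem cmean₀_smul (c : ℂ) (θ : Cochain I5 M5 0) : cmean₀ (c • θ) = c * cmean₀ θ :=
  cmean_smul c _
theorem cmean₀_lieD (w : Fin 5 → ℝ) (θ : Cochain I5 M5 0) : cmean₀ (lieD (fld w) θ) = 0 := by
  rw [cmean₀, lieD_degree_zero, cmean_act]

/-- The component along `e₁`, `e₂` of a Lie derivative along a field that rotates the plane
spanned by `e₁` and `e₂`. -/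
theorem contr_lieD_area {X : VField I5 M5} {c : ℝ} (h1 : ⁅X, e1⁆ = c • e2)
    (h2 : ⁅X, e2⁆ = (-c) • e1) {k : ℕ} {τ : Cochain I5 M5 (k + 2)} (h : IsForm τ) :
    contr e2 (contr e1 (lieD X τ)) = lieD X (contr e2 (contr e1 τ)) := by
  rw [contr_lieD, contr_sub, contr_lieD, h1, h2, h.rsmul_contr, (h.contr e1).rsmul_contr,
    contr_smul, h.contr_contr, h.contr_contr, smul_zero, smul_zero, sub_zero, sub_zero]

/-- The top component of `dβ` for a horizontal form of degree three. -/
theorem top_extD {β : Cochain I5 M5 3} (h : IsForm β) (h0 : contr (xi s) β = 0) :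
    contr e2 (contr e1 (contr (eta s) (contr circ2 (extD β)))) =
      lieD circ2 (contr e2 (contr e1 (contr (eta s) β))) -
      lieD (eta s) (contr e2 (contr e1 (contr circ2 β))) +
      lieD e1 (contr e2 (contr (eta s) (contr circ2 β))) -
      lieD e2 (contr e1 (contr (eta s) (contr circ2 β))) := by
  have hU := h.contr circ2
  have hη := h.contr (eta s)
  have hηU := hU.contr (eta s)
  have z : contr e3 (contr (eta s) (contr circ2 β)) = 0 := by
    rw [contr_e3 hηU (hU.contr_swap (h.contr_swap h0)), hU.contr_contr, smul_zero]
  have q1 : contr (eta s) (contr circ2 (extD β)) = lieD circ2 (contr (eta s) β) -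
      (lieD (eta s) (contr circ2 β) - extD (contr (eta s) (contr circ2 β))) := by
    rw [contr_extD _ h, contr_sub, contr_lieD, lie_circ2_eta, h.zero_contr, sub_zero,
      contr_extD _ hU]
  have q2 : contr e2 (contr e1 (lieD circ2 (contr (eta s) β))) =
      lieD circ2 (contr e2 (contr e1 (contr (eta s) β))) :=
    contr_lieD_area (c := 0) (by rw [lie_circ2_e1, zero_smul])
      (by rw [lie_circ2_e2, neg_zero, zero_smul]) hη
  have q3 : contr e2 (contr e1 (lieD (eta s) (contr circ2 β))) =
      lieD (eta s) (contr e2 (contr e1 (contr circ2 β))) :=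
    contr_lieD_area (c := -(2 * s)) lie_eta_e1 (by rw [lie_eta_e2, neg_neg]) hU
  rw [q1, contr_sub, contr_sub, contr_sub, contr_sub, q2, q3, contr_extD _ hηU, contr_sub,
    contr_lieD, lie_e1_e2, hηU.rsmul_contr, z, smul_zero, sub_zero, contr_extD_zero]
  abel

theorem cmean₀_top_extD {β : Cochain I5 M5 3} (h : IsForm β) (h0 : contr (xi s) β = 0) :
    cmean₀ (contr e2 (contr e1 (contr (eta s) (contr circ2 (extD β))))) = 0 := by
  rw [top_extD h h0, cmean₀_sub, cmean₀_add, cmean₀_sub, circ2_eq, eta_eq, e1_eq, e2_eq,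
    cmean₀_lieD, cmean₀_lieD, cmean₀_lieD, cmean₀_lieD]
  simp

end Brackets

/-! ### Left-invariant forms -/

section Invariant

variable {r s : ℝ}

/-- A function, as a form of degree zero. -/
def form₀ (f : Fun I5 M5) : Cochain I5 M5 0 := fun _ => ofRealF f

theorem lieD_form₀ (X : VField I5 M5) (f : Fun I5 M5) : lieD X (form₀ f) = form₀ (X f) := by
  funext v
  rw [lieD_degree_zero]
  apply cfun_ext
  · rw [reF_act]; rfl
  · rw [imF_act]
    change X (imF (ofRealF f)) = imF (ofRealF (X f))
    rw [imF_ofRealF, imF_ofRealF, map_zero]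

theorem form₀_zero : form₀ 0 = 0 := by
  funext v; ext p; exact Complex.ofReal_zero

theorem form₀_smul (c : ℝ) (f : Fun I5 M5) : form₀ (c • f) = (c : ℂ) • form₀ f := by
  funext v; ext p; exact Complex.ofReal_mul _ _

theorem form₀_add (f g : Fun I5 M5) : form₀ (f + g) = form₀ f + form₀ g := by
  funext v; ext p; exact Complex.ofReal_add _ _

theorem form₀_neg (f : Fun I5 M5) : form₀ (-f) = -form₀ f := by
  funext v; ext p; exact Complex.ofReal_neg _

theorem form₀_sub (f g : Fun I5 M5) : form₀ (f - g) = form₀ f - form₀ g := by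
  funext v; ext p; exact Complex.ofReal_sub _ _

theorem basicFor_form₀ {X : VField I5 M5} {f : Fun I5 M5} (h : X f = 0) : BasicFor X (form₀ f) :=
  ⟨isForm_degree_zero _, trivial, by rw [lieD_form₀, h, form₀_zero]⟩

theorem wedge_smul (φ : VField I5 M5 →ₗ[Fun I5 M5] Fun I5 M5) {k : ℕ} (c : ℂ)
    (θ : Cochain I5 M5 k) : wedge φ (c • θ) = c • wedge φ θ := by
  induction k with
  | zero =>
    refine ext_contr fun X => ?_
    rw [contr_smul, contr_wedge_zero, contr_wedge_zero]
    funext v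
    exact (smul_smul_comm c _ _).symm
  | succ k ih =>
    refine ext_contr fun X => ?_
    rw [contr_smul, contr_wedge, contr_wedge, contr_smul, ih, smul_sub]
    congr 1
    funext v
    exact (smul_smul_comm c _ _).symm

/-- The form `f a₁ ∧ a₂`. -/
def area (f : Fun I5 M5) : Cochain I5 M5 2 := wedge a1 (wedge a2 (form₀ f))

theorem dt2_circ2 : dt2 circ2 = 1 := by rw [circ2_eq, dt2_fld]; simp
theorem dt2_eta : dt2 (eta s) = 0 := by rw [eta_eq, dt2_fld]; simp [etaV]
theorem dt2_e1 : dt2 e1 = 0 := by rw [e1_eq, dt2_fld]; simp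
theorem dt2_e2 : dt2 e2 = 0 := by rw [e2_eq, dt2_fld]; simp
theorem etaDual_circ2 : etaDual s circ2 = 0 := by rw [circ2_eq, etaDual_fld]; simp
theorem etaDual_eta : etaDual s (eta s) = 1 := by
  have h := norm_pos s
  rw [eta_eq, etaDual_fld, ← map_one (algebraMap ℝ (Fun I5 M5))]
  congr 1
  simp [etaV]
  field_simp
  ring
theorem etaDual_e1 : etaDual s e1 = 0 := by rw [e1_eq, etaDual_fld]; simp
theorem etaDual_e2 : etaDual s e2 = 0 := by rw [e2_eq, etaDual_fld]; simp
theorem a1_circ2 : a1 circ2 = 0 := by rw [circ2_eq, a1_fld]; simp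
theorem a1_eta : a1 (eta s) = 0 := by rw [eta_eq, a1_fld]; simp [etaV]
theorem a1_e1 : a1 e1 = 1 := by rw [e1_eq, a1_fld]; simp
theorem a1_e2 : a1 e2 = 0 := by rw [e2_eq, a1_fld]; simp
theorem a2_circ2 : a2 circ2 = 0 := by rw [circ2_eq, a2_fld]; simp
theorem a2_eta : a2 (eta s) = 0 := by rw [eta_eq, a2_fld]; simp [etaV]
theorem a2_e1 : a2 e1 = 0 := by rw [e1_eq, a2_fld]; simp
theorem a2_e2 : a2 e2 = 1 := by rw [e2_eq, a2_fld]; simp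

theorem contr_area_xi (f : Fun I5 M5) : contr (xi s) (area f) = 0 := by
  rw [area, contr_wedge, contr_wedge_zero, a1_xi, a2_xi]; simp [wedge_zero]
theorem contr_area_circ2 (f : Fun I5 M5) : contr circ2 (area f) = 0 := by
  rw [area, contr_wedge, contr_wedge_zero, a1_circ2, a2_circ2]; simp [wedge_zero]
theorem contr_area_eta (f : Fun I5 M5) : contr (eta s) (area f) = 0 := by
  rw [area, contr_wedge, contr_wedge_zero, a1_eta, a2_eta]; simp [wedge_zero]
theorem contr_area_e1 (f : Fun I5 M5) : contr e1 (area f) = wedge a2 (form₀ f) := by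
  rw [area, contr_wedge, contr_wedge_zero, a1_e1, a2_e1]; simp [wedge_zero]
theorem xi_a2' (Y : VField I5 M5) :
    xi s (a2 Y) = a2 ⁅xi s, Y⁆ + ((-(2 * (1 - s))) • a1) Y := by
  rw [xi_a2]
  ext p
  change _ - 2 * (1 - s) * a1 Y p = _ + -(2 * (1 - s)) * a1 Y p
  ring

theorem isForm_area (f : Fun I5 M5) : IsForm (area f) :=
  ((isForm_degree_zero _).wedge _).wedge _

theorem basicFor_area {f : Fun I5 M5} (h : xi s f = 0) : BasicFor (xi s) (area f) where
  isForm := isForm_area f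
  horizontal := contr_area_xi f
  invariant := by
    rw [area, lieD_wedge_add (ψ := (2 * (1 - s)) • a2) xi_a1, lieD_wedge_add xi_a2', lieD_form₀,
      h, form₀_zero, wedge_zero, zero_add, rsmul_wedge, rsmul_wedge, wedge_self, smul_zero,
      add_zero, wedge_smul, wedge_self, smul_zero]

theorem isReal_wedge {k : ℕ} {φ : VField I5 M5 →ₗ[Fun I5 M5] Fun I5 M5} {θ : Cochain I5 M5 k}
    (h : IsReal θ) : IsReal (wedge φ θ) := by
  induction k with
  | zero =>
    intro v
    change imF (φ (v 0) • θ (Fin.tail v)) = 0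
    rw [imF_smul, h, mul_zero]
  | succ k ih =>
    intro v
    change imF (φ (v 0) • θ (Fin.tail v) - wedge φ (contr (v 0) θ) (Fin.tail v)) = 0
    rw [imF_sub, imF_smul, h, mul_zero, ih (θ := contr (v 0) θ) (fun w => h _), sub_zero]

theorem isReal_form₀ (f : Fun I5 M5) : IsReal (form₀ f) := fun _ => imF_ofRealF f

theorem isReal_add {k : ℕ} {θ τ : Cochain I5 M5 k} (h1 : IsReal θ) (h2 : IsReal τ) :
    IsReal (θ + τ) := fun v => by
  change imF (θ v + τ v) = 0
  rw [imF_add, h1, h2, add_zero]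

theorem isReal_sub {k : ℕ} {θ τ : Cochain I5 M5 k} (h1 : IsReal θ) (h2 : IsReal τ) :
    IsReal (θ - τ) := fun v => by
  change imF (θ v - τ v) = 0
  rw [imF_sub, h1, h2, sub_zero]

theorem xi_dt2 (Y : VField I5 M5) : xi s (dt2 Y) = dt2 ⁅xi s, Y⁆ := by rw [xi_eq, apply_dt2]

/-! ### Basic cohomology of top degree -/

/-- The transverse volume form. -/
def transVol (s : ℝ) : Cochain I5 M5 4 := wedge dt2 (wedge (etaDual s) (area 1))

theorem xi_one : xi s (1 : Fun I5 M5) = 0 := Derivation.map_one_eq_zero _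

theorem basicFor_transVol : BasicFor (xi s) (transVol s) :=
  ((basicFor_area xi_one).wedge etaDual_xi (xi_etaDual s)).wedge dt2_xi xi_dt2

theorem top_transVol :
    contr e2 (contr e1 (contr (eta s) (contr circ2 (transVol s)))) = form₀ 1 := by
  rw [transVol, contr_wedge, contr_wedge, etaDual_circ2, contr_area_circ2, wedge_zero, dt2_circ2,
    zero_smul, sub_zero, wedge_zero, sub_zero, one_smul, contr_wedge, contr_area_eta, wedge_zero,
    sub_zero, etaDual_eta, one_smul, contr_area_e1, contr_wedge_zero, a2_e2, one_smul]

/-- Functions constant on the leaves and of mean zero are divergences of basic vector fields. -/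
theorem exists_divergence {f : Fun I5 M5} (hf : xi s f = 0) :
    ∃ u v w₁ w₂ : Fun I5 M5, xi s u = 0 ∧ xi s v = 0 ∧ xi s w₁ = (2 * (1 - s)) • w₂ ∧
      xi s w₂ = -((2 * (1 - s)) • w₁) ∧
      circ2 u + eta s v + e1 w₁ + e2 w₂ = f - algebraMap ℝ _ (mean f) := by
  have hN := norm_pos s
  set N := (s ^ 2 + (1 - s) ^ 2)⁻¹ with hNdef
  set f₁ := CircleSubgroup.snd.avg f with hf₁
  set f₂ := CircleSubgroup.fst.avg f₁ with hf₂
  set f₃ := CircleSubgroup.hopf.avg f₂ with hf₃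
  have hx : ∀ g p, xi s g p = (1 - s) * e3 g p + s * circ1 g p := fun g p => rfl
  have hη : ∀ g p, eta s g p = (1 - s) * circ1 g p - s * e3 g p := fun g p => rfl
  have hh : ∀ t, lieV (xiV s) * emb (CircleSubgroup.hopf.c t) =
      emb (CircleSubgroup.hopf.c t) * lieV (xiV s) := hopf_comm rfl rfl
  have x1 : xi s f₁ = 0 := by
    rw [xi_eq, hf₁, CircleSubgroup.fld_avg_comm _ (snd_comm _), ← xi_eq, hf, map_zero]
  have x2 : xi s f₂ = 0 := by
    rw [xi_eq, hf₂, CircleSubgroup.fld_avg_comm _ (fst_comm _), ← xi_eq, x1, map_zero]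
  have u0 : xi s (CircleSubgroup.snd.prim f) = 0 := by
    rw [xi_eq, CircleSubgroup.fld_prim_comm _ (snd_comm _), ← xi_eq, hf, map_zero]
  have p0 : xi s (CircleSubgroup.fst.prim f₁) = 0 := by
    rw [xi_eq, CircleSubgroup.fld_prim_comm _ (fst_comm _), ← xi_eq, x1, map_zero]
  have q0 : xi s (CircleSubgroup.hopf.prim f₂) = 0 := by
    rw [xi_eq, CircleSubgroup.fld_prim_comm _ hh, ← xi_eq, x2, map_zero]
  have u1 : circ2 (CircleSubgroup.snd.prim f) = f - f₁ := by
    rw [← snd_fld, CircleSubgroup.fld_prim]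
  have p1 : circ1 (CircleSubgroup.fst.prim f₁) = f₁ - f₂ := by
    rw [← fst_fld, CircleSubgroup.fld_prim]
  have q1 : e3 (CircleSubgroup.hopf.prim f₂) = f₂ - f₃ := by
    rw [← hopf_fld, CircleSubgroup.fld_prim]
  set p := CircleSubgroup.fst.prim f₁
  set q := CircleSubgroup.hopf.prim f₂
  have c1 : circ1 f₂ = 0 := by rw [← fst_fld]; exact CircleSubgroup.fld_avg _ _
  have c2 : circ2 f₁ = 0 := by rw [← snd_fld]; exact CircleSubgroup.fld_avg _ _
  have hb : IsBase f₃ := by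
    refine ⟨?_, ?_, e3_avg _⟩
    · rw [hf₃, CircleSubgroup.avg, circ1_kernel, c1, map_zero]
    · rw [hf₃, CircleSubgroup.avg, circ2_kernel, hf₂, CircleSubgroup.avg, circ2_kernel, c2,
        map_zero, map_zero]
  have hm : mean f₃ = mean f := by
    rw [hf₃, hf₂, hf₁, CircleSubgroup.mean_avg, CircleSubgroup.mean_avg, CircleSubgroup.mean_avg]
  obtain ⟨φ, hφ, hP⟩ := exists_poisson hb
  have xφ : xi s φ = 0 := by
    ext x
    rw [hx, hφ.e3, hφ.circ1]
    simp
  -- `f - f₁` is the derivative of a primitive along `∂₂`, and `f₃ - mean f` a Laplacian. As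
  -- `∂₁ p = f₁ - f₂`, `e₃ q = f₂ - f₃` and `ξₛ` annihilates `p` and `q`, the remaining part
  -- `f₁ - f₃` is a derivative along `ηₛ`.
  refine ⟨_, (N * (1 - s)) • p - (s * N) • q, e1 φ, e2 φ, u0, ?_, ?_, ?_, ?_⟩
  · rw [map_sub, Derivation.map_smul, Derivation.map_smul, p0, q0, smul_zero, smul_zero, sub_zero]
  · rw [apply_comm_of_lie lie_xi_e1, xφ, map_zero, zero_add]; rfl
  · rw [apply_comm_of_lie lie_xi_e2, xφ, map_zero, zero_add]
    ext x
    exact neg_mul _ _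
  · rw [u1, add_assoc, hP, hm]
    ext x
    have a1 := congrArg (fun g : Fun I5 M5 => g x) p0
    have a2 := congrArg (fun g : Fun I5 M5 => g x) q0
    have a3 := congrArg (fun g : Fun I5 M5 => g x) p1
    have a4 := congrArg (fun g : Fun I5 M5 => g x) q1
    change xi s p x = 0 at a1
    change xi s q x = 0 at a2
    change circ1 p x = f₁ x - f₂ x at a3
    change e3 q x = f₂ x - f₃ x at a4
    change f x - f₁ x + eta s _ x + (f₃ x - mean f) = f x - mean f
    rw [map_sub, Derivation.map_smul, Derivation.map_smul]
    change f x - f₁ x + (N * (1 - s) * eta s p x - s * N * eta s q x) + (f₃ x - mean f) =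
      f x - mean f
    rw [hη, hη, a3, a4]
    rw [hx, a3] at a1
    rw [hx, a4] at a2
    have hN' : N * (s ^ 2 + (1 - s) ^ 2) = 1 := inv_mul_cancel₀ hN.ne'
    linear_combination (f₁ x - f₃ x) * hN' - N * s * a1 - N * (1 - s) * a2

end Invariant

section TopCohomology

variable {r s : ℝ}

/-- The component along the whole adapted frame. -/
def top (s : ℝ) {k : ℕ} (θ : Cochain I5 M5 (k + 4)) : Cochain I5 M5 k :=
  contr e2 (contr e1 (contr (eta s) (contr circ2 θ)))

theorem lieD_top {θ : Cochain I5 M5 4} (h : BasicFor (xi s) θ) : lieD (xi s) (top s θ) = 0 := by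
  have h' := (h.contr lie_xi_circ2).contr (lie_xi_eta (s := s))
  rw [top, ← contr_lieD_area lie_xi_e1 lie_xi_e2 h'.isForm, h'.invariant, contr_zero, contr_zero]

theorem isReal_contr {k : ℕ} {θ : Cochain I5 M5 (k + 1)} (h : IsReal θ) (X : VField I5 M5) :
    IsReal (contr X θ) := fun _ => h _

theorem IsReal.eq_form₀ {θ : Cochain I5 M5 0} (h : IsReal θ) : θ = form₀ (reF (θ Fin.elim0)) := by
  funext v
  rw [Subsingleton.elim v Fin.elim0]
  exact cfun_ext (reF_ofRealF _).symm ((h _).trans (imF_ofRealF _).symm)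

theorem form₀_injective {f g : Fun I5 M5} (h : form₀ f = form₀ g) : f = g :=
  congrArg reF (congrFun h Fin.elim0)

theorem cmean₀_form₀ (f : Fun I5 M5) : cmean₀ (form₀ f) = mean f := by
  change (⟨mean (reF (ofRealF f)), mean (imF (ofRealF f))⟩ : ℂ) = _
  rw [reF_ofRealF, imF_ofRealF, map_zero]
  rfl

/-- The 3-form with prescribed contractions whose differential is a given divergence. -/
def fluxForm (s : ℝ) (u v w₁ w₂ : Fun I5 M5) : Cochain I5 M5 3 :=
  wedge (etaDual s) (area u) - wedge dt2 (area v) +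
    wedge dt2 (wedge (etaDual s) (wedge a2 (form₀ w₁) - wedge a1 (form₀ w₂)))

variable {u v w₁ w₂ : Fun I5 M5}

theorem basicFor_fluxForm (hu : xi s u = 0) (hv : xi s v = 0)
    (h1 : xi s w₁ = (2 * (1 - s)) • w₂) (h2 : xi s w₂ = -((2 * (1 - s)) • w₁)) :
    BasicFor (xi s) (fluxForm s u v w₁ w₂) := by
  refine (((basicFor_area hu).wedge etaDual_xi (xi_etaDual s)).sub
    ((basicFor_area hv).wedge dt2_xi xi_dt2)).add
    (BasicFor.wedge (BasicFor.wedge ⟨?_, ?_, ?_⟩ etaDual_xi (xi_etaDual s)) dt2_xi xi_dt2)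
  · exact ((isForm_degree_zero _).wedge _).sub ((isForm_degree_zero _).wedge _)
  · rw [Horizontal, contr_sub, contr_wedge_zero, contr_wedge_zero, a1_xi, a2_xi, zero_smul,
      zero_smul, sub_zero]
  · rw [lieD_sub, lieD_wedge_add (ψ := (2 * (1 - s)) • a2) xi_a1, lieD_wedge_add xi_a2',
      lieD_form₀, lieD_form₀, h1, h2, form₀_neg, form₀_smul, form₀_smul, wedge_neg, wedge_smul,
      wedge_smul, rsmul_wedge, rsmul_wedge]
    push_cast
    module

theorem isReal_fluxForm : IsReal (fluxForm s u v w₁ w₂) := by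
  refine isReal_add (isReal_sub (isReal_wedge ?_) (isReal_wedge ?_))
    (isReal_wedge (isReal_wedge (isReal_sub ?_ ?_)))
  · exact isReal_wedge (isReal_wedge (isReal_form₀ _))
  · exact isReal_wedge (isReal_wedge (isReal_form₀ _))
  · exact isReal_wedge (isReal_form₀ _)
  · exact isReal_wedge (isReal_form₀ _)

theorem contr_fluxForm_circ2 : contr circ2 (fluxForm s u v w₁ w₂) =
    wedge (etaDual s) (wedge a2 (form₀ w₁) - wedge a1 (form₀ w₂)) - area v := by
  rw [fluxForm, contr_add, contr_sub, contr_wedge, contr_wedge, contr_wedge, contr_wedge,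
    contr_area_circ2, contr_area_circ2, etaDual_circ2, dt2_circ2, contr_sub, contr_wedge_zero,
    contr_wedge_zero, a1_circ2, a2_circ2]
  simp only [wedge_zero, zero_smul, one_smul, sub_zero, wedge_sub]
  abel

theorem contr_fluxForm_eta : contr (eta s) (fluxForm s u v w₁ w₂) =
    area u - wedge dt2 (wedge a2 (form₀ w₁) - wedge a1 (form₀ w₂)) := by
  rw [fluxForm, contr_add, contr_sub, contr_wedge, contr_wedge, contr_wedge, contr_wedge,
    contr_area_eta, contr_area_eta, etaDual_eta, dt2_eta, contr_sub, contr_wedge_zero,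
    contr_wedge_zero, a1_eta, a2_eta]
  simp only [wedge_zero, zero_smul, one_smul, sub_zero, zero_sub, wedge_sub]
  abel

theorem top_extD_fluxForm (h : BasicFor (xi s) (fluxForm s u v w₁ w₂)) :
    top s (extD (fluxForm s u v w₁ w₂)) = form₀ (circ2 u + eta s v + e1 w₁ + e2 w₂) := by
  rw [top, top_extD h.isForm h.contr_eq, contr_fluxForm_circ2, contr_fluxForm_eta]
  simp only [contr_sub, contr_wedge, contr_wedge_zero, contr_area_e1, contr_area_eta, etaDual_e1,
    etaDual_e2, etaDual_eta, dt2_e1, dt2_e2, a1_e1, a1_e2, a2_e1, a2_e2, a1_eta, a2_eta,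
    zero_smul, one_smul, sub_zero, zero_sub, wedge_zero, lieD_neg, lieD_form₀, form₀_add,
    neg_neg, wedge_neg]
  simp

theorem extD_transVol : extD (transVol s) = 0 :=
  eq_zero_of_degree s (k := 0) (basicFor_transVol (s := s)).isForm.extD
    (basicFor_transVol (s := s)).extD.contr_eq

/-- Evaluation of the top component and integration identify the basic cohomology of top degree
with `ℝ`, because functions of mean zero are divergences. -/
theorem hasOneDimBasicCohomology (s : ℝ) : HasOneDimBasicCohomology (fol s) 3 := by
  have hν := basicFor_transVol (s := s)
  refine ⟨transVol s, isBasic_span_iff.2 hν, isReal_wedge (isReal_wedge (isReal_wedge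
    (isReal_wedge (isReal_form₀ _)))), extD_transVol, fun θ hθ hr _ => ?_⟩
  replace hθ := isBasic_span_iff.1 hθ
  have hmean : ∀ c : ℝ, (∃ η : Cochain I5 M5 3, IsBasic (fol s) η ∧ IsReal η ∧
      θ = (c : ℂ) • transVol s + extD η) → (c : ℂ) = cmean₀ (top s θ) := by
    rintro c ⟨β, hβ, -, rfl⟩
    replace hβ := isBasic_span_iff.1 hβ
    have e : top s ((c : ℂ) • transVol s + extD β) = (c : ℂ) • form₀ 1 + top s (extD β) := by
      rw [← top_transVol (s := s)]; rfl
    rw [e, cmean₀_add, cmean₀_smul, cmean₀_form₀, top, cmean₀_top_extD hβ.isForm hβ.contr_eq,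
      ← map_one (algebraMap ℝ (Fun I5 M5)), mean_algebraMap]
    simp
  have hrt : IsReal (top s θ) :=
    isReal_contr (isReal_contr (isReal_contr (isReal_contr hr _) _) _) _
  have ht := hrt.eq_form₀
  set F := reF (top s θ Fin.elim0)
  have hF : xi s F = 0 := form₀_injective (by rw [← lieD_form₀, ← ht, lieD_top hθ, form₀_zero])
  obtain ⟨u, v, w₁, w₂, hu, hv, h1, h2, hd⟩ := exists_divergence hF
  have hβ := basicFor_fluxForm hu hv h1 h2
  refine ⟨mean F, ⟨_, isBasic_span_iff.2 hβ, isReal_fluxForm, ?_⟩, fun c hc => ?_⟩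
  · have hb := (hθ.sub (hν.smul (mean F : ℂ))).sub hβ.extD
    rw [← sub_eq_zero, ← sub_sub]
    refine eq_zero_of_top s (k := 0) hb.isForm hb.contr_eq ?_
    change top s θ - (mean F : ℂ) • top s (transVol s) - top s (extD (fluxForm s u v w₁ w₂)) = 0
    rw [ht, top_extD_fluxForm hβ, hd, form₀_sub, show top s (transVol s) = form₀ 1 from
      top_transVol, Algebra.algebraMap_eq_smul_one, form₀_smul]
    abel
  · have := hmean c hc
    rw [ht, cmean₀_form₀] at this
    exact_mod_cast this

end TopCohomology

/-! ### Invariant 1-forms -/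

section OneForms

variable {r s : ℝ}

/-- A real covector field, as a form of degree one. -/
def oneForm (φ : VField I5 M5 →ₗ[Fun I5 M5] Fun I5 M5) : Cochain I5 M5 1 := wedge φ (form₀ 1)

variable {φ : VField I5 M5 →ₗ[Fun I5 M5] Fun I5 M5}

theorem contr_oneForm (X : VField I5 M5) : contr X (oneForm φ) = form₀ (φ X) := by
  rw [oneForm, contr_wedge_zero]
  funext v
  apply cfun_ext
  · rw [Pi.smul_apply, reF_smul]; exact mul_one _
  · rw [Pi.smul_apply, imF_smul]
    exact (congrArg _ (imF_ofRealF _)).trans ((mul_zero _).trans (imF_ofRealF _).symm)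

theorem isForm_oneForm : IsForm (oneForm φ) := (isForm_degree_zero _).wedge _

theorem lieD_oneForm {X : VField I5 M5} (h : ∀ Y, X (φ Y) = φ ⁅X, Y⁆) :
    lieD X (oneForm φ) = 0 := by
  rw [oneForm, lieD_wedge h, lieD_form₀, Derivation.map_one_eq_zero, form₀_zero, wedge_zero]

theorem extD_form₀_algebraMap (c : ℝ) : extD (form₀ (algebraMap ℝ (Fun I5 M5) c)) = 0 := by
  refine ext_contr fun X => ?_
  rw [contr_extD_zero, lieD_form₀, Derivation.map_algebraMap, form₀_zero, contr_zero]

theorem contr_extD_oneForm {X : VField I5 M5} {c : ℝ} (h : ∀ Y, X (φ Y) = φ ⁅X, Y⁆)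
    (hc : φ X = algebraMap ℝ (Fun I5 M5) c) : contr X (extD (oneForm φ)) = 0 := by
  rw [contr_extD X isForm_oneForm, lieD_oneForm h, contr_oneForm, hc, extD_form₀_algebraMap,
    sub_zero]

theorem eta_etaDual (t : ℝ) (Y : VField I5 M5) : eta s (etaDual t Y) = etaDual t ⁅eta s, Y⁆ := by
  rw [eta_eq, apply_covector (ψ := 0) (etaDual_fld t) (fun w => ?_), LinearMap.zero_apply, add_zero]
  rw [etaDual_fld, LinearMap.zero_apply]
  simp [lieB, etaV]

theorem circ2_etaDual (t : ℝ) (Y : VField I5 M5) : circ2 (etaDual t Y) = etaDual t ⁅circ2, Y⁆ := by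
  rw [circ2_eq, apply_covector (ψ := 0) (etaDual_fld t) (fun w => ?_), LinearMap.zero_apply,
    add_zero]
  rw [etaDual_fld, LinearMap.zero_apply]
  simp [lieB]

theorem eta_dt2 (Y : VField I5 M5) : eta s (dt2 Y) = dt2 ⁅eta s, Y⁆ := by rw [eta_eq, apply_dt2]
theorem circ2_dt2 (Y : VField I5 M5) : circ2 (dt2 Y) = dt2 ⁅circ2, Y⁆ := by rw [circ2_eq, apply_dt2]

theorem extD_oneForm_dt2 : extD (oneForm dt2) = 0 := by
  refine ext_frame isForm_oneForm.extD IsForm.zero fun i => ?_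
  rw [contr_zero, frame_eq_fld]
  exact contr_extD_oneForm (apply_dt2 _) (dt2_fld _)

theorem transJ_circ2 : transJ r s circ2 = r • eta s := by
  rw [transJ_apply, dt2_circ2, etaDual_circ2, a1_circ2, a2_circ2]
  simp
theorem transJ_eta : transJ r s (eta s) = (-r⁻¹) • circ2 := by
  rw [transJ_apply, dt2_eta, etaDual_eta, a1_eta, a2_eta]
  module
theorem transJ_e1 : transJ r s e1 = e2 := by
  rw [transJ_apply, dt2_e1, etaDual_e1, a1_e1, a2_e1]
  simp
theorem transJ_e2 : transJ r s e2 = (-1 : ℝ) • e1 := by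
  rw [transJ_apply, dt2_e2, etaDual_e2, a1_e2, a2_e2]
  module

/-- The component along `e₁`, `e₂` of `J · θ`: the plane spanned by `e₁` and `e₂` is complex. -/
theorem contr_actJ_area {k : ℕ} {θ : Cochain I5 M5 (k + 2)} (h : IsForm θ) :
    contr e2 (contr e1 (actJ (transJ r s) θ)) = actJ (transJ r s) (contr e2 (contr e1 θ)) := by
  rw [contr_actJ, contr_add, contr_actJ, transJ_e1, transJ_e2, (h.contr e1).rsmul_contr,
    h.contr_contr, h.contr_contr, smul_zero, add_zero, add_zero]

/-- The mean of the component along `e₁`, `e₂` of an exact form measures the component of the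
primitive along `η`. -/
theorem cmean₀_extD_area {β : Cochain I5 M5 1} (h : IsForm β) (h0 : contr (xi s) β = 0) :
    cmean₀ (contr e2 (contr e1 (extD β))) =
      2 * ((s ^ 2 + (1 - s) ^ 2)⁻¹ * s : ℝ) * cmean₀ (contr (eta s) β) := by
  rw [contr_extD _ h, contr_sub, contr_lieD, contr_extD_zero, lie_e1_e2, h.rsmul_contr,
    contr_e3 h h0, cmean₀_sub, cmean₀_sub, e1_eq, e2_eq, cmean₀_lieD, cmean₀_lieD, cmean₀_smul,
    cmean₀_smul]
  push_cast
  ring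

end OneForms

/-! ### The transverse Kähler form of the Hopf foliation -/

section Kahler

variable {r s : ℝ}

/-- The fundamental form of the transverse metric. -/
def transKahler (r s : ℝ) : Cochain I5 M5 2 := wedge dt2 (oneForm (r⁻¹ • etaDual s)) + area 1

theorem rsmul_etaDual_xi : (r⁻¹ • etaDual s) (xi s) = 0 := by
  rw [LinearMap.smul_apply, etaDual_xi, smul_zero]

theorem derivation_rsmul_etaDual {X : VField I5 M5} (h : ∀ Y, X (etaDual s Y) = etaDual s ⁅X, Y⁆)
    (Y : VField I5 M5) : X ((r⁻¹ • etaDual s) Y) = (r⁻¹ • etaDual s) ⁅X, Y⁆ := by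
  rw [LinearMap.smul_apply, LinearMap.smul_apply, Derivation.map_smul, h]

theorem basicFor_transKahler : BasicFor (xi s) (transKahler r s) :=
  (((basicFor_form₀ xi_one).wedge rsmul_etaDual_xi
    (derivation_rsmul_etaDual (xi_etaDual s))).wedge dt2_xi xi_dt2).add (basicFor_area xi_one)

theorem isReal_transKahler : IsReal (transKahler r s) :=
  isReal_add (isReal_wedge (isReal_wedge (isReal_form₀ _)))
    (isReal_wedge (isReal_wedge (isReal_form₀ _)))

theorem form₀_mul (f g : Fun I5 M5) : f • form₀ g = form₀ (f * g) := by
  funext v; ext p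
  exact (Complex.ofReal_mul _ _).symm

theorem transKahler_apply (X Y : VField I5 M5) : transKahler r s ![X, Y] =
    ofRealF (dt2 X * (r⁻¹ • etaDual s Y) - (r⁻¹ • etaDual s X) * dt2 Y + a1 X * a2 Y -
      a2 X * a1 Y) := by
  have e : ∀ φ ψ : VField I5 M5 →ₗ[Fun I5 M5] Fun I5 M5,
      contr Y (contr X (wedge φ (wedge ψ (form₀ 1)))) = form₀ (φ X * ψ Y - ψ X * φ Y) :=
    fun φ ψ => by
      rw [contr_wedge, contr_sub, contr_wedge_zero, contr_wedge_zero, form₀_mul, form₀_mul,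
        form₀_sub, mul_one, mul_comm (φ Y)]
      congr 1
      change φ X • contr Y (oneForm ψ) = _
      rw [contr_oneForm, form₀_mul]
  have h1 : contr Y (contr X (transKahler r s)) = form₀ (dt2 X * (r⁻¹ • etaDual s Y) -
      (r⁻¹ • etaDual s X) * dt2 Y + a1 X * a2 Y - a2 X * a1 Y) := by
    rw [transKahler, contr_add, contr_add, oneForm, e, area, e, ← form₀_add, add_sub_assoc]
    rfl
  have h2 : transKahler r s ![X, Y] = contr Y (contr X (transKahler r s)) Fin.elim0 := by
    change _ = transKahler r s (Fin.cons X (Fin.cons Y Fin.elim0))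
    congr 1
  exact h2.trans (congrFun h1 _)

/-- For `s = 0` the form `η* = dt₁` is closed. -/
theorem extD_transKahler (r : ℝ) : extD (transKahler r 0) = 0 := by
  have hb := basicFor_transKahler (r := r) (s := 0)
  have hη : eta 0 = circ1 := by simp [eta]
  have hd : etaDual 0 = dt1 := by
    ext X p
    simp [etaDual]
  have ha : ∀ v : Fin 5 → ℝ, v 2 = 0 → v 3 = 0 → v 4 = 0 → lieD (fld v) (area 1) = 0 := by
    intro v h2 h3 h4
    rw [area, lieD_wedge fun Y => ?_, lieD_wedge fun Y => ?_, lieD_form₀,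
      Derivation.map_one_eq_zero, form₀_zero, wedge_zero, wedge_zero]
    · rw [apply_covector (ψ := 0) a2_fld (fun w => ?_), LinearMap.zero_apply, add_zero]
      rw [a2_fld, LinearMap.zero_apply]
      simp [lieB, h2, h3, h4]
    · rw [apply_covector (ψ := 0) a1_fld (fun w => ?_), LinearMap.zero_apply, add_zero]
      rw [a1_fld, LinearMap.zero_apply]
      simp [lieB, h2, h3, h4]
  have hc : extD (oneForm (r⁻¹ • etaDual 0)) = 0 := by
    refine ext_frame isForm_oneForm.extD IsForm.zero fun i => ?_
    rw [contr_zero, frame_eq_fld, hd]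
    refine contr_extD_oneForm (c := r⁻¹ * (Pi.single i 1 : Fin 5 → ℝ) 0) (fun Y => ?_) ?_
    · rw [LinearMap.smul_apply, LinearMap.smul_apply, Derivation.map_smul, apply_dt1]
    · rw [LinearMap.smul_apply, dt1_fld, const_mul_algebraMap]
  refine eq_zero_of_adapted_three 0 (k := 0) hb.isForm.extD hb.extD.contr_eq ?_ ?_
  · have e : contr circ2 (transKahler r 0) = oneForm (r⁻¹ • etaDual 0) := by
      rw [transKahler, contr_add, contr_wedge, contr_oneForm, LinearMap.smul_apply, etaDual_circ2,
        smul_zero, form₀_zero, wedge_zero, dt2_circ2, one_smul, contr_area_circ2, sub_zero,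
        add_zero]
    rw [contr_extD _ hb.isForm, e, hc, sub_zero, transKahler, lieD_add,
      lieD_wedge circ2_dt2, lieD_oneForm (derivation_rsmul_etaDual (circ2_etaDual 0)), wedge_zero,
      circ2_eq, ha _ (by simp) (by simp) (by simp), add_zero]
  · have e : contr (eta 0) (transKahler r 0) = -((r⁻¹ : ℝ) : ℂ) • oneForm dt2 := by
      rw [transKahler, contr_add, contr_wedge, contr_oneForm, LinearMap.smul_apply, etaDual_eta,
        form₀_smul, wedge_smul, dt2_eta, zero_smul, contr_area_eta, zero_sub, add_zero, neg_smul]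
      rfl
    rw [contr_extD _ hb.isForm, e, extD_smul, extD_oneForm_dt2, smul_zero, sub_zero, transKahler,
      lieD_add, lieD_wedge eta_dt2, lieD_oneForm (derivation_rsmul_etaDual (eta_etaDual 0)),
      wedge_zero, hη, circ1_eq, ha _ (by simp) (by simp) (by simp), add_zero]

theorem isTransverselyKahler_zero (hr : r ≠ 0) : IsTransverselyKahler (fol 0) (transJ r 0) := by
  refine ⟨isTransverselyHolomorphic hr, transKahler r 0, isBasic_span_iff.2 basicFor_transKahler,
    isReal_transKahler, extD_transKahler r, fun X Y => ?_, fun p X hX => ?_⟩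
  · rw [transKahler_apply, transKahler_apply]
    simp only [dt2_transJ, etaDual_transJ, a1_transJ, a2_transJ, smul_smul, inv_mul_cancel₀ hr,
      one_smul]
    congr 1
    ring
  · rw [transKahler_apply]
    refine (transMetric_pos hr p X hX).trans_eq ?_
    rw [transMetric_apply]
    simp only [dt2_transJ, etaDual_transJ, a1_transJ, a2_transJ, smul_smul, inv_mul_cancel₀ hr,
      one_smul]
    refine (congrArg (fun f : Fun I5 M5 => f p) ?_).trans (Complex.ofReal_re _).symm
    ring

end Kahler

/-! ### Failure of the `∂∂̄`-lemma for non-zero parameters -/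

section Failure

variable {r s : ℝ}

/-- The transverse form `∂₂* + i (r η)*` of type `(1, 0)`. -/
def zetaForm (r s : ℝ) : Cochain I5 M5 1 :=
  oneForm dt2 + (Complex.I * (r⁻¹ : ℝ)) • oneForm (etaDual s)

theorem basicFor_zetaForm : BasicFor (xi s) (zetaForm r s) :=
  ((basicFor_form₀ xi_one).wedge dt2_xi xi_dt2).add
    (((basicFor_form₀ xi_one).wedge etaDual_xi (xi_etaDual s)).smul _)

theorem actJ_oneForm (J : VField I5 M5 →ₗ[Fun I5 M5] VField I5 M5)
    (φ : VField I5 M5 →ₗ[Fun I5 M5] Fun I5 M5) :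
    actJ J (oneForm φ) = oneForm (φ ∘ₗ J) := by
  refine ext_contr fun X => ?_
  rw [contr_actJ, actJ_degree_zero, zero_add, contr_oneForm, contr_oneForm]
  rfl

theorem actJ_zetaForm (hr : r ≠ 0) :
    actJ (transJ r s) (zetaForm r s) = Complex.I • zetaForm r s := by
  refine ext_contr fun X => ?_
  have hr' : (r : ℂ) ≠ 0 := by exact_mod_cast hr
  rw [zetaForm, actJ_add, actJ_smul, actJ_oneForm, actJ_oneForm]
  simp only [contr_add, contr_smul, contr_oneForm]
  change form₀ (dt2 (transJ r s X)) + _ • form₀ (etaDual s (transJ r s X)) = _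
  rw [dt2_transJ, etaDual_transJ, form₀_neg, form₀_smul, form₀_smul]
  push_cast
  match_scalars
  · linear_combination (-(r : ℂ)⁻¹) * Complex.I_sq
  · field_simp

theorem contr_extD_zetaForm_circ2 : contr circ2 (extD (zetaForm r s)) = 0 := by
  rw [zetaForm, extD_add, extD_smul, contr_add, contr_smul,
    contr_extD_oneForm (c := 1) circ2_dt2 (by rw [dt2_circ2, map_one]),
    contr_extD_oneForm (c := 0) (circ2_etaDual s) (by rw [etaDual_circ2, map_zero]), smul_zero,
    add_zero]

theorem contr_extD_zetaForm_eta : contr (eta s) (extD (zetaForm r s)) = 0 := by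
  rw [zetaForm, extD_add, extD_smul, contr_add, contr_smul,
    contr_extD_oneForm (c := 0) eta_dt2 (by rw [dt2_eta, map_zero]),
    contr_extD_oneForm (c := 1) (eta_etaDual s) (by rw [etaDual_eta, map_one]), smul_zero,
    add_zero]

theorem actJ_extD_zetaForm : actJ (transJ r s) (extD (zetaForm r s)) = 0 := by
  have hb := basicFor_zetaForm (r := r) (s := s)
  refine eq_zero_of_adapted_two s (k := 0) (hb.isForm.extD.actJ _)
    (hb.extD.actJ transJ_xi lie_xi_transJ).contr_eq ?_ ?_ ?_
  · rw [contr_actJ, transJ_circ2, hb.isForm.extD.rsmul_contr, contr_extD_zetaForm_circ2,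
      contr_extD_zetaForm_eta, actJ_zero, smul_zero, add_zero]
  · rw [contr_actJ, transJ_eta, hb.isForm.extD.rsmul_contr, contr_extD_zetaForm_circ2,
      contr_extD_zetaForm_eta, actJ_zero, smul_zero, add_zero]
  · rw [contr_actJ_area hb.isForm.extD, actJ_degree_zero]

theorem delbar_zetaForm (hr : r ≠ 0) :
    delbar (transJ r s) (zetaForm r s) = extD (zetaForm r s) := by
  rw [delbar, actJ_extD_zetaForm, actJ_zetaForm hr, extD_smul, zero_sub, smul_neg, smul_smul,
    Complex.I_mul_I]
  module

theorem del_extD_zetaForm : del (transJ r s) (extD (zetaForm r s)) = 0 := by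
  have hb := basicFor_zetaForm (r := r) (s := s)
  rw [del, extD_extD hb.isForm, actJ_extD_zetaForm, extD_zero, actJ_zero]
  simp

/-- The mean of the component of `dζ` along `e₁`, `e₂` does not vanish. -/
theorem cmean₀_extD_zetaForm (hr : r ≠ 0) (hs : s ≠ 0) :
    cmean₀ (contr e2 (contr e1 (extD (zetaForm r s)))) ≠ 0 := by
  have hb := basicFor_zetaForm (r := r) (s := s)
  have hN : s ^ 2 + (1 - s) ^ 2 ≠ 0 := (norm_pos s).ne'
  have e : contr (eta s) (zetaForm r s) = (Complex.I * (r⁻¹ : ℝ)) • form₀ 1 := by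
    rw [zetaForm, contr_add, contr_smul, contr_oneForm, contr_oneForm, dt2_eta, etaDual_eta,
      form₀_zero, zero_add]
  rw [cmean₀_extD_area hb.isForm hb.contr_eq, e, cmean₀_smul, cmean₀_form₀,
    ← map_one (algebraMap ℝ (Fun I5 M5)), mean_algebraMap]
  have h1 : ((2 * ((s ^ 2 + (1 - s) ^ 2)⁻¹ * s) * r⁻¹ : ℝ) : ℂ) * Complex.I ≠ 0 :=
    mul_ne_zero (Complex.ofReal_ne_zero.2 (mul_ne_zero (mul_ne_zero two_ne_zero
      (mul_ne_zero (inv_ne_zero hN) hs)) (inv_ne_zero hr))) Complex.I_ne_zero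
  convert h1 using 1
  push_cast
  ring

/-- The obstruction to being in the image of `∂∂̄`: the mean of the component along `e₁`, `e₂` of
`∂β` only involves the means of the components of `β` along the torus. -/
theorem cmean₀_del_area {β : Cochain I5 M5 1} (h : BasicFor (xi s) β)
    (hU : cmean₀ (contr circ2 β) = 0) (hη : cmean₀ (contr (eta s) β) = 0) :
    cmean₀ (contr e2 (contr e1 (del (transJ r s) β))) = 0 := by
  have hJ := h.actJ (J := transJ r s) transJ_xi lie_xi_transJ
  have h1 : cmean₀ (contr (eta s) (actJ (transJ r s) β)) = 0 := by
    rw [contr_actJ, actJ_degree_zero, zero_add, transJ_eta, h.isForm.rsmul_contr, cmean₀_smul, hU,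
      mul_zero]
  rw [del]
  simp only [contr_smul, contr_sub, cmean₀_smul, cmean₀_sub]
  rw [contr_actJ_area h.isForm.extD, actJ_degree_zero, cmean₀_extD_area h.isForm h.contr_eq, hη,
    cmean₀_extD_area hJ.isForm hJ.contr_eq, h1, cmean₀]
  simp

theorem cmean₀_contr_delbar (f : Cochain I5 M5 0) (v w : Fin 5 → ℝ)
    (hJ : transJ r s (fld v) = fld w) : cmean₀ (contr (fld v) (delbar (transJ r s) f)) = 0 := by
  rw [delbar_eq_dc, contr_smul, contr_add, contr_smul, contr_extD_zero, contr_dc_zero, hJ]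
  rw [cmean₀_smul, cmean₀_add, cmean₀_smul, cmean₀_lieD, cmean₀_lieD]
  simp

theorem BasicFor.delbar {k : ℕ} {θ : Cochain I5 M5 k} (h : BasicFor (xi s) θ) :
    BasicFor (xi s) (delbar (transJ r s) θ) := by
  rw [delbar_eq_dc]
  exact (h.extD.add ((h.dc transJ_xi lie_xi_transJ).smul _)).smul _

/-- The form `∂̄ζ = dζ` is `∂`-closed. It is not in the image of `∂∂̄`, since its component along
`e₁`, `e₂` has a non-zero mean. -/
theorem not_satisfiesDDbarLemma (hr : r ≠ 0) (hs : s ≠ 0) :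
    ¬ SatisfiesDDbarLemma (fol s) (transJ r s) := by
  rintro ⟨hAB, hBC⟩
  have hb := basicFor_zetaForm (r := r) (s := s)
  set θ : Graded I5 M5 := Function.update 0 2 (extD (zetaForm r s)) with hθ
  set Z : Graded I5 M5 := Function.update 0 1 (zetaForm r s) with hZ
  have hθb : θ ∈ basicForms (fol s) := fun k => by
    by_cases hk : k = 2
    · subst hk
      rw [hθ, Function.update_self]
      exact isBasic_span_iff.2 hb.extD
    · rw [hθ, Function.update_of_ne hk]
      exact isBasic_span_iff.2 BasicFor.zero
  have hZb : Z ∈ basicForms (fol s) := fun k => by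
    by_cases hk : k = 1
    · subst hk
      rw [hZ, Function.update_self]
      exact isBasic_span_iff.2 hb
    · rw [hZ, Function.update_of_ne hk]
      exact isBasic_span_iff.2 BasicFor.zero
  have hdel0 : ∀ k, del (transJ r s) (0 : Cochain I5 M5 k) = 0 := fun k => by
    rw [del_eq_dc, extD_zero, dc_zero]; simp
  have hdelbar0 : ∀ k, delbar (transJ r s) (0 : Cochain I5 M5 k) = 0 := fun k => by
    rw [delbar_eq_dc, extD_zero, dc_zero]; simp
  have h1 : delG (transJ r s) θ = 0 := by
    funext k
    match k with
    | 0 => rfl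
    | k + 1 =>
      change del _ (θ k) = 0
      by_cases hk : k = 2
      · subst hk
        rw [hθ, Function.update_self, del_extD_zetaForm]
      · rw [hθ, Function.update_of_ne hk]
        exact hdel0 k
  have h2 : delbarG (transJ r s) Z = θ := by
    funext k
    match k with
    | 0 => rw [hθ, Function.update_of_ne (by norm_num)]; rfl
    | k + 1 =>
      change delbar _ (Z k) = _
      by_cases hk : k = 1
      · subst hk
        rw [hZ, hθ, Function.update_self]
        exact (delbar_zetaForm hr).trans (Function.update_self (β := fun k => Cochain I5 M5 k) 2 _ _).symm
      · rw [hZ, hθ, Function.update_of_ne hk, Function.update_of_ne (by omega)]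
        exact hdelbar0 k
  have hmem : θ ∈ {θ ∈ basicForms (fol s) | delG (transJ r s) θ = 0} ∩
      delbarG (transJ r s) '' basicForms (fol s) := ⟨⟨hθb, h1⟩, Z, hZb, h2⟩
  rw [hAB, hBC] at hmem
  obtain ⟨F, hF, hFθ⟩ := hmem
  have e : del (transJ r s) (delbar (transJ r s) (F 0)) = extD (zetaForm r s) := by
    have := congrFun hFθ 2
    rw [hθ, Function.update_self] at this
    exact this
  refine cmean₀_extD_zetaForm hr hs ?_
  rw [← e]
  refine cmean₀_del_area (isBasic_span_iff.1 (hF 0)).delbar ?_ ?_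
  · rw [circ2_eq]
    exact cmean₀_contr_delbar _ _ _ (transJ_fld _ _ _)
  · rw [eta_eq]
    exact cmean₀_contr_delbar _ _ _ (transJ_fld _ _ _)

end Failure

/-! ### Closed 1-forms on `S¹ × S³` -/

section FirstCohomology

theorem circ1_comm (w : Fin 5 → ℝ) (f : Fun I5 M5) : circ1 (fld w f) = fld w (circ1 f) := by
  rw [apply_comm_of_lie (lie_circ1_fld w), Derivation.zero_apply, add_zero]

theorem circ2_comm (w : Fin 5 → ℝ) (f : Fun I5 M5) : circ2 (fld w f) = fld w (circ2 f) := by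
  rw [apply_comm_of_lie (lie_circ2_fld w), Derivation.zero_apply, add_zero]

theorem e1_e2_comm (f : Fun I5 M5) : e1 (e2 f) = e2 (e1 f) + (2 : ℝ) • e3 f :=
  apply_comm_of_lie lie_e1_e2 f

theorem e2_e3_comm (f : Fun I5 M5) : e2 (e3 f) = e3 (e2 f) + (2 : ℝ) • e1 f :=
  apply_comm_of_lie lie_e2_e3 f

theorem e3_e1_comm (f : Fun I5 M5) : e3 (e1 f) = e1 (e3 f) + (2 : ℝ) • e2 f :=
  apply_comm_of_lie lie_e3_e1 f

theorem circ1_e1_comm (f : Fun I5 M5) : circ1 (e1 f) = e1 (circ1 f) := by rw [e1_eq, circ1_comm]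
theorem circ1_e2_comm (f : Fun I5 M5) : circ1 (e2 f) = e2 (circ1 f) := by rw [e2_eq, circ1_comm]
theorem circ1_e3_comm (f : Fun I5 M5) : circ1 (e3 f) = e3 (circ1 f) := by rw [e3_eq, circ1_comm]
theorem circ2_e1_comm (f : Fun I5 M5) : circ2 (e1 f) = e1 (circ2 f) := by rw [e1_eq, circ2_comm]
theorem circ2_e2_comm (f : Fun I5 M5) : circ2 (e2 f) = e2 (circ2 f) := by rw [e2_eq, circ2_comm]
theorem circ2_e3_comm (f : Fun I5 M5) : circ2 (e3 f) = e3 (circ2 f) := by rw [e3_eq, circ2_comm]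
theorem circ2_circ1_comm (f : Fun I5 M5) : circ2 (circ1 f) = circ1 (circ2 f) := by
  rw [circ1_eq, circ2_comm]

/-- The components `m₀, m₁, m₂, m₃` along `∂₁, e₁, e₂, e₃` of a closed 1-form on `S¹ × S³`. -/
structure ClosedComponents (m₀ m₁ m₂ m₃ : Fun I5 M5) : Prop where
  circ2_0 : circ2 m₀ = 0
  circ2_1 : circ2 m₁ = 0
  circ2_2 : circ2 m₂ = 0
  circ2_3 : circ2 m₃ = 0
  circ1_1 : circ1 m₁ = e1 m₀
  circ1_2 : circ1 m₂ = e2 m₀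
  circ1_3 : circ1 m₃ = e3 m₀
  curl_12 : e1 m₂ - e2 m₁ = (2 : ℝ) • m₃
  curl_23 : e2 m₃ - e3 m₂ = (2 : ℝ) • m₁
  curl_31 : e3 m₁ - e1 m₃ = (2 : ℝ) • m₂

variable {m₀ m₁ m₂ m₃ : Fun I5 M5}

theorem ClosedComponents.sub_exact (h : ClosedComponents m₀ m₁ m₂ m₃) {u : Fun I5 M5}
    (hu : circ2 u = 0) :
    ClosedComponents (m₀ - circ1 u) (m₁ - e1 u) (m₂ - e2 u) (m₃ - e3 u) where
  circ2_0 := by rw [map_sub, h.circ2_0, circ2_circ1_comm, hu, map_zero, sub_zero]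
  circ2_1 := by rw [map_sub, h.circ2_1, circ2_e1_comm, hu, map_zero, sub_zero]
  circ2_2 := by rw [map_sub, h.circ2_2, circ2_e2_comm, hu, map_zero, sub_zero]
  circ2_3 := by rw [map_sub, h.circ2_3, circ2_e3_comm, hu, map_zero, sub_zero]
  circ1_1 := by rw [map_sub, map_sub, h.circ1_1, circ1_e1_comm]
  circ1_2 := by rw [map_sub, map_sub, h.circ1_2, circ1_e2_comm]
  circ1_3 := by rw [map_sub, map_sub, h.circ1_3, circ1_e3_comm]
  curl_12 := by
    rw [map_sub, map_sub]
    linear_combination (norm := module) h.curl_12 - e1_e2_comm u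
  curl_23 := by
    rw [map_sub, map_sub]
    linear_combination (norm := module) h.curl_23 - e2_e3_comm u
  curl_31 := by
    rw [map_sub, map_sub]
    linear_combination (norm := module) h.curl_31 - e3_e1_comm u

/-- After subtraction of an exact form the component along `∂₁` vanishes. -/
theorem ClosedComponents.exists_first (h : ClosedComponents m₀ m₁ m₂ m₃) (hm : mean m₀ = 0) :
    ∃ u, circ2 u = 0 ∧ circ1 u = m₀ := by
  refine ⟨CircleSubgroup.fst.prim m₀, ?_, ?_⟩
  · rw [CircleSubgroup.prim, circ2_kernel, h.circ2_0, map_zero]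
  set a := CircleSubgroup.fst.avg m₀ with ha
  have hp : circ1 (CircleSubgroup.fst.prim m₀) = m₀ - a := by
    rw [← fst_fld, CircleSubgroup.fld_prim]
  have hc : ∀ (w : Fin 5 → ℝ) (m : Fun I5 M5), circ1 m = fld w m₀ → fld w a = 0 := fun w m e => by
    rw [ha, CircleSubgroup.fld_avg_comm _ (fst_comm w), ← e, circ1_eq,
      ← CircleSubgroup.fld_avg_comm _ (fst_comm _)]
    exact CircleSubgroup.fst.fld_avg m
  have h0 := eq_of_frame_eq_zero (f := a) fun i => by
    fin_cases i
    · change circ1 a = 0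
      rw [← fst_fld]
      exact CircleSubgroup.fst.fld_avg m₀
    · change circ2 a = 0
      rw [ha, CircleSubgroup.avg, circ2_kernel, h.circ2_0, map_zero]
    · change e1 a = 0
      rw [e1_eq]; exact hc _ m₁ (by rw [h.circ1_1, e1_eq])
    · change e2 a = 0
      rw [e2_eq]; exact hc _ m₂ (by rw [h.circ1_2, e2_eq])
    · change e3 a = 0
      rw [e3_eq]; exact hc _ m₃ (by rw [h.circ1_3, e3_eq])
  have h1 : a = algebraMap ℝ _ (a 1) := by
    ext p; exact h0 p 1
  have h2 : a 1 = 0 := by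
    have := CircleSubgroup.fst.mean_avg m₀
    rwa [← ha, hm, h1, mean_algebraMap] at this
  rw [hp, h1, h2, map_zero, sub_zero]

/-- After subtraction of an exact form the component along the Hopf fibres vanishes. -/
theorem ClosedComponents.exists_hopf (h : ClosedComponents 0 m₁ m₂ m₃) :
    ∃ u, circ2 u = 0 ∧ circ1 u = 0 ∧ e3 u = m₃ := by
  have c3 : circ1 m₃ = 0 := by rw [h.circ1_3, map_zero]
  set u := CircleSubgroup.hopf.prim m₃ with hu
  have u2 : circ2 u = 0 := by rw [hu, CircleSubgroup.prim, circ2_kernel, h.circ2_3, map_zero]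
  have u1 : circ1 u = 0 := by rw [hu, CircleSubgroup.prim, circ1_kernel, c3, map_zero]
  refine ⟨u, u2, u1, ?_⟩
  have h' := h.sub_exact u2
  have e : m₃ - e3 u = CircleSubgroup.hopf.avg m₃ := by
    rw [← hopf_fld, hu, CircleSubgroup.fld_prim, sub_sub_cancel]
  set a := m₃ - e3 u
  set b := m₁ - e1 u
  set c := m₂ - e2 u
  have hb : IsBase a := by
    refine ⟨?_, h'.circ2_3, by rw [e, e3_avg]⟩
    rw [h'.circ1_3, u1, sub_zero, map_zero]
  have hl : e1 (e1 a) + e2 (e2 a) = 0 := by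
    have l1 : e1 (e1 a) + e2 (e2 a) = e3 (e1 b + e2 c) := by
      have d1 : e1 a = e3 b - (2 : ℝ) • c := by
        linear_combination (norm := module) -h'.curl_31
      have d2 : e2 a = e3 c + (2 : ℝ) • b := by
        linear_combination (norm := module) h'.curl_23
      rw [d1, d2, map_sub, map_add, map_add, Derivation.map_smul, Derivation.map_smul]
      linear_combination (norm := module) e2_e3_comm c - e3_e1_comm b
    have ha : CircleSubgroup.hopf.avg a = a :=
      CircleSubgroup.avg_eq_self _ (by rw [hopf_fld, hb.e3])
    have l2 := horizontal_laplacian_avg a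
    rw [ha, l1, avg_e3] at l2
    rw [l1, l2]
  -- The constant `a` vanishes, as `2 a = e₁ c - e₂ b` has mean zero.
  have hm : mean a = 0 := by
    have := congrArg mean h'.curl_12
    rw [map_sub, mean_e1, mean_e2, map_smul, sub_zero, smul_eq_mul] at this
    linarith
  have := hb.eq_mean hl
  rw [hm, map_zero] at this
  exact (sub_eq_zero.1 this).symm

/-- A closed 1-form without components along `∂₁` and the Hopf fibres is exact. -/
theorem ClosedComponents.exists_base (h : ClosedComponents 0 m₁ m₂ 0) :
    ∃ u, IsBase u ∧ e1 u = m₁ ∧ e2 u = m₂ := by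
  have c1 : e3 m₁ = (2 : ℝ) • m₂ := by
    have := h.curl_31
    rwa [map_zero, sub_zero] at this
  have c2 : e3 m₂ = -((2 : ℝ) • m₁) := by
    have := h.curl_23
    rw [map_zero, zero_sub] at this
    rw [← this, neg_neg]
  have c3 : e1 m₂ = e2 m₁ := by
    have := h.curl_12
    rwa [smul_zero, sub_eq_zero] at this
  have hb : IsBase (e1 m₁ + e2 m₂) := by
    refine ⟨?_, ?_, ?_⟩
    · rw [map_add, circ1_e1_comm, circ1_e2_comm, h.circ1_1, h.circ1_2]
      simp only [map_zero, add_zero]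
    · rw [map_add, circ2_e1_comm, circ2_e2_comm, h.circ2_1, h.circ2_2]
      simp only [map_zero, add_zero]
    · have d := e2_e3_comm m₂
      rw [c2, map_neg, Derivation.map_smul] at d
      rw [map_add, e3_e1_comm, c1, Derivation.map_smul]
      linear_combination (norm := module) -d
  obtain ⟨u, hu, hP⟩ := exists_poisson hb
  rw [map_add, mean_e1, mean_e2, add_zero, map_zero, sub_zero] at hP
  refine ⟨u, hu, ?_⟩
  have h' := h.sub_exact hu.circ2
  have k0 : (0 : Fun I5 M5) - e3 u = 0 := by rw [hu.e3, sub_zero]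
  rw [hu.circ1, sub_zero, k0] at h'
  set q₁ := m₁ - e1 u with hq₁
  set q₂ := m₂ - e2 u with hq₂
  have d1 : e3 q₁ = (2 : ℝ) • q₂ := by
    have := h'.curl_31
    rwa [map_zero, sub_zero] at this
  have d2 : e3 q₂ = -((2 : ℝ) • q₁) := by
    have := h'.curl_23
    rw [map_zero, zero_sub] at this
    rw [← this, neg_neg]
  have d3 : e1 q₂ = e2 q₁ := by
    have := h'.curl_12
    rwa [smul_zero, sub_eq_zero] at this
  have d4 : e1 q₁ = -e2 q₂ := by
    rw [hq₁, hq₂, map_sub, map_sub]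
    linear_combination (norm := module) -hP
  -- The Bochner formula: the horizontal Laplacian of `q₁` is `4 q₁`.
  have hB : e1 (e1 q₁) + e2 (e2 q₁) = (4 : ℝ) • q₁ := by
    rw [← d3, d4, map_neg]
    linear_combination (norm := module) (-2 : ℝ) • d2 - e1_e2_comm q₂
  have hz : mean (e1 q₁ * e1 q₁ + e2 q₁ * e2 q₁ + (4 : ℝ) • (q₁ * q₁)) = 0 := by
    have : e1 q₁ * e1 q₁ + e2 q₁ * e2 q₁ + (4 : ℝ) • (q₁ * q₁) =
        e1 (q₁ * e1 q₁) + e2 (q₁ * e2 q₁) := by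
      rw [← mul_smul_comm, ← hB]
      simp only [Derivation.leibniz, smul_eq_mul]
      ring
    rw [this, map_add, mean_e1, mean_e2, add_zero]
  have hpos : ∀ p, 0 ≤ (e1 q₁ * e1 q₁ + e2 q₁ * e2 q₁ + (4 : ℝ) • (q₁ * q₁)) p := fun p => by
    change 0 ≤ e1 q₁ p * e1 q₁ p + e2 q₁ p * e2 q₁ p + 4 * (q₁ p * q₁ p)
    linarith [mul_self_nonneg (e1 q₁ p), mul_self_nonneg (e2 q₁ p), mul_self_nonneg (q₁ p)]
  have h0 := eq_zero_of_mean_eq_zero hpos hz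
  have z1 : q₁ = 0 := by
    ext p
    have := congrArg (fun f : Fun I5 M5 => f p) h0
    change e1 q₁ p * e1 q₁ p + e2 q₁ p * e2 q₁ p + 4 * (q₁ p * q₁ p) = 0 at this
    change q₁ p = 0
    refine mul_self_eq_zero.1 ?_
    linarith [mul_self_nonneg (e1 q₁ p), mul_self_nonneg (e2 q₁ p), mul_self_nonneg (q₁ p)]
  have z2 : q₂ = 0 := by
    rw [z1, map_zero] at d1
    have := (smul_eq_zero.1 d1.symm).resolve_left two_ne_zero
    exact this
  exact ⟨(sub_eq_zero.1 z1).symm, (sub_eq_zero.1 z2).symm⟩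

theorem ClosedComponents.exists_primitive (h : ClosedComponents m₀ m₁ m₂ m₃) (hm : mean m₀ = 0) :
    ∃ u, circ1 u = m₀ ∧ e1 u = m₁ ∧ e2 u = m₂ ∧ e3 u = m₃ := by
  obtain ⟨u, u2, u1⟩ := h.exists_first hm
  have h' := h.sub_exact u2
  rw [u1, sub_self] at h'
  obtain ⟨v, v2, v1, v3⟩ := h'.exists_hopf
  have h'' := h'.sub_exact v2
  rw [v1, sub_zero, v3, sub_self] at h''
  obtain ⟨w, hw, w1, w2⟩ := h''.exists_base
  refine ⟨u + v + w, ?_, ?_, ?_, ?_⟩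
  · rw [map_add, map_add, u1, v1, hw.circ1, add_zero, add_zero]
  · rw [map_add, map_add, w1]; abel
  · rw [map_add, map_add, w2]; abel
  · rw [map_add, map_add, v3, hw.e3]; abel

end FirstCohomology

/-! ### The Pfaffian of a closed basic 2-form -/

section Pfaffian

variable {s : ℝ}

/-- The average over the second circle of `ι_U θ`, for a closed basic 2-form `θ` and `U = ∂₂`, is
exact. -/
theorem exists_potential (hs : s ≠ 0) {l₀ l₁ l₂ A B₁ B₂ : Fun I5 M5}
    (x0 : xi s l₀ = 0) (x1 : xi s l₁ = (2 * (1 - s)) • l₂) (x2 : xi s l₂ = -((2 * (1 - s)) • l₁))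
    (dA : circ2 A = e1 l₂ - e2 l₁ + (2 * (s * (s ^ 2 + (1 - s) ^ 2)⁻¹)) • l₀)
    (d2 : circ2 B₂ = eta s l₂ - e2 l₀ - (2 * s) • l₁)
    (d1 : circ2 B₁ = eta s l₁ - e1 l₀ + (2 * s) • l₂) :
    ∃ u, xi s u = 0 ∧ eta s u = CircleSubgroup.snd.avg l₀ ∧
      e1 u = CircleSubgroup.snd.avg l₁ ∧ e2 u = CircleSubgroup.snd.avg l₂ := by
  have hN := norm_pos s
  have hN' : (s ^ 2 + (1 - s) ^ 2)⁻¹ * (s ^ 2 + (1 - s) ^ 2) = 1 := inv_mul_cancel₀ hN.ne'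
  have a1 : ∀ g, circ1 g = (s ^ 2 + (1 - s) ^ 2)⁻¹ • (s • xi s g + (1 - s) • eta s g) := fun g =>
    congrArg (fun X : VField I5 M5 => X g) (circ1_eq_adapted s)
  have a3 : ∀ g, e3 g = (s ^ 2 + (1 - s) ^ 2)⁻¹ • ((1 - s) • xi s g - s • eta s g) := fun g =>
    congrArg (fun X : VField I5 M5 => X g) (e3_eq_adapted s)
  set N := (s ^ 2 + (1 - s) ^ 2)⁻¹
  have hU : ∀ g, CircleSubgroup.snd.avg (circ2 g) = 0 := fun g => by
    rw [circ2_eq, ← CircleSubgroup.fld_avg_comm _ (snd_comm _)]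
    exact CircleSubgroup.snd.fld_avg g
  have hη : ∀ g, eta s (CircleSubgroup.snd.avg g) = CircleSubgroup.snd.avg (eta s g) := fun g => by
    rw [eta_eq, CircleSubgroup.fld_avg_comm _ (snd_comm _)]
  have h1 : ∀ g, e1 (CircleSubgroup.snd.avg g) = CircleSubgroup.snd.avg (e1 g) := fun g => by
    rw [e1_eq, CircleSubgroup.fld_avg_comm _ (snd_comm _)]
  have h2 : ∀ g, e2 (CircleSubgroup.snd.avg g) = CircleSubgroup.snd.avg (e2 g) := fun g => by
    rw [e2_eq, CircleSubgroup.fld_avg_comm _ (snd_comm _)]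
  have hx : ∀ g, xi s (CircleSubgroup.snd.avg g) = CircleSubgroup.snd.avg (xi s g) := fun g => by
    rw [xi_eq, CircleSubgroup.fld_avg_comm _ (snd_comm _)]
  have hU0 : ∀ g, circ2 (CircleSubgroup.snd.avg g) = 0 := fun g => by
    rw [← snd_fld]; exact CircleSubgroup.snd.fld_avg g
  have y0 := hx l₀
  have y1 := hx l₁
  have y2 := hx l₂
  rw [x0, map_zero] at y0
  rw [x1, map_smul] at y1
  rw [x2, map_neg, map_smul] at y2
  have cA := hU A
  have c2 := hU B₂
  have c1 := hU B₁
  rw [dA, map_add, map_sub, map_smul, ← h1, ← h2] at cA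
  rw [d2, map_sub, map_sub, map_smul, ← hη, ← h2] at c2
  rw [d1, map_add, map_sub, map_smul, ← hη, ← h1] at c1
  have k0 := hU0 l₀
  have k1 := hU0 l₁
  have k2 := hU0 l₂
  set b₀ := CircleSubgroup.snd.avg l₀
  set b₁ := CircleSubgroup.snd.avg l₁
  set b₂ := CircleSubgroup.snd.avg l₂
  have hcl : ClosedComponents ((N * (1 - s)) • b₀) b₁ b₂ ((-(N * s)) • b₀) := by
    refine ⟨?_, k1, k2, ?_, ?_, ?_, ?_, ?_, ?_, ?_⟩
    · rw [Derivation.map_smul, k0, smul_zero]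
    · rw [Derivation.map_smul, k0, smul_zero]
    · rw [a1, Derivation.map_smul]
      linear_combination (norm := module) (N * s) • y1 + (N * (1 - s)) • c1
    · rw [a1, Derivation.map_smul]
      linear_combination (norm := module) (N * s) • y2 + (N * (1 - s)) • c2
    · rw [a1, a3, Derivation.map_smul, Derivation.map_smul, Derivation.map_smul,
        Derivation.map_smul, y0]
      module
    · linear_combination (norm := module) cA
    · rw [a3, Derivation.map_smul]
      linear_combination (norm := module) (-(N * (1 - s))) • y2 + (N * s) • c2 +
        (2 : ℝ) • hN' • b₁
    · rw [a3, Derivation.map_smul]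
      linear_combination (norm := module) (N * (1 - s)) • y1 - (N * s) • c1 +
        (2 : ℝ) • hN' • b₂
  -- This is where `s ≠ 0` is used: `N s b₀` is, up to a constant factor, the curl of `(b₁, b₂)`.
  have hm : mean ((N * (1 - s)) • b₀) = 0 := by
    have := congrArg mean hcl.curl_12
    rw [map_sub, mean_e1, mean_e2, map_smul, map_smul, sub_zero, smul_eq_mul, smul_eq_mul] at this
    rw [map_smul, smul_eq_mul]
    have hN0 : N * s ≠ 0 := mul_ne_zero (inv_ne_zero hN.ne') hs
    have hz : mean b₀ = 0 := by
      have h' : N * s * mean b₀ = 0 := by linarith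
      exact (mul_eq_zero.1 h').resolve_left hN0
    rw [hz, mul_zero]
  obtain ⟨u, u0, u1, u2, u3⟩ := hcl.exists_primitive hm
  refine ⟨u, ?_, ?_, u1, u2⟩
  · have e : xi s u = (1 - s) • e3 u + s • circ1 u := rfl
    rw [e, u0, u3]
    module
  · have e : eta s u = (1 - s) • circ1 u - s • e3 u := rfl
    rw [e, u0, u3]
    linear_combination (norm := module) hN' • b₀

theorem circ2_eta_comm (f : Fun I5 M5) : circ2 (eta s f) = eta s (circ2 f) := by
  rw [eta_eq, circ2_comm]

theorem mean_eta (f : Fun I5 M5) : mean (eta s f) = 0 := by rw [eta_eq, mean_fld_eq_zero]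

/-- The quadratic form `κ ↦ ∫ κ ∧ d L_U κ` on basic 1-forms vanishes, being both symmetric and
antisymmetric; here `A, B₁, B₂` differ from the components of `dκ` by functions invariant under
`U = ∂₂`. -/
theorem mean_curl {c : ℝ} {k₀ k₁ k₂ A B₁ B₂ : Fun I5 M5}
    (dA : circ2 A = circ2 (e1 k₂ - e2 k₁ + c • k₀))
    (d2 : circ2 B₂ = circ2 (eta s k₂ - e2 k₀ - (2 * s) • k₁))
    (d1 : circ2 B₁ = circ2 (eta s k₁ - e1 k₀ + (2 * s) • k₂)) :
    mean (circ2 k₀ * A - circ2 k₁ * B₂ + circ2 k₂ * B₁) = 0 := by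
  set C := e1 k₂ - e2 k₁ + c • k₀ with hC
  set D₂ := eta s k₂ - e2 k₀ - (2 * s) • k₁ with hD₂
  set D₁ := eta s k₁ - e1 k₀ + (2 * s) • k₂ with hD₁
  have hC' : circ2 C = e1 (circ2 k₂) - e2 (circ2 k₁) + c • circ2 k₀ := by
    rw [hC, map_add, map_sub, Derivation.map_smul, circ2_e1_comm, circ2_e2_comm]
  have hD₂' : circ2 D₂ = eta s (circ2 k₂) - e2 (circ2 k₀) - (2 * s) • circ2 k₁ := by
    rw [hD₂, map_sub, map_sub, Derivation.map_smul, circ2_eta_comm, circ2_e2_comm]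
  have hD₁' : circ2 D₁ = eta s (circ2 k₁) - e1 (circ2 k₀) + (2 * s) • circ2 k₂ := by
    rw [hD₁, map_add, map_sub, Derivation.map_smul, circ2_eta_comm, circ2_e1_comm]
  -- Twice the integrand is a sum of derivatives along left-invariant fields.
  have e : (2 : ℝ) • (circ2 k₀ * A - circ2 k₁ * B₂ + circ2 k₂ * B₁) =
      circ2 ((2 : ℝ) • (k₀ * A - k₁ * B₂ + k₂ * B₁) - (k₀ * C - k₁ * D₂ + k₂ * D₁)) -
      (e1 (k₀ * circ2 k₂ - k₂ * circ2 k₀) + e2 (k₁ * circ2 k₀ - k₀ * circ2 k₁) +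
        eta s (k₂ * circ2 k₁ - k₁ * circ2 k₂)) := by
    simp only [map_sub, map_add, Derivation.map_smul, Derivation.leibniz, smul_eq_mul, dA, d1, d2]
    rw [hC', hD₁', hD₂', hC, hD₁, hD₂]
    simp only [Algebra.smul_def, map_mul, map_ofNat]
    ring
  have z : ∀ f g₁ g₂ g₃ : Fun I5 M5, mean (circ2 f - (e1 g₁ + e2 g₂ + eta s g₃)) = 0 := by
    intro f g₁ g₂ g₃
    rw [map_sub, map_add, map_add, mean_circ2, mean_e1, mean_e2, mean_eta]
    simp
  have h := congrArg mean e
  rw [z, map_smul, smul_eq_mul] at h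
  linarith

/-- For `s ≠ 0`, a closed basic 2-form with components `lᵢ = θ(∂₂, ·)`, `A = θ(e₁, e₂)`, `Bᵢ = θ(η, eᵢ)` has
a Pfaffian of mean zero. -/
theorem mean_pfaffian (hs : s ≠ 0) {l₀ l₁ l₂ A B₁ B₂ : Fun I5 M5}
    (x0 : xi s l₀ = 0) (x1 : xi s l₁ = (2 * (1 - s)) • l₂) (x2 : xi s l₂ = -((2 * (1 - s)) • l₁))
    (dA : circ2 A = e1 l₂ - e2 l₁ + (2 * (s * (s ^ 2 + (1 - s) ^ 2)⁻¹)) • l₀)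
    (d2 : circ2 B₂ = eta s l₂ - e2 l₀ - (2 * s) • l₁)
    (d1 : circ2 B₁ = eta s l₁ - e1 l₀ + (2 * s) • l₂)
    (hc : eta s A - e1 B₂ + e2 B₁ = 0) : mean (l₀ * A - l₁ * B₂ + l₂ * B₁) = 0 := by
  obtain ⟨u, xu, v0, v1, v2⟩ := exists_potential hs x0 x1 x2 dA d2 d1
  have E1 : mean (eta s u * A - e1 u * B₂ + e2 u * B₁) = 0 := by
    have : eta s u * A - e1 u * B₂ + e2 u * B₁ =
        eta s (u * A) - e1 (u * B₂) + e2 (u * B₁) - u * (eta s A - e1 B₂ + e2 B₁) := by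
      simp only [Derivation.leibniz, smul_eq_mul]
      ring
    rw [this, hc, mul_zero, sub_zero, map_add, map_sub, mean_eta, mean_e1, mean_e2, sub_zero,
      add_zero]
  have hk : ∀ g, circ2 (CircleSubgroup.snd.prim g) = g - CircleSubgroup.snd.avg g := fun g => by
    rw [← snd_fld]; exact CircleSubgroup.snd.fld_prim g
  have w0 := hk l₀
  have w1 := hk l₁
  have w2 := hk l₂
  rw [← v0] at w0
  rw [← v1] at w1
  rw [← v2] at w2
  set k₀ := CircleSubgroup.snd.prim l₀
  set k₁ := CircleSubgroup.snd.prim l₁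
  set k₂ := CircleSubgroup.snd.prim l₂
  have t0 : l₀ = eta s u + circ2 k₀ := by rw [w0]; abel
  have t1 : l₁ = e1 u + circ2 k₁ := by rw [w1]; abel
  have t2 : l₂ = e2 u + circ2 k₂ := by rw [w2]; abel
  have a3 : e3 u = (s ^ 2 + (1 - s) ^ 2)⁻¹ • ((1 - s) • xi s u - s • eta s u) :=
    congrArg (fun X : VField I5 M5 => X u) (e3_eq_adapted s)
  have lie0 := e1_e2_comm u
  rw [a3, xu] at lie0
  have lie1 : eta s (e1 u) = e1 (eta s u) + (-(2 * s)) • e2 u := apply_comm_of_lie lie_eta_e1 u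
  have lie2 : eta s (e2 u) = e2 (eta s u) + (2 * s) • e1 u := apply_comm_of_lie lie_eta_e2 u
  have E2 : mean (circ2 k₀ * A - circ2 k₁ * B₂ + circ2 k₂ * B₁) = 0 := by
    refine mean_curl (s := s) (c := 2 * (s * (s ^ 2 + (1 - s) ^ 2)⁻¹)) ?_ ?_ ?_
    · rw [dA, map_add, map_sub, Derivation.map_smul, circ2_e1_comm, circ2_e2_comm, t0, t1, t2,
        map_add, map_add]
      linear_combination (norm := module) lie0
    · rw [d2, map_sub, map_sub, Derivation.map_smul, circ2_eta_comm, circ2_e2_comm, t0, t1, t2,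
        map_add, map_add]
      linear_combination (norm := module) lie2
    · rw [d1, map_add, map_sub, Derivation.map_smul, circ2_eta_comm, circ2_e1_comm, t0, t1, t2,
        map_add, map_add]
      linear_combination (norm := module) lie1
  have e : l₀ * A - l₁ * B₂ + l₂ * B₁ = (eta s u * A - e1 u * B₂ + e2 u * B₁) +
      (circ2 k₀ * A - circ2 k₁ * B₂ + circ2 k₂ * B₁) := by
    rw [t0, t1, t2]
    ring
  rw [e, map_add, E1, E2, add_zero]

end Pfaffian

/-! ### Transverse symplectic forms -/

section Symplectic

variable {s : ℝ}

instance : ConnectedSpace S3 :=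
  isConnected_iff_connectedSpace.1 (isConnected_sphere (by
    rw [← Module.finrank_eq_rank, Quaternion.finrank_eq_four]; norm_num) 0 zero_le_one)

/-- A function without zeros has non-zero mean. -/
theorem exists_eq_zero_of_mean {f : Fun I5 M5} (h : mean f = 0) : ∃ p, f p = 0 := by
  by_contra! hne
  have hc : Continuous f := Fun.continuous f
  have hsign : (∀ p, 0 ≤ f p) ∨ ∀ p, 0 ≤ (-f) p := by
    by_contra! hcon
    obtain ⟨⟨p, hp⟩, q, hq⟩ := hcon
    have hq' : 0 ≤ f q := by
      have : -f q < 0 := hq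
      linarith
    obtain ⟨x, hx⟩ := mem_range_of_exists_le_of_exists_ge hc ⟨p, hp.le⟩ ⟨q, hq'⟩
    exact hne x hx
  rcases hsign with h0 | h0
  · exact hne 1 (congrArg (fun g : Fun I5 M5 => g 1) (eq_zero_of_mean_eq_zero h0 h))
  · have := eq_zero_of_mean_eq_zero h0 (by rw [map_neg, h, neg_zero])
    exact hne 1 (congrArg (fun g : Fun I5 M5 => g 1) (neg_eq_zero.1 this))

theorem coframe_congr {X Y : VField I5 M5} {p : M5} (h : ∀ f : Fun I5 M5, X f p = Y f p) (i : Fin 5) :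
    coframe i X p = coframe i Y p := by
  have hv : vec X p = vec Y p := by simp only [vec, h]
  rw [coframe_apply_of_vec (vec_eq_coframe Y p ▸ hv) i]

/-- Fields with constant coefficients tangent to the leaves at one point have no transverse
component. -/
theorem transverse_eq_zero {p : M5} {b c₁ c₂ : ℝ}
    (h : TangentAt (fol s) p (b • eta s + c₁ • e1 + c₂ • e2)) : b = 0 ∧ c₁ = 0 ∧ c₂ = 0 := by
  obtain ⟨Y, hY, hp⟩ := h
  obtain ⟨g, rfl⟩ := Submodule.mem_span_singleton.1 hY
  have hN := norm_pos s
  have c : ∀ w : Fin 5 → ℝ, ∀ i, coframe i (fld w) p = w i := fun w i => by rw [coframe_fld]; rfl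
  have e : b • eta s + c₁ • e1 + c₂ • e2 = fld ![b * (1 - s), 0, c₁, c₂, -(b * s)] := by
    rw [fld_eq, eta]
    change _ = (b * (1 - s)) • circ1 + (0 : ℝ) • circ2 + c₁ • e1 + c₂ • e2 + (-(b * s)) • e3
    module
  have k : ∀ i, (![b * (1 - s), 0, c₁, c₂, -(b * s)] : Fin 5 → ℝ) i = g p * xiV s i := fun i => by
    rw [← c ![b * (1 - s), 0, c₁, c₂, -(b * s)] i, ← e, coframe_congr hp, map_smul]
    change g p * coframe i (xi s) p = _
    rw [xi_eq, c]
  have k0 := k 0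
  have k2 := k 2
  have k3 := k 3
  have k4 := k 4
  simp [xiV] at k0 k2 k3 k4
  refine ⟨?_, k2, k3⟩
  have : b * (s ^ 2 + (1 - s) ^ 2) = 0 := by linear_combination (1 - s) * k0 - s * k4
  exact (mul_eq_zero.1 this).resolve_right hN.ne'

/-- The contraction `ι_Y ι_X dλ` of the differential of a 1-form. -/
theorem contr_contr_extD {l : Cochain I5 M5 1} (h : IsForm l) (X Y : VField I5 M5) :
    contr Y (contr X (extD l)) =
      lieD X (contr Y l) - contr ⁅X, Y⁆ l - lieD Y (contr X l) := by
  rw [contr_extD X h, contr_sub, contr_lieD, contr_extD_zero]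

theorem cochain_two_eq (θ : Cochain I5 M5 2) (X Y : VField I5 M5) :
    θ ![X, Y] = contr Y (contr X θ) Fin.elim0 := by
  change _ = θ (Fin.cons X (Fin.cons Y Fin.elim0))
  congr 1

theorem contr_eq_zero_at {l : Cochain I5 M5 1} (h : IsForm l) (p : M5)
    (h0 : contr (xi s) l Fin.elim0 p = 0) (h1 : contr circ2 l Fin.elim0 p = 0)
    (h2 : contr (eta s) l Fin.elim0 p = 0) (h3 : contr e1 l Fin.elim0 p = 0)
    (h4 : contr e2 l Fin.elim0 p = 0) (Y : VField I5 M5) : contr Y l Fin.elim0 p = 0 := by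
  rw [h.contr_eq_sum]
  have hf : ∀ i, contr (frame i) l Fin.elim0 p = 0 := by
    intro i
    fin_cases i
    · change contr circ1 l Fin.elim0 p = 0
      rw [circ1_eq_adapted s, h.contr_rsmul_sum]
      change _ * (_ * contr (xi s) l Fin.elim0 p + _ * contr (eta s) l Fin.elim0 p) = (0 : ℂ)
      rw [h0, h2]
      simp
    · exact h1
    · exact h3
    · exact h4
    · change contr e3 l Fin.elim0 p = 0
      rw [e3_eq_adapted s, h.rsmul_contr, h.sub_contr, h.rsmul_contr, h.rsmul_contr]
      change _ * (_ * contr (xi s) l Fin.elim0 p - _ * contr (eta s) l Fin.elim0 p) = (0 : ℂ)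
      rw [h0, h2]
      simp
  rw [Finset.sum_apply]
  have : ∀ F : Fin 5 → CFun I5 M5, (∑ i, F i) p = ∑ i, F i p := fun F => by
    simp [Fin.sum_univ_five]
  rw [this]
  refine Finset.sum_eq_zero fun i _ => ?_
  change ((coframe i Y p : ℝ) : ℂ) * contr (frame i) l Fin.elim0 p = 0
  rw [hf, mul_zero]

/-- The Pfaffian of a closed basic 2-form has mean zero, hence a zero, where the form is
degenerate. -/
theorem not_isTransverselySymplectic (hs : s ≠ 0) : ¬ IsTransverselySymplectic (fol s) := by
  rintro ⟨θ, hb, hr, hd, hnd⟩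
  replace hb := isBasic_span_iff.1 hb
  have hf := hb.isForm
  have comp : ∀ X Y, ∃ f : Fun I5 M5, contr Y (contr X θ) = form₀ f := fun X Y =>
    ⟨_, (isReal_contr (isReal_contr hr X) Y).eq_form₀⟩
  obtain ⟨l₀, hl₀⟩ := comp circ2 (eta s)
  obtain ⟨l₁, hl₁⟩ := comp circ2 e1
  obtain ⟨l₂, hl₂⟩ := comp circ2 e2
  obtain ⟨A, hA⟩ := comp e1 e2
  obtain ⟨B₁, hB₁⟩ := comp (eta s) e1
  obtain ⟨B₂, hB₂⟩ := comp (eta s) e2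
  have hl := hb.contr (lie_xi_circ2 (s := s))
  have hm := hb.contr (lie_xi_eta (s := s))
  -- Since `dθ = 0`, `L_X θ = d ι_X θ`.
  have hL : ∀ X, lieD X θ = extD (contr X θ) := fun X => by
    have := contr_extD X hf
    rw [hd, contr_zero] at this
    exact (sub_eq_zero.1 this.symm)
  have three : ∀ {τ : Cochain I5 M5 1}, IsForm τ → contr (xi s) τ = 0 → ∀ {f : Fun I5 M5},
      contr (eta s) τ = form₀ f → contr ((2 : ℝ) • e3) τ =
        form₀ ((-(2 * (s * (s ^ 2 + (1 - s) ^ 2)⁻¹))) • f) := fun hτ h0 f h1 => by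
    rw [hτ.rsmul_contr, contr_e3 hτ h0, h1, form₀_smul, smul_smul]
    congr 1
    push_cast
    ring
  have x0 : xi s l₀ = 0 := form₀_injective (by
    rw [← lieD_form₀, ← hl₀, (hl.contr lie_xi_eta).invariant, form₀_zero])
  have x1 : xi s l₁ = (2 * (1 - s)) • l₂ := form₀_injective (by
    have := contr_lieD (xi s) e1 (contr circ2 θ)
    rw [hl.invariant, contr_zero, lie_xi_e1, hl.isForm.rsmul_contr, hl₁, hl₂] at this
    rw [← lieD_form₀, form₀_smul, ← sub_eq_zero, ← this])
  have x2 : xi s l₂ = -((2 * (1 - s)) • l₁) := form₀_injective (by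
    have := contr_lieD (xi s) e2 (contr circ2 θ)
    rw [hl.invariant, contr_zero, lie_xi_e2, hl.isForm.rsmul_contr, hl₁, hl₂] at this
    rw [← lieD_form₀, form₀_neg, form₀_smul, ← sub_eq_zero, this]
    push_cast
    module)
  have dA : circ2 A = e1 l₂ - e2 l₁ + (2 * (s * (s ^ 2 + (1 - s) ^ 2)⁻¹)) • l₀ :=
    form₀_injective (by
      have h1 := contr_lieD_area (c := 0) (X := circ2) (by rw [lie_circ2_e1, zero_smul])
        (by rw [lie_circ2_e2, neg_zero, zero_smul]) hf
      rw [hL, contr_contr_extD hl.isForm, hl₁, hl₂, hA, lie_e1_e2,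
        three hl.isForm hl.contr_eq hl₀, lieD_form₀, lieD_form₀, lieD_form₀] at h1
      rw [← h1, form₀_add, form₀_sub, form₀_smul, form₀_smul]
      push_cast
      module)
  have d2 : circ2 B₂ = eta s l₂ - e2 l₀ - (2 * s) • l₁ := form₀_injective (by
    have h1 : contr e2 (contr (eta s) (lieD circ2 θ)) = lieD circ2 (contr e2 (contr (eta s) θ)) := by
      rw [contr_lieD, lie_circ2_eta, hf.zero_contr, sub_zero, contr_lieD, lie_circ2_e2,
        hm.isForm.zero_contr, sub_zero]
    rw [hL, contr_contr_extD hl.isForm, hl₀, hl₂, hB₂, lie_eta_e2, hl.isForm.rsmul_contr, hl₁,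
      lieD_form₀, lieD_form₀, lieD_form₀] at h1
    rw [← h1, form₀_sub, form₀_sub, form₀_smul]
    abel)
  have d1 : circ2 B₁ = eta s l₁ - e1 l₀ + (2 * s) • l₂ := form₀_injective (by
    have h1 : contr e1 (contr (eta s) (lieD circ2 θ)) = lieD circ2 (contr e1 (contr (eta s) θ)) := by
      rw [contr_lieD, lie_circ2_eta, hf.zero_contr, sub_zero, contr_lieD, lie_circ2_e1,
        hm.isForm.zero_contr, sub_zero]
    rw [hL, contr_contr_extD hl.isForm, hl₀, hl₁, hB₁, lie_eta_e1, hl.isForm.rsmul_contr, hl₂,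
      lieD_form₀, lieD_form₀, lieD_form₀] at h1
    rw [← h1, form₀_add, form₀_sub, form₀_smul]
    push_cast
    module)
  have hc : eta s A - e1 B₂ + e2 B₁ = 0 := form₀_injective (by
    have h1 := contr_lieD_area (c := -(2 * s)) lie_eta_e1 (by rw [lie_eta_e2, neg_neg]) hf
    have hz : contr (eta s) (contr (eta s) θ) = form₀ 0 := by rw [hf.contr_contr, form₀_zero]
    rw [hL, contr_contr_extD hm.isForm, hB₁, hB₂, hA, lie_e1_e2,
      three hm.isForm hm.contr_eq hz, lieD_form₀, lieD_form₀, lieD_form₀, smul_zero,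
      form₀_zero, sub_zero] at h1
    rw [form₀_add, form₀_sub, ← h1, form₀_zero]
    abel)
  obtain ⟨p, hp⟩ := exists_eq_zero_of_mean (mean_pfaffian hs x0 x1 x2 dA d2 d1 hc)
  change l₀ p * A p - l₁ p * B₂ p + l₂ p * B₁ p = 0 at hp
  have ev : ∀ {X Y : VField I5 M5} {f : Fun I5 M5}, contr Y (contr X θ) = form₀ f →
      contr Y (contr X θ) Fin.elim0 p = (f p : ℂ) ∧ contr X (contr Y θ) Fin.elim0 p = -(f p : ℂ) :=
    fun {X Y f} h => by
      refine ⟨by rw [h]; rfl, ?_⟩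
      rw [hf.contr_anticomm, h]
      rfl
  have evs : ∀ X, contr X (contr X θ) Fin.elim0 p = 0 := fun X => by rw [hf.contr_contr]; rfl
  -- A transverse vector in the kernel of `θ` at `p`, given by its coefficients.
  have key : ∀ b c₁ c₂ : ℝ, l₀ p * b + l₁ p * c₁ + l₂ p * c₂ = 0 → -B₁ p * c₁ - B₂ p * c₂ = 0 →
      B₁ p * b - A p * c₂ = 0 → B₂ p * b + A p * c₁ = 0 → b = 0 ∧ c₁ = 0 ∧ c₂ = 0 := by
    intro b c₁ c₂ k1 k2 k3 k4
    have hX : ∀ Y, contr Y (contr (b • eta s + c₁ • e1 + c₂ • e2) θ) Fin.elim0 p =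
        b * contr Y (contr (eta s) θ) Fin.elim0 p + c₁ * contr Y (contr e1 θ) Fin.elim0 p +
          c₂ * contr Y (contr e2 θ) Fin.elim0 p := fun Y => by
      rw [hf.add_contr, hf.add_contr, hf.rsmul_contr, hf.rsmul_contr, hf.rsmul_contr]
      rfl
    refine transverse_eq_zero (s := s) (hnd p _ fun Y => ?_)
    rw [cochain_two_eq θ]
    refine contr_eq_zero_at (s := s) (hf.contr _) p ?_ ?_ ?_ ?_ ?_ Y
    · rw [hf.contr_swap hb.contr_eq]; rfl
    · rw [hX, (ev hl₀).2, (ev hl₁).2, (ev hl₂).2]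
      have := congrArg (fun x : ℝ => (x : ℂ)) k1
      push_cast at this
      linear_combination -this
    · rw [hX, evs, (ev hB₁).2, (ev hB₂).2]
      have := congrArg (fun x : ℝ => (x : ℂ)) k2
      push_cast at this
      linear_combination this
    · rw [hX, evs, (ev hB₁).1, (ev hA).2]
      have := congrArg (fun x : ℝ => (x : ℂ)) k3
      push_cast at this
      linear_combination this
    · rw [hX, evs, (ev hB₂).1, (ev hA).1]
      have := congrArg (fun x : ℝ => (x : ℂ)) k4
      push_cast at this
      linear_combination this
  -- A row of the matrix of complementary minors is in the kernel if the Pfaffian vanishes.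
  obtain ⟨zA, zB₂, zB₁⟩ := key (A p) (-B₂ p) (B₁ p) (by linarith) (by ring) (by ring) (by ring)
  rw [neg_eq_zero] at zB₂
  obtain ⟨z1, z0, -⟩ := key (l₁ p) (-l₀ p) 0 (by ring) (by rw [zB₁, zB₂]; ring)
    (by rw [zB₁]; ring) (by rw [zB₂, zA]; ring)
  rw [neg_eq_zero] at z0
  exact one_ne_zero (key 1 0 0 (by rw [z0]; ring) (by ring) (by rw [zB₁]; ring)
    (by rw [zB₂]; ring)).1

theorem IsTransverselyKahler.isTransverselySymplectic {F : Submodule (Fun I5 M5) (VField I5 M5)}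
    {J : VField I5 M5 →ₗ[Fun I5 M5] VField I5 M5} (h : IsTransverselyKahler F J) :
    IsTransverselySymplectic F := by
  obtain ⟨-, θ, h1, h2, h3, -, h4⟩ := h
  refine ⟨θ, h1, h2, h3, fun p X hX => ?_⟩
  by_contra hT
  have := h4 p X hT
  rw [hX] at this
  exact lt_irrefl _ this

end Symplectic

/-! ### The twisted differential on basic forms -/

section TwistedDifferential

variable {r s : ℝ} {k : ℕ}

theorem fsmul_lieD_zero (f : Fun I5 M5) (X : VField I5 M5) (θ : Cochain I5 M5 0) :
    lieD (f • X) θ = f • lieD X θ := by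
  funext v
  rw [Pi.smul_apply, lieD_degree_zero, lieD_degree_zero, smul_act]

theorem add_lieD_zero (X Y : VField I5 M5) (θ : Cochain I5 M5 0) :
    lieD (X + Y) θ = lieD X θ + lieD Y θ := by
  funext v
  rw [Pi.add_apply, lieD_degree_zero, lieD_degree_zero, lieD_degree_zero, add_act]

theorem rsmul_lieD (c : ℝ) (X : VField I5 M5) {θ : Cochain I5 M5 k} (h : IsForm θ) :
    lieD (c • X) θ = (c : ℂ) • lieD X θ := by
  cases k with
  | zero => rw [← contr_extD_zero, ← contr_extD_zero, h.extD.rsmul_contr]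
  | succ k =>
    have h1 := contr_extD X h
    have h2 := contr_extD (c • X) h
    rw [h.extD.rsmul_contr, h.rsmul_contr, extD_smul, h1, smul_sub] at h2
    exact (sub_left_injective h2).symm

theorem transJ_transJ_circ2 (hr : r ≠ 0) : transJ r s (transJ r s circ2) = (-1 : ℝ) • circ2 := by
  rw [transJ_circ2, LinearMap.map_smul_of_tower, transJ_eta, smul_smul, mul_neg, mul_inv_cancel₀ hr]

theorem transJ_transJ_eta (hr : r ≠ 0) : transJ r s (transJ r s (eta s)) = (-1 : ℝ) • eta s := by
  rw [transJ_eta, LinearMap.map_smul_of_tower, transJ_circ2, smul_smul, neg_mul,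
    inv_mul_cancel₀ hr]

theorem rsmul_vlie (c : ℝ) (X Y : VField I5 M5) : ⁅c • X, Y⁆ = c • ⁅X, Y⁆ := by
  ext f p
  simp only [Derivation.commutator_apply, Derivation.smul_apply, Derivation.map_smul]
  change c * X (Y f) p - c * Y (X f) p = c * (X (Y f) p - Y (X f) p)
  ring

theorem lie_rsmul_transJ {X : VField I5 M5} (c : ℝ)
    (h : ∀ Y, ⁅X, transJ r s Y⁆ = transJ r s ⁅X, Y⁆) (Y : VField I5 M5) :
    ⁅c • X, transJ r s Y⁆ = transJ r s ⁅c • X, Y⁆ := by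
  rw [rsmul_vlie, rsmul_vlie, h, LinearMap.map_smul_of_tower]

theorem BasicFor.dcJ {θ : Cochain I5 M5 k} (h : BasicFor (xi s) θ) :
    BasicFor (xi s) (BasicGeom.dc (transJ r s) θ) := h.dc transJ_xi lie_xi_transJ

theorem BasicFor.actJJ {θ : Cochain I5 M5 k} (h : BasicFor (xi s) θ) :
    BasicFor (xi s) (BasicGeom.actJ (transJ r s) θ) := h.actJ transJ_xi lie_xi_transJ

theorem actJ_actJ_one (hr : r ≠ 0) {θ : Cochain I5 M5 1} (h : BasicFor (xi s) θ) :
    actJ (transJ r s) (actJ (transJ r s) θ) = -θ := by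
  refine ext_contr fun X => ?_
  rw [contr_actJ, actJ_degree_zero, zero_add, contr_actJ, actJ_degree_zero, zero_add, contr_neg,
    eq_neg_iff_add_eq_zero, ← h.isForm.add_contr, transJ_transJ hr, h.isForm.fsmul_contr,
    h.contr_eq, smul_zero]

theorem dc_eq (J : VField I5 M5 →ₗ[Fun I5 M5] VField I5 M5) (θ : Cochain I5 M5 k) :
    dc J θ = actJ J (extD θ) - extD (actJ J θ) := rfl

/-- The commutator `[J, dᶜ] + d`, which vanishes on basic forms. -/
def twist (r s : ℝ) (θ : Cochain I5 M5 k) : Cochain I5 M5 (k + 1) :=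
  actJ (transJ r s) (dc (transJ r s) θ) - dc (transJ r s) (actJ (transJ r s) θ) + extD θ

/-- The operator `twist` anticommutes with contractions. -/
theorem contr_twist {X : VField I5 M5} (hX : ∀ Y, ⁅X, transJ r s Y⁆ = transJ r s ⁅X, Y⁆)
    (hJX : ∀ Y, ⁅transJ r s X, transJ r s Y⁆ = transJ r s ⁅transJ r s X, Y⁆)
    (hXX : transJ r s (transJ r s X) = (-1 : ℝ) • X) {θ : Cochain I5 M5 (k + 1)} (h : IsForm θ) :
    contr X (twist r s θ) = -twist r s (contr X θ) := by
  have h1 := h.actJ (transJ r s)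
  rw [twist, twist, contr_add, contr_sub, contr_actJ, contr_dc hX h, contr_dc hJX h, contr_dc hX h1,
    contr_actJ, contr_extD X h, hXX, rsmul_lieD _ _ h, lieD_actJ hJX, actJ_sub, dc_add]
  push_cast
  module

/-- Integrability of the transverse complex structure, in terms of differential operators. -/
theorem twist_eq_zero (hr : r ≠ 0) {θ : Cochain I5 M5 k} (h : BasicFor (xi s) θ) :
    twist r s θ = 0 := by
  have hb : ∀ {k : ℕ} {θ : Cochain I5 M5 k}, BasicFor (xi s) θ → BasicFor (xi s) (twist r s θ) :=
    fun h => (h.dcJ.actJJ.sub h.actJJ.dcJ).add h.extD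
  induction k with
  | zero =>
    refine ext_contr fun X => ?_
    rw [twist, contr_add, contr_sub, contr_actJ, actJ_degree_zero, actJ_degree_zero, dc_zero,
      contr_dc_zero, contr_extD_zero, contr_zero, sub_zero, zero_add, ← add_lieD_zero,
      transJ_transJ hr, fsmul_lieD_zero, h.invariant, smul_zero]
  | succ k ih =>
    have hU : contr circ2 (twist r s θ) = 0 := by
      rw [contr_twist lie_circ2_transJ (by
        rw [transJ_circ2]; exact lie_rsmul_transJ _ lie_eta_transJ) (transJ_transJ_circ2 hr)
        h.isForm, ih (h.contr lie_xi_circ2), neg_zero]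
    have hη : contr (eta s) (twist r s θ) = 0 := by
      rw [contr_twist lie_eta_transJ (by
        rw [transJ_eta]; exact lie_rsmul_transJ _ lie_circ2_transJ) (transJ_transJ_eta hr)
        h.isForm, ih (h.contr lie_xi_eta), neg_zero]
    cases k with
    | zero =>
      refine eq_zero_of_adapted_two s (hb h).isForm (hb h).contr_eq hU hη ?_
      rw [twist, dc_eq _ (actJ (transJ r s) θ), actJ_actJ_one hr h]
      simp only [contr_add, contr_sub, extD_neg, contr_neg]
      rw [contr_actJ_area (h.dcJ (r := r)).isForm, contr_actJ_area (h.actJJ (r := r)).isForm.extD,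
        actJ_degree_zero, actJ_degree_zero]
      abel
    | succ k => exact eq_zero_of_adapted_three s (hb h).isForm (hb h).contr_eq hU hη

theorem actJ_dc (hr : r ≠ 0) {θ : Cochain I5 M5 k} (h : BasicFor (xi s) θ) :
    actJ (transJ r s) (dc (transJ r s) θ) = dc (transJ r s) (actJ (transJ r s) θ) - extD θ := by
  have := twist_eq_zero hr h
  rw [twist] at this
  linear_combination (norm := module) this

theorem dc_dc (hr : r ≠ 0) {θ : Cochain I5 M5 k} (h : BasicFor (xi s) θ) :
    dc (transJ r s) (dc (transJ r s) θ) = 0 := by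
  have e : dc (transJ r s) (dc (transJ r s) θ) = -dc (transJ r s) (dc (transJ r s) θ) := by
    conv_lhs => rw [dc_eq _ (dc (transJ r s) θ), extD_dc _ h.isForm, actJ_dc hr h, actJ_neg, actJ_dc hr h.extD,
      extD_sub, extD_dc _ (h.actJJ (r := r)).isForm, extD_extD h.isForm]
    rw [dc_eq _ θ, dc_sub]
    module
  have e2 : (2 : ℂ) • dc (transJ r s) (dc (transJ r s) θ) = 0 := by
    linear_combination (norm := module) e
  exact (smul_eq_zero.1 e2).resolve_left two_ne_zero

/-- The operators `∂̄` (for `ε = 1`) and `∂` (for `ε = -1`). -/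
def dEps (r s : ℝ) (ε : ℂ) (θ : Cochain I5 M5 k) : Cochain I5 M5 (k + 1) :=
  (1 / 2 : ℂ) • (extD θ + (ε * Complex.I) • dc (transJ r s) θ)

theorem delbar_eq_dEps (θ : Cochain I5 M5 k) : delbar (transJ r s) θ = dEps r s 1 θ := by
  rw [dEps, one_mul]; rfl

theorem del_eq_dEps (θ : Cochain I5 M5 k) : del (transJ r s) θ = dEps r s (-1) θ := by
  rw [dEps, del_eq_dc]; module

theorem BasicFor.dEps {θ : Cochain I5 M5 k} (h : BasicFor (xi s) θ) (ε : ℂ) :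
    BasicFor (xi s) (dEps r s ε θ) := (h.extD.add (h.dcJ.smul _)).smul _

theorem dEps_dEps (hr : r ≠ 0) {θ : Cochain I5 M5 k} (h : BasicFor (xi s) θ) (ε δ : ℂ) :
    dEps r s δ (dEps r s ε θ) =
      (1 / 4 * ((ε - δ) * Complex.I)) • extD (dc (transJ r s) θ) := by
  rw [dEps, dEps, extD_smul, dc_smul, extD_add, dc_add, extD_smul, dc_smul, dc_dc hr h,
    extD_extD h.isForm]
  have := extD_dc (transJ r s) h.isForm
  have e : dc (transJ r s) (extD θ) = -extD (dc (transJ r s) θ) := by rw [this, neg_neg]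
  rw [e]
  module

theorem dEps_zero (ε : ℂ) : dEps r s ε (0 : Cochain I5 M5 k) = 0 := by
  rw [dEps, extD_zero, dc_zero, smul_zero, add_zero, smul_zero]

theorem dEps_neg (ε : ℂ) (θ : Cochain I5 M5 k) : dEps r s ε (-θ) = -dEps r s ε θ := by
  rw [dEps, dEps, extD_neg, dc_neg]; module

/-- A form closed under `∂` and `∂̄` is closed under `d` and `dᶜ`. -/
theorem closed_of_dEps {ε : ℂ} (hε : ε ≠ 0) {θ : Cochain I5 M5 k} (h1 : dEps r s ε θ = 0)
    (h2 : dEps r s (-ε) θ = 0) : extD θ = 0 ∧ dc (transJ r s) θ = 0 := by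
  have e1 : extD θ = 0 := by
    have : extD θ = dEps r s ε θ + dEps r s (-ε) θ := by rw [dEps, dEps]; module
    rw [this, h1, h2, add_zero]
  refine ⟨e1, ?_⟩
  have e2 : (ε * Complex.I) • dc (transJ r s) θ = 0 := by
    have : (ε * Complex.I) • dc (transJ r s) θ = dEps r s ε θ - dEps r s (-ε) θ := by
      rw [dEps, dEps]; module
    rw [this, h1, h2, sub_zero]
  exact (smul_eq_zero.1 e2).resolve_left (mul_ne_zero hε Complex.I_ne_zero)

/-! ### Forms invariant under the torus generated by `∂₂` and `η` -/

/-- Basic forms invariant under `∂₂` and `η`. -/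
structure TorusBasic (s : ℝ) (θ : Cochain I5 M5 k) : Prop where
  basic : BasicFor (xi s) θ
  lie_circ2 : lieD circ2 θ = 0
  lie_eta : lieD (eta s) θ = 0

theorem contr_extD_of_invariant {X : VField I5 M5} {θ : Cochain I5 M5 (k + 1)} (h : IsForm θ)
    (hX : lieD X θ = 0) : contr X (extD θ) = -extD (contr X θ) := by
  rw [contr_extD X h, hX, zero_sub]

theorem contr_dc_of_invariant {X : VField I5 M5} {θ : Cochain I5 M5 (k + 1)} (h : IsForm θ)
    (hJ : ∀ Y, ⁅X, transJ r s Y⁆ = transJ r s ⁅X, Y⁆) (hX : lieD (transJ r s X) θ = 0) :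
    contr X (dc (transJ r s) θ) = -dc (transJ r s) (contr X θ) := by
  rw [contr_dc hJ h, hX, zero_sub]

namespace TorusBasic

theorem contr_circ2_extD {θ : Cochain I5 M5 (k + 1)} (h : TorusBasic s θ) :
    contr circ2 (extD θ) = -extD (contr circ2 θ) :=
  contr_extD_of_invariant h.basic.isForm h.lie_circ2

theorem contr_eta_extD {θ : Cochain I5 M5 (k + 1)} (h : TorusBasic s θ) :
    contr (eta s) (extD θ) = -extD (contr (eta s) θ) :=
  contr_extD_of_invariant h.basic.isForm h.lie_eta

theorem lie_transJ_circ2 {θ : Cochain I5 M5 k} (h : TorusBasic s θ) :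
    lieD (transJ r s circ2) θ = 0 := by
  rw [transJ_circ2, rsmul_lieD _ _ h.basic.isForm, h.lie_eta, smul_zero]

theorem lie_transJ_eta {θ : Cochain I5 M5 k} (h : TorusBasic s θ) :
    lieD (transJ r s (eta s)) θ = 0 := by
  rw [transJ_eta, rsmul_lieD _ _ h.basic.isForm, h.lie_circ2, smul_zero]

theorem contr_circ2_dc {θ : Cochain I5 M5 (k + 1)} (h : TorusBasic s θ) :
    contr circ2 (dc (transJ r s) θ) = -dc (transJ r s) (contr circ2 θ) :=
  contr_dc_of_invariant h.basic.isForm lie_circ2_transJ h.lie_transJ_circ2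

theorem contr_eta_dc {θ : Cochain I5 M5 (k + 1)} (h : TorusBasic s θ) :
    contr (eta s) (dc (transJ r s) θ) = -dc (transJ r s) (contr (eta s) θ) :=
  contr_dc_of_invariant h.basic.isForm lie_eta_transJ h.lie_transJ_eta

theorem extD {θ : Cochain I5 M5 k} (h : TorusBasic s θ) : TorusBasic s (extD θ) :=
  ⟨h.basic.extD, by rw [lieD_extD _ h.basic.isForm, h.lie_circ2, extD_zero],
    by rw [lieD_extD _ h.basic.isForm, h.lie_eta, extD_zero]⟩

theorem actJ {θ : Cochain I5 M5 k} (h : TorusBasic s θ) : TorusBasic s (actJ (transJ r s) θ) :=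
  ⟨h.basic.actJJ, by rw [lieD_actJ lie_circ2_transJ, h.lie_circ2, actJ_zero],
    by rw [lieD_actJ lie_eta_transJ, h.lie_eta, actJ_zero]⟩

theorem sub {θ τ : Cochain I5 M5 k} (h : TorusBasic s θ) (h' : TorusBasic s τ) :
    TorusBasic s (θ - τ) :=
  ⟨h.basic.sub h'.basic, by rw [lieD_sub, h.lie_circ2, h'.lie_circ2, sub_zero],
    by rw [lieD_sub, h.lie_eta, h'.lie_eta, sub_zero]⟩

theorem add {θ τ : Cochain I5 M5 k} (h : TorusBasic s θ) (h' : TorusBasic s τ) :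
    TorusBasic s (θ + τ) :=
  ⟨h.basic.add h'.basic, by rw [lieD_add, h.lie_circ2, h'.lie_circ2, add_zero],
    by rw [lieD_add, h.lie_eta, h'.lie_eta, add_zero]⟩

theorem smul {θ : Cochain I5 M5 k} (h : TorusBasic s θ) (c : ℂ) : TorusBasic s (c • θ) :=
  ⟨h.basic.smul c, by rw [lieD_smul, h.lie_circ2, smul_zero],
    by rw [lieD_smul, h.lie_eta, smul_zero]⟩

theorem zero : TorusBasic s (0 : Cochain I5 M5 k) := ⟨BasicFor.zero, lieD_zero _, lieD_zero _⟩

theorem dc {θ : Cochain I5 M5 k} (h : TorusBasic s θ) : TorusBasic s (dc (transJ r s) θ) :=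
  h.extD.actJ.sub h.actJ.extD

theorem dEps {θ : Cochain I5 M5 k} (h : TorusBasic s θ) (ε : ℂ) : TorusBasic s (dEps r s ε θ) :=
  (h.extD.add (h.dc.smul _)).smul _

theorem contr_circ2 {θ : Cochain I5 M5 (k + 1)} (h : TorusBasic s θ) :
    TorusBasic s (contr circ2 θ) := by
  have hη : ⁅eta s, circ2⁆ = 0 := by rw [vlie_anti, lie_circ2_eta, neg_zero]
  refine ⟨h.basic.contr lie_xi_circ2, ?_, ?_⟩
  · have := contr_lieD circ2 circ2 θ
    rw [h.lie_circ2, lie_self, h.basic.isForm.zero_contr, sub_zero] at this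
    exact this.symm
  · have := contr_lieD (eta s) circ2 θ
    rw [h.lie_eta, hη, h.basic.isForm.zero_contr, sub_zero] at this
    exact this.symm

theorem contr_eta {θ : Cochain I5 M5 (k + 1)} (h : TorusBasic s θ) :
    TorusBasic s (contr (eta s) θ) := by
  refine ⟨h.basic.contr lie_xi_eta, ?_, ?_⟩
  · have := contr_lieD circ2 (eta s) θ
    rw [h.lie_circ2, lie_circ2_eta, h.basic.isForm.zero_contr, sub_zero] at this
    exact this.symm
  · have := contr_lieD (eta s) (eta s) θ
    rw [h.lie_eta, lie_self, h.basic.isForm.zero_contr, sub_zero] at this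
    exact this.symm

theorem wedge_dt2 {θ : Cochain I5 M5 k} (h : TorusBasic s θ) : TorusBasic s (wedge dt2 θ) :=
  ⟨h.basic.wedge dt2_xi xi_dt2, by rw [lieD_wedge circ2_dt2, h.lie_circ2, wedge_zero],
    by rw [lieD_wedge eta_dt2, h.lie_eta, wedge_zero]⟩

theorem wedge_etaDual {θ : Cochain I5 M5 k} (h : TorusBasic s θ) :
    TorusBasic s (wedge (etaDual s) θ) :=
  ⟨h.basic.wedge etaDual_xi (xi_etaDual s),
    by rw [lieD_wedge (circ2_etaDual s), h.lie_circ2, wedge_zero],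
    by rw [lieD_wedge (eta_etaDual s), h.lie_eta, wedge_zero]⟩

theorem contr_circ2_ddc {θ : Cochain I5 M5 (k + 1)} (h : TorusBasic s θ) :
    contr circ2 (BasicGeom.extD (BasicGeom.dc (transJ r s) θ)) =
      BasicGeom.extD (BasicGeom.dc (transJ r s) (contr circ2 θ)) := by
  rw [(h.dc (r := r)).contr_circ2_extD, h.contr_circ2_dc, extD_neg, neg_neg]

theorem contr_eta_ddc {θ : Cochain I5 M5 (k + 1)} (h : TorusBasic s θ) :
    contr (eta s) (BasicGeom.extD (BasicGeom.dc (transJ r s) θ)) =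
      BasicGeom.extD (BasicGeom.dc (transJ r s) (contr (eta s) θ)) := by
  rw [(h.dc (r := r)).contr_eta_extD, h.contr_eta_dc, extD_neg, neg_neg]

theorem contr_circ2_ddc_zero {θ : Cochain I5 M5 0} (h : TorusBasic s θ) :
    contr circ2 (BasicGeom.extD (BasicGeom.dc (transJ r s) θ)) = 0 := by
  rw [(h.dc (r := r)).contr_circ2_extD, contr_dc_zero, h.lie_transJ_circ2, extD_zero, neg_zero]

theorem contr_eta_ddc_zero {θ : Cochain I5 M5 0} (h : TorusBasic s θ) :
    contr (eta s) (BasicGeom.extD (BasicGeom.dc (transJ r s) θ)) = 0 := by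
  rw [(h.dc (r := r)).contr_eta_extD, contr_dc_zero, h.lie_transJ_eta, extD_zero, neg_zero]

theorem contr_circ2_dEps {θ : Cochain I5 M5 (k + 1)} (h : TorusBasic s θ) (ε : ℂ) :
    contr circ2 (BasicGeom.dEps r s ε θ) = -BasicGeom.dEps r s ε (contr circ2 θ) := by
  rw [BasicGeom.dEps, BasicGeom.dEps, contr_smul, contr_add, contr_smul, h.contr_circ2_extD,
    h.contr_circ2_dc]
  module

theorem contr_eta_dEps {θ : Cochain I5 M5 (k + 1)} (h : TorusBasic s θ) (ε : ℂ) :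
    contr (eta s) (BasicGeom.dEps r s ε θ) = -BasicGeom.dEps r s ε (contr (eta s) θ) := by
  rw [BasicGeom.dEps, BasicGeom.dEps, contr_smul, contr_add, contr_smul, h.contr_eta_extD,
    h.contr_eta_dc]
  module

end TorusBasic

end TwistedDifferential

/-! ### The basic `∂∂̄`-lemma for the Hopf foliation -/

section DDbar

variable {r : ℝ} {k : ℕ}

theorem eta_zero : eta 0 = circ1 := by simp [eta]
theorem xi_zero : xi 0 = e3 := by simp [xi]

theorem eq_form₀_add (f : Cochain I5 M5 0) :
    f = form₀ (reF (f Fin.elim0)) + Complex.I • form₀ (imF (f Fin.elim0)) := by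
  funext v
  rw [Subsingleton.elim v Fin.elim0]
  ext p
  change f Fin.elim0 p = ((f Fin.elim0 p).re : ℂ) + Complex.I * ((f Fin.elim0 p).im : ℂ)
  rw [mul_comm, Complex.re_add_im]

theorem form₀_add_I_injective {a b c d : Fun I5 M5}
    (h : form₀ a + Complex.I • form₀ b = form₀ c + Complex.I • form₀ d) : a = c ∧ b = d := by
  have hp : ∀ p, (a p : ℂ) + Complex.I * (b p : ℂ) = (c p : ℂ) + Complex.I * (d p : ℂ) := fun p =>
    congrArg (fun f : CFun I5 M5 => f p) (congrFun h Fin.elim0)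
  constructor <;> ext p
  · simpa using congrArg Complex.re (hp p)
  · simpa using congrArg Complex.im (hp p)

theorem lieD_form₀_add (X : VField I5 M5) (a b : Fun I5 M5) :
    lieD X (form₀ a + Complex.I • form₀ b) = form₀ (X a) + Complex.I • form₀ (X b) := by
  rw [lieD_add, lieD_smul, lieD_form₀, lieD_form₀]

theorem form₀_add_I_eq_zero {a b : Fun I5 M5} (h : form₀ a + Complex.I • form₀ b = 0) :
    a = 0 ∧ b = 0 :=
  form₀_add_I_injective (h.trans (by rw [form₀_zero, smul_zero, add_zero]))

/-- On functions of the leaf space, `d dᶜ` is the Laplacian of the base of the Hopf fibration. -/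
theorem ddc_area {f : Cochain I5 M5 0} (h : BasicFor (xi 0) f) :
    contr e2 (contr e1 (extD (dc (transJ r 0) f))) =
      -(lieD e1 (lieD e1 f) + lieD e2 (lieD e2 f)) := by
  have hb := h.dcJ (r := r)
  rw [contr_contr_extD hb.isForm, contr_dc_zero _ e2, contr_dc_zero _ e1, transJ_e1, transJ_e2,
    rsmul_lieD _ _ h.isForm, lie_e1_e2, hb.isForm.rsmul_contr, contr_e3 hb.isForm hb.contr_eq,
    lieD_smul]
  push_cast
  module

theorem ddc_torus (hr : r ≠ 0) {f : Cochain I5 M5 0} (h : BasicFor (xi 0) f) :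
    contr (eta 0) (contr circ2 (extD (dc (transJ r 0) f))) = (-((r⁻¹ : ℝ) : ℂ)) •
      (lieD circ2 (lieD circ2 f) + ((r ^ 2 : ℝ) : ℂ) • lieD circ1 (lieD circ1 f)) := by
  have hb := h.dcJ (r := r)
  have hr' : (r : ℂ) ≠ 0 := by exact_mod_cast hr
  rw [contr_contr_extD hb.isForm, contr_dc_zero _ (eta 0), contr_dc_zero _ circ2, transJ_eta,
    transJ_circ2, rsmul_lieD _ _ h.isForm, rsmul_lieD _ _ h.isForm, lie_circ2_eta, hb.isForm.zero_contr,
    lieD_smul, lieD_smul, eta_zero]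
  push_cast
  match_scalars
  · ring
  · field_simp

/-- A basic function annihilated by `d dᶜ` is constant. -/
theorem extD_eq_zero_of_ddc (hr : r ≠ 0) {f : Cochain I5 M5 0} (h : BasicFor (xi 0) f)
    (h0 : extD (dc (transJ r 0) f) = 0) : extD f = 0 := by
  have hlap : lieD circ2 (lieD circ2 f) + ((r ^ 2 : ℝ) : ℂ) • lieD circ1 (lieD circ1 f) = 0 := by
    have := ddc_torus hr h
    rw [h0, contr_zero, contr_zero] at this
    exact (smul_eq_zero.1 this.symm).resolve_left
      (neg_ne_zero.2 (Complex.ofReal_ne_zero.2 (inv_ne_zero hr)))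
  have hG : frameOp torusMean f = f := by
    have hG := laplacian_frameOp_green hr h.isForm
    rw [circ1_eq, circ2_eq] at hG hlap
    rw [lieD_frameOp (commutes_green hr) _ h.isForm, lieD_frameOp (commutes_green hr) _ h.isForm,
      lieD_frameOp (commutes_green hr) _ (h.isForm.lieD _),
      lieD_frameOp (commutes_green hr) _ (h.isForm.lieD _), ← frameOp_smul, ← frameOp_add, hlap,
      frameOp_zero] at hG
    exact (sub_eq_zero.1 hG.symm).symm
  have hU : lieD circ2 f = 0 := by
    rw [← hG]; exact lieD_frameOp_eq_zero lie_circ2_frame circ2_torusMean h.isForm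
  have hη : lieD (eta 0) f = 0 := by
    rw [← hG, eta_zero]; exact lieD_frameOp_eq_zero lie_circ1_frame circ1_torusMean h.isForm
  have hh : lieD e1 (lieD e1 f) + lieD e2 (lieD e2 f) = 0 := by
    have := ddc_area (r := r) h
    rw [h0, contr_zero, contr_zero] at this
    exact neg_eq_zero.1 this.symm
  have h12 : lieD e1 f = 0 ∧ lieD e2 f = 0 := by
    rw [eq_form₀_add f] at hh ⊢
    simp only [lieD_form₀_add] at hh ⊢
    have hh' : form₀ (e1 (e1 (reF (f Fin.elim0))) + e2 (e2 (reF (f Fin.elim0)))) +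
        Complex.I • form₀ (e1 (e1 (imF (f Fin.elim0))) + e2 (e2 (imF (f Fin.elim0)))) = 0 := by
      rw [← hh, form₀_add, form₀_add]
      module
    obtain ⟨k1, k2⟩ := form₀_add_I_eq_zero hh'
    rw [(harmonic_eq_zero k1).1, (harmonic_eq_zero k1).2, (harmonic_eq_zero k2).1,
      (harmonic_eq_zero k2).2, form₀_zero]
    simp
  refine eq_zero_of_adapted 0 h.isForm.extD ?_ ?_ ?_ ?_ ?_ <;> rw [contr_extD_zero]
  exacts [h.invariant, hU, hη, h12.1, h12.2]

/-- The Poisson equation for basic functions invariant under the torus. -/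
theorem exists_poisson_form {g : Cochain I5 M5 0} (h : TorusBasic 0 g) (hm : cmean₀ g = 0) :
    ∃ u : Cochain I5 M5 0, TorusBasic 0 u ∧ lieD e1 (lieD e1 u) + lieD e2 (lieD e2 u) = g := by
  have hc := eq_form₀_add g
  set a := reF (g Fin.elim0)
  set b := imF (g Fin.elim0)
  have z : ∀ X : VField I5 M5, lieD X g = 0 → X a = 0 ∧ X b = 0 := fun X hX => by
    rw [hc, lieD_form₀_add] at hX
    exact form₀_add_I_eq_zero hX
  have z1 := z circ1 (by rw [← eta_zero]; exact h.lie_eta)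
  have z2 := z circ2 h.lie_circ2
  have z3 := z e3 (by rw [← xi_zero]; exact h.basic.invariant)
  have ma : mean a = 0 := congrArg Complex.re hm
  have mb : mean b = 0 := congrArg Complex.im hm
  obtain ⟨u, hu, hPu⟩ := exists_poisson ⟨z1.1, z2.1, z3.1⟩
  obtain ⟨v, hv, hPv⟩ := exists_poisson ⟨z1.2, z2.2, z3.2⟩
  rw [ma, map_zero, sub_zero] at hPu
  rw [mb, map_zero, sub_zero] at hPv
  refine ⟨form₀ u + Complex.I • form₀ v, ⟨⟨isForm_degree_zero _, trivial, ?_⟩, ?_, ?_⟩, ?_⟩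
  · rw [lieD_form₀_add, xi_zero, hu.e3, hv.e3, form₀_zero]; simp
  · rw [lieD_form₀_add, hu.circ2, hv.circ2, form₀_zero]; simp
  · rw [lieD_form₀_add, eta_zero, hu.circ1, hv.circ1, form₀_zero]; simp
  · simp only [lieD_form₀_add]
    rw [hc, ← hPu, ← hPv, form₀_add, form₀_add]
    module

/-- The mean of the component along `e₁`, `e₂` of forms in the image of `∂` or `∂̄`. -/
theorem cmean₀_dEps_area {β : Cochain I5 M5 1} (h : BasicFor (xi 0) β) (ε : ℂ) :
    cmean₀ (contr e2 (contr e1 (dEps r 0 ε β))) = 0 := by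
  have hJ := h.actJJ (r := r)
  have e : ∀ {τ : Cochain I5 M5 1}, BasicFor (xi 0) τ →
      cmean₀ (contr e2 (contr e1 (extD τ))) = 0 := fun hτ => by
    rw [cmean₀_extD_area hτ.isForm hτ.contr_eq]; simp
  rw [dEps, dc_eq]
  simp only [contr_smul, contr_add, contr_sub, cmean₀_smul]
  rw [cmean₀_add, cmean₀_smul, cmean₀_sub, e h, e hJ, contr_actJ_area h.isForm.extD,
    actJ_degree_zero, cmean₀]
  simp

/-- Forms in the image of one of the operators `∂`, `∂̄` and in the kernel of the other one, with a
primitive invariant under the torus. -/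
def TorusExact (r : ℝ) (ε : ℂ) (α : Cochain I5 M5 (k + 1)) : Prop :=
  (∃ β, TorusBasic 0 β ∧ α = dEps r 0 ε β) ∧ dEps r 0 (-ε) α = 0

namespace TorusExact

variable {ε : ℂ}

theorem torusBasic {α : Cochain I5 M5 (k + 1)} (h : TorusExact r ε α) : TorusBasic 0 α := by
  obtain ⟨⟨β, hβ, rfl⟩, -⟩ := h
  exact hβ.dEps ε

theorem contr_circ2 {α : Cochain I5 M5 (k + 2)} (h : TorusExact r ε α) :
    TorusExact r ε (contr circ2 α) := by
  refine ⟨?_, ?_⟩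
  · obtain ⟨⟨β, hβ, rfl⟩, -⟩ := h
    refine ⟨-BasicGeom.contr circ2 β, ?_, by rw [hβ.contr_circ2_dEps, dEps_neg]⟩
    rw [← neg_one_smul ℂ]
    exact hβ.contr_circ2.smul _
  · have := h.torusBasic.contr_circ2_dEps (r := r) (-ε)
    rw [h.2, contr_zero] at this
    exact neg_eq_zero.1 this.symm

theorem contr_eta {α : Cochain I5 M5 (k + 2)} (h : TorusExact r ε α) :
    TorusExact r ε (contr (eta 0) α) := by
  refine ⟨?_, ?_⟩
  · obtain ⟨⟨β, hβ, rfl⟩, -⟩ := h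
    refine ⟨-BasicGeom.contr (eta 0) β, ?_, by rw [hβ.contr_eta_dEps, dEps_neg]⟩
    rw [← neg_one_smul ℂ]
    exact hβ.contr_eta.smul _
  · have := h.torusBasic.contr_eta_dEps (r := r) (-ε)
    rw [h.2, contr_zero] at this
    exact neg_eq_zero.1 this.symm

end TorusExact

variable {ε : ℂ}

theorem ddc_eq_zero_of_dEps (hr : r ≠ 0) (hε : ε ≠ 0) {β : Cochain I5 M5 k}
    (hβ : BasicFor (xi 0) β) (h : dEps r 0 (-ε) (dEps r 0 ε β) = 0) :
    extD (dc (transJ r 0) β) = 0 := by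
  rw [dEps_dEps hr hβ] at h
  refine (smul_eq_zero.1 h).resolve_left ?_
  rw [sub_neg_eq_add, ← two_mul]
  exact mul_ne_zero (by norm_num) (mul_ne_zero (mul_ne_zero two_ne_zero hε) Complex.I_ne_zero)

theorem dEps_eq_zero_of_degree_zero (hr : r ≠ 0) (hε : ε ≠ 0) {β : Cochain I5 M5 0}
    (hβ : BasicFor (xi 0) β) (h : dEps r 0 (-ε) (dEps r 0 ε β) = 0) : dEps r 0 ε β = 0 := by
  have := extD_eq_zero_of_ddc hr hβ (ddc_eq_zero_of_dEps hr hε hβ h)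
  rw [dEps, dc_degree_zero, this, actJ_zero, smul_zero, add_zero, smul_zero]

theorem torusExact_one (hr : r ≠ 0) (hε : ε ≠ 0) {α : Cochain I5 M5 1} (h : TorusExact r ε α) :
    α = 0 := by
  obtain ⟨⟨β, hβ, rfl⟩, h⟩ := h
  exact dEps_eq_zero_of_degree_zero hr hε hβ.basic h

/-- For forms invariant under the torus, the contractions with `∂₂` and `η` anticommute with `d` and
`dᶜ`. In degree two only the component along `e₁`, `e₂` remains, and a potential is given by the
Poisson equation. -/
theorem torusExact_two (hr : r ≠ 0) (hε : ε ≠ 0) {α : Cochain I5 M5 2} (h : TorusExact r ε α) :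
    ∃ γ, TorusBasic 0 γ ∧ α = extD (dc (transJ r 0) γ) := by
  have hα := h.torusBasic
  have hU := torusExact_one hr hε h.contr_circ2
  have hη := torusExact_one hr hε h.contr_eta
  have hg : TorusBasic 0 (contr e2 (contr e1 α)) := by
    refine ⟨⟨isForm_degree_zero _, trivial, ?_⟩, ?_, ?_⟩
    · rw [← contr_lieD_area lie_xi_e1 lie_xi_e2 hα.basic.isForm, hα.basic.invariant]; rfl
    · rw [← contr_lieD_area (c := 0) (by rw [lie_circ2_e1, zero_smul])
        (by rw [lie_circ2_e2, neg_zero, zero_smul]) hα.basic.isForm, hα.lie_circ2]; rfl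
    · rw [← contr_lieD_area lie_eta_e1 (by rw [lie_eta_e2, neg_neg]) hα.basic.isForm,
        hα.lie_eta]; rfl
  have hm : cmean₀ (contr e2 (contr e1 α)) = 0 := by
    obtain ⟨⟨β, hβ, rfl⟩, -⟩ := h
    exact cmean₀_dEps_area hβ.basic ε
  obtain ⟨u, hu, hP⟩ := exists_poisson_form hg hm
  refine ⟨(-1 : ℂ) • u, hu.smul _, ?_⟩
  have hd : TorusBasic 0 (α - extD (dc (transJ r 0) ((-1 : ℂ) • u))) :=
    hα.sub ((hu.smul (-1)).dc (r := r)).extD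
  refine sub_eq_zero.1 (eq_zero_of_adapted_two 0 (k := 0) hd.basic.isForm hd.basic.contr_eq ?_ ?_ ?_)
  · rw [contr_sub, hU, (hu.smul (-1)).contr_circ2_ddc_zero, sub_zero]
  · rw [contr_sub, hη, (hu.smul (-1)).contr_eta_ddc_zero, sub_zero]
  · rw [contr_sub, contr_sub, ddc_area (hu.smul (-1)).basic, lieD_smul, lieD_smul, lieD_smul,
      lieD_smul, ← hP]
    module

theorem TorusBasic.ext_three {α β : Cochain I5 M5 3} (hα : TorusBasic 0 α) (hβ : TorusBasic 0 β)
    (h1 : BasicGeom.contr circ2 α = BasicGeom.contr circ2 β)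
    (h2 : BasicGeom.contr (eta 0) α = BasicGeom.contr (eta 0) β) : α = β := by
  have hd := (hα.sub hβ).basic
  exact sub_eq_zero.1 (eq_zero_of_adapted_three 0 (k := 0) hd.isForm hd.contr_eq
    (by rw [contr_sub, h1, sub_self]) (by rw [contr_sub, h2, sub_self]))

theorem TorusBasic.ext_four {α β : Cochain I5 M5 4} (hα : TorusBasic 0 α) (hβ : TorusBasic 0 β)
    (h : BasicGeom.contr (eta 0) (BasicGeom.contr circ2 α) =
      BasicGeom.contr (eta 0) (BasicGeom.contr circ2 β)) : α = β := by
  have hd := (hα.sub hβ).basic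
  refine sub_eq_zero.1 (eq_zero_of_top 0 (k := 0) hd.isForm hd.contr_eq ?_)
  rw [contr_sub, contr_sub, h, sub_self]
  rfl

/-- The components along the torus of a form of degree three are of degree two. -/
theorem torusExact_three (hr : r ≠ 0) (hε : ε ≠ 0) {α : Cochain I5 M5 3} (h : TorusExact r ε α) :
    ∃ γ, TorusBasic 0 γ ∧ α = extD (dc (transJ r 0) γ) := by
  obtain ⟨u, hu, hu'⟩ := torusExact_two hr hε h.contr_circ2
  obtain ⟨v, hv, hv'⟩ := torusExact_two hr hε h.contr_eta
  have hγ : TorusBasic 0 (wedge dt2 u + wedge (etaDual 0) v) := hu.wedge_dt2.add hv.wedge_etaDual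
  refine ⟨_, hγ, h.torusBasic.ext_three (hγ.dc (r := r)).extD ?_ ?_⟩
  · rw [hγ.contr_circ2_ddc, contr_add, contr_wedge_zero, contr_wedge_zero, dt2_circ2,
      etaDual_circ2, one_smul, zero_smul, add_zero, hu']
  · rw [hγ.contr_eta_ddc, contr_add, contr_wedge_zero, contr_wedge_zero, dt2_eta,
      etaDual_eta, one_smul, zero_smul, zero_add v, hv']

theorem torusExact_four (hr : r ≠ 0) (hε : ε ≠ 0) {α : Cochain I5 M5 4} (h : TorusExact r ε α) :
    ∃ γ, TorusBasic 0 γ ∧ α = extD (dc (transJ r 0) γ) := by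
  obtain ⟨u, hu, hu'⟩ := torusExact_two hr hε h.contr_circ2.contr_eta
  have hγ := hu.wedge_etaDual.wedge_dt2
  refine ⟨_, hγ, h.torusBasic.ext_four (hγ.dc (r := r)).extD ?_⟩
  rw [hγ.contr_circ2_ddc, hγ.contr_circ2.contr_eta_ddc, contr_wedge,
    contr_wedge_zero, dt2_circ2, etaDual_circ2, one_smul, zero_smul, wedge_zero, sub_zero,
    contr_wedge_zero, etaDual_eta, one_smul, hu']

theorem torusExact_ddc (hr : r ≠ 0) (hε : ε ≠ 0) {α : Cochain I5 M5 (k + 2)}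
    (h : TorusExact r ε α) : ∃ γ, TorusBasic 0 γ ∧ α = extD (dc (transJ r 0) γ) := by
  match k, α, h with
  | 0, _, h => exact torusExact_two hr hε h
  | 1, _, h => exact torusExact_three hr hε h
  | 2, _, h => exact torusExact_four hr hε h
  | k + 3, α, h =>
    refine ⟨0, TorusBasic.zero, ?_⟩
    rw [dc_zero, extD_zero]
    exact eq_zero_of_degree 0 h.torusBasic.basic.isForm h.torusBasic.basic.contr_eq

/-- Closed and `dᶜ`-closed forms differ from their torus average by a form in the image of
`d dᶜ`. -/
theorem sub_torusMean_eq_ddc (hr : r ≠ 0) {α : Cochain I5 M5 (k + 2)} (h : BasicFor (xi 0) α)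
    (h1 : extD α = 0) (h2 : dc (transJ r 0) α = 0) :
    ∃ γ, BasicFor (xi 0) γ ∧ α - frameOp torusMean α = extD (dc (transJ r 0) γ) := by
  -- With `β` the Green operator applied to `α`, the form `r ι_U ι_η β` is a potential, `U = ∂₂`.
  have hG : BasicFor (xi 0) (frameOp (green hr) α) := by
    rw [xi_eq] at h ⊢
    exact h.frameOp (commutes_green hr)
  have g1 : extD (frameOp (green hr) α) = 0 := by
    rw [extD_frameOp (commutes_green hr) h.isForm, h1, frameOp_zero]
  have g2 : dc (transJ r 0) (frameOp (green hr) α) = 0 := by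
    rw [dc_frameOp (commutes_green hr) (transJ_fld r 0) h.isForm, h2, frameOp_zero]
  have hlap := laplacian_frameOp_green hr h.isForm
  set β := frameOp (green hr) α
  have hη := hG.contr lie_xi_eta
  have hf := hG.isForm
  refine ⟨(r : ℂ) • contr circ2 (contr (eta 0) β), (hη.contr lie_xi_circ2).smul _, ?_⟩
  -- `L_X β = d ι_X β` as `dβ = 0`.
  have l1 : ∀ X, extD (contr X β) = lieD X β := fun X => by
    have := contr_extD X hf
    rw [g1, contr_zero] at this
    exact (sub_eq_zero.1 this.symm).symm
  have l2 : dc (transJ r 0) (contr (eta 0) β) = ((-r⁻¹ : ℝ) : ℂ) • lieD circ2 β := by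
    have := contr_dc lie_eta_transJ hf (J := transJ r 0)
    rw [g2, contr_zero, transJ_eta, rsmul_lieD _ _ hf] at this
    exact (sub_eq_zero.1 this.symm).symm
  have l3 : dc (transJ r 0) (contr circ2 (contr (eta 0) β)) =
      (r : ℂ) • lieD (eta 0) (contr (eta 0) β) +
        ((r⁻¹ : ℝ) : ℂ) • contr circ2 (lieD circ2 β) := by
    have := contr_dc lie_circ2_transJ hη.isForm (J := transJ r 0)
    rw [l2, transJ_circ2, rsmul_lieD _ _ hη.isForm, contr_smul] at this
    push_cast at this ⊢
    linear_combination (norm := module) this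
  have l4 : extD (contr circ2 (lieD circ2 β)) = lieD circ2 (lieD circ2 β) := by
    have := contr_extD circ2 (hf.lieD circ2)
    rw [← lieD_extD _ hf, g1, lieD_zero, contr_zero] at this
    exact (sub_eq_zero.1 this.symm).symm
  have hr' : (r : ℂ) ≠ 0 := by exact_mod_cast hr
  rw [dc_smul, extD_smul, l3, extD_add, extD_smul, extD_smul, ← lieD_extD _ hη.isForm, l1, l4,
    ← hlap, eta_zero]
  push_cast
  match_scalars
  · field_simp
  · ring

/-- The core of the `∂∂̄`-lemma, in positive degree. -/
theorem exists_ddc (hr : r ≠ 0) (hε : ε ≠ 0) {β : Cochain I5 M5 (k + 1)} (hβ : BasicFor (xi 0) β)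
    (h : dEps r 0 (-ε) (dEps r 0 ε β) = 0) :
    ∃ γ, BasicFor (xi 0) γ ∧ dEps r 0 ε β = extD (dc (transJ r 0) γ) := by
  have hT := commutes_torusMean
  have hα := hβ.dEps (r := r) ε
  have hz : dEps r 0 ε (dEps r 0 ε β) = 0 := by
    rw [dEps_dEps hr hβ, sub_self, zero_mul, mul_zero, zero_smul]
  obtain ⟨c1, c2⟩ := closed_of_dEps hε hz h
  obtain ⟨γ, hγ, e⟩ := sub_torusMean_eq_ddc hr hα c1 c2
  have hop : ∀ {j : ℕ} (δ : ℂ) {θ : Cochain I5 M5 j}, IsForm θ →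
      dEps r 0 δ (frameOp torusMean θ) = frameOp torusMean (dEps r 0 δ θ) := fun δ θ hθ => by
    rw [dEps, dEps, extD_frameOp hT hθ, dc_frameOp hT (transJ_fld r 0) hθ, frameOp_smul,
      frameOp_add, frameOp_smul]
  have hE : TorusExact r ε (frameOp torusMean (dEps r 0 ε β)) := by
    refine ⟨⟨frameOp torusMean β, ⟨?_, ?_, ?_⟩, (hop ε hβ.isForm).symm⟩, ?_⟩
    · rw [xi_eq] at hβ ⊢
      exact hβ.frameOp hT
    · exact lieD_frameOp_eq_zero lie_circ2_frame circ2_torusMean hβ.isForm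
    · rw [eta_zero]; exact lieD_frameOp_eq_zero lie_circ1_frame circ1_torusMean hβ.isForm
    · rw [hop _ hα.isForm, h, frameOp_zero]
  obtain ⟨γ', hγ', e'⟩ := torusExact_ddc hr hε hE
  refine ⟨γ + γ', hγ.add hγ'.basic, ?_⟩
  rw [dc_add, extD_add, ← e, ← e', sub_add_cancel]

/-- The graded form of the core of the `∂∂̄`-lemma. -/
theorem exists_graded (hr : r ≠ 0) (hε : ε ≠ 0) {β : Graded I5 M5}
    (hβ : ∀ k, BasicFor (xi 0) (β k)) (h : ∀ k, dEps r 0 (-ε) (dEps r 0 ε (β k)) = 0) :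
    dEps r 0 ε (β 0) = 0 ∧ ∃ γ : Graded I5 M5, (∀ k, BasicFor (xi 0) (γ k)) ∧
      ∀ k, dEps r 0 ε (β (k + 1)) = extD (dc (transJ r 0) (γ k)) := by
  refine ⟨dEps_eq_zero_of_degree_zero hr hε (hβ 0) (h 0), ?_⟩
  choose γ h1 h2 using fun k => exists_ddc hr hε (hβ (k + 1)) (h (k + 1))
  exact ⟨γ, h1, h2⟩

theorem mem_basicForms {θ : Graded I5 M5} :
    θ ∈ basicForms (fol 0) ↔ ∀ k, BasicFor (xi 0) (θ k) :=
  forall_congr' fun _ => isBasic_span_iff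

theorem delG_succ (θ : Graded I5 M5) (k : ℕ) :
    delG (transJ r 0) θ (k + 1) = dEps r 0 (-1) (θ k) := del_eq_dEps _

theorem delbarG_succ (θ : Graded I5 M5) (k : ℕ) :
    delbarG (transJ r 0) θ (k + 1) = dEps r 0 1 (θ k) := delbar_eq_dEps _

theorem satisfiesDDbarLemma_zero (hr : r ≠ 0) : SatisfiesDDbarLemma (fol 0) (transJ r 0) := by
  have hJ0 : ∀ ε : ℂ, dEps r 0 ε (0 : Cochain I5 M5 0) = 0 := dEps_zero
  have bdel : ∀ {θ : Graded I5 M5}, θ ∈ basicForms (fol 0) →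
      delG (transJ r 0) θ ∈ basicForms (fol 0) := fun {θ} h => by
    rw [mem_basicForms] at h ⊢
    intro k
    match k with
    | 0 => exact BasicFor.zero
    | k + 1 => rw [delG_succ]; exact (h k).dEps _
  have bdelbar : ∀ {θ : Graded I5 M5}, θ ∈ basicForms (fol 0) →
      delbarG (transJ r 0) θ ∈ basicForms (fol 0) := fun {θ} h => by
    rw [mem_basicForms] at h ⊢
    intro k
    match k with
    | 0 => exact BasicFor.zero
    | k + 1 => rw [delbarG_succ]; exact (h k).dEps _
  -- `∂² = 0`, `∂̄² = 0`, `∂∂̄ = -∂̄∂`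
  have sq1 : ∀ {θ : Graded I5 M5}, θ ∈ basicForms (fol 0) →
      delG (transJ r 0) (delG (transJ r 0) θ) = 0 := fun {θ} h => by
    rw [mem_basicForms] at h
    funext k
    match k with
    | 0 => rfl
    | 1 => rw [delG_succ]; exact hJ0 _
    | k + 2 =>
      rw [delG_succ, delG_succ, dEps_dEps hr (h k), sub_self, zero_mul, mul_zero, zero_smul]; rfl
  have sq2 : ∀ {θ : Graded I5 M5}, θ ∈ basicForms (fol 0) →
      delbarG (transJ r 0) (delbarG (transJ r 0) θ) = 0 := fun {θ} h => by
    rw [mem_basicForms] at h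
    funext k
    match k with
    | 0 => rfl
    | 1 => rw [delbarG_succ]; exact hJ0 _
    | k + 2 =>
      rw [delbarG_succ, delbarG_succ, dEps_dEps hr (h k), sub_self, zero_mul, mul_zero,
        zero_smul]; rfl
  have anti : ∀ {θ : Graded I5 M5}, θ ∈ basicForms (fol 0) →
      delbarG (transJ r 0) (delG (transJ r 0) θ) = -delG (transJ r 0) (delbarG (transJ r 0) θ) :=
    fun {θ} h => by
    rw [mem_basicForms] at h
    funext k
    rw [Pi.neg_apply]
    match k with
    | 0 => exact neg_zero.symm
    | 1 =>
      rw [delbarG_succ, delG_succ]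
      change dEps r 0 1 (0 : Cochain I5 M5 0) = -dEps r 0 (-1) (0 : Cochain I5 M5 0)
      rw [hJ0, hJ0, neg_zero]
    | k + 2 =>
      rw [delbarG_succ, delG_succ, delG_succ, delbarG_succ, dEps_dEps hr (h k),
        dEps_dEps hr (h k)]
      module
  have ndel : ∀ θ : Graded I5 M5, delG (transJ r 0) (-θ) = -delG (transJ r 0) θ := fun θ => by
    funext k
    rw [Pi.neg_apply]
    match k with
    | 0 => exact neg_zero.symm
    | k + 1 => rw [delG_succ, delG_succ, Pi.neg_apply, dEps_neg]
  have bneg : ∀ {θ : Graded I5 M5}, θ ∈ basicForms (fol 0) → -θ ∈ basicForms (fol 0) :=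
    fun {θ} h => by
    rw [mem_basicForms] at h ⊢
    exact fun k => (h k).neg
  -- The core, for both operators.
  have core : ∀ {ε : ℂ}, ε = 1 ∨ ε = -1 → ∀ {θ β : Graded I5 M5}, β ∈ basicForms (fol 0) →
      θ 0 = 0 → (∀ k, θ (k + 1) = dEps r 0 ε (β k)) → (∀ k, dEps r 0 (-ε) (θ k) = 0) →
      θ ∈ (fun θ => delG (transJ r 0) (delbarG (transJ r 0) θ)) '' basicForms (fol 0) := by
    intro ε hε θ β hβ t0 t1 hker
    rw [mem_basicForms] at hβ
    have hε0 : ε ≠ 0 := by rcases hε with rfl | rfl <;> norm_num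
    obtain ⟨z, γ, hγ, e⟩ := exists_graded hr hε0 hβ fun k => by rw [← t1]; exact hker _
    refine ⟨fun k => (-(2 * Complex.I)) • γ k, mem_basicForms.2 fun k => (hγ k).smul _, ?_⟩
    funext k
    match k with
    | 0 => exact t0.symm
    | 1 =>
      rw [t1, z]
      change del (transJ r 0) (0 : Cochain I5 M5 0) = 0
      rw [del_eq_dEps, hJ0]
    | k + 2 =>
      rw [t1, e]
      change delG (transJ r 0) _ (k + 1 + 1) = _
      rw [delG_succ, delbarG_succ, dEps_dEps hr ((hγ k).smul _), dc_smul, extD_smul, smul_smul]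
      have : (1 / 4 * ((1 - -1) * Complex.I) * -(2 * Complex.I) : ℂ) = 1 := by
        linear_combination (-1 : ℂ) * Complex.I_mul_I
      rw [this, one_smul]
  have hAC : {θ ∈ basicForms (fol 0) | delG (transJ r 0) θ = 0} ∩
      delbarG (transJ r 0) '' basicForms (fol 0) ⊆
      (fun θ => delG (transJ r 0) (delbarG (transJ r 0) θ)) '' basicForms (fol 0) := by
    rintro _ ⟨⟨-, hker⟩, β, hβ, rfl⟩
    refine core (Or.inl rfl) hβ rfl (fun k => delbarG_succ β k) fun k => ?_
    rw [← delG_succ, hker]; rfl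
  have hBC : {θ ∈ basicForms (fol 0) | delbarG (transJ r 0) θ = 0} ∩
      delG (transJ r 0) '' basicForms (fol 0) ⊆
      (fun θ => delG (transJ r 0) (delbarG (transJ r 0) θ)) '' basicForms (fol 0) := by
    rintro _ ⟨⟨-, hker⟩, β, hβ, rfl⟩
    refine core (Or.inr rfl) hβ rfl (fun k => delG_succ β k) fun k => ?_
    rw [neg_neg, ← delbarG_succ, hker]; rfl
  have hCA : (fun θ => delG (transJ r 0) (delbarG (transJ r 0) θ)) '' basicForms (fol 0) ⊆
      {θ ∈ basicForms (fol 0) | delG (transJ r 0) θ = 0} ∩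
      delbarG (transJ r 0) '' basicForms (fol 0) := by
    rintro _ ⟨β, hβ, rfl⟩
    refine ⟨⟨bdel (bdelbar hβ), sq1 (bdelbar hβ)⟩, delG (transJ r 0) (-β), bdel (bneg hβ), ?_⟩
    rw [anti (bneg hβ), ← ndel]
    congr 1
    funext k
    rw [Pi.neg_apply]
    match k with
    | 0 => exact neg_zero
    | k + 1 => rw [delbarG_succ, delbarG_succ, Pi.neg_apply, dEps_neg, neg_neg]
  have hCB : (fun θ => delG (transJ r 0) (delbarG (transJ r 0) θ)) '' basicForms (fol 0) ⊆
      {θ ∈ basicForms (fol 0) | delbarG (transJ r 0) θ = 0} ∩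
      delG (transJ r 0) '' basicForms (fol 0) := by
    rintro _ ⟨β, hβ, rfl⟩
    refine ⟨⟨bdel (bdelbar hβ), ?_⟩, delbarG (transJ r 0) β, bdelbar hβ, rfl⟩
    change delbarG (transJ r 0) (delG (transJ r 0) (delbarG (transJ r 0) β)) = 0
    rw [anti (bdelbar hβ), sq2 hβ]
    funext k
    rw [Pi.neg_apply]
    match k with
    | 0 => exact neg_zero
    | k + 1 =>
      rw [delG_succ]
      change -dEps r 0 (-1) (0 : Cochain I5 M5 k) = 0
      rw [dEps_zero, neg_zero]
  exact ⟨(hAC.trans hCB).antisymm (hBC.trans hCA), hBC.antisymm hCB⟩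

end DDbar

end BasicGeom

end

theorem mainTheorem12 (ρ : ℝ → ℝ) (hρ : ∀ s, ρ s ≠ 0) :
    -- a family of one-dimensional, transversely Hermitian, homologically orientable foliations
    (∀ s ∈ Icc (0 : ℝ) 1,
      (∀ p, ∃ f, (xi s f) p ≠ 0) ∧
      IsTransverselyHermitian (fol s) (transJ (ρ s) s) ∧
      HasOneDimBasicCohomology (fol s) 3) ∧
    (ContDiff ℝ ∞ ρ → IsSmoothFamily xi (fun s => transJ (ρ s) s)) ∧
    -- the foliation with parameter zero
    IsTransverselyKahler (fol 0) (transJ (ρ 0) 0) ∧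
    SatisfiesDDbarLemma (fol 0) (transJ (ρ 0) 0) ∧
    -- the foliations with non-zero parameter
    (∀ s ∈ Ioc (0 : ℝ) 1, ¬ IsTransverselySymplectic (fol s) ∧
      ∀ J, ¬ IsTransverselyKahler (fol s) J) ∧
    (∀ s ∈ Ioc (0 : ℝ) 1, Irrational s → ¬ SatisfiesDDbarLemma (fol s) (transJ (ρ s) s)) ∧
    -- neither property is rigid
    (∀ U ∈ 𝓝 (0 : ℝ), ∃ s ∈ U ∩ Icc (0 : ℝ) 1,
      (∀ J, ¬ IsTransverselyKahler (fol s) J) ∧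
      ¬ SatisfiesDDbarLemma (fol s) (transJ (ρ s) s)) := by
  have nonrigid : ∀ s ∈ Ioc (0 : ℝ) 1, (¬ IsTransverselySymplectic (fol s)) ∧
      (∀ J, ¬ IsTransverselyKahler (fol s) J) ∧
      ¬ SatisfiesDDbarLemma (fol s) (transJ (ρ s) s) := fun s hs =>
    ⟨not_isTransverselySymplectic hs.1.ne',
      fun _ h => not_isTransverselySymplectic hs.1.ne' h.isTransverselySymplectic,
      not_satisfiesDDbarLemma (hρ s) hs.1.ne'⟩
  refine ⟨fun s _ => ⟨xi_ne_zero s, isTransverselyHermitian (hρ s), hasOneDimBasicCohomology s⟩,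
    isSmoothFamily hρ, isTransverselyKahler_zero (hρ 0), satisfiesDDbarLemma_zero (hρ 0),
    fun s hs => ⟨(nonrigid s hs).1, (nonrigid s hs).2.1⟩, fun s hs _ => (nonrigid s hs).2.2, ?_⟩
  intro U hU
  obtain ⟨ε, hε, hU⟩ := Metric.mem_nhds_iff.1 hU
  have h0 : 0 < min (ε / 2) 1 := lt_min (half_pos hε) one_pos
  refine ⟨min (ε / 2) 1, ⟨hU ?_, h0.le, min_le_right _ _⟩,
    (nonrigid _ ⟨h0, min_le_right _ _⟩).2⟩
  rw [Metric.mem_ball, Real.dist_0_eq_abs, abs_of_pos h0]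
  exact (min_le_left _ _).trans_lt (half_lt_self hε)
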